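/- **Setting.** Let $\mathcal C$ be a tensor category: a symmetric monoidal category enriched over abelian groups, with bi-additive $\otimes$ and unit $\mathbf 1$ (direct sums are not needed). Let $\mathbf{ECube}$ be the category with objects $\underline n=\{0,1\}^n$, $n\ge 0$, whose morphisms form the smallest class of maps closed under composition and cartesian products that contains the identities, the faces $\eta_{n,i,\varepsilon}:\underline n\to\underline{n+1}$ (insert $\varepsilon\in\{0,1\}$ at place $i$), the projections $p_{n,i}:\underline n\to\underline{n-1}$ (forget the $i$-th coordinate), the permutations of the factors, the involutions $0\leftrightarrow1$ in one factor, and the multiplication $\underline 2\to\underline 1$. An extended co-cubical object is a functor $\square^*:\mathbf{ECube}\to\mathcal C$; let $\square^0\cong\mathbf 1$ be a fixed isomorphism. A *multiplication* on $\square^*$ is a family $\mu_{n,m}:\square^n\otimes\square^m\to\square^{n+m}$ that is natural in both variables for all morphisms of $\mathbf{ECube}$, associative, commutative (exchanging the factors of the source corresponds to the block exchange of $\underline{n+m}$) and unital. A *co-multiplication* is a natural family $\delta^n:\square^n\to\square^n\otimes\square^n$ that is co-associative, co-commutative and co-unital (for $\square^n\to\square^0\cong\mathbf 1$). A *bi-multiplication*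 consists of both, such that $\mu_{n,m}$ and $\delta_{n,m}=(p^1_{n,m}\otimes p^2_{n,m})\circ\delta^{n+m}$ are inverse to each other for all $n,m\ge0$, where $p^1_{n,m},p^2_{n,m}$ are the projections of $\underline{n+m}$ onto the first $n$ and the last $m$ factors. Put $d=\sum_{i=1}^{n+1}(-1)^i(\eta_{n,i,1}-\eta_{n,i,0}):\square^n\to\square^{n+1}$. For objects $X,Y$ let $\mathrm{Hom}_{dg\mathcal C}(X,Y)$ be the non-degenerate complex, with differential $f\mapsto f\circ(\mathrm{id}_X\otimes d)$, of the cubical abelian group $n\mapsto\mathrm{Hom}_{\mathcal C}(X\otimes\square^n,Y)$, realized by the morphisms killed by all faces $\eta_{i,1}$. The object $\square^*$ is *homotopy invariant* if for all $n,X,Y$ the map $i_n:\underline 0\to\underline n$ with image $0^n$ induces a quasi-isomorphism $\mathrm{Hom}_{dg\mathcal C}(X,Y)\to\mathrm{Hom}_{dg\mathcal C}(X,Y\otimes\square^n)$. For a finite non-empty ordered set $I$, objects $X_i$ $(i\in I)$ and $Y$, let $P_I(\{X_i\},Y)$ be the complex whose elements of degree $m$ are the families, over all $a\in\mathbb N^I$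 and $n\ge 0$ with $n-\sum_i a_i=m$, of morphisms $$f_{a,n}:\bigotimes_i X_i\otimes\bigotimes_i\square^{a_i}\to Y\otimes\square^n$$ that are killed by all faces $\eta_{j,1}$ of each $\square^{a_i}$ and by all projections $p_j$ of $\square^n$, with differential $f\mapsto d_Y\circ f-(-1)^m f\circ d_X$. Here $d_Y=\mathrm{id}_Y\otimes d$, and $d_X$ is the total differential of $\bigotimes_i X_i\otimes\bigotimes_i\square^{a_i}$: the sum over $j$ of $(-1)^{\sum_{i<j}a_i}$ times $d$ acting on the factor $\square^{a_j}$. The DG category $dg_e\mathcal C$ has the objects of $\mathcal C$ and $\mathrm{Hom}_{dg_e\mathcal C}(X,Y)=P_{1}(X,Y)$, with composition of families and the identity families projected to the morphisms killed by $\eta_{j,1}$ and $p_j$. For a surjection $\pi:J\to I$, $J_i=\pi^{-1}(i)$, and elements $f\in P_I(\{Y_i\},Z)$, $g_i\in P_{J_i}(\{X_j\}_{j\in J_i},Y_i)$, the composition $f(g_i)\in P_J(\{X_j\},Z)$ is $$\bigotimes_{j\in J} X_j\otimes\bigotimes_{j\in J}\square^{b_j}\cong\bigotimes_i\Big(\bigotimes_{j\in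 J_i}X_j\otimes\bigotimes_{j\in J_i}\square^{b_j}\Big)\xrightarrow{\ \otimes g_i\ }\bigotimes_i(Y_i\otimes\square^{a_i})\cong\bigotimes_i Y_i\otimes\bigotimes_i\square^{a_i}\xrightarrow{\ f\ }Z\otimes\square^n ,$$ with the Koszul sign of the permutation of the $\square^{b_j}$ (of degree $b_j$) and of the application of $\bigotimes_i g_i$. A *pseudo-tensor structure* on a DG category $\mathcal D$ consists of complexes $P_I(\{X_i\},Y)$ and multi-additive compositions $f(g_i)$ which are maps of complexes, are associative for $K\to J\to I$ (with Koszul sign for moving the $g_i$ past the $h_j$), for which $P_1$ with its composition is $\mathrm{Hom}_{\mathcal D}$, and for which the identities of $\mathcal D$ are units. It is *representable* by objects $\bigotimes_{i}X_i$ if there are isomorphisms $\lambda:P_I(\{X_i\},-)\to\mathrm{Hom}_{\mathcal D}(\bigotimes_i X_i,-)$ in the derived category of DG functors from $\mathcal D$ to complexes of abelian groups, with $\bigotimes_i X_i=X$ and $\lambda=\mathrm{id}$ if the family consists of one object $X$. The inverse $\lambda^{-1}$ is then given by a cocycle $u_{\{X_i\}}\in P_I(\{X_i\},\bigotimes_iX_i)^0$.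 For $\pi:J\to I$ let $\epsilon_\pi:\bigotimes_{j\in J}X_j\to\bigotimes_{i\in I}\bigotimes_{j\in J_i}X_j$ be the morphism of $H^0\mathcal D$ whose composition with $u_{\{X_j\}_{j\in J}}$ is the class of the composition of $u$ with the elements $u_{\{X_j\}_{j\in J_i}}$. A representable pseudo-tensor structure *induces a tensor structure on $H^0\mathcal D$* if all $\epsilon_\pi$ are isomorphisms and there is a symmetric monoidal structure with bi-additive tensor product on $H^0\mathcal D$ together with isomorphisms of abelian groups $H^0P_I(\{X_i\},Y)\cong\mathrm{Hom}_{H^0\mathcal D}(\bigotimes_iX_i,Y)$ (on the right, the tensor product of that structure) which are compatible with compositions and with the identification of $P_1$, and which send the classes of the $u_{\{X_i\}}$ to isomorphisms from the tensor products to the representing objects. **Theorem.** Suppose that the extended co-cubical object $\square^*$ admits a bi-multiplication and is homotopy invariant. Then the complexes $P_I(\{X_i\},Y)$ with the compositions above form a pseudo-tensor structure on $dg_e\mathcal C$. It is representable by the tensor products $\bigotimes_iX_i=X_1\otimes\cdots\otimes X_k$ of $\mathcal C$, and it induces a tensor structure on $H^0dg_e\mathcal C$. -/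

import Mathlib

open CategoryTheory MonoidalCategory

universe v u

/-! ## Cubes -/

/-- The maps `{0,1}^n → {0,1}^m` belonging to the extended cubical category: the smallest class of
maps closed under composition and cartesian products which contains the identities, the faces
`η_{n,i,ε}`, the projections `p_{n,i}`, the permutations of the factors, the involutions `0 ↔ 1` in
one factor, and the multiplication `{0,1}² → {0,1}`. -/
inductive IsECubeMap : {n m : ℕ} → ((Fin n → Bool) → (Fin m → Bool)) → Prop
  | id (n : ℕ) : IsECubeMap (fun y : Fin n → Bool => y)
  | comp {n m k : ℕ} {f : (Fin n → Bool) → (Fin m → Bool)} {g : (Fin m → Bool) → (Fin k → Bool)} :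
      IsECubeMap f → IsECubeMap g → IsECubeMap (fun y => g (f y))
  | face (n : ℕ) (i : Fin (n + 1)) (ε : Bool) :
      IsECubeMap (fun y : Fin n → Bool => Fin.insertNth (α := fun _ => Bool) i ε y)
  | proj (n : ℕ) (i : Fin (n + 1)) :
      IsECubeMap (fun y : Fin (n + 1) → Bool => fun j : Fin n => y (i.succAbove j))
  | perm (n : ℕ) (s : Equiv.Perm (Fin n)) : IsECubeMap (fun y : Fin n → Bool => fun j => y (s j))
  | invol (n : ℕ) (i : Fin n) :
      IsECubeMap (fun y : Fin n → Bool => Function.update y i (!(y i)))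
  | mul : IsECubeMap (fun (y : Fin 2 → Bool) (_ : Fin 1) => y 0 && y 1)
  | prod {n m n' m' : ℕ} {f : (Fin n → Bool) → (Fin m → Bool)}
      {g : (Fin n' → Bool) → (Fin m' → Bool)} :
      IsECubeMap f → IsECubeMap g →
      IsECubeMap (fun y : Fin (n + n') → Bool =>
        Fin.append (f fun i => y (Fin.castAdd n' i)) (g fun i => y (Fin.natAdd n i)))

/-- The extended cubical category `ECube`: its objects are the sets `{0,1}^n`, `n ≥ 0`. -/
structure ECube : Type where
  /-- the number of factors `{0,1}` -/
  dim : ℕ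

namespace ECube

/-- A morphism of `ECube` is a map of sets in the class `IsECubeMap`. -/
@[ext]
structure Hom (a b : ECube) : Type where
  /-- the underlying map of sets -/
  fn : (Fin a.dim → Bool) → (Fin b.dim → Bool)
  isMap : IsECubeMap fn

instance : Category ECube where
  Hom := Hom
  id a := ⟨fun y => y, .id a.dim⟩
  comp f g := ⟨fun y => g.fn (f.fn y), f.isMap.comp g.isMap⟩

@[ext]
theorem hom_ext {a b : ECube} {f g : a ⟶ b} (h : ∀ y, Hom.fn f y = Hom.fn g y) : f = g :=
  Hom.ext (funext h)

/-- The face `η_{n,i,ε}`, inserting `ε` at the place `i`. -/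
def face (n : ℕ) (i : Fin (n + 1)) (ε : Bool) : (⟨n⟩ : ECube) ⟶ ⟨n + 1⟩ :=
  ⟨fun y => Fin.insertNth (α := fun _ => Bool) i ε y, .face n i ε⟩

/-- The projection `p_{n+1,i}`, forgetting the `i`-th coordinate. -/
def proj (n : ℕ) (i : Fin (n + 1)) : (⟨n + 1⟩ : ECube) ⟶ ⟨n⟩ :=
  ⟨fun y j => y (i.succAbove j), .proj n i⟩

/-- The product `f × g`. -/
def prod {n m n' m' : ℕ} (f : (⟨n⟩ : ECube) ⟶ ⟨m⟩) (g : (⟨n'⟩ : ECube) ⟶ ⟨m'⟩) :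
    (⟨n + n'⟩ : ECube) ⟶ ⟨m + m'⟩ :=
  ⟨fun y => Fin.append (Hom.fn f fun i => y (Fin.castAdd n' i))
    (Hom.fn g fun i => y (Fin.natAdd n i)), f.isMap.prod g.isMap⟩

theorem isECubeMap_equiv {n m : ℕ} (s : Fin m ≃ Fin n) :
    IsECubeMap (fun (y : Fin n → Bool) (j : Fin m) => y (s j)) := by
  have h : m = n := by simpa using Fintype.card_congr s
  subst h
  exact .perm m s

/-- The reindexing of the coordinates along a bijection. -/
def reindex {n m : ℕ} (s : Fin m ≃ Fin n) : (⟨n⟩ : ECube) ⟶ ⟨m⟩ :=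
  ⟨fun y j => y (s j), isECubeMap_equiv s⟩

/-- The symmetry `τ_{n,m} : {0,1}^n × {0,1}^m → {0,1}^m × {0,1}^n`. -/
def swap (n m : ℕ) : (⟨n + m⟩ : ECube) ⟶ ⟨m + n⟩ := reindex finAddFlip

theorem isECubeMap_fst (n m : ℕ) :
    IsECubeMap (fun (y : Fin (n + m) → Bool) (j : Fin n) => y (Fin.castAdd m j)) := by
  induction m with
  | zero => exact .id n
  | succ m ih =>
    have h := (IsECubeMap.proj (n + m) (Fin.last _)).comp ih
    simp only [Fin.succAbove_last] at h
    exact h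

/-- The projection `p¹_{n,m}` onto the first `n` factors. -/
def fst (n m : ℕ) : (⟨n + m⟩ : ECube) ⟶ ⟨n⟩ :=
  ⟨fun y j => y (Fin.castAdd m j), isECubeMap_fst n m⟩

/-- The projection `p²_{n,m}` onto the last `m` factors. -/
def snd (n m : ℕ) : (⟨n + m⟩ : ECube) ⟶ ⟨m⟩ := swap n m ≫ fst m n

theorem snd_fn (n m : ℕ) (y : Fin (n + m) → Bool) (j : Fin m) :
    Hom.fn (snd n m) y j = y (Fin.natAdd n j) :=
  congrArg y (finAddFlip_apply_castAdd j n)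

/-- The projection `p_n` of `{0,1}^n` to the point. -/
def toPt (n : ℕ) : (⟨n⟩ : ECube) ⟶ ⟨0⟩ :=
  reindex (finCongr (Nat.zero_add n)) ≫ fst 0 n

theorem isECubeMap_zero (n : ℕ) :
    IsECubeMap (fun (_ : Fin 0 → Bool) (_ : Fin n) => false) := by
  induction n with
  | zero =>
    convert IsECubeMap.id 0
  | succ n ih =>
    have h := ih.comp (IsECubeMap.face n 0 false)
    convert h using 3 with y j
    refine Fin.cases ?_ (fun i => ?_) j <;> simp

/-- The map `i_n` from the point to `{0,1}^n` with image `0^n`. -/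
def zeroPt (n : ℕ) : (⟨0⟩ : ECube) ⟶ ⟨n⟩ := ⟨fun _ _ => false, isECubeMap_zero n⟩

end ECube

/-! ## Tensor products of finite families -/

section Tensor

variable {C : Type u} [Category.{v} C] [MonoidalCategory C]

/-- The tensor product `A j₁ ⊗ (A j₂ ⊗ (⋯ ⊗ A j_k))` over a list `[j₁, …, j_k]`; it is `A j₁` for
`k = 1`. -/
def tensL {J : Type} (A : J → C) : List J → C
  | [] => 𝟙_ C
  | [j] => A j
  | j :: k :: L => A j ⊗ tensL A (k :: L)

/-- The empty tensor product is the unit object. -/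
def tensLNil {J : Type} (A : J → C) : tensL A [] ≅ 𝟙_ C := Iso.refl _

/-- `A j ⊗ (⨂ L) ≅ ⨂ (j :: L)`: the identity for `L ≠ []`, the unit isomorphism for `L = []`. -/
def tensLCons {J : Type} (A : J → C) (j : J) : ∀ L : List J, A j ⊗ tensL A L ≅ tensL A (j :: L)
  | [] => ρ_ (A j)
  | _ :: _ => Iso.refl _

/-- The tensor product of a family of morphisms. -/
def tensLHom {J : Type} {A B : J → C} (φ : ∀ j, A j ⟶ B j) : ∀ L : List J, tensL A L ⟶ tensL B L
  | [] => (tensLNil A).hom ≫ (tensLNil B).inv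
  | j :: L => (tensLCons A j L).inv ≫ (φ j ⊗ₘ tensLHom φ L) ≫ (tensLCons B j L).hom

theorem tensLHom_id {J : Type} (A : J → C) : ∀ L : List J, tensLHom (fun j => 𝟙 (A j)) L = 𝟙 _
  | [] => (tensLNil A).hom_inv_id
  | j :: L => by rw [tensLHom, tensLHom_id A L]; simp

theorem tensLHom_comp {J : Type} {A B D : J → C} (φ : ∀ j, A j ⟶ B j) (ψ : ∀ j, B j ⟶ D j) :
    ∀ L : List J, tensLHom φ L ≫ tensLHom ψ L = tensLHom (fun j => φ j ≫ ψ j) L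
  | [] => by simp [tensLHom]
  | j :: L => by
    simp only [tensLHom, Category.assoc, Iso.hom_inv_id_assoc]
    rw [tensorHom_comp_tensorHom_assoc, tensLHom_comp φ ψ L]

/-- The tensor product of a family of isomorphisms. -/
def tensLIso {J : Type} {A B : J → C} (φ : ∀ j, A j ≅ B j) (L : List J) : tensL A L ≅ tensL B L where
  hom := tensLHom (fun j => (φ j).hom) L
  inv := tensLHom (fun j => (φ j).inv) L
  hom_inv_id := by simp [tensLHom_comp, tensLHom_id]
  inv_hom_id := by simp [tensLHom_comp, tensLHom_id]

/-- `(⨂ L) ⊗ (⨂ M) ≅ ⨂ (L ++ M)`. -/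
def tensLAppend {J : Type} (A : J → C) :
    ∀ L M : List J, tensL A L ⊗ tensL A M ≅ tensL A (L ++ M)
  | [], M => whiskerRightIso (tensLNil A) _ ≪≫ λ_ (tensL A M)
  | j :: L, M => whiskerRightIso (tensLCons A j L).symm _ ≪≫ α_ _ _ _ ≪≫
      whiskerLeftIso (A j) (tensLAppend A L M) ≪≫ tensLCons A j (L ++ M)

/-- Removing the inner brackets in a tensor product of tensor products. -/
def tensLFlat {I J : Type} (A : J → C) (B : I → List J) :
    ∀ L : List I, tensL (fun i => tensL A (B i)) L ≅ tensL A (L.flatMap B)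
  | [] => tensLNil _ ≪≫ (tensLNil A).symm
  | i :: L => (tensLCons (fun i => tensL A (B i)) i L).symm ≪≫
      whiskerLeftIso (tensL A (B i)) (tensLFlat A B L) ≪≫ tensLAppend A (B i) (L.flatMap B)

/-- Renaming the indices of a tensor product. -/
def tensLMap {I J : Type} (A : J → C) (s : I → J) :
    ∀ L : List I, tensL A (L.map s) ≅ tensL (fun i => A (s i)) L
  | [] => tensLNil A ≪≫ (tensLNil _).symm
  | i :: L => (tensLCons A (s i) (L.map s)).symm ≪≫ whiskerLeftIso (A (s i)) (tensLMap A s L) ≪≫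
      tensLCons (fun i => A (s i)) i L

variable [SymmetricCategory C]

/-- The symmetry isomorphism moving the factor `j` to the front. -/
def tensLPull {J : Type} [DecidableEq J] (A : J → C) (j : J) :
    ∀ L : List J, j ∈ L → (tensL A L ≅ A j ⊗ tensL A (L.erase j))
  | [], h => absurd h List.not_mem_nil
  | k :: L, h =>
    if e : k = j then
      eqToIso (by rw [e]) ≪≫ (tensLCons A j L).symm ≪≫
      whiskerLeftIso (A j) (eqToIso (by subst e; simp))
    else
      (tensLCons A k L).symm ≪≫
      whiskerLeftIso (A k) (tensLPull A j L ((List.mem_cons.1 h).resolve_left (Ne.symm e))) ≪≫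
      (α_ _ _ _).symm ≪≫ whiskerRightIso (β_ (A k) (A j)) _ ≪≫ α_ _ _ _ ≪≫
      whiskerLeftIso (A j) (tensLCons A k (L.erase j) ≪≫ eqToIso (by simp [e]))

/-- The symmetry isomorphism of tensor products given by a permutation of the factors. -/
def tensLPerm {J : Type} [DecidableEq J] (A : J → C) :
    ∀ L M : List J, L.Perm M → (tensL A L ≅ tensL A M)
  | _, [], h => eqToIso (by rw [h.eq_nil])
  | L, j :: M, h => tensLPull A j L (h.mem_iff.2 List.mem_cons_self) ≪≫
      whiskerLeftIso (A j) (tensLPerm A (L.erase j) M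
        (by simpa using h.erase j)) ≪≫ tensLCons A j M

/-- The symmetry isomorphism `⨂_j (A_j ⊗ B_j) ≅ (⨂_j A_j) ⊗ (⨂_j B_j)`, which does not change the
order of the `A_j`, nor that of the `B_j`. -/
def tensLMul {J : Type} (A B : J → C) :
    ∀ L : List J, tensL (fun j => A j ⊗ B j) L ≅ tensL A L ⊗ tensL B L
  | [] => tensLNil _ ≪≫ (λ_ (𝟙_ C)).symm ≪≫
      whiskerRightIso (tensLNil A).symm _ ≪≫ whiskerLeftIso _ (tensLNil B).symm
  | j :: L => (tensLCons (fun j => A j ⊗ B j) j L).symm ≪≫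
      whiskerLeftIso (A j ⊗ B j) (tensLMul A B L) ≪≫
      { hom := tensorμ (A j) (B j) (tensL A L) (tensL B L)
        inv := tensorδ (A j) (B j) (tensL A L) (tensL B L)
        hom_inv_id := tensorμ_tensorδ _ _ _ _
        inv_hom_id := tensorδ_tensorμ _ _ _ _ } ≪≫
      whiskerRightIso (tensLCons A j L) _ ≪≫ whiskerLeftIso _ (tensLCons B j L)

end Tensor

/-- A finite non-empty set `α = {e 0, …, e n}` together with a numbering of its elements. -/
structure FinIdx where
  /-- the set -/
  α : Type
  /-- the number of elements minus one -/
  n : ℕ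
  /-- the numbering -/
  e : Fin (n + 1) ≃ α

namespace FinIdx

/-- The set `{0, …, n}` with its natural numbering. -/
def fin (n : ℕ) : FinIdx := ⟨Fin (n + 1), n, Equiv.refl _⟩

/-- The one-element index set. -/
abbrev one : FinIdx := fin 0

instance (I : FinIdx) : Fintype I.α := Fintype.ofEquiv _ I.e

instance (I : FinIdx) : DecidableEq I.α := fun a b =>
  decidable_of_iff (I.e.symm a = I.e.symm b) I.e.symm.injective.eq_iff

/-- The elements of the set, in the order of the numbering. -/
def list (I : FinIdx) : List I.α := List.ofFn I.e

theorem mem_list (I : FinIdx) (i : I.α) : i ∈ I.list :=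
  List.mem_ofFn.2 ⟨I.e.symm i, I.e.apply_symm_apply i⟩

theorem nodup_list (I : FinIdx) : I.list.Nodup := List.nodup_ofFn.2 I.e.injective

/-- The elements of `J ≅ ∐ i, F i`, enumerated block by block. -/
abbrev blocks {I : FinIdx} {F : I.α → FinIdx} {J : FinIdx} (σ : (Σ i, (F i).α) ≃ J.α) : List J.α :=
  I.list.flatMap fun i => (F i).list.map fun t => σ ⟨i, t⟩

theorem blocks_perm {I : FinIdx} {F : I.α → FinIdx} {J : FinIdx} (σ : (Σ i, (F i).α) ≃ J.α) :
    J.list.Perm (blocks σ) := by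
  rw [List.perm_ext_iff_of_nodup J.nodup_list]
  · intro j
    refine ⟨fun _ => ?_, fun _ => J.mem_list j⟩
    obtain ⟨⟨i, t⟩, rfl⟩ := σ.surjective j
    exact List.mem_flatMap.2 ⟨i, I.mem_list i, List.mem_map.2 ⟨t, (F i).mem_list t, rfl⟩⟩
  · rw [blocks, List.nodup_flatMap]
    refine ⟨fun i _ => (F i).nodup_list.map fun t t' h => by simpa using h, ?_⟩
    refine I.nodup_list.imp ?_
    intro i i' hne j hj hj'
    obtain ⟨t, _, rfl⟩ := List.mem_map.1 hj
    obtain ⟨t', _, h⟩ := List.mem_map.1 hj'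
    exact hne (congrArg Sigma.fst (σ.injective h)).symm

end FinIdx

section Tens

variable {C : Type u} [Category.{v} C] [MonoidalCategory C]

/-- The tensor product of a family indexed by a numbered finite set. -/
abbrev tens (I : FinIdx) (A : I.α → C) : C := tensL A I.list

/-- The tensor product of a family of morphisms. -/
abbrev tensHom (I : FinIdx) {A B : I.α → C} (φ : ∀ i, A i ⟶ B i) : tens I A ⟶ tens I B :=
  tensLHom φ I.list

/-- For a partition `J ≅ ∐ i, F i` the symmetry isomorphism `⨂_{j ∈ J} A_j ≅ ⨂_{i ∈ I} ⨂_{j ∈ F i} A_j`. -/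
def tensShuffle [SymmetricCategory C] {I : FinIdx} {F : I.α → FinIdx} {J : FinIdx}
    (σ : (Σ i, (F i).α) ≃ J.α) (A : J.α → C) :
    tens J A ≅ tens I fun i => tens (F i) fun t => A (σ ⟨i, t⟩) :=
  tensLPerm A _ _ (FinIdx.blocks_perm σ) ≪≫ (tensLFlat A _ I.list).symm ≪≫
    tensLIso (fun i => tensLMap A (fun t => σ ⟨i, t⟩) (F i).list) I.list

end Tens

section TensorLemmas

variable {C : Type u} [Category.{v} C] [MonoidalCategory C]

theorem tensLCons_natural {J : Type} {A B : J → C} (φ : ∀ j, A j ⟶ B j) (j : J) (L : List J) :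
    (φ j ⊗ₘ tensLHom φ L) ≫ (tensLCons B j L).hom =
      (tensLCons A j L).hom ≫ tensLHom φ (j :: L) := by
  simp [tensLHom]

theorem tensLCons_inv_natural {J : Type} {A B : J → C} (φ : ∀ j, A j ⟶ B j) (j : J) (L : List J) :
    tensLHom φ (j :: L) ≫ (tensLCons B j L).inv =
      (tensLCons A j L).inv ≫ (φ j ⊗ₘ tensLHom φ L) := by
  simp [tensLHom]

/-- Two squares, tensored from the left by a morphism. -/
theorem whisker_square {X X' Y Y' Z Z' : C} (p : X ⟶ X') {f : Y ⟶ Y'} {g : Y' ⟶ Z'} {f' : Y ⟶ Z}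
    {g' : Z ⟶ Z'} (h : f ≫ g = f' ≫ g') :
    (p ⊗ₘ f) ≫ X' ◁ g = X ◁ f' ≫ (p ⊗ₘ g') := by
  rw [← id_tensorHom, ← id_tensorHom, tensorHom_comp_tensorHom, tensorHom_comp_tensorHom, h]
  simp

theorem whisker_square_right {X X' Y Y' Z Z' : C} (p : X ⟶ X') {f : Y ⟶ Y'} {g : Y' ⟶ Z'}
    {f' : Y ⟶ Z} {g' : Z ⟶ Z'} (h : f ≫ g = f' ≫ g') :
    (f ⊗ₘ p) ≫ g ▷ X' = f' ▷ X ≫ (g' ⊗ₘ p) := by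
  rw [← tensorHom_id, ← tensorHom_id, tensorHom_comp_tensorHom, tensorHom_comp_tensorHom, h]
  simp

theorem tensLAppend_natural {J : Type} {A B : J → C} (φ : ∀ j, A j ⟶ B j) :
    ∀ L M : List J, (tensLHom φ L ⊗ₘ tensLHom φ M) ≫ (tensLAppend B L M).hom =
      (tensLAppend A L M).hom ≫ tensLHom φ (L ++ M)
  | [], M => by
    have h : tensLHom φ [] ≫ (tensLNil B).hom = (tensLNil A).hom ≫ 𝟙 _ := by simp [tensLHom]
    simp only [tensLAppend, Iso.trans_hom, whiskerRightIso_hom, Category.assoc]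
    rw [reassoc_of% whisker_square_right (tensLHom φ M) h, id_tensorHom]
    exact congrArg (fun f => (tensLNil A).hom ▷ tensL A M ≫ f) (leftUnitor_naturality (tensLHom φ M))
  | j :: L, M => by
    have h := whisker_square (φ j) (tensLAppend_natural φ L M)
    have h1 := whisker_square_right (tensLHom φ M) (tensLCons_inv_natural φ j L)
    have h2 := tensLCons_natural φ j (L ++ M)
    simp only [tensLAppend, Iso.trans_hom, whiskerRightIso_hom, whiskerLeftIso_hom, Iso.symm_hom,
      Category.assoc]
    rw [reassoc_of% h1, associator_naturality_assoc, reassoc_of% h, h2]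
    rfl

theorem tensLFlat_natural {I J : Type} {A A' : J → C} (φ : ∀ j, A j ⟶ A' j) (B : I → List J) :
    ∀ L : List I, tensLHom (fun i => tensLHom φ (B i)) L ≫ (tensLFlat A' B L).hom =
      (tensLFlat A B L).hom ≫ tensLHom φ (L.flatMap B)
  | [] => by
    simp only [tensLFlat, Iso.trans_hom, tensLHom, Iso.symm_hom, Category.assoc,
      Iso.inv_hom_id_assoc]
    erw [Iso.inv_hom_id_assoc]
  | i :: L => by
    have h := whisker_square (tensLHom φ (B i)) (tensLFlat_natural φ B L)
    have h1 := tensLCons_inv_natural (fun i => tensLHom φ (B i)) i L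
    have h2 := tensLAppend_natural φ (B i) (L.flatMap B)
    simp only [tensLFlat, Iso.trans_hom, whiskerLeftIso_hom, Iso.symm_hom, Category.assoc]
    rw [reassoc_of% h1, reassoc_of% h, h2]
    rfl

theorem tensLMap_natural {I J : Type} {A B : J → C} (φ : ∀ j, A j ⟶ B j) (s : I → J) :
    ∀ L : List I, tensLHom φ (L.map s) ≫ (tensLMap B s L).hom =
      (tensLMap A s L).hom ≫ tensLHom (fun i => φ (s i)) L
  | [] => by
    change ((tensLNil A).hom ≫ (tensLNil B).inv) ≫ (tensLNil B).hom ≫ (tensLNil _).inv =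
      ((tensLNil A).hom ≫ (tensLNil _).inv) ≫ (tensLNil _).hom ≫ (tensLNil _).inv
    simp only [Category.assoc, Iso.inv_hom_id_assoc]
  | i :: L => by
    have h := whisker_square (φ (s i)) (tensLMap_natural φ s L)
    have h1 := tensLCons_inv_natural φ (s i) (L.map s)
    have h2 := tensLCons_natural (fun i => φ (s i)) i L
    simp only [tensLMap, Iso.trans_hom, whiskerLeftIso_hom, Iso.symm_hom, Category.assoc]
    rw [← h2, ← reassoc_of% h, ← reassoc_of% h1]
    rfl

theorem tensLHom_eqToHom {J : Type} {A B : J → C} (φ : ∀ j, A j ⟶ B j) {L M : List J}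
    (h : L = M) :
    tensLHom φ L ≫ eqToHom (congrArg (tensL B) h) =
      eqToHom (congrArg (tensL A) h) ≫ tensLHom φ M := by
  subst h; simp

theorem tensLHom_zero [Preadditive C] [MonoidalPreadditive C] {J : Type} {A B : J → C}
    (φ : ∀ j, A j ⟶ B j) (j : J) (hj : φ j = 0) : ∀ L : List J, j ∈ L → tensLHom φ L = 0
  | [], h => absurd h List.not_mem_nil
  | k :: L, h => by
    rcases List.mem_cons.1 h with rfl | h
    · simp [tensLHom, hj]
    · simp [tensLHom, tensLHom_zero φ j hj L h]

variable [SymmetricCategory C]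

theorem tensLPull_natural {J : Type} [DecidableEq J] {A B : J → C} (φ : ∀ j, A j ⟶ B j) (j : J) :
    ∀ (L : List J) (h : j ∈ L), tensLHom φ L ≫ (tensLPull B j L h).hom =
      (tensLPull A j L h).hom ≫ (φ j ⊗ₘ tensLHom φ (L.erase j))
  | [], h => absurd h List.not_mem_nil
  | k :: L, h => by
    by_cases e : k = j
    · subst e
      have h1 := tensLCons_inv_natural φ k L
      have h3 := whisker_square (φ k) (tensLHom_eqToHom φ (show L = (k :: L).erase k by simp))
      simp only [tensLPull, dite_true, Iso.trans_hom, Iso.symm_hom, eqToIso.hom, eqToHom_refl,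
        Category.id_comp, whiskerLeftIso_hom, Category.assoc]
      rw [reassoc_of% h1, h3]
    · have h0 : j ∈ L := (List.mem_cons.1 h).resolve_left (Ne.symm e)
      have h1 := tensLCons_inv_natural φ k L
      have ih := whisker_square (φ k) (tensLPull_natural φ j L h0)
      have hb := whisker_square_right (tensLHom φ (L.erase j))
        (BraidedCategory.braiding_naturality (φ k) (φ j))
      have h2 : tensLHom φ (k :: L.erase j) ≫ eqToHom (congrArg (tensL B) (show k :: L.erase j =
          (k :: L).erase j by simp [e])) = eqToHom (congrArg (tensL A) (show k :: L.erase j =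
          (k :: L).erase j by simp [e])) ≫ tensLHom φ ((k :: L).erase j) := tensLHom_eqToHom φ (by simp [e])
      have h3 : (φ k ⊗ₘ tensLHom φ (L.erase j)) ≫ ((tensLCons B k (L.erase j)).hom ≫
          eqToHom (congrArg (tensL B) (show k :: L.erase j = (k :: L).erase j by simp [e]))) =
          ((tensLCons A k (L.erase j)).hom ≫ eqToHom (congrArg (tensL A)
            (show k :: L.erase j = (k :: L).erase j by simp [e]))) ≫
          tensLHom φ ((k :: L).erase j) := by
        rw [reassoc_of% tensLCons_natural φ k (L.erase j), h2, Category.assoc]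
      have h4 := whisker_square (φ j) h3
      simp only [tensLPull, dif_neg e, Iso.trans_hom, Iso.symm_hom, eqToIso.hom,
        whiskerLeftIso_hom, whiskerRightIso_hom, Category.assoc]
      rw [reassoc_of% h1, reassoc_of% ih, associator_inv_naturality_assoc, reassoc_of% hb,
        associator_naturality_assoc, h4]

theorem tensLPerm_natural {J : Type} [DecidableEq J] {A B : J → C} (φ : ∀ j, A j ⟶ B j) :
    ∀ (L M : List J) (h : L.Perm M), tensLHom φ L ≫ (tensLPerm B L M h).hom =
      (tensLPerm A L M h).hom ≫ tensLHom φ M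
  | L, [], h => by
    obtain rfl := h.eq_nil
    simp [tensLPerm]
  | L, j :: M, h => by
    have ih := whisker_square (φ j)
      (tensLPerm_natural φ (L.erase j) M (by simpa using h.erase j))
    have h1 := tensLPull_natural φ j L (h.mem_iff.2 List.mem_cons_self)
    have h2 := tensLCons_natural φ j M
    simp only [tensLPerm, Iso.trans_hom, whiskerLeftIso_hom, Category.assoc]
    rw [reassoc_of% h1, reassoc_of% ih, h2]

theorem tensLMul_natural {J : Type} {A B A' B' : J → C} (φ : ∀ j, A j ⟶ A' j)
    (ψ : ∀ j, B j ⟶ B' j) :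
    ∀ L : List J, tensLHom (fun j => φ j ⊗ₘ ψ j) L ≫ (tensLMul A' B' L).hom =
      (tensLMul A B L).hom ≫ (tensLHom φ L ⊗ₘ tensLHom ψ L)
  | [] => by
    simp only [tensLMul, tensLHom, Iso.trans_hom, Iso.symm_hom, whiskerRightIso_hom,
      whiskerLeftIso_hom, Category.assoc, Iso.inv_hom_id_assoc]
    simp only [← tensorHom_id, ← id_tensorHom, tensorHom_comp_tensorHom,
      Iso.inv_hom_id_assoc, Category.comp_id, Category.id_comp]
  | j :: L => by
    have ih := whisker_square (φ j ⊗ₘ ψ j) (tensLMul_natural φ ψ L)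
    have h1 := tensLCons_inv_natural (fun j => φ j ⊗ₘ ψ j) j L
    have h2 := tensorμ_natural (φ j) (ψ j) (tensLHom φ L) (tensLHom ψ L)
    have hA := tensLCons_natural φ j L
    have hB := tensLCons_natural ψ j L
    simp only [tensLMul, Iso.trans_hom, whiskerLeftIso_hom, whiskerRightIso_hom, Iso.symm_hom,
      Category.assoc]
    rw [reassoc_of% h1, reassoc_of% ih, reassoc_of% h2,
      reassoc_of% whisker_square_right (ψ j ⊗ₘ tensLHom ψ L) hA, whisker_square _ hB]

theorem tensShuffle_natural {I : FinIdx} {F : I.α → FinIdx} {J : FinIdx}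
    (σ : (Σ i, (F i).α) ≃ J.α) {A B : J.α → C} (φ : ∀ j, A j ⟶ B j) :
    tensHom J φ ≫ (tensShuffle σ B).hom =
      (tensShuffle σ A).hom ≫ tensHom I fun i => tensHom (F i) fun t => φ (σ ⟨i, t⟩) := by
  have h1 := tensLPerm_natural φ J.list _ (FinIdx.blocks_perm σ)
  have h2 := tensLFlat_natural φ (fun i => (F i).list.map fun t => σ ⟨i, t⟩) I.list
  have h3 : tensLHom φ (I.list.flatMap fun i => (F i).list.map fun t => σ ⟨i, t⟩) ≫
      (tensLFlat B (fun i => (F i).list.map fun t => σ ⟨i, t⟩) I.list).inv =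
      (tensLFlat A (fun i => (F i).list.map fun t => σ ⟨i, t⟩) I.list).inv ≫
      tensLHom (fun i => tensLHom φ ((F i).list.map fun t => σ ⟨i, t⟩)) I.list := by
    rw [Iso.comp_inv_eq, Category.assoc, h2, Iso.inv_hom_id_assoc]
  simp only [tensShuffle, Iso.trans_hom, Iso.symm_hom, Category.assoc, tensLIso]
  rw [reassoc_of% h1, reassoc_of% h3, tensLHom_comp, tensLHom_comp]
  congr 3
  funext i
  exact tensLMap_natural φ (fun t => σ ⟨i, t⟩) (F i).list

end TensorLemmas

section Cubical

variable {C : Type u} [Category.{v} C] [MonoidalCategory C]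

namespace ECube

/-- The identification of the cubes for equal numbers of factors. -/
def cast {n m : ℕ} (h : n = m) : (⟨n⟩ : ECube) ⟶ ⟨m⟩ := reindex (finCongr h.symm)

end ECube

/-- A multiplication `μ_{n,m} : □^n ⊗ □^m ⟶ □^{n+m}` on an extended co-cubical object `Q = □^*`
whose value at the point is identified with the unit object by `u`. -/
structure CubeMul [BraidedCategory C] (Q : ECube ⥤ C) (u : Q.obj ⟨0⟩ ≅ 𝟙_ C) where
  /-- the morphisms `μ_{n,m}` -/
  hom (n m : ℕ) : Q.obj ⟨n⟩ ⊗ Q.obj ⟨m⟩ ⟶ Q.obj ⟨n + m⟩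
  natural {n m n' m' : ℕ} (f : (⟨n⟩ : ECube) ⟶ ⟨m⟩) (g : (⟨n'⟩ : ECube) ⟶ ⟨m'⟩) :
    (Q.map f ⊗ₘ Q.map g) ≫ hom m m' = hom n n' ≫ Q.map (ECube.prod f g)
  assoc (p n m : ℕ) :
    hom p n ▷ Q.obj ⟨m⟩ ≫ hom (p + n) m ≫ Q.map (ECube.cast (Nat.add_assoc p n m)) =
      (α_ _ _ _).hom ≫ Q.obj ⟨p⟩ ◁ hom n m ≫ hom p (n + m)
  comm (n m : ℕ) : hom n m ≫ Q.map (ECube.swap n m) = (β_ _ _).hom ≫ hom m n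
  unit (n : ℕ) :
    (λ_ (Q.obj ⟨n⟩)).inv ≫ u.inv ▷ Q.obj ⟨n⟩ ≫ hom 0 n ≫ Q.map (ECube.cast (Nat.zero_add n)) = 𝟙 _

/-- A co-multiplication `δ^n : □^n ⟶ □^n ⊗ □^n` on an extended co-cubical object `Q = □^*`. -/
structure CubeComul [BraidedCategory C] (Q : ECube ⥤ C) (u : Q.obj ⟨0⟩ ≅ 𝟙_ C) where
  /-- the morphisms `δ^n` -/
  hom (n : ℕ) : Q.obj ⟨n⟩ ⟶ Q.obj ⟨n⟩ ⊗ Q.obj ⟨n⟩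
  natural {n m : ℕ} (f : (⟨n⟩ : ECube) ⟶ ⟨m⟩) : Q.map f ≫ hom m = hom n ≫ (Q.map f ⊗ₘ Q.map f)
  coassoc (n : ℕ) : hom n ≫ hom n ▷ Q.obj ⟨n⟩ ≫ (α_ _ _ _).hom = hom n ≫ Q.obj ⟨n⟩ ◁ hom n
  cocomm (n : ℕ) : hom n ≫ (β_ _ _).hom = hom n
  counit (n : ℕ) :
    hom n ≫ Q.map (ECube.toPt n) ▷ Q.obj ⟨n⟩ ≫ u.hom ▷ Q.obj ⟨n⟩ ≫ (λ_ (Q.obj ⟨n⟩)).hom = 𝟙 _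

/-- The morphism `δ_{n,m} = (p¹_{n,m} ⊗ p²_{n,m}) ∘ δ^{n+m} : □^{n+m} ⟶ □^n ⊗ □^m`. -/
def CubeComul.split [BraidedCategory C] {Q : ECube ⥤ C} {u : Q.obj ⟨0⟩ ≅ 𝟙_ C} (δ : CubeComul Q u)
    (n m : ℕ) : Q.obj ⟨n + m⟩ ⟶ Q.obj ⟨n⟩ ⊗ Q.obj ⟨m⟩ :=
  δ.hom (n + m) ≫ (Q.map (ECube.fst n m) ⊗ₘ Q.map (ECube.snd n m))

/-- A bi-multiplication: a multiplication and a co-multiplication such that `μ_{n,m}` and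
`δ_{n,m}` are inverse isomorphisms. -/
structure CubeBimul [BraidedCategory C] (Q : ECube ⥤ C) (u : Q.obj ⟨0⟩ ≅ 𝟙_ C) where
  /-- the multiplication -/
  mul : CubeMul Q u
  /-- the co-multiplication -/
  comul : CubeComul Q u
  mul_split (n m : ℕ) : mul.hom n m ≫ comul.split n m = 𝟙 _
  split_mul (n m : ℕ) : comul.split n m ≫ mul.hom n m = 𝟙 _

end Cubical

section CubeComplex

variable {C : Type u} [Category.{v} C] [Preadditive C]

/-- The differential `d = ∑_{i=1}^{n+1} (-1)^i (η_{n,i,1} - η_{n,i,0}) : □^n ⟶ □^{n+1}`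
(`i` is counted from `0` in the formula below). -/
def cubeD (Q : ECube ⥤ C) (n : ℕ) : Q.obj ⟨n⟩ ⟶ Q.obj ⟨n + 1⟩ :=
  ∑ i : Fin (n + 1), (-1 : ℤ) ^ ((i : ℕ) + 1) •
    (Q.map (ECube.face n i true) - Q.map (ECube.face n i false))

/-- The idempotent `η_{n,i,1} ∘ p_{n+1,i}` of `{0,1}^n`, replacing the `i`-th coordinate by `1`. -/
def ECube.setOne : (n : ℕ) → Fin n → ((⟨n⟩ : ECube) ⟶ ⟨n⟩)
  | n + 1, i => ECube.proj n i ≫ ECube.face n i true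

/-- The product of the commuting idempotents `id - η_{n,i,1} ∘ p_{n+1,i}`, `i = 1, …, n`. This is an
idempotent endomorphism of `□^n`: a morphism out of `□^n` is killed by all faces `η_{n,i,1}` if and only if it is fixed by
precomposition with `cubeE`, and a morphism into `□^n` is killed by all projections `p_{n,i}`
if and only if it is fixed by postcomposition with `cubeE`. -/
def cubeE (Q : ECube ⥤ C) (n : ℕ) : Q.obj ⟨n⟩ ⟶ Q.obj ⟨n⟩ :=
  (List.finRange n).foldr (fun i x => (𝟙 _ - Q.map (ECube.setOne n i)) ≫ x) (𝟙 _)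

theorem ECube.setOne_fn (n : ℕ) (i : Fin n) (y : Fin n → Bool) :
    Hom.fn (ECube.setOne n i) y = Function.update y i true := by
  cases n with
  | zero => exact i.elim0
  | succ n =>
    change Fin.insertNth (α := fun _ => Bool) i true (fun j => y (i.succAbove j)) = _
    funext k
    refine Fin.succAboveCases i ?_ (fun j => ?_) k
    · simp
    · simp

theorem ECube.setOne_comm (n : ℕ) (i j : Fin n) :
    ECube.setOne n i ≫ ECube.setOne n j = ECube.setOne n j ≫ ECube.setOne n i := by
  ext1 y
  change Hom.fn (ECube.setOne n j) (Hom.fn (ECube.setOne n i) y) =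
    Hom.fn (ECube.setOne n i) (Hom.fn (ECube.setOne n j) y)
  simp only [ECube.setOne_fn]
  by_cases h : i = j
  · rw [h]
  · rw [Function.update_comm h]

section E

variable (Q : ECube ⥤ C) {n : ℕ}

theorem foldE_left {A : C} (i : Fin n) (L : List (Fin n)) (hi : i ∈ L) (a : A ⟶ Q.obj ⟨n⟩)
    (h : a ≫ Q.map (ECube.setOne n i) = a) :
    a ≫ L.foldr (fun i x => (𝟙 _ - Q.map (ECube.setOne n i)) ≫ x) (𝟙 _) = 0 := by
  induction L generalizing a with
  | nil => simp at hi
  | cons k L ih =>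
    rw [List.foldr_cons, ← Category.assoc]
    rcases List.mem_cons.1 hi with rfl | hi
    · simp [Preadditive.comp_sub, h]
    · refine ih hi _ ?_
      simp only [Preadditive.comp_sub, Preadditive.sub_comp, Category.comp_id, Category.assoc, h]
      rw [← Q.map_comp, ECube.setOne_comm, Q.map_comp, reassoc_of% h]

/-- A morphism into `□^n` fixed by one of the idempotents is killed by `cubeE`. -/
theorem comp_cubeE_of_fixed {A : C} (i : Fin n) (a : A ⟶ Q.obj ⟨n⟩)
    (h : a ≫ Q.map (ECube.setOne n i) = a) : a ≫ cubeE Q n = 0 :=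
  foldE_left Q i _ (List.mem_finRange i) a h

theorem foldE_right {A : C} (i : Fin n) (L : List (Fin n)) (hi : i ∈ L) (a : Q.obj ⟨n⟩ ⟶ A)
    (h : Q.map (ECube.setOne n i) ≫ a = a) :
    L.foldr (fun i x => (𝟙 _ - Q.map (ECube.setOne n i)) ≫ x) (𝟙 _) ≫ a = 0 := by
  have comm : ∀ M : List (Fin n),
      Q.map (ECube.setOne n i) ≫
        M.foldr (fun i x => (𝟙 _ - Q.map (ECube.setOne n i)) ≫ x) (𝟙 _) =
      M.foldr (fun i x => (𝟙 _ - Q.map (ECube.setOne n i)) ≫ x) (𝟙 _) ≫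
        Q.map (ECube.setOne n i) := by
    intro M
    induction M with
    | nil => simp
    | cons k M ih =>
      rw [List.foldr_cons, Category.assoc, ← ih]
      simp only [Preadditive.comp_sub, Preadditive.sub_comp, Category.id_comp,
        ← Category.assoc]
      simp only [← Q.map_comp, ECube.setOne_comm n i k]
  induction L with
  | nil => simp at hi
  | cons k L ih =>
    rw [List.foldr_cons, Category.assoc]
    rcases List.mem_cons.1 hi with rfl | hi
    · have : Q.map (ECube.setOne n i) ≫ L.foldr (fun i x => (𝟙 _ - Q.map (ECube.setOne n i)) ≫ x)
          (𝟙 _) ≫ a = L.foldr (fun i x => (𝟙 _ - Q.map (ECube.setOne n i)) ≫ x) (𝟙 _) ≫ a := by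
        rw [← Category.assoc, comm, Category.assoc, h]
      rw [Preadditive.sub_comp, this, Category.id_comp, sub_self]
    · rw [ih hi, Limits.comp_zero]

/-- A morphism out of `□^n` fixed by one of the idempotents is killed by `cubeE`. -/
theorem cubeE_comp_of_fixed {A : C} (i : Fin n) (a : Q.obj ⟨n⟩ ⟶ A)
    (h : Q.map (ECube.setOne n i) ≫ a = a) : cubeE Q n ≫ a = 0 :=
  foldE_right Q i _ (List.mem_finRange i) a h

theorem foldE_fix_left {A : C} (L : List (Fin n)) (a : A ⟶ Q.obj ⟨n⟩)
    (h : ∀ i, a ≫ Q.map (ECube.setOne n i) = 0) :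
    a ≫ L.foldr (fun i x => (𝟙 _ - Q.map (ECube.setOne n i)) ≫ x) (𝟙 _) = a := by
  induction L with
  | nil => simp
  | cons k L ih =>
    rw [List.foldr_cons, ← Category.assoc, Preadditive.comp_sub, h, Category.comp_id, sub_zero, ih]

theorem foldE_fix_right {A : C} (L : List (Fin n)) (a : Q.obj ⟨n⟩ ⟶ A)
    (h : ∀ i, Q.map (ECube.setOne n i) ≫ a = 0) :
    L.foldr (fun i x => (𝟙 _ - Q.map (ECube.setOne n i)) ≫ x) (𝟙 _) ≫ a = a := by
  induction L with
  | nil => simp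
  | cons k L ih =>
    rw [List.foldr_cons, Category.assoc, ih, Preadditive.sub_comp, h, Category.id_comp, sub_zero]

theorem ECube.face_setOne (n : ℕ) (i : Fin (n + 1)) :
    ECube.face n i true ≫ ECube.setOne (n + 1) i = ECube.face n i true := by
  ext1 y
  refine (ECube.setOne_fn _ _ _).trans ?_
  change Function.update (Fin.insertNth (α := fun _ => Bool) i true y) i true =
    Fin.insertNth (α := fun _ => Bool) i true y
  rw [Function.update_eq_self_iff]
  simp

theorem ECube.setOne_proj (n : ℕ) (i : Fin (n + 1)) :
    ECube.setOne (n + 1) i ≫ ECube.proj n i = ECube.proj n i := by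
  ext1 y
  funext j
  change ECube.Hom.fn (ECube.setOne (n + 1) i) y (i.succAbove j) = y (i.succAbove j)
  rw [ECube.setOne_fn]
  exact Function.update_of_ne (Fin.succAbove_ne i j) _ _

theorem setOne_comp_cubeE (i : Fin n) : Q.map (ECube.setOne n i) ≫ cubeE Q n = 0 := by
  apply comp_cubeE_of_fixed Q i
  rw [← Q.map_comp]
  congr 1
  ext1 y
  refine (ECube.setOne_fn _ _ _).trans ?_
  rw [ECube.setOne_fn, Function.update_idem]

theorem cubeE_comp_setOne (i : Fin n) : cubeE Q n ≫ Q.map (ECube.setOne n i) = 0 := by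
  apply cubeE_comp_of_fixed Q i
  rw [← Q.map_comp]
  congr 1
  ext1 y
  change ECube.Hom.fn (ECube.setOne n i) (ECube.Hom.fn (ECube.setOne n i) y) = _
  rw [ECube.setOne_fn, ECube.setOne_fn, Function.update_idem]

theorem cubeE_idem (n : ℕ) : cubeE Q n ≫ cubeE Q n = cubeE Q n :=
  foldE_fix_left Q _ _ fun i => cubeE_comp_setOne Q i

/-- A morphism out of `□^{n+1}` is killed by all the faces `η_{n,i,1}` if and only if it is fixed by
`cubeE`. -/
theorem cubeE_comp_eq_iff {A : C} (n : ℕ) (a : Q.obj ⟨n + 1⟩ ⟶ A) :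
    cubeE Q (n + 1) ≫ a = a ↔ ∀ i, Q.map (ECube.face n i true) ≫ a = 0 := by
  constructor
  · intro h i
    rw [← h, ← Category.assoc, comp_cubeE_of_fixed Q i, Limits.zero_comp]
    rw [← Q.map_comp, ECube.face_setOne]
  · intro h
    refine foldE_fix_right Q _ a fun i => ?_
    change Q.map (ECube.proj n i ≫ ECube.face n i true) ≫ a = 0
    rw [Q.map_comp, Category.assoc, h, Limits.comp_zero]

/-- A morphism into `□^{n+1}` is killed by all the projections `p_{n+1,i}` if and only if it is fixed
by `cubeE`. -/
theorem comp_cubeE_eq_iff {A : C} (n : ℕ) (a : A ⟶ Q.obj ⟨n + 1⟩) :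
    a ≫ cubeE Q (n + 1) = a ↔ ∀ i, a ≫ Q.map (ECube.proj n i) = 0 := by
  constructor
  · intro h i
    rw [← h, Category.assoc, cubeE_comp_of_fixed Q i, Limits.comp_zero]
    rw [← Q.map_comp, ECube.setOne_proj]
  · intro h
    refine foldE_fix_left Q _ a fun i => ?_
    change a ≫ Q.map (ECube.proj n i ≫ ECube.face n i true) = 0
    rw [Q.map_comp, reassoc_of% h i, Limits.zero_comp]

end E

theorem ECube.face_face (n : ℕ) (i k : Fin (n + 1)) (ε ε' : Bool) (h : i ≤ k) :
    ECube.face n i ε ≫ ECube.face (n + 1) k.succ ε' =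
      ECube.face n k ε' ≫ ECube.face (n + 1) i.castSucc ε := by
  ext1 y
  change Fin.insertNth (α := fun _ => Bool) k.succ ε' (Fin.insertNth (α := fun _ => Bool) i ε y) =
    Fin.insertNth (α := fun _ => Bool) i.castSucc ε (Fin.insertNth (α := fun _ => Bool) k ε' y)
  funext l
  refine Fin.succAboveCases k.succ ?_ (fun l => ?_) l
  · have e : k.succ = i.castSucc.succAbove k := by
      rw [Fin.le_def] at h
      ext
      simp only [Fin.succAbove, Fin.lt_def, Fin.val_castSucc, Fin.val_succ]
      split_ifs <;> simp at * <;> omega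
    rw [Fin.insertNth_apply_same, e, Fin.insertNth_apply_succAbove, Fin.insertNth_apply_same]
  · rw [Fin.insertNth_apply_succAbove]
    refine Fin.succAboveCases i ?_ (fun r => ?_) l
    · have e : k.succ.succAbove i = i.castSucc := by
        rw [Fin.le_def] at h
        ext
        simp only [Fin.succAbove, Fin.lt_def, Fin.val_castSucc, Fin.val_succ]
        split_ifs <;> simp at * <;> omega
      rw [e, Fin.insertNth_apply_same, Fin.insertNth_apply_same]
    · have e : k.succ.succAbove (i.succAbove r) = i.castSucc.succAbove (k.succAbove r) := by
        rw [Fin.le_def] at h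
        ext
        simp only [Fin.succAbove, Fin.lt_def]
        split_ifs <;> simp at * <;> omega
      rw [e]
      simp only [Fin.insertNth_apply_succAbove]

theorem cubeD_comp_cubeD (Q : ECube ⥤ C) (n : ℕ) : cubeD Q n ≫ cubeD Q (n + 1) = 0 := by
  have key : ∀ i k : Fin (n + 1), i ≤ k →
      (Q.map (ECube.face n i true) - Q.map (ECube.face n i false)) ≫
        (Q.map (ECube.face (n + 1) k.succ true) - Q.map (ECube.face (n + 1) k.succ false)) =
      (Q.map (ECube.face n k true) - Q.map (ECube.face n k false)) ≫
        (Q.map (ECube.face (n + 1) i.castSucc true) -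
          Q.map (ECube.face (n + 1) i.castSucc false)) := by
    intro i k h
    simp only [Preadditive.comp_sub, Preadditive.sub_comp, ← Q.map_comp,
      ECube.face_face n i k _ _ h]
    abel
  simp only [cubeD, Preadditive.comp_sum, Preadditive.sum_comp, ← Finset.sum_product',
    Finset.univ_product_univ]
  rw [← Finset.sum_add_sum_compl (Finset.univ.filter
    fun ij : Fin (n + 1 + 1) × Fin (n + 1) => (ij.1 : ℕ) ≤ (ij.2 : ℕ)),
    ← eq_neg_iff_add_eq_zero, ← Finset.sum_neg_distrib]
  refine Finset.sum_bij (fun ij hij => (ij.2.succ, Fin.castLT ij.1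
    (lt_of_le_of_lt (Finset.mem_filter.mp hij).right (Fin.is_lt ij.2)))) ?_ ?_ ?_ ?_
  · intro ij hij
    simp only [Finset.compl_filter, Finset.mem_filter, Finset.mem_univ, true_and, Fin.val_succ,
      Fin.val_castLT] at hij ⊢
    omega
  · rintro ⟨i, j⟩ hij ⟨i', j'⟩ hij' h
    simp only [Prod.mk.injEq, Fin.ext_iff, Fin.val_castLT, Fin.val_succ] at h ⊢
    exact ⟨h.2, by omega⟩
  · rintro ⟨i, j⟩ hij
    simp only [Finset.compl_filter, Finset.mem_filter, Finset.mem_univ, true_and, not_le] at hij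
    have hi : i ≠ 0 := by
      rintro rfl
      simp at hij
    refine ⟨(j.castSucc, i.pred hi), ?_, ?_⟩
    · simp only [Finset.mem_filter, Finset.mem_univ, true_and, Fin.val_castSucc, Fin.val_pred]
      omega
    · simp
  · rintro ⟨i, j⟩ hij
    simp only [Finset.mem_filter, Finset.mem_univ, true_and] at hij
    simp only [Preadditive.zsmul_comp, Preadditive.comp_zsmul, smul_smul, ← neg_smul]
    have h := key (Fin.castLT i (lt_of_le_of_lt hij j.isLt)) j hij
    rw [Fin.castSucc_castLT] at h
    rw [h]
    congr 1
    simp only [Fin.val_succ, Fin.val_castLT, pow_succ]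
    ring

theorem cubeE_comp_cubeD (Q : ECube ⥤ C) (n : ℕ) :
    cubeE Q n ≫ cubeD Q n = cubeD Q n ≫ cubeE Q (n + 1) := by
  have hA : (cubeE Q n ≫ cubeD Q n) ≫ cubeE Q (n + 1) = cubeE Q n ≫ cubeD Q n := by
    rw [comp_cubeE_eq_iff]
    intro i
    simp only [cubeD, Preadditive.comp_sum, Preadditive.sum_comp]
    refine Finset.sum_eq_zero fun k _ => ?_
    simp only [Preadditive.comp_zsmul, Preadditive.zsmul_comp, Preadditive.comp_sub,
      Preadditive.sub_comp, Category.assoc]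
    by_cases hk : i = k
    · subst hk
      have e : ∀ ε, ECube.face n i ε ≫ ECube.proj n i = 𝟙 _ := by
        intro ε
        ext1 y
        funext j
        exact Fin.insertNth_apply_succAbove (α := fun _ => Bool) i ε y j
      simp only [← Q.map_comp, e, sub_self, smul_zero]
    · obtain ⟨j, rfl⟩ := Fin.exists_succAbove_eq hk
      have e : ∀ ε, cubeE Q n ≫ Q.map (ECube.face n k ε) ≫ Q.map (ECube.proj n (k.succAbove j)) = 0 := by
        intro ε
        apply cubeE_comp_of_fixed Q j
        simp only [← Q.map_comp]
        congr 1
        ext1 y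
        funext l
        change Fin.insertNth (α := fun _ => Bool) k ε (ECube.Hom.fn (ECube.setOne n j) y)
          ((k.succAbove j).succAbove l) =
          Fin.insertNth (α := fun _ => Bool) k ε y ((k.succAbove j).succAbove l)
        rw [ECube.setOne_fn]
        by_cases hl : (k.succAbove j).succAbove l = k
        · rw [hl, Fin.insertNth_apply_same, Fin.insertNth_apply_same]
        · obtain ⟨r, hr⟩ := Fin.exists_succAbove_eq hl
          rw [← hr, Fin.insertNth_apply_succAbove, Fin.insertNth_apply_succAbove,
            Function.update_of_ne]
          rintro rfl
          exact Fin.succAbove_ne _ _ hr.symm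
      rw [e, e, sub_self, smul_zero]
  have hB : cubeE Q n ≫ cubeD Q n ≫ cubeE Q (n + 1) = cubeD Q n ≫ cubeE Q (n + 1) := by
    refine foldE_fix_right Q _ _ fun i => ?_
    simp only [cubeD, Preadditive.comp_sum, Preadditive.sum_comp]
    refine Finset.sum_eq_zero fun k _ => ?_
    have e : ∀ ε, Q.map (ECube.setOne n i) ≫ Q.map (ECube.face n k ε) ≫ cubeE Q (n + 1) = 0 := by
      intro ε
      rw [← Category.assoc]
      apply comp_cubeE_of_fixed Q (k.succAbove i)
      simp only [← Q.map_comp]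
      congr 1
      ext1 y
      refine (ECube.setOne_fn _ _ _).trans ?_
      rw [Function.update_eq_self_iff]
      change true = Fin.insertNth (α := fun _ => Bool) k ε (ECube.Hom.fn (ECube.setOne n i) y) _
      rw [Fin.insertNth_apply_succAbove, ECube.setOne_fn, Function.update_self]
    simp only [Preadditive.comp_zsmul, Preadditive.zsmul_comp, Preadditive.comp_sub,
      Preadditive.sub_comp, e, sub_self, smul_zero]
  rw [← hA, Category.assoc, hB]

end CubeComplex

/-! ## DG categories, DG modules and their derived category -/

/-- Complexes of abelian groups, with differential of degree `1`. -/
abbrev AbComplex : Type (v + 1) := CochainComplex AddCommGrpCat.{v} ℤ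

namespace AbComplex

/-- The `0`-cocycles. -/
def Z0 (K : AbComplex.{v}) : AddSubgroup (K.X 0) := (K.d 0 1).hom.ker

/-- The `0`-coboundaries. -/
def B0 (K : AbComplex.{v}) : AddSubgroup (K.X 0) := (K.d (-1) 0).hom.range

/-- The cohomology in degree `0`. -/
abbrev H0 (K : AbComplex.{v}) : Type v := K.Z0 ⧸ K.B0.addSubgroupOf K.Z0

/-- The class of a `0`-cocycle. -/
abbrev mk (K : AbComplex.{v}) (z : K.Z0) : K.H0 := QuotientAddGroup.mk z

end AbComplex

/-- A DG category with set of objects `O`. -/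
structure DGCat (O : Type u) where
  /-- the morphism complexes -/
  Hom : O → O → AbComplex.{v}
  /-- the composition `g ∘ f` of `g` of degree `p` and `f` of degree `q` -/
  comp {X Y Z : O} (p q n : ℤ) (h : p + q = n) :
    (Hom Y Z).X p →+ (Hom X Y).X q →+ (Hom X Z).X n
  /-- the identities -/
  id (X : O) : (Hom X X).X 0
  d_comp {X Y Z : O} (p q n : ℤ) (h : p + q = n) (g : (Hom Y Z).X p) (f : (Hom X Y).X q) :
    (Hom X Z).d n (n + 1) (comp p q n h g f) =
      comp (p + 1) q (n + 1) (by omega) ((Hom Y Z).d p (p + 1) g) f +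
        p.negOnePow • comp p (q + 1) (n + 1) (by omega) g ((Hom X Y).d q (q + 1) f)
  d_id (X : O) : (Hom X X).d 0 1 (id X) = 0
  id_comp {X Y : O} (q : ℤ) (f : (Hom X Y).X q) : comp 0 q q (by omega) (id Y) f = f
  comp_id {X Y : O} (p : ℤ) (f : (Hom X Y).X p) : comp p 0 p (by omega) f (id X) = f
  assoc {X Y Z W : O} (p q r pq qr n : ℤ) (hpq : p + q = pq) (hqr : q + r = qr)
    (hn : p + q + r = n) (f : (Hom Z W).X p) (g : (Hom Y Z).X q) (h : (Hom X Y).X r) :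
    comp pq r n (by omega) (comp p q pq hpq f g) h = comp p qr n (by omega) f (comp q r qr hqr g h)

/-- A DG functor from a DG category to the DG category of complexes of abelian groups. -/
structure DGMod {O : Type u} (𝒟 : DGCat.{v} O) where
  /-- the complexes -/
  obj : O → AbComplex.{v}
  /-- the action of the morphisms -/
  act {X Y : O} (p q n : ℤ) (h : p + q = n) : (𝒟.Hom X Y).X p →+ (obj X).X q →+ (obj Y).X n
  d_act {X Y : O} (p q n : ℤ) (h : p + q = n) (f : (𝒟.Hom X Y).X p) (x : (obj X).X q) :
    (obj Y).d n (n + 1) (act p q n h f x) =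
      act (p + 1) q (n + 1) (by omega) ((𝒟.Hom X Y).d p (p + 1) f) x +
        p.negOnePow • act p (q + 1) (n + 1) (by omega) f ((obj X).d q (q + 1) x)
  id_act {X : O} (q : ℤ) (x : (obj X).X q) : act 0 q q (by omega) (𝒟.id X) x = x
  comp_act {X Y Z : O} (p q r pq qr n : ℤ) (hpq : p + q = pq) (hqr : q + r = qr)
    (hn : p + q + r = n) (g : (𝒟.Hom Y Z).X p) (f : (𝒟.Hom X Y).X q) (x : (obj X).X r) :
    act pq r n (by omega) (𝒟.comp p q pq hpq g f) x = act p qr n (by omega) g (act q r qr hqr f x)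

namespace DGMod

variable {O : Type u} {𝒟 : DGCat.{v} O}

/-- The closed morphisms of degree `0` of DG modules. -/
@[ext]
structure Hom (M N : DGMod 𝒟) where
  /-- the components -/
  app (X : O) : M.obj X ⟶ N.obj X
  app_act {X Y : O} (p q n : ℤ) (h : p + q = n) (f : (𝒟.Hom X Y).X p) (x : (M.obj X).X q) :
    (app Y).f n (M.act p q n h f x) = N.act p q n h f ((app X).f q x)

instance : Category (DGMod 𝒟) where
  Hom := Hom
  id M := ⟨fun X => 𝟙 (M.obj X), fun _ _ _ _ _ _ => rfl⟩
  comp φ ψ := ⟨fun X => φ.app X ≫ ψ.app X, fun p q n h f x => by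
    simp [φ.app_act, ψ.app_act]⟩

/-- The quasi-isomorphisms of DG modules. -/
def quasiIso (𝒟 : DGCat.{v} O) : MorphismProperty (DGMod 𝒟) := fun _ _ φ =>
  ∀ X, QuasiIso (Hom.app φ X)

/-- The derived category `D(𝒟ᵒᵖ)` of DG functors from `𝒟` to complexes of abelian groups: the
localization with respect to the quasi-isomorphisms. -/
abbrev Derived (𝒟 : DGCat.{v} O) : Type _ := (quasiIso 𝒟).Localization

/-- The DG functor `Hom(A, -)`. -/
def corep (𝒟 : DGCat.{v} O) (A : O) : DGMod 𝒟 where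
  obj X := 𝒟.Hom A X
  act p q n h := 𝒟.comp p q n h
  d_act p q n h f x := 𝒟.d_comp p q n h f x
  id_act q x := 𝒟.id_comp q x
  comp_act p q r pq qr n hpq hqr hn g f x := 𝒟.assoc p q r pq qr n hpq hqr hn g f x

/-- The morphism `Hom(A, -) ⟶ M`, `h ↦ h · u`, given by a `0`-cocycle `u` of `M(A)`. -/
def ofCocycle (M : DGMod 𝒟) (A : O) (u : (M.obj A).Z0) : corep 𝒟 A ⟶ M :=
  Hom.mk
    (fun X => { 
      f n := AddCommGrpCat.ofHom ((M.act n 0 n (by omega)).flip u.1)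
      comm' p q h := by
        obtain rfl : p + 1 = q := h
        ext x
        have h0 : (M.obj A).d 0 (0 + 1) u.1 = 0 := u.2
        have := M.d_act p 0 p (by omega) x u.1
        rw [h0, map_zero, smul_zero] at this
        exact this.trans (add_zero _) })
    (fun p q n h f x => M.comp_act p q 0 n q n h (by omega) (by omega) f x u.1)

end DGMod

/-! ### The homotopy category -/

/-- The objects of the homotopy category `H⁰ 𝒟`. -/
@[ext]
structure H0Cat {O : Type u} (𝒟 : DGCat.{v} O) where
  /-- the object of `𝒟` -/
  obj : O

namespace H0Cat

variable {O : Type u} {𝒟 : DGCat.{v} O}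

theorem comp_mem {X Y Z : O} (g : (𝒟.Hom Y Z).Z0) (f : (𝒟.Hom X Y).Z0) :
    𝒟.comp 0 0 0 (by omega) g.1 f.1 ∈ (𝒟.Hom X Z).Z0 := by
  have h := 𝒟.d_comp 0 0 0 (by omega) g.1 f.1
  have hg : (𝒟.Hom Y Z).d 0 (0 + 1) g.1 = 0 := g.2
  have hf : (𝒟.Hom X Y).d 0 (0 + 1) f.1 = 0 := f.2
  rw [hg, hf, map_zero, map_zero, AddMonoidHom.zero_apply, smul_zero] at h
  exact h.trans (add_zero _)

theorem comp_mem_left {X Y Z : O} (g : (𝒟.Hom Y Z).X 0) (hg : g ∈ (𝒟.Hom Y Z).B0)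
    (f : (𝒟.Hom X Y).Z0) : 𝒟.comp 0 0 0 (by omega) g f.1 ∈ (𝒟.Hom X Z).B0 := by
  obtain ⟨a, rfl⟩ := hg
  refine ⟨𝒟.comp (-1) 0 (-1) (by omega) a f.1, ?_⟩
  have h := 𝒟.d_comp (-1) 0 (-1) (by omega) a f.1
  have hf : (𝒟.Hom X Y).d 0 (0 + 1) f.1 = 0 := f.2
  rw [hf, map_zero, smul_zero] at h
  exact h.trans (add_zero _)

theorem comp_mem_right {X Y Z : O} (g : (𝒟.Hom Y Z).Z0) (f : (𝒟.Hom X Y).X 0)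
    (hf : f ∈ (𝒟.Hom X Y).B0) : 𝒟.comp 0 0 0 (by omega) g.1 f ∈ (𝒟.Hom X Z).B0 := by
  obtain ⟨b, rfl⟩ := hf
  refine ⟨𝒟.comp 0 (-1) (-1) (by omega) g.1 b, ?_⟩
  have h := 𝒟.d_comp 0 (-1) (-1) (by omega) g.1 b
  have hg : (𝒟.Hom Y Z).d 0 (0 + 1) g.1 = 0 := g.2
  rw [hg, map_zero, AddMonoidHom.zero_apply, Int.negOnePow_zero, one_smul] at h
  exact h.trans (zero_add _)

/-- The composition `g ∘ f` of morphisms in `H⁰ 𝒟`. -/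
def comp {X Y Z : O} : (𝒟.Hom Y Z).H0 → (𝒟.Hom X Y).H0 → (𝒟.Hom X Z).H0 :=
  Quotient.map₂ (fun g f => ⟨𝒟.comp 0 0 0 (by omega) g.1 f.1, comp_mem g f⟩) (by
    intro g g' hg f f' hf
    refine QuotientAddGroup.leftRel_apply.2 ?_
    have hg1 : -g + g' ∈ (𝒟.Hom Y Z).B0.addSubgroupOf (𝒟.Hom Y Z).Z0 :=
      QuotientAddGroup.leftRel_apply.1 hg
    have hf1 : -f + f' ∈ (𝒟.Hom X Y).B0.addSubgroupOf (𝒟.Hom X Y).Z0 :=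
      QuotientAddGroup.leftRel_apply.1 hf
    have h1 := comp_mem_left _ (AddSubgroup.mem_addSubgroupOf.1 hg1) f
    have h2 := comp_mem_right g' _ (AddSubgroup.mem_addSubgroupOf.1 hf1)
    have h3 := add_mem h1 h2
    simp only [AddSubgroup.coe_add, AddSubgroup.coe_neg, map_add,
      map_neg, AddMonoidHom.add_apply, AddMonoidHom.neg_apply] at h3
    refine AddSubgroup.mem_addSubgroupOf.2 ?_
    rwa [add_assoc, add_neg_cancel_left] at h3)

/-- The category `H⁰ 𝒟`: morphisms are the classes of `0`-cocycles. -/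
instance : Category.{v} (H0Cat 𝒟) where
  Hom X Y := (𝒟.Hom X.obj Y.obj).H0
  id X := (𝒟.Hom X.obj X.obj).mk ⟨𝒟.id X.obj, 𝒟.d_id X.obj⟩
  comp f g := comp g f
  id_comp := by
    rintro X Y ⟨f⟩
    exact congrArg (QuotientAddGroup.mk) (Subtype.ext (𝒟.comp_id 0 f.1))
  comp_id := by
    rintro X Y ⟨f⟩
    exact congrArg (QuotientAddGroup.mk) (Subtype.ext (𝒟.id_comp 0 f.1))
  assoc := by
    rintro X Y Z W ⟨f⟩ ⟨g⟩ ⟨h⟩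
    exact congrArg (QuotientAddGroup.mk)
      (Subtype.ext (𝒟.assoc 0 0 0 0 0 0 rfl rfl rfl h.1 g.1 f.1).symm)

/-- The morphism of `H⁰ 𝒟` given by a `0`-cocycle. -/
def homMk {X Y : O} (z : (𝒟.Hom X Y).Z0) : (⟨X⟩ : H0Cat 𝒟) ⟶ ⟨Y⟩ := (𝒟.Hom X Y).mk z

instance : Preadditive (H0Cat 𝒟) where
  homGroup X Y := inferInstanceAs (AddCommGroup (𝒟.Hom X.obj Y.obj).H0)
  add_comp := by
    rintro X Y Z ⟨f⟩ ⟨f'⟩ ⟨g⟩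
    exact congrArg (QuotientAddGroup.mk)
      (Subtype.ext (map_add (𝒟.comp 0 0 0 (add_zero 0) g.1) f.1 f'.1))
  comp_add := by
    rintro X Y Z ⟨f⟩ ⟨g⟩ ⟨g'⟩
    exact congrArg (QuotientAddGroup.mk)
      (Subtype.ext (DFunLike.congr_fun (map_add (𝒟.comp 0 0 0 (add_zero 0)) g.1 g'.1) f.1))

end H0Cat

/-! ## Pseudo-tensor structures -/

namespace FinIdx

instance (I : FinIdx) : LT I.α := ⟨fun i j => I.e.symm i < I.e.symm j⟩

instance (I : FinIdx) : DecidableRel (α := I.α) (· < ·) := fun i j =>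
  inferInstanceAs (Decidable (I.e.symm i < I.e.symm j))

/-- The exponent of the sign in the composition of homogeneous elements. For elements `x_j`
(`j ∈ J ≅ ∐ i, F i`) of degree `p j` and elements `g_i` (`i ∈ I`) of degree `n i`, this is the sign
of the rearrangement of `(⊗_i g_i) ⊗ (⊗_{j ∈ J} x_j)` into `⊗_i (g_i ⊗ (⊗_{j ∈ F i} x_j))`. -/
def koszul {I : FinIdx} {F : I.α → FinIdx} {J : FinIdx} (σ : (Σ i, (F i).α) ≃ J.α)
    (n : I.α → ℤ) (p : J.α → ℤ) : ℤ :=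
  (∑ i, ∑ l, if l < i then (∑ t, p (σ ⟨l, t⟩)) * n i else 0) +
    ∑ a : Σ i, (F i).α, ∑ b : Σ i, (F i).α,
      if Sigma.Lex (· < ·) (fun _ => (· < ·)) a b ∧ σ b < σ a then p (σ a) * p (σ b) else 0

/-- `∐_{i ∈ {0}} J = J`. -/
def sigmaOne (J : FinIdx) : (Σ _ : one.α, J.α) ≃ J.α where
  toFun p := p.2
  invFun j := ⟨(0 : Fin 1), j⟩
  left_inv := by
    rintro ⟨i, j⟩
    obtain rfl : i = (0 : Fin 1) := Subsingleton.elim (α := Fin 1) _ _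
    rfl
  right_inv _ := rfl

/-- `∐_{i ∈ I} {0} = I`. -/
def sigmaUnit (I : FinIdx) : (Σ _ : I.α, one.α) ≃ I.α where
  toFun p := p.1
  invFun i := ⟨i, (0 : Fin 1)⟩
  left_inv := by
    rintro ⟨i, j⟩
    obtain rfl : j = (0 : Fin 1) := Subsingleton.elim (α := Fin 1) _ _
    rfl
  right_inv _ := rfl

end FinIdx

namespace AbComplex

/-- The family `(g_i)` with `g_k` replaced by `∂ g_k`. -/
def dAt {I : FinIdx} {K : I.α → AbComplex.{v}} {n : I.α → ℤ} (g : ∀ i, (K i).X (n i)) (k : I.α)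
    (i : I.α) : (K i).X (n i + if i = k then 1 else 0) :=
  if h : i = k then (K i).d _ _ (g i) else cast (by simp [h]) (g i)

theorem sum_dAt {I : FinIdx} {n : I.α → ℤ} {m N : ℤ} (h : m + ∑ i, n i = N) (k : I.α) :
    m + ∑ i, (n i + if i = k then 1 else 0) = N + 1 := by
  rw [Finset.sum_add_distrib, Finset.sum_ite_eq' Finset.univ k, if_pos (Finset.mem_univ k), ← h]
  ring

end AbComplex

/-- The data of a pseudo-tensor structure on a DG category `𝒟` with set of objects `O`. A surjection
`J ↠ I` of finite sets is given by its fibres `F i` and the bijection `σ : ∐ i, F i ≅ J`. -/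
structure PseudoTensorData {O : Type u} (𝒟 : DGCat.{v} O) where
  /-- the complexes `P_I({X_i}, Y)` -/
  P (I : FinIdx) (X : I.α → O) (Y : O) : AbComplex.{v}
  /-- the composition `f(g_i)` -/
  comp {I : FinIdx} {F : I.α → FinIdx} {J : FinIdx} (σ : (Σ i, (F i).α) ≃ J.α) {X : J.α → O}
    {Y : I.α → O} {Z : O} (m : ℤ) (n : I.α → ℤ) (N : ℤ) (h : m + ∑ i, n i = N)
    (f : (P I Y Z).X m) (g : ∀ i, (P (F i) (fun t => X (σ ⟨i, t⟩)) (Y i)).X (n i)) :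
    (P J X Z).X N
  /-- the identification of `P_1(X, Y)` with the complex `Hom(X, Y)` of `𝒟` -/
  unary (X Y : O) : 𝒟.Hom X Y ≅ P FinIdx.one (fun _ => X) Y

namespace PseudoTensorData

variable {O : Type u} {𝒟 : DGCat.{v} O} (D : PseudoTensorData 𝒟)

/-- The element of `P_1(X, Y)` given by a morphism of `𝒟`. -/
def un {X Y : O} {p : ℤ} (f : (𝒟.Hom X Y).X p) : (D.P FinIdx.one (fun _ => X) Y).X p :=
  (D.unary X Y).hom.f p f

/-- The identification of `P_I({X_i}, Y)` and `P_I({X'_i}, Y)` for equal families of objects. -/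
def castX {I : FinIdx} {X X' : I.α → O} {Y : O} {m : ℤ} (h : ∀ i, X i = X' i)
    (f : (D.P I X Y).X m) : (D.P I X' Y).X m :=
  cast (by rw [funext h]) f

/-- The axioms of a pseudo-tensor structure. -/
structure IsPseudoTensor : Prop where
  comp_add_left {I : FinIdx} {F : I.α → FinIdx} {J : FinIdx} (σ : (Σ i, (F i).α) ≃ J.α)
    {X : J.α → O} {Y : I.α → O} {Z : O} (m : ℤ) (n : I.α → ℤ) (N : ℤ) (h : m + ∑ i, n i = N)
    (f f' : (D.P I Y Z).X m) (g : ∀ i, (D.P (F i) (fun t => X (σ ⟨i, t⟩)) (Y i)).X (n i)) :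
    D.comp σ m n N h (f + f') g = D.comp σ m n N h f g + D.comp σ m n N h f' g
  comp_add_right {I : FinIdx} {F : I.α → FinIdx} {J : FinIdx} (σ : (Σ i, (F i).α) ≃ J.α)
    {X : J.α → O} {Y : I.α → O} {Z : O} (m : ℤ) (n : I.α → ℤ) (N : ℤ) (h : m + ∑ i, n i = N)
    (f : (D.P I Y Z).X m) (g : ∀ i, (D.P (F i) (fun t => X (σ ⟨i, t⟩)) (Y i)).X (n i))
    (k : I.α) (x y : (D.P (F k) (fun t => X (σ ⟨k, t⟩)) (Y k)).X (n k)) :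
    D.comp σ m n N h f (Function.update g k (x + y)) =
      D.comp σ m n N h f (Function.update g k x) + D.comp σ m n N h f (Function.update g k y)
  /-- the composition is a map of complexes -/
  d_comp {I : FinIdx} {F : I.α → FinIdx} {J : FinIdx} (σ : (Σ i, (F i).α) ≃ J.α)
    {X : J.α → O} {Y : I.α → O} {Z : O} (m : ℤ) (n : I.α → ℤ) (N : ℤ) (h : m + ∑ i, n i = N)
    (f : (D.P I Y Z).X m) (g : ∀ i, (D.P (F i) (fun t => X (σ ⟨i, t⟩)) (Y i)).X (n i)) :
    (D.P J X Z).d N (N + 1) (D.comp σ m n N h f g) =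
      D.comp σ (m + 1) n (N + 1) (by omega) ((D.P I Y Z).d m (m + 1) f) g +
        ∑ k, (m + ∑ i with i < k, n i).negOnePow •
          D.comp σ m _ (N + 1) (AbComplex.sum_dAt h k) f (AbComplex.dAt g k)
  /-- the composition is associative: `f(g_i(h_j)) = ± (f(g_i))(h_j)` for surjections
  `K ↠ J ↠ I` with fibres `F i ⊆ J` and `G j ⊆ K`, and `H i ⊆ K` for the composition `K ↠ I` -/
  assoc {I : FinIdx} {F : I.α → FinIdx} {J : FinIdx} (σ : (Σ i, (F i).α) ≃ J.α)
    {G : J.α → FinIdx} {K : FinIdx} (ρ : (Σ j, (G j).α) ≃ K.α)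
    {H : I.α → FinIdx} (τ : ∀ i, (Σ t, (G (σ ⟨i, t⟩)).α) ≃ (H i).α)
    (θ : (Σ i, (H i).α) ≃ K.α) (hθ : ∀ i t s, ρ ⟨σ ⟨i, t⟩, s⟩ = θ ⟨i, τ i ⟨t, s⟩⟩)
    {W : K.α → O} {X : J.α → O} {Y : I.α → O} {Z : O}
    (m : ℤ) (n : I.α → ℤ) (p : J.α → ℤ) (q : I.α → ℤ) (M N : ℤ)
    (hq : ∀ i, n i + ∑ t, p (σ ⟨i, t⟩) = q i) (hN' : m + ∑ i, q i = N)
    (hM : m + ∑ i, n i = M) (hN : M + ∑ j, p j = N)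
    (f : (D.P I Y Z).X m) (g : ∀ i, (D.P (F i) (fun t => X (σ ⟨i, t⟩)) (Y i)).X (n i))
    (h : ∀ j, (D.P (G j) (fun s => W (ρ ⟨j, s⟩)) (X j)).X (p j)) :
    D.comp θ m q N hN' f (fun i => D.comp (τ i) (n i) (fun t => p (σ ⟨i, t⟩)) (q i) (hq i) (g i)
        fun t => D.castX (fun s => congrArg W (hθ i t s)) (h (σ ⟨i, t⟩))) =
      (FinIdx.koszul σ n p).negOnePow • D.comp ρ M p N hN (D.comp σ m n M hM f g) h
  /-- the identity `id_E ∈ P_1(E, E)` is the identity of the DG category -/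
  id_comp {J : FinIdx} {X : J.α → O} {Y : O} (n : ℤ) (h : 0 + ∑ _ : FinIdx.one.α, n = n)
    (f : (D.P J X Y).X n) :
    D.comp (F := fun _ => J) (FinIdx.sigmaOne J) 0 (fun _ => n) n h (D.un (𝒟.id Y)) (fun _ => f) = f
  comp_id {I : FinIdx} {X : I.α → O} {Y : O} (m : ℤ) (h : m + ∑ _ : I.α, (0 : ℤ) = m)
    (f : (D.P I X Y).X m) :
    D.comp (F := fun _ => FinIdx.one) (FinIdx.sigmaUnit I) (X := X) m (fun _ => 0) m h f
      (fun i => D.un (𝒟.id (X i))) = f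
  /-- the composition of elements of `P_1` is the composition of the DG category -/
  un_comp {X Y Z : O} (p q n : ℤ) (h : p + q = n) (h' : p + ∑ _ : FinIdx.one.α, q = n)
    (g : (𝒟.Hom Y Z).X p) (f : (𝒟.Hom X Y).X q) :
    D.un (𝒟.comp p q n h g f) =
      D.comp (F := fun _ => FinIdx.one) (FinIdx.sigmaOne FinIdx.one) (X := fun _ => X) p
        (fun _ => q) n h' (D.un g) (fun _ => D.un f)

end PseudoTensorData

namespace PseudoTensorData

variable {O : Type u} {𝒟 : DGCat.{v} O} {D : PseudoTensorData 𝒟}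

theorem sum_one {p q n : ℤ} (h : p + q = n) : p + ∑ _ : FinIdx.one.α, q = n := by
  have : ∑ _ : FinIdx.one.α, q = q := by
    rw [Finset.sum_const, Finset.card_univ]
    have : Fintype.card FinIdx.one.α = 1 := Fintype.card_congr FinIdx.one.e.symm
    rw [this, one_smul]
  rw [this, h]

theorem one_unique (i : FinIdx.one.α) : i = (0 : Fin 1) := Subsingleton.elim (α := Fin 1) _ _

theorem dAt_self {I : FinIdx} {K : I.α → AbComplex.{v}} {n : I.α → ℤ}
    (g : ∀ i, (K i).X (n i)) (k : I.α) :
    HEq (AbComplex.dAt g k k) ((K k).d (n k) (n k + 1) (g k)) := by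
  rw [AbComplex.dAt, dif_pos rfl, if_pos rfl]

theorem update_one {A : FinIdx.one.α → Type v} (x y : ∀ i, A i) :
    Function.update x (0 : Fin 1) (y (0 : Fin 1)) = y := by
  funext i
  obtain rfl := one_unique i
  exact Function.update_self _ _ _

theorem castX_self {I : FinIdx} {X : I.α → O} {Y : O} {m : ℤ} (h : ∀ i, X i = X i)
    (f : (D.P I X Y).X m) : D.castX h f = f := rfl

/-- The action of a morphism of `𝒟` on `P_I({X_i}, -)`. -/
def act (D : PseudoTensorData 𝒟) {I : FinIdx} {X : I.α → O} {Y Z : O} {p q n : ℤ} (h : p + q = n)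
    (f : (𝒟.Hom Y Z).X p) (x : (D.P I X Y).X q) : (D.P I X Z).X n :=
  D.comp (F := fun _ => I) (FinIdx.sigmaOne I) p (fun _ => q) n (sum_one h) (D.un f) (fun _ => x)

theorem un_add {X Y : O} {p : ℤ} (f f' : (𝒟.Hom X Y).X p) :
    D.un (f + f') = D.un f + D.un f' := map_add ((D.unary X Y).hom.f p).hom f f'

theorem un_d {X Y : O} {p : ℤ} (f : (𝒟.Hom X Y).X p) :
    D.un ((𝒟.Hom X Y).d p (p + 1) f) = (D.P FinIdx.one (fun _ => X) Y).d p (p + 1) (D.un f) := by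
  exact (ConcreteCategory.congr_hom ((D.unary X Y).hom.comm p (p + 1)) f).symm

theorem comp_congr {I : FinIdx} {F : I.α → FinIdx} {J : FinIdx} (σ : (Σ i, (F i).α) ≃ J.α)
    {X : J.α → O} {Y : I.α → O} {Z : O} (m : ℤ) {n n' : I.α → ℤ} (N : ℤ) (h : m + ∑ i, n i = N)
    (h' : m + ∑ i, n' i = N) (f : (D.P I Y Z).X m)
    (g : ∀ i, (D.P (F i) (fun t => X (σ ⟨i, t⟩)) (Y i)).X (n i))
    (g' : ∀ i, (D.P (F i) (fun t => X (σ ⟨i, t⟩)) (Y i)).X (n' i))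
    (hn : n = n') (hg : ∀ i, HEq (g i) (g' i)) :
    D.comp σ m n N h f g = D.comp σ m n' N h' f g' := by
  subst hn
  obtain rfl : g = g' := funext fun i => eq_of_heq (hg i)
  rfl

theorem act_add (hD : D.IsPseudoTensor) {I : FinIdx} {X : I.α → O} {Y Z : O} {p q n : ℤ}
    (h : p + q = n) (f : (𝒟.Hom Y Z).X p) (x y : (D.P I X Y).X q) :
    D.act h f (x + y) = D.act h f x + D.act h f y := by
  have e (z : (D.P I X Y).X q) :
      D.act h f z = D.comp (F := fun _ => I) (FinIdx.sigmaOne I) p (fun _ => q) n (sum_one h)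
        (D.un f) (Function.update (fun _ => x) (0 : Fin 1) z) :=
    congrArg (D.comp (F := fun _ => I) (FinIdx.sigmaOne I) p (fun _ => q) n (sum_one h) (D.un f))
      (update_one (A := fun _ => (D.P I X Y).X q) (fun _ => x) (fun _ => z)).symm
  rw [e (x + y), e x, e y]
  exact hD.comp_add_right (F := fun _ => I) (FinIdx.sigmaOne I) (X := X) p (fun _ => q) n
    (sum_one h) (D.un f) (fun _ => x) (0 : Fin 1) x y

theorem add_act (hD : D.IsPseudoTensor) {I : FinIdx} {X : I.α → O} {Y Z : O} {p q n : ℤ}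
    (h : p + q = n) (f f' : (𝒟.Hom Y Z).X p) (x : (D.P I X Y).X q) :
    D.act h (f + f') x = D.act h f x + D.act h f' x := by
  have := hD.comp_add_left (F := fun _ => I) (FinIdx.sigmaOne I) (X := X) p (fun _ => q) n
    (sum_one h) (D.un f) (D.un f') (fun _ => x)
  rw [← un_add] at this
  exact this

theorem d_act (hD : D.IsPseudoTensor) {I : FinIdx} {X : I.α → O} {Y Z : O} {p q n : ℤ}
    (h : p + q = n) (f : (𝒟.Hom Y Z).X p) (x : (D.P I X Y).X q) :
    (D.P I X Z).d n (n + 1) (D.act h f x) =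
      D.act (by omega) ((𝒟.Hom Y Z).d p (p + 1) f) x +
        p.negOnePow • D.act (by omega) f ((D.P I X Y).d q (q + 1) x) := by
  refine (hD.d_comp (F := fun _ => I) (FinIdx.sigmaOne I) (X := X) p (fun _ => q) n
    (sum_one h) (D.un f) (fun _ => x)).trans ?_
  have hempty : (Finset.univ.filter fun i : FinIdx.one.α => i < (0 : Fin 1)) = ∅ := by
    rw [Finset.filter_eq_empty_iff]
    intro i _
    obtain rfl := one_unique i
    exact lt_irrefl (0 : Fin 1)
  refine congrArg₂ (· + ·) ?_ ?_
  · exact congrArg (fun z => D.comp (F := fun _ => I) (FinIdx.sigmaOne I) (X := X) (p + 1)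
      (fun _ => q) (n + 1) (sum_one (by omega)) z (fun _ => x)) (un_d f).symm
  refine (Fintype.sum_eq_single (0 : Fin 1) (fun k hk => absurd (one_unique k) hk)).trans ?_
  refine congrArg₂ (fun (a : ℤˣ) (b : (D.P I X Z).X (n + 1)) => a • b) ?_ ?_
  · rw [hempty, Finset.sum_empty, add_zero]
  refine comp_congr _ _ _ _ _ _ _ _ ?_ ?_
  · funext i
    exact congrArg (q + ·) (if_pos (one_unique i))
  · intro i
    obtain rfl := one_unique i
    exact dAt_self (I := FinIdx.one) (K := fun _ => D.P I X Y) (fun _ => x) (0 : Fin 1)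

theorem comp_act (hD : D.IsPseudoTensor) {I : FinIdx} {X : I.α → O} {Y Z Z' : O}
    (p q r pq qr n : ℤ) (hpq : p + q = pq) (hqr : q + r = qr) (hn : p + q + r = n)
    (g : (𝒟.Hom Z Z').X p) (f : (𝒟.Hom Y Z).X q) (x : (D.P I X Y).X r) :
    D.act (by omega) (𝒟.comp p q pq hpq g f) x =
      D.act (p := p) (q := qr) (n := n) (by omega) g (D.act hqr f x) := by
  have h := hD.assoc (F := fun _ => FinIdx.one) (FinIdx.sigmaOne FinIdx.one)
    (G := fun _ => I) (FinIdx.sigmaOne I) (H := fun _ => I) (fun _ => FinIdx.sigmaOne I)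
    (FinIdx.sigmaOne I) (fun _ _ _ => rfl) (W := X) (X := fun _ => Y) (Y := fun _ => Z)
    p (fun _ => q) (fun _ => r) (fun _ => qr) pq n (fun _ => sum_one hqr)
    (sum_one (by omega)) (sum_one hpq) (sum_one (by omega)) (D.un g) (fun _ => D.un f) (fun _ => x)
  have hk : FinIdx.koszul (F := fun _ => FinIdx.one) (FinIdx.sigmaOne FinIdx.one) (fun _ => q)
      (fun _ => r) = 0 := by
    rw [FinIdx.koszul, Finset.sum_eq_zero, Finset.sum_eq_zero, add_zero]
    · rintro ⟨i, t⟩ _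
      refine Finset.sum_eq_zero ?_
      rintro ⟨i', t'⟩ _
      rw [if_neg]
      obtain rfl := one_unique t
      obtain rfl := one_unique t'
      exact fun h => lt_irrefl (0 : Fin 1) h.2
    · intro i _
      refine Finset.sum_eq_zero fun l _ => ?_
      obtain rfl := one_unique i
      obtain rfl := one_unique l
      exact if_neg (lt_irrefl (0 : Fin 1))
  rw [hk, Int.negOnePow_zero, one_smul, ← hD.un_comp p q pq hpq] at h
  exact h.symm

/-- The DG functor `P_I({X_i}, -)`. -/
def toMod (hD : D.IsPseudoTensor) (I : FinIdx) (X : I.α → O) : DGMod 𝒟 where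
  obj Y := D.P I X Y
  act _ _ _ h := AddMonoidHom.mk' (fun f => AddMonoidHom.mk' (fun x => D.act h f x)
    (act_add hD h f)) (fun f f' => AddMonoidHom.ext (add_act hD h f f'))
  d_act _ _ _ h f x := d_act hD h f x
  id_act q x := hD.id_comp q _ x
  comp_act p q r pq qr n hpq hqr hn g f x := comp_act hD p q r pq qr n hpq hqr hn g f x

/-- The pseudo-tensor structure is representable: objects `⊗_{i ∈ I} X_i` and isomorphisms
`λ : P_I({X_i}, -) ≅ Hom(⊗_{i ∈ I} X_i, -)` in the derived category. The inverse of `λ` is given by a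
cocycle `univ ∈ P_I({X_i}, ⊗_{i ∈ I} X_i)`, the image of the identity. -/
structure Representation (hD : D.IsPseudoTensor) where
  /-- the object `⊗_{i ∈ I} X_i` -/
  obj (I : FinIdx) (X : I.α → O) : O
  /-- the isomorphism in the derived category -/
  lam (I : FinIdx) (X : I.α → O) :
    (DGMod.quasiIso 𝒟).Q.obj (toMod hD I X) ≅ (DGMod.quasiIso 𝒟).Q.obj (DGMod.corep 𝒟 (obj I X))
  /-- the universal element -/
  univ (I : FinIdx) (X : I.α → O) : (D.P I X (obj I X)).Z0
  lam_inv (I : FinIdx) (X : I.α → O) :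
    (lam I X).inv = (DGMod.quasiIso 𝒟).Q.map ((toMod hD I X).ofCocycle (obj I X) (univ I X))
  obj_one (X : O) : obj FinIdx.one (fun _ => X) = X
  univ_one (X : O) : HEq (univ FinIdx.one (fun _ => X)).1 (D.un (𝒟.id X))

end PseudoTensorData

namespace PseudoTensorData

variable {O : Type u} {𝒟 : DGCat.{v} O}

/-- An isomorphism of the pseudo-tensor structure `H⁰ P` on `H⁰ 𝒟` with the pseudo-tensor structure
`({X_i}, Y) ↦ Hom(⊗_i X_i, Y)` given by a tensor structure on `H⁰ 𝒟`. -/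
structure TensorComparison (D : PseudoTensorData 𝒟) [MonoidalCategory (H0Cat 𝒟)]
    [SymmetricCategory (H0Cat 𝒟)] where
  /-- the isomorphisms of abelian groups -/
  iso (I : FinIdx) (X : I.α → O) (Y : O) :
    (D.P I X Y).H0 ≃+ (tens I (fun i => (⟨X i⟩ : H0Cat 𝒟)) ⟶ ⟨Y⟩)
  iso_un {X Y : O} (f : (𝒟.Hom X Y).Z0) (c : (D.P FinIdx.one (fun _ => X) Y).Z0)
    (hc : c.1 = D.un f.1) : iso FinIdx.one (fun _ => X) Y (AbComplex.mk _ c) = H0Cat.homMk f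
  iso_comp {I : FinIdx} {F : I.α → FinIdx} {J : FinIdx} (σ : (Σ i, (F i).α) ≃ J.α) {X : J.α → O}
    {Y : I.α → O} {Z : O} (h : 0 + ∑ _ : I.α, (0 : ℤ) = 0)
    (f : (D.P I Y Z).Z0) (g : ∀ i, (D.P (F i) (fun t => X (σ ⟨i, t⟩)) (Y i)).Z0)
    (c : (D.P J X Z).Z0) (hc : c.1 = D.comp σ 0 (fun _ => 0) 0 h f.1 fun i => (g i).1) :
    iso J X Z (AbComplex.mk _ c) = (tensShuffle σ fun j => (⟨X j⟩ : H0Cat 𝒟)).hom ≫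
      tensHom I (fun i => iso (F i) _ (Y i) (AbComplex.mk _ (g i))) ≫ iso I Y Z (AbComplex.mk _ f)

/-- A representable pseudo-tensor structure induces a tensor structure on `H⁰ 𝒟`: the morphisms
`ε_π : ⊗_{j ∈ J} X_j ⟶ ⊗_{i ∈ I} (⊗_{j ∈ F i} X_j)` in `H⁰ 𝒟`, which are
characterized by `ε_π(univ) = univ(univ_i)`, are isomorphisms, and there is a symmetric monoidal
structure on `H⁰ 𝒟`, with bi-additive tensor product, whose pseudo-tensor structure is `H⁰ P`, the
universal elements giving isomorphisms of the tensor products with the representing objects. -/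
def Representation.InducesTensorStructure {D : PseudoTensorData 𝒟} {hD : D.IsPseudoTensor}
    (R : Representation hD) : Prop :=
  (∀ (I : FinIdx) (F : I.α → FinIdx) (J : FinIdx) (σ : (Σ i, (F i).α) ≃ J.α) (X : J.α → O),
    ∃ ε : (𝒟.Hom (R.obj J X) (R.obj I fun i => R.obj (F i) fun t => X (σ ⟨i, t⟩))).Z0,
      D.act (add_zero 0) ε.1 (R.univ J X).1 -
          D.comp σ 0 (fun _ => 0) 0 (by simp) (R.univ I _).1 (fun i => (R.univ (F i) _).1) ∈
        (D.P J X (R.obj I fun i => R.obj (F i) fun t => X (σ ⟨i, t⟩))).B0 ∧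
      IsIso (H0Cat.homMk ε)) ∧
  ∃ (_ : MonoidalCategory (H0Cat 𝒟)) (_ : SymmetricCategory (H0Cat 𝒟))
    (_ : MonoidalPreadditive (H0Cat 𝒟)) (E : D.TensorComparison),
    ∀ (I : FinIdx) (X : I.α → O), IsIso (E.iso I X (R.obj I X) (AbComplex.mk _ (R.univ I X)))

end PseudoTensorData

/-! ## The DG category `dg_e C` -/

section Extended

variable {C : Type u} [Category.{v} C] [Preadditive C] [MonoidalCategory C]

section

variable (Q : ECube ⥤ C)

/-- Postcomposition with the differential of `□^*` in the target. -/
def dTarget {A Y : C} (f : ∀ n : ℕ, A ⟶ Y ⊗ Q.obj ⟨n⟩) : ∀ n : ℕ, A ⟶ Y ⊗ Q.obj ⟨n⟩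
  | 0 => 0
  | n + 1 => f n ≫ Y ◁ cubeD Q n

theorem dTarget_add {A Y : C} (f g : ∀ n : ℕ, A ⟶ Y ⊗ Q.obj ⟨n⟩) (n : ℕ) :
    dTarget Q (fun n => f n + g n) n = dTarget Q f n + dTarget Q g n := by
  cases n with
  | zero => simp [dTarget]
  | succ n => simp [dTarget]

theorem dTarget_comp {A B Y : C} (h : A ⟶ B) (f : ∀ n : ℕ, B ⟶ Y ⊗ Q.obj ⟨n⟩) (n : ℕ) :
    dTarget Q (fun n => h ≫ f n) n = h ≫ dTarget Q f n := by
  cases n with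
  | zero => simp [dTarget]
  | succ n => simp [dTarget]

theorem dTarget_sub {A Y : C} (f g : ∀ n : ℕ, A ⟶ Y ⊗ Q.obj ⟨n⟩) (n : ℕ) :
    dTarget Q (fun n => f n - g n) n = dTarget Q f n - dTarget Q g n := by
  cases n with
  | zero => simp [dTarget]
  | succ n => simp [dTarget]

theorem dTarget_smul {A Y : C} (s : ℤˣ) (f : ∀ n : ℕ, A ⟶ Y ⊗ Q.obj ⟨n⟩) (n : ℕ) :
    dTarget Q (fun n => s • f n) n = s • dTarget Q f n := by
  cases n with
  | zero => simp [dTarget]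
  | succ n => simp [dTarget, Units.smul_def]

theorem dTarget_cubeE {A Y : C} (f : ∀ n : ℕ, A ⟶ Y ⊗ Q.obj ⟨n⟩)
    (hf : ∀ n, f n ≫ Y ◁ cubeE Q n = f n) (n : ℕ) :
    dTarget Q f n ≫ Y ◁ cubeE Q n = dTarget Q f n := by
  cases n with
  | zero => simp [dTarget]
  | succ n =>
    simp only [dTarget, Category.assoc]
    rw [← MonoidalCategory.whiskerLeft_comp, ← cubeE_comp_cubeD,
      MonoidalCategory.whiskerLeft_comp, reassoc_of% hf n]

end

variable [MonoidalPreadditive C]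

section HomotopyInvariance

variable (Q : ECube ⥤ C)

/-- The non-degenerate morphisms `X ⊗ □^n ⟶ Z`: those killed by the faces `η_{n,i,1}`. They form a
complement of the subgroup of degenerate morphisms. -/
def dgHomGroup (X Z : C) (n : ℕ) : AddSubgroup (X ⊗ Q.obj ⟨n⟩ ⟶ Z) where
  carrier := {f | X ◁ cubeE Q n ≫ f = f}
  add_mem' {f g} hf hg := by
    simp only [Set.mem_ofPred_eq] at *
    rw [Preadditive.comp_add, hf, hg]
  zero_mem' := by simp
  neg_mem' {f} hf := by
    simp only [Set.mem_ofPred_eq] at *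
    rw [Preadditive.comp_neg, hf]

/-- Precomposition with the differential of `□^*`. -/
def dgHomD (X Z : C) (n : ℕ) : dgHomGroup Q X Z (n + 1) →+ dgHomGroup Q X Z n :=
  AddMonoidHom.mk' (fun f => ⟨X ◁ cubeD Q n ≫ f.1, by
      have hf : X ◁ cubeE Q (n + 1) ≫ f.1 = f.1 := f.2
      change X ◁ cubeE Q n ≫ X ◁ cubeD Q n ≫ f.1 = _
      rw [← MonoidalCategory.whiskerLeft_comp_assoc, cubeE_comp_cubeD,
        MonoidalCategory.whiskerLeft_comp_assoc, hf]⟩)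
    (fun f g => Subtype.ext (Preadditive.comp_add _ _ _ _ _ _))

/-- The complex `Hom_{dg C}(X, Z)`, in homological notation: the non-degenerate complex of the
cubical abelian group `n ↦ Hom(X ⊗ □^n, Z)`. -/
def dgHom (X Z : C) : ChainComplex AddCommGrpCat.{v} ℕ :=
  ChainComplex.of (fun n => AddCommGrpCat.of (dgHomGroup Q X Z n))
    (fun n => AddCommGrpCat.ofHom (dgHomD Q X Z n))
    (fun n => by
      ext f
      change X ◁ cubeD Q n ≫ X ◁ cubeD Q (n + 1) ≫ _ = 0
      rw [← MonoidalCategory.whiskerLeft_comp_assoc, cubeD_comp_cubeD,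
        MonoidalPreadditive.whiskerLeft_zero, Limits.zero_comp])

theorem dgHom_d (X Z : C) (n : ℕ) :
    (dgHom Q X Z).d (n + 1) n = AddCommGrpCat.ofHom (dgHomD Q X Z n) :=
  ChainComplex.of_d (fun n => AddCommGrpCat.of (dgHomGroup Q X Z n))
    (fun n => AddCommGrpCat.ofHom (dgHomD Q X Z n)) n

/-- The map of complexes `Hom_{dg C}(X, Z) ⟶ Hom_{dg C}(X, Z')` induced by a morphism `Z ⟶ Z'`. -/
def dgHomMap (X : C) {Z Z' : C} (φ : Z ⟶ Z') : dgHom Q X Z ⟶ dgHom Q X Z' where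
  f n := AddCommGrpCat.ofHom (AddMonoidHom.mk'
    (fun (f : dgHomGroup Q X Z n) => (⟨f.1 ≫ φ, by
        have hf : X ◁ cubeE Q n ≫ f.1 = f.1 := f.2
        change X ◁ cubeE Q n ≫ f.1 ≫ φ = _
        rw [← Category.assoc, hf]⟩ : dgHomGroup Q X Z' n))
      (fun f g => Subtype.ext (Preadditive.add_comp _ _ _ _ _ _)))
  comm' i j h := by
    obtain rfl : j + 1 = i := h
    rw [dgHom_d, dgHom_d]
    ext f
    exact Subtype.ext (Category.assoc (obj := C) _ _ _).symm

/-- The co-cubical object `□^*` is homotopy invariant: for all `n`, `X`, `Y` the map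
`Hom_{dg C}(X, Y) ⟶ Hom_{dg C}(X, Y ⊗ □^n)` induced by `i_n` is a quasi-isomorphism. -/
def HomotopyInvariant (u : Q.obj ⟨0⟩ ≅ 𝟙_ C) : Prop :=
  ∀ (n : ℕ) (X Y : C), QuasiIso
    (dgHomMap Q X ((ρ_ Y).inv ≫ Y ◁ u.inv ≫ Y ◁ Q.map (ECube.zeroPt n)))

end HomotopyInvariance

variable (Q : ECube ⥤ C)

/-- The group `Hom_{dg_e C}(X, Y)^p` of families of morphisms `f_a : X ⊗ □^a ⟶ Y ⊗ □^n`, where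
`n = p + a` (the components with `n ≠ p + a` are `0`), which are killed by the faces `η_{i,1}` of
`□^a` and by the projections `p_i` of `□^n`. -/
def dgeHom (X Y : C) (p : ℤ) : AddSubgroup (∀ a n : ℕ, X ⊗ Q.obj ⟨a⟩ ⟶ Y ⊗ Q.obj ⟨n⟩) where
  carrier := {f | (∀ a n : ℕ, (n : ℤ) ≠ p + a → f a n = 0) ∧
    (∀ a n, X ◁ cubeE Q a ≫ f a n = f a n) ∧ ∀ a n, f a n ≫ Y ◁ cubeE Q n = f a n}
  add_mem' {f g} hf hg := by
    refine ⟨fun a n h => ?_, fun a n => ?_, fun a n => ?_⟩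
    · simp [hf.1 a n h, hg.1 a n h]
    · simp [hf.2.1 a n, hg.2.1 a n]
    · simp [hf.2.2 a n, hg.2.2 a n]
  zero_mem' := ⟨fun _ _ _ => rfl, fun _ _ => by simp, fun _ _ => by simp⟩
  neg_mem' {f} hf := by
    refine ⟨fun a n h => ?_, fun a n => ?_, fun a n => ?_⟩
    · simp [hf.1 a n h]
    · simp [hf.2.1 a n]
    · simp [hf.2.2 a n]

theorem dTarget_dTarget {A Y : C} (f : ∀ n : ℕ, A ⟶ Y ⊗ Q.obj ⟨n⟩) (n : ℕ) :
    dTarget Q (dTarget Q f) n = 0 := by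
  match n with
  | 0 => rfl
  | 1 => simp [dTarget]
  | n + 2 =>
    simp only [dTarget, Category.assoc]
    rw [← MonoidalCategory.whiskerLeft_comp, cubeD_comp_cubeD,
      MonoidalPreadditive.whiskerLeft_zero, Limits.comp_zero]

/-- The differential `f ↦ d_Y ∘ f - (-1)^p f ∘ d_X` of `Hom_{dg_e C}(X, Y)`. -/
def dgeD (X Y : C) (p : ℤ) (f : ∀ a n : ℕ, X ⊗ Q.obj ⟨a⟩ ⟶ Y ⊗ Q.obj ⟨n⟩) (a n : ℕ) :
    X ⊗ Q.obj ⟨a⟩ ⟶ Y ⊗ Q.obj ⟨n⟩ :=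
  dTarget Q (f a) n - p.negOnePow • (X ◁ cubeD Q a ≫ f (a + 1) n)

theorem dgeD_mem {X Y : C} {p : ℤ} {f : ∀ a n : ℕ, X ⊗ Q.obj ⟨a⟩ ⟶ Y ⊗ Q.obj ⟨n⟩}
    (hf : f ∈ dgeHom Q X Y p) : dgeD Q X Y p f ∈ dgeHom Q X Y (p + 1) := by
  refine ⟨fun a n h => ?_, fun a n => ?_, fun a n => ?_⟩
  · have h1 : dTarget Q (f a) n = 0 := by
      cases n with
      | zero => rfl
      | succ n =>
        rw [dTarget, hf.1 a n (by push_cast at h; omega), Limits.zero_comp]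
    rw [dgeD, h1, hf.1 (a + 1) n (by push_cast; omega), Limits.comp_zero, smul_zero, sub_zero]
  · rw [dgeD, Preadditive.comp_sub, ← dTarget_comp]
    simp only [hf.2.1 a]
    congr 1
    rw [Units.smul_def, Preadditive.comp_zsmul, ← MonoidalCategory.whiskerLeft_comp_assoc,
      cubeE_comp_cubeD, MonoidalCategory.whiskerLeft_comp_assoc, hf.2.1]
  · rw [dgeD, Preadditive.sub_comp, dTarget_cubeE Q _ (hf.2.2 a), Units.smul_def,
      Preadditive.zsmul_comp, Category.assoc, hf.2.2]

theorem dgeD_dgeD {X Y : C} (p : ℤ) (f : ∀ a n : ℕ, X ⊗ Q.obj ⟨a⟩ ⟶ Y ⊗ Q.obj ⟨n⟩) :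
    dgeD Q X Y (p + 1) (dgeD Q X Y p f) = 0 := by
  funext a n
  have h1 : dTarget Q (dgeD Q X Y p f a) n =
      dTarget Q (dTarget Q (f a)) n -
        p.negOnePow • (X ◁ cubeD Q a ≫ dTarget Q (f (a + 1)) n) := by
    rw [← dTarget_comp, ← dTarget_smul, ← dTarget_sub]
    rfl
  have h2 : X ◁ cubeD Q a ≫ X ◁ cubeD Q (a + 1) ≫ f (a + 1 + 1) n = 0 := by
    rw [← MonoidalCategory.whiskerLeft_comp_assoc, cubeD_comp_cubeD,
        MonoidalPreadditive.whiskerLeft_zero, Limits.zero_comp]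
  change dTarget Q (dgeD Q X Y p f a) n - (p + 1).negOnePow •
    (X ◁ cubeD Q a ≫ dgeD Q X Y p f (a + 1) n) = 0
  rw [h1, dTarget_dTarget, dgeD, Int.negOnePow_succ, Preadditive.comp_sub]
  simp only [Units.smul_def, Preadditive.comp_zsmul, h2, smul_zero, sub_zero, Units.val_neg,
    neg_smul]
  abel

/-- The differential as a homomorphism. -/
def dgeDHom (X Y : C) (p : ℤ) : dgeHom Q X Y p →+ dgeHom Q X Y (p + 1) :=
  AddMonoidHom.mk' (fun f => ⟨dgeD Q X Y p f.1, dgeD_mem Q f.2⟩) (fun f g => Subtype.ext (by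
    funext a n
    change dTarget Q (fun n => f.1 a n + g.1 a n) n -
      p.negOnePow • (X ◁ cubeD Q a ≫ (f.1 (a + 1) n + g.1 (a + 1) n)) =
      dgeD Q X Y p f.1 a n + dgeD Q X Y p g.1 a n
    rw [dTarget_add, Preadditive.comp_add, smul_add, dgeD, dgeD]
    abel))

/-- The complex `Hom_{dg_e C}(X, Y)`. -/
def dgeComplex (X Y : C) : AbComplex.{v} :=
  CochainComplex.of (fun p => AddCommGrpCat.of (dgeHom Q X Y p))
    (fun p => AddCommGrpCat.ofHom (dgeDHom Q X Y p))
    (fun p => by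
      ext f
      exact congrFun (congrFun (dgeD_dgeD Q p _) _) _)

theorem dgeComplex_d (X Y : C) (p : ℤ) :
    (dgeComplex Q X Y).d p (p + 1) = AddCommGrpCat.ofHom (dgeDHom Q X Y p) :=
  CochainComplex.of_d (fun p => AddCommGrpCat.of (dgeHom Q X Y p))
    (fun p => AddCommGrpCat.ofHom (dgeDHom Q X Y p)) p

/-- The composition in `dg_e C`: the component `X ⊗ □^a ⟶ Z ⊗ □^k` of `g ∘ f` is the composition of
the components `X ⊗ □^a ⟶ Y ⊗ □^b ⟶ Z ⊗ □^k`, where `b = q + a` and `q` is the degree of `f`. -/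
def dgeCompFun {X Y Z : C} (q : ℤ) (g : ∀ a n : ℕ, Y ⊗ Q.obj ⟨a⟩ ⟶ Z ⊗ Q.obj ⟨n⟩)
    (f : ∀ a n : ℕ, X ⊗ Q.obj ⟨a⟩ ⟶ Y ⊗ Q.obj ⟨n⟩) (a k : ℕ) : X ⊗ Q.obj ⟨a⟩ ⟶ Z ⊗ Q.obj ⟨k⟩ :=
  f a (q + a).toNat ≫ g (q + a).toNat k

theorem dgeCompFun_mem {X Y Z : C} {p q n : ℤ} (h : p + q = n)
    {g : ∀ a n : ℕ, Y ⊗ Q.obj ⟨a⟩ ⟶ Z ⊗ Q.obj ⟨n⟩} (hg : g ∈ dgeHom Q Y Z p)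
    {f : ∀ a n : ℕ, X ⊗ Q.obj ⟨a⟩ ⟶ Y ⊗ Q.obj ⟨n⟩} (hf : f ∈ dgeHom Q X Y q) :
    dgeCompFun Q q g f ∈ dgeHom Q X Z n := by
  refine ⟨fun a k hk => ?_, fun a k => ?_, fun a k => ?_⟩
  · by_cases h0 : 0 ≤ q + a
    · rw [dgeCompFun, hg.1 _ k (by omega), Limits.comp_zero]
    · rw [dgeCompFun, hf.1 a _ (by omega), Limits.zero_comp]
  · rw [dgeCompFun, ← Category.assoc, hf.2.1]
  · rw [dgeCompFun, Category.assoc, hg.2.2]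

theorem dgeComp_d {X Y Z : C} {p q n : ℤ} (h : p + q = n)
    {g : ∀ a n : ℕ, Y ⊗ Q.obj ⟨a⟩ ⟶ Z ⊗ Q.obj ⟨n⟩}
    {f : ∀ a n : ℕ, X ⊗ Q.obj ⟨a⟩ ⟶ Y ⊗ Q.obj ⟨n⟩} (hf : f ∈ dgeHom Q X Y q) :
    dgeD Q X Z n (dgeCompFun Q q g f) = dgeCompFun Q q (dgeD Q Y Z p g) f +
      p.negOnePow • dgeCompFun Q (q + 1) g (dgeD Q X Y q f) := by
  subst h
  funext a k
  change dTarget Q (fun k => f a (q + a).toNat ≫ g (q + a).toNat k) k -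
    (p + q).negOnePow • (X ◁ cubeD Q a ≫ f (a + 1) (q + (a + 1 : ℕ)).toNat ≫
      g (q + (a + 1 : ℕ)).toNat k) =
    f a (q + a).toNat ≫ (dTarget Q (g (q + a).toNat) k -
      p.negOnePow • (Y ◁ cubeD Q (q + a).toNat ≫ g ((q + a).toNat + 1) k)) +
    p.negOnePow • ((dTarget Q (f a) (q + 1 + a).toNat -
      q.negOnePow • (X ◁ cubeD Q a ≫ f (a + 1) (q + 1 + a).toNat)) ≫ g (q + 1 + a).toNat k)
  have e1 : (q + (a + 1 : ℕ)).toNat = (q + 1 + a).toNat := by congr 1; push_cast; ring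
  have e2 : f a (q + a).toNat ≫ Y ◁ cubeD Q (q + a).toNat ≫ g ((q + a).toNat + 1) k =
      dTarget Q (f a) (q + 1 + a).toNat ≫ g (q + 1 + a).toNat k := by
    by_cases h0 : 0 ≤ q + a
    · have e3 : (q + 1 + a).toNat = (q + a).toNat + 1 := by omega
      rw [e3, dTarget, Category.assoc]
    · have e3 : (q + 1 + a).toNat = 0 := by omega
      rw [e3, dTarget, hf.1 a _ (by omega), Limits.zero_comp, Limits.zero_comp]
  rw [dTarget_comp, e1]
  simp only [Preadditive.comp_sub, Preadditive.sub_comp, Units.smul_def, Preadditive.comp_zsmul,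
    Preadditive.zsmul_comp, smul_sub, Category.assoc, e2, Int.negOnePow_add, Units.val_mul, mul_smul]
  abel

/-- The identity of `X` in `dg_e C`: the projector `cubeE` onto the non-degenerate part. -/
def dgeIdFun (X : C) (a n : ℕ) : X ⊗ Q.obj ⟨a⟩ ⟶ X ⊗ Q.obj ⟨n⟩ :=
  if h : a = n then X ◁ (cubeE Q a ≫ Q.map (ECube.cast h)) else 0

theorem ECube.cast_rfl (n : ℕ) : ECube.cast (rfl : n = n) = 𝟙 _ := rfl

theorem dgeIdFun_self (X : C) (a : ℕ) : dgeIdFun Q X a a = X ◁ cubeE Q a := by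
  rw [dgeIdFun, dif_pos rfl, ECube.cast_rfl, Q.map_id, Category.comp_id]

theorem dgeIdFun_ne (X : C) {a n : ℕ} (h : a ≠ n) : dgeIdFun Q X a n = 0 := dif_neg h

theorem dgeIdFun_mem (X : C) : dgeIdFun Q X ∈ dgeHom Q X X 0 := by
  refine ⟨fun a n h => dgeIdFun_ne Q X (by omega), fun a n => ?_, fun a n => ?_⟩
  · by_cases h : a = n
    · subst h
      rw [dgeIdFun_self, ← MonoidalCategory.whiskerLeft_comp, cubeE_idem]
    · rw [dgeIdFun_ne Q X h, Limits.comp_zero]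
  · by_cases h : a = n
    · subst h
      rw [dgeIdFun_self, ← MonoidalCategory.whiskerLeft_comp, cubeE_idem]
    · rw [dgeIdFun_ne Q X h, Limits.zero_comp]

theorem dgeIdFun_d (X : C) : dgeD Q X X 0 (dgeIdFun Q X) = 0 := by
  funext a n
  change dTarget Q (dgeIdFun Q X a) n - Int.negOnePow 0 • (X ◁ cubeD Q a ≫ dgeIdFun Q X (a + 1) n) = 0
  rw [Int.negOnePow_zero, one_smul]
  cases n with
  | zero => rw [dTarget, dgeIdFun_ne Q X (by omega), Limits.comp_zero, sub_zero]
  | succ n =>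
    by_cases h : a = n
    · subst h
      rw [dTarget, dgeIdFun_self, dgeIdFun_self, ← MonoidalCategory.whiskerLeft_comp,
        ← MonoidalCategory.whiskerLeft_comp, cubeE_comp_cubeD, sub_self]
    · rw [dTarget, dgeIdFun_ne Q X h, dgeIdFun_ne Q X (by omega), Limits.comp_zero,
        Limits.zero_comp, sub_zero]

theorem dgeId_comp {X Y : C} {q : ℤ} {f : ∀ a n : ℕ, X ⊗ Q.obj ⟨a⟩ ⟶ Y ⊗ Q.obj ⟨n⟩}
    (hf : f ∈ dgeHom Q X Y q) : dgeCompFun Q q (dgeIdFun Q Y) f = f := by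
  funext a k
  rw [dgeCompFun]
  by_cases h : (q + a).toNat = k
  · subst h
    rw [dgeIdFun_self, hf.2.2]
  · rw [dgeIdFun_ne Q Y h, Limits.comp_zero, hf.1 a k (by omega)]

theorem dgeComp_id {X Y : C} {p : ℤ} {f : ∀ a n : ℕ, X ⊗ Q.obj ⟨a⟩ ⟶ Y ⊗ Q.obj ⟨n⟩}
    (hf : f ∈ dgeHom Q X Y p) : dgeCompFun Q 0 f (dgeIdFun Q X) = f := by
  funext a k
  rw [dgeCompFun]
  have e : (0 + (a : ℤ)).toNat = a := by omega
  rw [e, dgeIdFun_self, hf.2.1]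

theorem dgeComp_assoc {X Y Z W : C} {q r qr : ℤ} (hqr : q + r = qr)
    (f : ∀ a n : ℕ, Z ⊗ Q.obj ⟨a⟩ ⟶ W ⊗ Q.obj ⟨n⟩)
    {g : ∀ a n : ℕ, Y ⊗ Q.obj ⟨a⟩ ⟶ Z ⊗ Q.obj ⟨n⟩}
    {h : ∀ a n : ℕ, X ⊗ Q.obj ⟨a⟩ ⟶ Y ⊗ Q.obj ⟨n⟩} (hh : h ∈ dgeHom Q X Y r) :
    dgeCompFun Q r (dgeCompFun Q q f g) h = dgeCompFun Q qr f (dgeCompFun Q r g h) := by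
  funext a k
  simp only [dgeCompFun, Category.assoc]
  by_cases h0 : 0 ≤ r + a
  · have e : (q + ((r + a).toNat : ℕ)).toNat = (qr + a).toNat := by omega
    rw [e]
  · rw [hh.1 a _ (by omega), Limits.zero_comp, Limits.zero_comp]

/-- The DG category `dg_e C`. -/
def dge : DGCat.{v} C where
  Hom X Y := dgeComplex Q X Y
  comp {X Y Z} p q n h := AddMonoidHom.mk' (fun (g : dgeHom Q Y Z p) =>
      (AddMonoidHom.mk' (fun (f : dgeHom Q X Y q) =>
        (⟨dgeCompFun Q q g.1 f.1, dgeCompFun_mem Q h g.2 f.2⟩ : dgeHom Q X Z n))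
      (fun f f' => Subtype.ext (funext fun _ => funext fun _ => Preadditive.add_comp _ _ _ _ _ _))))
    (fun g g' => AddMonoidHom.ext fun f => Subtype.ext (funext fun _ => funext fun _ =>
      Preadditive.comp_add _ _ _ _ _ _))
  id X := (⟨dgeIdFun Q X, dgeIdFun_mem Q X⟩ : dgeHom Q X X 0)
  d_comp {X Y Z} p q n h g f := by
    rw [dgeComplex_d, dgeComplex_d, dgeComplex_d]
    exact Subtype.ext (dgeComp_d Q h f.2)
  d_id X := by
    have := dgeComplex_d Q X X 0
    exact (ConcreteCategory.congr_hom this _).trans (Subtype.ext (dgeIdFun_d Q X))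
  id_comp q f := Subtype.ext (dgeId_comp Q f.2)
  comp_id p f := Subtype.ext (dgeComp_id Q f.2)
  assoc p q r pq qr n hpq hqr hn f g h := Subtype.ext (dgeComp_assoc Q hqr f.1 h.2)

end Extended

/-! ## The pseudo-tensor structure on `dg_e C` -/

section MultiCube

variable {C : Type u} [Category.{v} C] [Preadditive C] [MonoidalCategory C]
  [MonoidalPreadditive C] (Q : ECube ⥤ C)

/-- The tensor product of the cubes `□^{b i}`. -/
abbrev cubes (I : FinIdx) (b : I.α → ℕ) : C := tens I fun i => Q.obj ⟨b i⟩

/-- The tensor product of the projectors `cubeE`: a morphism out of `⊗_i □^{b i}` is fixed by it if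
and only if it is killed by the faces `η_{k,1}` of every factor. -/
abbrev cubesE (I : FinIdx) (b : I.α → ℕ) : cubes Q I b ⟶ cubes Q I b :=
  tensHom I fun i => cubeE Q (b i)

/-- The group `P_I({X_i}, Y)^m` of families of morphisms
`f_b : (⊗_i X_i) ⊗ (⊗_i □^{b i}) ⟶ Y ⊗ □^n`, where `n = m + ∑ i, b i` (the components with
`n ≠ m + ∑ i, b i` are `0`), which are killed by the faces `η_{k,1}` of all `□^{b i}` and by the
projections `p_k` of `□^n`. -/
def multiHom (I : FinIdx) (X : I.α → C) (Y : C) (m : ℤ) :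
    AddSubgroup (∀ (b : I.α → ℕ) (n : ℕ), tens I X ⊗ cubes Q I b ⟶ Y ⊗ Q.obj ⟨n⟩) where
  carrier := {f | (∀ (b : I.α → ℕ) (n : ℕ), (n : ℤ) ≠ m + ∑ i, (b i : ℤ) → f b n = 0) ∧
    (∀ b n, tens I X ◁ cubesE Q I b ≫ f b n = f b n) ∧ ∀ b n, f b n ≫ Y ◁ cubeE Q n = f b n}
  add_mem' {f g} hf hg := by
    refine ⟨fun b n h => ?_, fun b n => ?_, fun b n => ?_⟩
    · simp [hf.1 b n h, hg.1 b n h]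
    · simp [hf.2.1 b n, hg.2.1 b n]
    · simp [hf.2.2 b n, hg.2.2 b n]
  zero_mem' := ⟨fun _ _ _ => rfl, fun _ _ => by simp, fun _ _ => by simp⟩
  neg_mem' {f} hf := by
    refine ⟨fun b n h => ?_, fun b n => ?_, fun b n => ?_⟩
    · simp [hf.1 b n h]
    · simp [hf.2.1 b n]
    · simp [hf.2.2 b n]

/-- The differential `□^n ⟶ □^m` for `m = n + 1`. -/
def cubeStep (n m : ℕ) : Q.obj ⟨n⟩ ⟶ Q.obj ⟨m⟩ :=
  if h : n + 1 = m then cubeD Q n ≫ Q.map (ECube.cast h) else 0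

/-- The identity `□^n ⟶ □^m` for `m = n`. -/
def cubeSame (n m : ℕ) : Q.obj ⟨n⟩ ⟶ Q.obj ⟨m⟩ :=
  if h : n = m then Q.map (ECube.cast h) else 0

/-- The family `b` with `b j` replaced by `b j + 1`. -/
def bump {I : FinIdx} (b : I.α → ℕ) (j : I.α) : I.α → ℕ := fun i => if i = j then b i + 1 else b i

/-- The morphism `id ⊗ ⋯ ⊗ d ⊗ ⋯ ⊗ id : ⊗_i □^{b i} ⟶ ⊗_i □^{b' i}` with `d` at the place `j`, for
`b' = bump b j`. -/
def cubesD (I : FinIdx) (b b' : I.α → ℕ) (j : I.α) : cubes Q I b ⟶ cubes Q I b' :=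
  tensHom I fun i => if i = j then cubeStep Q (b i) (b' i) else cubeSame Q (b i) (b' i)

/-- The differential `f ↦ d_Y ∘ f - (-1)^m f ∘ d` of `P_I({X_i}, Y)`, where
`d = ∑_j (-1)^{∑_{i < j} b i} id ⊗ ⋯ ⊗ d ⊗ ⋯ ⊗ id` is the differential of the tensor product of the
cubes. -/
def multiD (I : FinIdx) (X : I.α → C) (Y : C) (m : ℤ)
    (f : ∀ (b : I.α → ℕ) (n : ℕ), tens I X ⊗ cubes Q I b ⟶ Y ⊗ Q.obj ⟨n⟩) (b : I.α → ℕ) (n : ℕ) :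
    tens I X ⊗ cubes Q I b ⟶ Y ⊗ Q.obj ⟨n⟩ :=
  dTarget Q (f b) n - m.negOnePow • ∑ j, (∑ i with i < j, (b i : ℤ)).negOnePow •
    (tens I X ◁ cubesD Q I b (bump b j) j ≫ f (bump b j) n)

theorem cubeStep_succ (n : ℕ) : cubeStep Q n (n + 1) = cubeD Q n := by
  rw [cubeStep, dif_pos rfl, ECube.cast_rfl, Q.map_id, Category.comp_id]

theorem cubeSame_self (n : ℕ) : cubeSame Q n n = 𝟙 _ := by
  rw [cubeSame, dif_pos rfl, ECube.cast_rfl, Q.map_id]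

theorem cubeE_step (n m : ℕ) : cubeE Q n ≫ cubeStep Q n m = cubeStep Q n m ≫ cubeE Q m := by
  by_cases h : n + 1 = m
  · subst h
    rw [cubeStep_succ, cubeE_comp_cubeD]
  · rw [cubeStep, dif_neg h, Limits.comp_zero, Limits.zero_comp]

theorem cubeE_same (n m : ℕ) : cubeE Q n ≫ cubeSame Q n m = cubeSame Q n m ≫ cubeE Q m := by
  by_cases h : n = m
  · subst h
    rw [cubeSame_self, Category.comp_id, Category.id_comp]
  · rw [cubeSame, dif_neg h, Limits.comp_zero, Limits.zero_comp]

theorem cubesD_cubesE {I : FinIdx} (b : I.α → ℕ) (j : I.α) :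
    cubesE Q I b ≫ cubesD Q I b (bump b j) j = cubesD Q I b (bump b j) j ≫ cubesE Q I (bump b j) := by
  rw [cubesD, tensLHom_comp, tensLHom_comp]
  congr 1
  funext i
  by_cases h : i = j
  · simp only [if_pos h, cubeE_step]
  · simp only [if_neg h, cubeE_same]

theorem sum_bump {I : FinIdx} (b : I.α → ℕ) (j : I.α) :
    ∑ i, (bump b j i : ℤ) = ∑ i, (b i : ℤ) + 1 := by
  have : ∀ i, (bump b j i : ℤ) = b i + if i = j then 1 else 0 := by
    intro i
    rw [bump]
    split_ifs <;> simp
  simp only [this, Finset.sum_add_distrib, Finset.sum_ite_eq', Finset.mem_univ, if_true]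

theorem multiD_mem {I : FinIdx} {X : I.α → C} {Y : C} {m : ℤ}
    {f : ∀ (b : I.α → ℕ) (n : ℕ), tens I X ⊗ cubes Q I b ⟶ Y ⊗ Q.obj ⟨n⟩}
    (hf : f ∈ multiHom Q I X Y m) : multiD Q I X Y m f ∈ multiHom Q I X Y (m + 1) := by
  refine ⟨fun b n h => ?_, fun b n => ?_, fun b n => ?_⟩
  · have h1 : dTarget Q (f b) n = 0 := by
      cases n with
      | zero => rfl
      | succ n =>
        rw [dTarget, hf.1 b n (by push_cast at h; omega), Limits.zero_comp]
    rw [multiD, h1, Finset.sum_eq_zero, smul_zero, sub_zero]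
    intro j _
    rw [hf.1 (bump b j) n (by rw [sum_bump]; omega), Limits.comp_zero, smul_zero]
  · rw [multiD, Preadditive.comp_sub, ← dTarget_comp]
    simp only [hf.2.1 b]
    congr 1
    rw [Units.smul_def, Preadditive.comp_zsmul, Preadditive.comp_sum]
    congr 1
    refine Finset.sum_congr rfl fun j _ => ?_
    rw [Units.smul_def, Preadditive.comp_zsmul, ← MonoidalCategory.whiskerLeft_comp_assoc,
      cubesD_cubesE, MonoidalCategory.whiskerLeft_comp_assoc, hf.2.1]
  · rw [multiD, Preadditive.sub_comp, dTarget_cubeE Q _ (hf.2.2 b), Units.smul_def,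
      Preadditive.zsmul_comp, Preadditive.sum_comp]
    congr 2
    refine Finset.sum_congr rfl fun j _ => ?_
    rw [Units.smul_def, Preadditive.zsmul_comp, Category.assoc, hf.2.2]

theorem bump_bump {I : FinIdx} (b : I.α → ℕ) (j k : I.α) :
    bump (bump b j) k = bump (bump b k) j := by
  funext i
  simp only [bump]
  split_ifs <;> rfl

theorem bump_self {I : FinIdx} (b : I.α → ℕ) (j : I.α) : bump b j j = b j + 1 := if_pos rfl

theorem bump_ne {I : FinIdx} (b : I.α → ℕ) {i j : I.α} (h : i ≠ j) : bump b j i = b i := if_neg h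

theorem cubeStep_step (n m k : ℕ) : cubeStep Q n m ≫ cubeStep Q m k = 0 := by
  by_cases h : n + 1 = m
  · subst h
    by_cases h : n + 1 + 1 = k
    · subst h
      rw [cubeStep_succ, cubeStep_succ, cubeD_comp_cubeD]
    · rw [cubeStep, cubeStep, dif_neg h, Limits.comp_zero]
  · rw [cubeStep, dif_neg h, Limits.zero_comp]

theorem cubesD_self {I : FinIdx} (b b' b'' : I.α → ℕ) (j : I.α) :
    cubesD Q I b b' j ≫ cubesD Q I b' b'' j = 0 := by
  rw [cubesD, cubesD, tensLHom_comp]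
  refine tensLHom_zero _ j ?_ _ (I.mem_list j)
  rw [if_pos rfl, if_pos rfl, cubeStep_step]

theorem cubesD_comm {I : FinIdx} (b b'' : I.α → ℕ) {j k : I.α} (hjk : j ≠ k)
    (h : b'' = bump (bump b j) k) :
    cubesD Q I b (bump b j) j ≫ cubesD Q I (bump b j) b'' k =
      cubesD Q I b (bump b k) k ≫ cubesD Q I (bump b k) b'' j := by
  simp only [cubesD, tensLHom_comp]
  congr 1
  funext i
  have hi : b'' i = bump (bump b j) k i := congrFun h i
  generalize b'' i = c at hi
  by_cases h1 : i = j
  · subst h1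
    rw [if_pos rfl, if_pos rfl, if_neg hjk, if_neg hjk, bump_ne b hjk, cubeSame_self]
    rw [bump_ne _ hjk] at hi
    subst hi
    rw [cubeSame_self, Category.comp_id, Category.id_comp]
  · by_cases h2 : i = k
    · subst h2
      rw [if_pos rfl, if_pos rfl, if_neg h1, if_neg h1, bump_ne b h1, cubeSame_self]
      rw [bump_self, bump_ne _ h1, ← bump_self b] at hi
      subst hi
      rw [cubeSame_self, Category.comp_id, Category.id_comp]
    · simp only [if_neg h1, if_neg h2]
      rw [bump_ne _ h2, bump_ne _ h1] at hi
      subst hi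
      rw [bump_ne _ h1, bump_ne _ h2]

theorem sign_bump {I : FinIdx} (b : I.α → ℕ) {j k : I.α} (hjk : j ≠ k) :
    ((∑ i with i < j, (b i : ℤ)) + ∑ i with i < k, (bump b j i : ℤ)).negOnePow =
      -((∑ i with i < k, (b i : ℤ)) + ∑ i with i < j, (bump b k i : ℤ)).negOnePow := by
  have e : ∀ j k : I.α, ∑ i with i < k, (bump b j i : ℤ) =
      ∑ i with i < k, (b i : ℤ) + if j < k then 1 else 0 := by
    intro j k
    have : ∀ i, (bump b j i : ℤ) = b i + if i = j then 1 else 0 := by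
      intro i
      rw [bump]
      split_ifs <;> simp
    simp only [this, Finset.sum_add_distrib, Finset.sum_ite_eq', Finset.mem_filter,
      Finset.mem_univ, true_and]
  rw [e, e]
  have hne : I.e.symm j ≠ I.e.symm k := fun h => hjk (I.e.symm.injective h)
  rcases lt_or_gt_of_ne hne with h | h
  · have h1 : j < k := h
    have h2 : ¬ k < j := fun h' => lt_asymm h h'
    rw [if_pos h1, if_neg h2, add_zero, ← add_assoc, Int.negOnePow_succ, add_comm]
  · have h1 : k < j := h
    have h2 : ¬ j < k := fun h' => lt_asymm h h'
    rw [if_pos h1, if_neg h2, add_zero, ← add_assoc, Int.negOnePow_succ, add_comm, neg_neg]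

theorem multiD_multiD {I : FinIdx} {X : I.α → C} {Y : C} (m : ℤ)
    (f : ∀ (b : I.α → ℕ) (n : ℕ), tens I X ⊗ cubes Q I b ⟶ Y ⊗ Q.obj ⟨n⟩) :
    multiD Q I X Y (m + 1) (multiD Q I X Y m f) = 0 := by
  funext b n
  let S : ((b' : I.α → ℕ) → (tens I X ⊗ cubes Q I b' ⟶ Y ⊗ Q.obj ⟨n⟩)) → (b : I.α → ℕ) →
      (tens I X ⊗ cubes Q I b ⟶ Y ⊗ Q.obj ⟨n⟩) := fun φ b =>
    ∑ j, (∑ i with i < j, (b i : ℤ)).negOnePow • (tens I X ◁ cubesD Q I b (bump b j) j ≫ φ (bump b j))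
  have h1 : dTarget Q (multiD Q I X Y m f b) n =
      dTarget Q (dTarget Q (f b)) n - m.negOnePow • S (fun b' => dTarget Q (f b') n) b := by
    cases n with
    | zero => simp [dTarget, S]
    | succ n =>
      simp only [dTarget, multiD, S, Preadditive.sub_comp, Units.smul_def, Preadditive.zsmul_comp,
        Preadditive.sum_comp, Category.assoc]
  have h2 : S (fun b' => multiD Q I X Y m f b' n) b =
      S (fun b' => dTarget Q (f b') n) b - m.negOnePow • S (S fun b' => f b' n) b := by
    simp only [multiD, S, Preadditive.comp_sub, Units.smul_def, Preadditive.comp_zsmul, smul_sub,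
      Finset.sum_sub_distrib, Finset.smul_sum]
    congr 1
    refine Finset.sum_congr rfl fun j _ => ?_
    simp only [Preadditive.comp_sum, Preadditive.comp_zsmul, Finset.smul_sum]
    refine Finset.sum_congr rfl fun k _ => ?_
    rw [smul_comm]
  have h3 : S (S fun b' => f b' n) b = 0 := by
    have aux : ∀ (j k : I.α) (b'' : I.α → ℕ), b'' = bump (bump b j) k →
        tens I X ◁ cubesD Q I b (bump b j) j ≫ tens I X ◁ cubesD Q I (bump b j)
          (bump (bump b j) k) k ≫ f (bump (bump b j) k) n =
        tens I X ◁ (cubesD Q I b (bump b j) j ≫ cubesD Q I (bump b j) b'' k) ≫ f b'' n := by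
      rintro j k _ rfl
      rw [MonoidalCategory.whiskerLeft_comp, Category.assoc]
    have h4 : S (S fun b' => f b' n) b = ∑ x : I.α × I.α,
        ((∑ i with i < x.1, (b i : ℤ)) + ∑ i with i < x.2, (bump b x.1 i : ℤ)).negOnePow •
        (tens I X ◁ cubesD Q I b (bump b x.1) x.1 ≫ tens I X ◁ cubesD Q I (bump b x.1)
          (bump (bump b x.1) x.2) x.2 ≫ f (bump (bump b x.1) x.2) n) := by
      rw [Fintype.sum_prod_type]
      refine Finset.sum_congr rfl fun j _ => ?_
      rw [Preadditive.comp_sum, Finset.smul_sum]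
      refine Finset.sum_congr rfl fun k _ => ?_
      rw [Int.negOnePow_add, mul_smul]
      congr 1
      rw [Units.smul_def, Preadditive.comp_zsmul, ← Units.smul_def]
    have h5 : ∀ j, tens I X ◁ cubesD Q I b (bump b j) j ≫ tens I X ◁ cubesD Q I (bump b j)
          (bump (bump b j) j) j ≫ f (bump (bump b j) j) n = 0 := by
      intro j
      rw [aux j j _ rfl, cubesD_self, MonoidalPreadditive.whiskerLeft_zero, Limits.zero_comp]
    rw [h4]
    refine Finset.sum_involution (fun x _ => (x.2, x.1)) ?_ ?_ (fun _ _ => Finset.mem_univ _)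
      (fun _ _ => rfl)
    · rintro ⟨j, k⟩ _
      by_cases hjk : j = k
      · subst hjk
        simp only [h5, smul_zero, add_zero]
      · dsimp only
        rw [aux j k _ rfl, aux k j _ (bump_bump b j k), sign_bump b hjk, cubesD_comm Q b _ hjk rfl,
          Units.neg_smul, neg_add_cancel]
    · rintro ⟨j, k⟩ _ hx hjk
      obtain rfl : k = j := congrArg Prod.fst hjk
      exact hx (by rw [h5, smul_zero])
  change dTarget Q (multiD Q I X Y m f b) n -
    (m + 1).negOnePow • S (fun b' => multiD Q I X Y m f b' n) b = 0
  rw [h1, h2, h3, dTarget_dTarget, smul_zero, sub_zero, Int.negOnePow_succ, Units.neg_smul]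
  abel

/-- The differential as a homomorphism. -/
def multiDHom (I : FinIdx) (X : I.α → C) (Y : C) (m : ℤ) :
    multiHom Q I X Y m →+ multiHom Q I X Y (m + 1) :=
  AddMonoidHom.mk' (fun f => ⟨multiD Q I X Y m f.1, multiD_mem Q f.2⟩)
    (fun f g => Subtype.ext (by
      funext b n
      have h1 := dTarget_add Q (f.1 b) (g.1 b) n
      change dTarget Q (fun n => f.1 b n + g.1 b n) n - m.negOnePow •
        ∑ j, (∑ i with i < j, (b i : ℤ)).negOnePow •
          (tens I X ◁ cubesD Q I b (bump b j) j ≫ (f.1 (bump b j) n + g.1 (bump b j) n)) =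
        multiD Q I X Y m f.1 b n + multiD Q I X Y m g.1 b n
      simp only [Preadditive.comp_add, smul_add, Finset.sum_add_distrib, h1, multiD]
      abel))

/-- The complex `P_I({X_i}, Y)`. -/
def multiComplex (I : FinIdx) (X : I.α → C) (Y : C) : AbComplex.{v} :=
  CochainComplex.of (fun m => AddCommGrpCat.of (multiHom Q I X Y m))
    (fun m => AddCommGrpCat.ofHom (multiDHom Q I X Y m))
    (fun m => by
      ext f
      exact congrFun (congrFun (multiD_multiD Q m _) _) _)

theorem multiComplex_d (I : FinIdx) (X : I.α → C) (Y : C) (m : ℤ) :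
    (multiComplex Q I X Y).d m (m + 1) = AddCommGrpCat.ofHom (multiDHom Q I X Y m) :=
  CochainComplex.of_d (fun m => AddCommGrpCat.of (multiHom Q I X Y m))
    (fun m => AddCommGrpCat.ofHom (multiDHom Q I X Y m)) m

/-! ### The composition -/

section Composition

variable [SymmetricCategory C]

/-- The composition of `f` with `g_i` (of degree `n i`) in terms of components, where
`⊗_j X_j ⊗ ⊗_j □^{b j} ≅ ⊗_i ((⊗_{j ∈ F i} X_j) ⊗ (⊗_{j ∈ F i} □^{b j})) ⟶ ⊗_i (Y_i ⊗ □^{a i}) ≅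
⊗_i Y_i ⊗ ⊗_i □^{a i} ⟶ Z ⊗ □^k`, with `a i = n i + ∑_{j ∈ F i} b j`, up to the Koszul sign of
`⊗_i g_i` and of the permutation of the cubes `□^b`, which have degree `b`. -/
def multiCompFun {I : FinIdx} {F : I.α → FinIdx} {J : FinIdx} (σ : (Σ i, (F i).α) ≃ J.α)
    {X : J.α → C} {Y : I.α → C} {Z : C} (n : I.α → ℤ)
    (f : ∀ (a : I.α → ℕ) (k : ℕ), tens I Y ⊗ cubes Q I a ⟶ Z ⊗ Q.obj ⟨k⟩)
    (g : ∀ (i : I.α) (b : (F i).α → ℕ) (k : ℕ),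
      tens (F i) (fun t => X (σ ⟨i, t⟩)) ⊗ cubes Q (F i) b ⟶ Y i ⊗ Q.obj ⟨k⟩)
    (b : J.α → ℕ) (k : ℕ) : tens J X ⊗ cubes Q J b ⟶ Z ⊗ Q.obj ⟨k⟩ :=
  let a : I.α → ℕ := fun i => (n i + ∑ t, (b (σ ⟨i, t⟩) : ℤ)).toNat
  (FinIdx.koszul σ n fun j => (b j : ℤ)).negOnePow •
    (((tensShuffle σ X).hom ⊗ₘ (tensShuffle σ fun j => Q.obj ⟨b j⟩).hom) ≫
      (tensLMul _ _ I.list).inv ≫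
      tensHom I (fun i => g i (fun t => b (σ ⟨i, t⟩)) (a i)) ≫
      (tensLMul Y (fun i => Q.obj ⟨a i⟩) I.list).hom ≫ f a k)

theorem multiCompFun_mem {I : FinIdx} {F : I.α → FinIdx} {J : FinIdx} (σ : (Σ i, (F i).α) ≃ J.α)
    {X : J.α → C} {Y : I.α → C} {Z : C} {m : ℤ} {n : I.α → ℤ} {N : ℤ} (h : m + ∑ i, n i = N)
    {f : ∀ (a : I.α → ℕ) (k : ℕ), tens I Y ⊗ cubes Q I a ⟶ Z ⊗ Q.obj ⟨k⟩}
    (hf : f ∈ multiHom Q I Y Z m)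
    {g : ∀ (i : I.α) (b : (F i).α → ℕ) (k : ℕ),
      tens (F i) (fun t => X (σ ⟨i, t⟩)) ⊗ cubes Q (F i) b ⟶ Y i ⊗ Q.obj ⟨k⟩}
    (hg : ∀ i, g i ∈ multiHom Q (F i) (fun t => X (σ ⟨i, t⟩)) (Y i) (n i)) :
    multiCompFun Q σ n f g ∈ multiHom Q J X Z N := by
  refine ⟨fun b k hk => ?_, fun b k => ?_, fun b k => ?_⟩
  · rw [multiCompFun]
    by_cases h0 : ∀ i, 0 ≤ n i + ∑ t, (b (σ ⟨i, t⟩) : ℤ)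
    · rw [hf.1, Limits.comp_zero, Limits.comp_zero, Limits.comp_zero, Limits.comp_zero, smul_zero]
      have e : ∀ i, (((n i + ∑ t, (b (σ ⟨i, t⟩) : ℤ)).toNat : ℕ) : ℤ) =
          n i + ∑ t, (b (σ ⟨i, t⟩) : ℤ) := fun i => Int.toNat_of_nonneg (h0 i)
      have e2 : ∑ i, ∑ t, (b (σ ⟨i, t⟩) : ℤ) = ∑ j, (b j : ℤ) := by
        rw [← Fintype.sum_sigma (fun p : Σ i, (F i).α => (b (σ p) : ℤ))]
        exact Equiv.sum_comp σ (fun j => (b j : ℤ))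
      simp only [e, Finset.sum_add_distrib, e2]
      omega
    · push Not at h0
      obtain ⟨i, hi⟩ := h0
      unfold tensHom
      rw [tensLHom_zero _ i ?_ _ (I.mem_list i)]
      · simp only [Limits.zero_comp, Limits.comp_zero, smul_zero]
      · exact (hg i).1 _ _ (by omega)
  · rw [multiCompFun, Units.smul_def, Preadditive.comp_zsmul]
    congr 1
    have h1 : tens J X ◁ cubesE Q J b ≫
        ((tensShuffle σ X).hom ⊗ₘ (tensShuffle σ fun j => Q.obj ⟨b j⟩).hom) =
        ((tensShuffle σ X).hom ⊗ₘ (tensShuffle σ fun j => Q.obj ⟨b j⟩).hom) ≫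
        (𝟙 _ ⊗ₘ tensHom I fun i => cubesE Q (F i) fun t => b (σ ⟨i, t⟩)) := by
      rw [← id_tensorHom, tensorHom_comp_tensorHom, tensorHom_comp_tensorHom,
        tensShuffle_natural σ (fun j => cubeE Q (b j)), Category.id_comp, Category.comp_id]
    have h2 := tensLMul_natural (fun i => 𝟙 (tens (F i) fun t => X (σ ⟨i, t⟩)))
      (fun i => cubesE Q (F i) fun t => b (σ ⟨i, t⟩)) I.list
    rw [tensLHom_id, ← Iso.eq_comp_inv, Category.assoc, ← Iso.inv_comp_eq] at h2
    rw [reassoc_of% h1, reassoc_of% h2.symm]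
    have h3 := tensLHom_comp (fun i => 𝟙 (tens (F i) fun t => X (σ ⟨i, t⟩)) ⊗ₘ
      cubesE Q (F i) fun t => b (σ ⟨i, t⟩)) (fun i => g i (fun t => b (σ ⟨i, t⟩))
        (n i + ∑ t, (b (σ ⟨i, t⟩) : ℤ)).toNat) I.list
    simp only [id_tensorHom, (hg _).2.1] at h3
    simp only [id_tensorHom]
    rw [reassoc_of% h3]
  · rw [multiCompFun, Units.smul_def, Preadditive.zsmul_comp]
    simp only [Category.assoc, hf.2.2]

end Composition

end MultiCube

section Data

variable {C : Type u} [Category.{v} C] [Preadditive C] [MonoidalCategory C]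
  [MonoidalPreadditive C] (Q : ECube ⥤ C)

theorem tensHom_one {A B : FinIdx.one.α → C} (φ : ∀ i, A i ⟶ B i) :
    tensHom FinIdx.one φ = φ (0 : Fin 1) := by
  change (ρ_ (A (0 : Fin 1))).inv ≫ (φ (0 : Fin 1) ⊗ₘ (𝟙 (𝟙_ C) ≫ 𝟙 (𝟙_ C))) ≫
    (ρ_ (B (0 : Fin 1))).hom = φ (0 : Fin 1)
  rw [Category.comp_id, tensorHom_id, rightUnitor_naturality, Iso.inv_hom_id_assoc]

theorem sum_one_eq (b : FinIdx.one.α → ℤ) : ∑ i, b i = b (0 : Fin 1) :=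
  Fintype.sum_eq_single (0 : Fin 1) fun i hi => absurd (PseudoTensorData.one_unique i) hi

theorem const_one (b : FinIdx.one.α → ℕ) : b = fun _ => b (0 : Fin 1) :=
  funext fun i => congrArg b (PseudoTensorData.one_unique i)

/-- A family in `Hom_{dg_e C}(X, Y)^p` as an element of `P_1(X, Y)^p`. -/
def unFun {X Y : C} (f : ∀ a n : ℕ, X ⊗ Q.obj ⟨a⟩ ⟶ Y ⊗ Q.obj ⟨n⟩) (b : FinIdx.one.α → ℕ) (n : ℕ) :
    tens FinIdx.one (fun _ => X) ⊗ cubes Q FinIdx.one b ⟶ Y ⊗ Q.obj ⟨n⟩ :=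
  f (b (0 : Fin 1)) n

/-- An element of `P_1(X, Y)^p` as a family in `Hom_{dg_e C}(X, Y)^p`. -/
def unInv {X Y : C} (f : ∀ (b : FinIdx.one.α → ℕ) (n : ℕ),
    tens FinIdx.one (fun _ => X) ⊗ cubes Q FinIdx.one b ⟶ Y ⊗ Q.obj ⟨n⟩) (a n : ℕ) :
    X ⊗ Q.obj ⟨a⟩ ⟶ Y ⊗ Q.obj ⟨n⟩ :=
  f (fun _ => a) n

theorem unFun_mem {X Y : C} {p : ℤ} {f : ∀ a n : ℕ, X ⊗ Q.obj ⟨a⟩ ⟶ Y ⊗ Q.obj ⟨n⟩}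
    (hf : f ∈ dgeHom Q X Y p) : unFun Q f ∈ multiHom Q FinIdx.one (fun _ => X) Y p := by
  refine ⟨fun b n h => ?_, fun b n => ?_, fun b n => ?_⟩
  · rw [sum_one_eq] at h
    exact hf.1 _ n h
  · exact (congrArg (fun z => X ◁ z ≫ f (b (0 : Fin 1)) n)
      (tensHom_one fun i => cubeE Q (b i))).trans (hf.2.1 _ n)
  · exact hf.2.2 _ n

theorem unInv_mem {X Y : C} {p : ℤ} {f : ∀ (b : FinIdx.one.α → ℕ) (n : ℕ),
    tens FinIdx.one (fun _ => X) ⊗ cubes Q FinIdx.one b ⟶ Y ⊗ Q.obj ⟨n⟩}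
    (hf : f ∈ multiHom Q FinIdx.one (fun _ => X) Y p) : unInv Q f ∈ dgeHom Q X Y p := by
  refine ⟨fun a n h => ?_, fun a n => ?_, fun a n => ?_⟩
  · refine hf.1 (fun _ => a) n ?_
    rwa [sum_one_eq]
  · exact (congrArg (fun z => X ◁ z ≫ f (fun _ => a) n)
      (tensHom_one fun _ => cubeE Q a)).symm.trans (hf.2.1 (fun _ => a) n)
  · exact hf.2.2 (fun _ => a) n

theorem cubesD_one (b : FinIdx.one.α → ℕ) (j : FinIdx.one.α) (hj : j = (0 : Fin 1)) :
    cubesD Q FinIdx.one b (bump b j) j = cubeStep Q (b (0 : Fin 1)) (bump b j (0 : Fin 1)) := by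
  exact (tensHom_one (A := fun i => Q.obj ⟨b i⟩) (B := fun i => Q.obj ⟨bump b j i⟩)
    fun i : FinIdx.one.α => if i = j then cubeStep Q (b i) (bump b j i) else
      cubeSame Q (b i) (bump b j i)).trans (if_pos hj.symm)

theorem filter_one (j : FinIdx.one.α) : (Finset.univ.filter fun i => i < j) = ∅ := by
  rw [Finset.filter_eq_empty_iff]
  intro i _
  rw [PseudoTensorData.one_unique i, PseudoTensorData.one_unique j]
  exact lt_irrefl (0 : Fin 1)

theorem unFun_d {X Y : C} {p : ℤ} (f : ∀ a n : ℕ, X ⊗ Q.obj ⟨a⟩ ⟶ Y ⊗ Q.obj ⟨n⟩) :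
    multiD Q FinIdx.one (fun _ => X) Y p (unFun Q f) = unFun Q (dgeD Q X Y p f) := by
  funext b n
  have e : cubesD Q FinIdx.one b (bump b (0 : Fin 1)) (0 : Fin 1) = cubeD Q (b (0 : Fin 1)) :=
    (cubesD_one Q b (0 : Fin 1) rfl).trans (cubeStep_succ Q (b (0 : Fin 1)))
  have hs (j : FinIdx.one.α) : (∑ i with i < j, (b i : ℤ)).negOnePow = 1 := by
    rw [filter_one, Finset.sum_empty, Int.negOnePow_zero]
  refine congrArg (fun z => dTarget Q (unFun Q f b) n - p.negOnePow • z) ?_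
  refine (Fintype.sum_eq_single (0 : Fin 1)
    fun i hi => absurd (PseudoTensorData.one_unique i) hi).trans ?_
  refine (congrArg₂ (fun (s : ℤˣ) (z : X ⊗ Q.obj ⟨b (0 : Fin 1)⟩ ⟶ Y ⊗ Q.obj ⟨n⟩) => s • z)
    (hs (0 : Fin 1)) (congrArg (fun z => X ◁ z ≫ f (b (0 : Fin 1) + 1) n) e)).trans (one_smul _ _)

/-- The isomorphism `Hom_{dg_e C}(X, Y) ≅ P_1(X, Y)`. -/
def unIso (X Y : C) : dgeComplex Q X Y ≅ multiComplex Q FinIdx.one (fun _ => X) Y :=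
  HomologicalComplex.Hom.isoOfComponents
    (fun p => AddEquiv.toAddCommGrpIso (X := AddCommGrpCat.of (dgeHom Q X Y p))
      (Y := AddCommGrpCat.of (multiHom Q FinIdx.one (fun _ => X) Y p))
      { toFun f := ⟨unFun Q f.1, unFun_mem Q f.2⟩
        invFun f := ⟨unInv Q f.1, unInv_mem Q f.2⟩
        left_inv _ := rfl
        right_inv f := Subtype.ext (by
          funext b n
          rw [const_one b]
          rfl)
        map_add' _ _ := rfl })
    (fun p q h => by
      obtain rfl : p + 1 = q := h
      rw [dgeComplex_d, multiComplex_d]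
      ext f
      exact Subtype.ext (unFun_d Q f.1))

/-- The data of the pseudo-tensor structure on `dg_e C`. -/
def dgeData [SymmetricCategory C] : PseudoTensorData (dge Q) where
  P I X Y := multiComplex Q I X Y
  comp {I F J} σ {X Y Z} m n N h f g :=
    (⟨multiCompFun Q σ n (f : multiHom Q I Y Z m).1
        (fun i => (g i : multiHom Q (F i) (fun t => X (σ ⟨i, t⟩)) (Y i) (n i)).1),
      multiCompFun_mem Q σ h (f : multiHom Q I Y Z m).2
        (fun i => (g i : multiHom Q (F i) (fun t => X (σ ⟨i, t⟩)) (Y i) (n i)).2)⟩ :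
      multiHom Q J X Z N)
  unary X Y := unIso Q X Y

end Data

/-! Three ingredients carry the theorem: coherence with signs, an acyclicity coming from the
bi-multiplication, and an exactness coming from homotopy invariance.

Pseudo-tensor axioms. The compositions are built from symmetry isomorphisms which regroup tensor
products. Permutation isomorphisms of flat lists compose (`tensLPerm_trans`), and every shuffle
becomes such an isomorphism once the nested tensor products are flattened (`tensShuffle_presL`);
this gives `tensShuffle_assoc`. The separation of the objects from the cubes is the constraint of
the lax braided functor `⊗ : C × C ⥤ C` (`tensLMul_lax`), hence compatible with shuffles
(`tensShuffle_tensLMul`). The Koszul signs are, modulo 2, weighted numbers of inversions between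
total orders. These form a cocycle (`inversions_add`), whence the sign of associativity
(`koszul_assoc`); `koszul_bump` is the sign in the Leibniz rule `multiComp_d`.

Representability. Put `T = ⊗ X_i`. The complex `Hom(T, Y)` embeds into `P_I({X_i}, Y)` as the
subcomplex of the families whose components vanish as soon as a cube other than the first has
positive dimension (`extendFst`, `exists_extendFst`). The quotient is acyclic: when some `□^m` with
`m ≥ 1` stands beside the first cube, the map `{0,1}^{a+1} × {0,1}^m → {0,1}^a × {0,1}^m` which
merges the last coordinate of the first cube into a coordinate of the other one by taking the
maximum is a contracting homotopy in the first direction (`CubeBimul.cubeD_absorb_succ`). The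
isomorphisms `μ` and `δ_{n,m}` turn this map of cubes into a morphism of tensor products. The
unwanted components are then cleared successively, by increasing dimension of the first cube, and
the corrections converge because each component is changed only once (`CubeBimul.exists_clearing`).
So the universal element induces a quasi-isomorphism (`quasiIso_ofCocycle_univFst`).

The homotopy category. By homotopy invariance, for `n ≥ 1` the complex of the non-degenerate
morphisms `X ⊗ □^a ⟶ Y ⊗ □^n` killed by the projections is exact
(`HomotopyInvariant.exists_cubeD_comp`). Hence a `0`-cocycle of `Hom_{dg_e C}(X, Y)` is a coboundary
if and only if its component `X ⊗ □^0 ⟶ Y ⊗ □^0` factors through `d : □^0 ⟶ □^1`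
(`exists_of_mem_B0`, `HomotopyInvariant.mem_B0`). Therefore `H⁰` is the quotient of `C` by an
additive ideal which is stable under tensor products, and the symmetric monoidal structure descends
along the full functor `toH0`. Taking the component with all cubes of dimension `0` identifies `H⁰
P_I({X_i}, Y)` with the morphisms `T ⟶ Y` of the homotopy category (`HomotopyInvariant.zeroEquiv`),
compatibly with compositions (`zeroStrip_comp`), and `ε_π` is the class of the shuffle isomorphism
of `C`. -/

section Coherence

/-! ### Functoriality of the permutation isomorphisms. -/

variable {C : Type u} [Category.{v} C] [MonoidalCategory C]

/-- The identification of tensor products over equal lists. -/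
abbrev castL {J : Type} (A : J → C) {L M : List J} (h : L = M) : tensL A L ⟶ tensL A M :=
  eqToHom (congrArg (tensL A) h)

theorem tensLCons_castL {J : Type} (A : J → C) (j : J) {L M : List J} (h : L = M) :
    A j ◁ castL A h ≫ (tensLCons A j M).hom =
      (tensLCons A j L).hom ≫ castL A (congrArg (j :: ·) h) := by
  subst h; simp

theorem tensLCons_castL_assoc {J : Type} (A : J → C) (j : J) {L M : List J} (h : L = M) {Z : C}
    (f : tensL A (j :: M) ⟶ Z) : A j ◁ castL A h ≫ (tensLCons A j M).hom ≫ f =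
      (tensLCons A j L).hom ≫ castL A (congrArg (j :: ·) h) ≫ f := by
  subst h; simp

variable [SymmetricCategory C]

/-- The symmetry `X ⊗ (Y ⊗ T) ⟶ Y ⊗ (X ⊗ T)`. -/
def swapFront (X Y T : C) : X ⊗ Y ⊗ T ⟶ Y ⊗ X ⊗ T :=
  (α_ X Y T).inv ≫ (β_ X Y).hom ▷ T ≫ (α_ Y X T).hom

theorem swapFront_natural {X X' Y Y' T T' : C} (f : X ⟶ X') (g : Y ⟶ Y') (h : T ⟶ T') :
    (f ⊗ₘ g ⊗ₘ h) ≫ swapFront X' Y' T' = swapFront X Y T ≫ (g ⊗ₘ f ⊗ₘ h) := by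
  have := whisker_square_right h (BraidedCategory.braiding_naturality f g)
  simp only [swapFront, Category.assoc]
  rw [associator_inv_naturality_assoc, reassoc_of% this, associator_naturality]

theorem swapFront_natural_right (X Y : C) {T T' : C} (h : T ⟶ T') :
    X ◁ Y ◁ h ≫ swapFront X Y T' = swapFront X Y T ≫ Y ◁ X ◁ h := by
  simpa using swapFront_natural (𝟙 X) (𝟙 Y) h

theorem swapFront_natural_right_assoc (X Y : C) {T T' Z : C} (h : T ⟶ T')
    (f : Y ⊗ X ⊗ T' ⟶ Z) :
    X ◁ Y ◁ h ≫ swapFront X Y T' ≫ f = swapFront X Y T ≫ Y ◁ X ◁ h ≫ f := by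
  rw [reassoc_of% swapFront_natural_right X Y h]

theorem swapFront_swapFront (X Y T : C) : swapFront X Y T ≫ swapFront Y X T = 𝟙 _ := by
  simp [swapFront, ← comp_whiskerRight_assoc]

/-- The Yang–Baxter relation of the braiding with a spectator `T`; everything else is monoidal
coherence. It is the only relation between three moving factors used in comparing pulls. -/
theorem swapFront_yang_baxter (X Y Z T : C) :
    swapFront X Y (Z ⊗ T) ≫ Y ◁ swapFront X Z T ≫ swapFront Y Z (X ⊗ T) =
      X ◁ swapFront Y Z T ≫ swapFront X Z (Y ⊗ T) ≫ Z ◁ swapFront X Y T := by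
  trans 𝟙 _ ⊗≫ ((β_ X Y).hom ▷ Z ⊗≫ Y ◁ (β_ X Z).hom ⊗≫ (β_ Y Z).hom ▷ X) ▷ T ⊗≫ 𝟙 _
  · simp only [swapFront]
    monoidal
  · rw [BraidedCategory.yang_baxter']
    simp only [swapFront]
    monoidal

variable {J : Type} [DecidableEq J] (A : J → C)

theorem tensLPull_self (j : J) (L : List J) (h : j ∈ j :: L) :
    (tensLPull A j (j :: L) h).hom = (tensLCons A j L).inv ≫ A j ◁ castL A (by simp) := by
  simp [tensLPull]

theorem tensLPull_of_ne {j k : J} (e : k ≠ j) (L : List J) (h0 : j ∈ L) (h : j ∈ k :: L) :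
    (tensLPull A j (k :: L) h).hom = (tensLCons A k L).inv ≫ A k ◁ (tensLPull A j L h0).hom ≫
      swapFront _ _ _ ≫ A j ◁ ((tensLCons A k (L.erase j)).hom ≫ castL A (by simp [e])) := by
  simp [tensLPull, e, swapFront]

theorem castL_tensLPull (j : J) {L M : List J} (h : L = M) (hj : j ∈ M) :
    castL A h ≫ (tensLPull A j M hj).hom =
      (tensLPull A j L (h ▸ hj)).hom ≫ A j ◁ castL A (congrArg (List.erase · j) h) := by
  subst h; simp

/-- Two pulls commute up to the exchange of the two factors which end in front. Let `i` be the head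
of the list. If `i` is neither `j` nor `k`, three factors move past each other and Yang–Baxter
applies. If `i = k`, both sides contain a single exchange of the two factors. If `i = j`, the left
side exchanges them twice, which is trivial since the braiding is symmetric. -/
theorem tensLPull_comm {j k : J} (e : j ≠ k) : ∀ (L : List J) (hj : j ∈ L) (hk : k ∈ L)
    (hj' : j ∈ L.erase k) (hk' : k ∈ L.erase j),
    (tensLPull A k L hk).hom ≫ A k ◁ (tensLPull A j (L.erase k) hj').hom ≫ swapFront _ _ _ =
      (tensLPull A j L hj).hom ≫ A j ◁ (tensLPull A k (L.erase j) hk').hom ≫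
        A j ◁ A k ◁ castL A (List.erase_comm ..)
  | [], hj, _, _, _ => absurd hj List.not_mem_nil
  | i :: L, hj, hk, hj', hk' => by
    by_cases e1 : i = k
    · subst e1
      have h0 : j ∈ L := (List.mem_cons.1 hj).resolve_left e
      rw [tensLPull_self, tensLPull_of_ne A e.symm L h0]
      have hc : i ∈ i :: L.erase j := List.mem_cons_self
      have h1 := castL_tensLPull A i (show i :: L.erase j = (i :: L).erase j by simp [e.symm]) hk'
      have h2 := castL_tensLPull A j (show L = (i :: L).erase i by simp) hj'
      simp only [MonoidalCategory.whiskerLeft_comp, Category.assoc]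
      rw [← MonoidalCategory.whiskerLeft_comp_assoc (A i) (castL A _), h2,
        ← MonoidalCategory.whiskerLeft_comp_assoc (A j) (castL A _), h1, tensLPull_self]
      simp only [MonoidalCategory.whiskerLeft_comp, Category.assoc, swapFront_natural_right]
      simp only [← MonoidalCategory.whiskerLeft_comp, ← MonoidalCategory.whiskerLeft_comp_assoc,
        Iso.hom_inv_id_assoc, eqToHom_trans]
    · by_cases e2 : i = j
      · subst e2
        have h0 : k ∈ L := (List.mem_cons.1 hk).resolve_left e.symm
        rw [tensLPull_self, tensLPull_of_ne A e L h0]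
        have hc : i ∈ i :: L.erase k := List.mem_cons_self
        have h1 := castL_tensLPull A i (show i :: L.erase k = (i :: L).erase k by simp [e]) hj'
        have h2 := castL_tensLPull A k (show L = (i :: L).erase i by simp) hk'
        simp only [MonoidalCategory.whiskerLeft_comp, Category.assoc]
        rw [← MonoidalCategory.whiskerLeft_comp_assoc (A k) (castL A _), h1,
          ← MonoidalCategory.whiskerLeft_comp_assoc (A i) (castL A _), h2, tensLPull_self]
        simp only [MonoidalCategory.whiskerLeft_comp, Category.assoc, swapFront_natural_right]
        rw [← MonoidalCategory.whiskerLeft_comp_assoc (A k) (tensLCons A i _).hom,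
          Iso.hom_inv_id, MonoidalCategory.whiskerLeft_id, Category.id_comp,
          swapFront_natural_right_assoc, reassoc_of% swapFront_swapFront]
        simp only [← MonoidalCategory.whiskerLeft_comp, eqToHom_trans]
      · have j0 : j ∈ L := (List.mem_cons.1 hj).resolve_left (Ne.symm e2)
        have k0 : k ∈ L := (List.mem_cons.1 hk).resolve_left (Ne.symm e1)
        have j1 : j ∈ L.erase k := (List.mem_erase_of_ne e).2 j0
        have k1 : k ∈ L.erase j := (List.mem_erase_of_ne e.symm).2 k0
        have ih := tensLPull_comm e L j0 k0 j1 k1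
        have h1 := castL_tensLPull A j (show i :: L.erase k = (i :: L).erase k by simp [e1]) hj'
        have h2 := castL_tensLPull A k (show i :: L.erase j = (i :: L).erase j by simp [e2]) hk'
        rw [tensLPull_of_ne A e1 L k0, tensLPull_of_ne A e2 L j0]
        simp only [MonoidalCategory.whiskerLeft_comp, Category.assoc]
        rw [← MonoidalCategory.whiskerLeft_comp_assoc (A k) (castL A _), h1,
          ← MonoidalCategory.whiskerLeft_comp_assoc (A j) (castL A _), h2,
          tensLPull_of_ne A e1 _ k1, tensLPull_of_ne A e2 _ j1]
        simp only [MonoidalCategory.whiskerLeft_comp, Category.assoc, swapFront_natural_right]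
        rw [← MonoidalCategory.whiskerLeft_comp_assoc (A k) (tensLCons A i _).hom,
          Iso.hom_inv_id, MonoidalCategory.whiskerLeft_id, Category.id_comp,
          ← MonoidalCategory.whiskerLeft_comp_assoc (A j) (tensLCons A i _).hom,
          Iso.hom_inv_id, MonoidalCategory.whiskerLeft_id, Category.id_comp,
          swapFront_natural_right_assoc, swapFront_natural_right_assoc,
          ← swapFront_natural_right_assoc, reassoc_of% swapFront_yang_baxter]
        have ih' := congrArg (fun f => A i ◁ f) ih
        simp only [MonoidalCategory.whiskerLeft_comp] at ih'
        rw [reassoc_of% ih', swapFront_natural_right_assoc, swapFront_natural_right_assoc]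
        simp only [← MonoidalCategory.whiskerLeft_comp, eqToHom_trans]
        rw [swapFront_natural_right_assoc]
        simp only [← MonoidalCategory.whiskerLeft_comp]
        rw [reassoc_of% tensLCons_castL A i (show (L.erase j).erase k = (L.erase k).erase j from List.erase_comm ..), eqToHom_trans]

theorem tensLPerm_cons' (L : List J) (j : J) (M : List J) (h : L.Perm (j :: M)) (hj : j ∈ L)
    (h' : (L.erase j).Perm M) :
    (tensLPerm A L (j :: M) h).hom = (tensLPull A j L hj).hom ≫
      A j ◁ (tensLPerm A (L.erase j) M h').hom ≫ (tensLCons A j M).hom := by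
  simp [tensLPerm]

theorem castL_tensLPerm {L M N : List J} (h : L = M) (h' : M.Perm N) :
    castL A h ≫ (tensLPerm A M N h').hom = (tensLPerm A L N (h ▸ h')).hom := by
  subst h; simp

theorem tensLPerm_castL {L M N : List J} (h : L.Perm M) (h' : M = N) :
    (tensLPerm A L M h).hom ≫ castL A h' = (tensLPerm A L N (h' ▸ h)).hom := by
  subst h'; simp

theorem tensLPerm_cons (j : J) {L M : List J} (h : L.Perm M) :
    (tensLPerm A (j :: L) (j :: M) (h.cons j)).hom = (tensLCons A j L).inv ≫
      A j ◁ (tensLPerm A L M h).hom ≫ (tensLCons A j M).hom := by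
  rw [tensLPerm_cons' A _ j M _ List.mem_cons_self (by simpa using h), tensLPull_self,
    Category.assoc, ← MonoidalCategory.whiskerLeft_comp_assoc, castL_tensLPerm]

theorem tensLPerm_refl : ∀ (L : List J) (h : L.Perm L), (tensLPerm A L L h).hom = 𝟙 _
  | [], _ => by simp [tensLPerm]
  | j :: L, _ => by
    rw [tensLPerm_cons A j (List.Perm.refl L), tensLPerm_refl L]
    simp

theorem tensLPerm_eq {L M : List J} (h : L = M) :
    (tensLPerm A L M (.of_eq h)).hom = castL A h := by
  subst h; simp [tensLPerm_refl]

theorem tensLPerm_swap {j k : J} (e : j ≠ k) (L : List J) (h : (j :: k :: L).Perm (k :: j :: L)) :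
    (tensLPerm A (j :: k :: L) (k :: j :: L) h).hom = (tensLCons A j (k :: L)).inv ≫
      A j ◁ (tensLCons A k L).inv ≫ swapFront _ _ _ ≫ A k ◁ (tensLCons A j L).hom ≫
        (tensLCons A k (j :: L)).hom := by
  rw [tensLPerm_cons' A _ k (j :: L) _ (by simp) (by simp [e]), tensLPull_of_ne A e _ (by simp),
    tensLPull_self, tensLPerm_eq A (show (j :: k :: L).erase k = j :: L by simp [e])]
  simp only [MonoidalCategory.whiskerLeft_comp, Category.assoc, swapFront_natural_right_assoc]
  simp only [← MonoidalCategory.whiskerLeft_comp_assoc, eqToHom_trans_assoc,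
    tensLCons_castL_assoc, Category.assoc, eqToHom_trans]
  simp

/-- `tensLPerm` pulls the entries of the target list one after the other, so its compatibility with
one more pull reduces, entry by entry, to the commutation of two pulls. -/
theorem tensLPerm_tensLPull (k : J) : ∀ (L M : List J) (h : L.Perm M) (hL : k ∈ L) (hM : k ∈ M),
    (tensLPerm A L M h).hom ≫ (tensLPull A k M hM).hom = (tensLPull A k L hL).hom ≫
      A k ◁ (tensLPerm A (L.erase k) (M.erase k) (h.erase k)).hom
  | _, [], _, _, hM => absurd hM List.not_mem_nil
  | L, j :: M, h, hL, hM => by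
    have hj : j ∈ L := h.mem_iff.2 List.mem_cons_self
    have hp : (L.erase j).Perm M := by simpa using h.erase j
    rw [tensLPerm_cons' A _ j M _ hj hp]
    by_cases e : j = k
    · subst e
      rw [tensLPull_self]
      simp only [Category.assoc, Iso.hom_inv_id_assoc]
      rw [← MonoidalCategory.whiskerLeft_comp, tensLPerm_castL]
    · have k0 : k ∈ M := (List.mem_cons.1 hM).resolve_left (Ne.symm e)
      have k1 : k ∈ L.erase j := hp.mem_iff.2 k0
      have j1 : j ∈ L.erase k := (List.mem_erase_of_ne e).2 hj
      have ih := tensLPerm_tensLPull k (L.erase j) M hp k1 k0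
      have hc := tensLPull_comm A (Ne.symm e) L hL hj k1 j1
      have hq : ((L.erase k).erase j).Perm (M.erase k) := by
        rw [List.erase_comm]; exact hp.erase k
      rw [tensLPull_of_ne A e M k0]
      simp only [Category.assoc, Iso.hom_inv_id_assoc]
      rw [← MonoidalCategory.whiskerLeft_comp_assoc, ih, MonoidalCategory.whiskerLeft_comp_assoc,
        swapFront_natural_right_assoc, reassoc_of% hc]
      simp only [← MonoidalCategory.whiskerLeft_comp, ← MonoidalCategory.whiskerLeft_comp_assoc]
      have hq' : (L.erase k).Perm (j :: M.erase k) := (List.perm_cons_erase j1).trans (hq.cons j)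
      have hx := tensLPerm_castL A hq' (show j :: M.erase k = (j :: M).erase k by simp [e])
      rw [← hx, tensLPerm_cons' A _ j _ hq' j1 hq]
      have hy := castL_tensLPerm A (show (L.erase k).erase j = (L.erase j).erase k from List.erase_comm ..) (hp.erase k)
      simp only [← hy, MonoidalCategory.whiskerLeft_comp, Category.assoc]

/-- A composite of permutation isomorphisms depends only on its first and last lists. The coherence
of shuffles is reduced to this. -/
theorem tensLPerm_trans : ∀ {L M N : List J} (h : L.Perm M) (h' : M.Perm N),
    (tensLPerm A L M h).hom ≫ (tensLPerm A M N h').hom = (tensLPerm A L N (h.trans h')).hom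
  | L, M, [], h, h' => by
    obtain rfl := h'.eq_nil
    obtain rfl := h.eq_nil
    simp [tensLPerm]
  | L, M, j :: N, h, h' => by
    have hM : j ∈ M := h'.mem_iff.2 List.mem_cons_self
    have hL : j ∈ L := h.mem_iff.2 hM
    have hp : (M.erase j).Perm N := by simpa using h'.erase j
    rw [tensLPerm_cons' A M j N h' hM hp, tensLPerm_cons' A L j N _ hL ((h.erase j).trans hp),
      reassoc_of% tensLPerm_tensLPull A j L M h hL hM, ← MonoidalCategory.whiskerLeft_comp_assoc,
      tensLPerm_trans]

end Coherence

/-! ### Concatenation, and presentations by flat tensor products. -/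

section Presentations

variable {C : Type u} [Category.{v} C] [MonoidalCategory C]

theorem tensLAppend_nil {K : Type} (W : K → C) (M : List K) :
    (tensLAppend W [] M).hom = (λ_ (tensL W M)).hom :=
  (congrArg (· ≫ (λ_ (tensL W M)).hom) (id_whiskerRight (𝟙_ C) (tensL W M))).trans
    (Category.id_comp _)

theorem tensLAppend_cons {K : Type} (W : K → C) (k : K) (L M : List K) :
    (tensLAppend W (k :: L) M).hom = (tensLCons W k L).inv ▷ tensL W M ≫ (α_ _ _ _).hom ≫
      W k ◁ (tensLAppend W L M).hom ≫ (tensLCons W k (L ++ M)).hom := rfl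

theorem tensLAppend_castL {K : Type} (W : K → C) (L : List K) {M M' : List K} (h : M = M') :
    tensL W L ◁ castL W h ≫ (tensLAppend W L M').hom =
      (tensLAppend W L M).hom ≫ castL W (congrArg (L ++ ·) h) := by
  subst h; simp

theorem tensLAppend_assoc {K : Type} (W : K → C) : ∀ L M N : List K,
    (α_ _ _ _).hom ≫ tensL W L ◁ (tensLAppend W M N).hom ≫ (tensLAppend W L (M ++ N)).hom =
      (tensLAppend W L M).hom ▷ tensL W N ≫ (tensLAppend W (L ++ M) N).hom ≫
        castL W (List.append_assoc L M N)
  | [], M, N => by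
    rw [tensLAppend_nil, tensLAppend_nil]
    change (α_ (𝟙_ C) _ _).hom ≫ 𝟙_ C ◁ (tensLAppend W M N).hom ≫ (λ_ _).hom =
      (λ_ _).hom ▷ tensL W N ≫ (tensLAppend W M N).hom ≫ 𝟙 _
    simp
  | k :: L, M, N => by
    have ih := tensLAppend_assoc W L M N
    have hc := tensLCons_castL W k (List.append_assoc L M N)
    simp only [tensLAppend_cons, List.cons_append, comp_whiskerRight, Category.assoc]
    rw [← hc, hom_inv_whiskerRight_assoc, associator_naturality_middle_assoc]
    rw [← MonoidalCategory.whiskerLeft_comp_assoc (W k), ← MonoidalCategory.whiskerLeft_comp_assoc,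
      Category.assoc, ← ih]
    rw [whisker_exchange_assoc, ← associator_naturality_left_assoc]
    simp

variable {K : Type} (W : K → C)

/-- The morphism `⨂_j A_j ⟶ ⨂ (L.flatMap B)` for a family of objects `A_j` with given morphisms
`ν_j : A_j ⟶ ⨂ (B j)` to tensor products of objects `W k`. -/
def presL {J : Type} {A : J → C} {B : J → List K} (ν : ∀ j, A j ⟶ tensL W (B j)) (L : List J) :
    tensL A L ⟶ tensL W (L.flatMap B) :=
  tensLHom ν L ≫ (tensLFlat W B L).hom

variable {J : Type} {A : J → C} {B : J → List K} (ν : ∀ j, A j ⟶ tensL W (B j))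

theorem presL_nil : presL W ν [] = 𝟙 (𝟙_ C) := by
  change (𝟙 (𝟙_ C) ≫ 𝟙 (𝟙_ C)) ≫ 𝟙 (𝟙_ C) ≫ 𝟙 (𝟙_ C) = 𝟙 (𝟙_ C)
  simp

theorem presL_cons (j : J) (L : List J) : presL W ν (j :: L) =
    (tensLCons A j L).inv ≫ (ν j ⊗ₘ presL W ν L) ≫ (tensLAppend W (B j) (L.flatMap B)).hom := by
  simp only [presL, tensLHom, tensLFlat, Iso.trans_hom, Iso.symm_hom, whiskerLeftIso_hom,
    Category.assoc]
  erw [Iso.hom_inv_id_assoc]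
  rw [← id_tensorHom, tensorHom_comp_tensorHom_assoc, Category.comp_id]

instance [∀ j, IsIso (ν j)] (L : List J) : IsIso (presL W ν L) := by
  have : IsIso (tensLHom ν L) :=
    (tensLIso (fun j => asIso (ν j)) L).isIso_hom
  unfold presL
  infer_instance

theorem tensLHom_presL {A' : J → C} (φ : ∀ j, A' j ⟶ A j) (L : List J) :
    tensLHom φ L ≫ presL W ν L = presL W (fun j => φ j ≫ ν j) L := by
  simp only [presL]
  rw [← tensLHom_comp, Category.assoc]

/-- Flattening commutes with concatenation; the content of the inductive step is the associativity
of concatenation. -/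
theorem presL_append : ∀ L M : List J,
    (tensLAppend A L M).hom ≫ presL W ν (L ++ M) = (presL W ν L ⊗ₘ presL W ν M) ≫
      (tensLAppend W (L.flatMap B) (M.flatMap B)).hom ≫ castL W List.flatMap_append.symm
  | [], M => by
    have key : ∀ {T T' : C} (p : T ⟶ T'),
        (λ_ T).hom ≫ p = (𝟙 (𝟙_ C) ⊗ₘ p) ≫ (λ_ T').hom ≫ 𝟙 _ := by intros; simp
    refine (congrArg (· ≫ presL W ν M) (tensLAppend_nil A M)).trans
      ((key (presL W ν M)).trans ?_)
    exact congrArg₂ (fun x y => (x ⊗ₘ presL W ν M) ≫ y ≫ 𝟙 _) (presL_nil W ν).symm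
      (tensLAppend_nil W (M.flatMap B)).symm
  | j :: L, M => by
    have ih := presL_append L M
    have h1 := tensLAppend_assoc W (B j) (L.flatMap B) (M.flatMap B)
    have h2 : B j ++ L.flatMap B ++ M.flatMap B = B j ++ (L ++ M).flatMap B := by simp
    have h3 : (ν j ⊗ₘ (tensLAppend A L M).hom ≫ presL W ν (L ++ M)) =
        (ν j ⊗ₘ (presL W ν L ⊗ₘ presL W ν M)) ≫ tensL W (B j) ◁
          (tensLAppend W (L.flatMap B) (M.flatMap B)).hom ≫
            tensL W (B j) ◁ castL W List.flatMap_append.symm := by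
      rw [ih]; simp [← id_tensorHom, tensorHom_comp_tensorHom]
    have h4 := tensLAppend_castL W (B j) (List.flatMap_append (xs := L) (ys := M) (f := B)).symm
    have h5 : (presL W ν (j :: L) ⊗ₘ presL W ν M) = (tensLCons A j L).inv ▷ _ ≫
        ((ν j ⊗ₘ presL W ν L) ⊗ₘ presL W ν M) ≫
          (tensLAppend W (B j) (L.flatMap B)).hom ▷ _ := by
      rw [presL_cons, ← tensorHom_id, ← tensorHom_id, tensorHom_comp_tensorHom,
        tensorHom_comp_tensorHom, Category.comp_id, Category.id_comp]
    have h6 : (tensLAppend A (j :: L) M).hom ≫ presL W ν (j :: L ++ M) =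
        (tensLCons A j L).inv ▷ _ ≫ (α_ _ _ _).hom ≫ (ν j ⊗ₘ (tensLAppend A L M).hom ≫
          presL W ν (L ++ M)) ≫ (tensLAppend W (B j) ((L ++ M).flatMap B)).hom := by
      rw [tensLAppend_cons]
      have := presL_cons W ν j (L ++ M)
      simp only [List.cons_append, Category.assoc]
      rw [this, Iso.hom_inv_id_assoc, ← id_tensorHom, tensorHom_comp_tensorHom_assoc,
        Category.id_comp]
    rw [h6, h3, h5]
    simp only [Category.assoc, h4]
    rw [← associator_naturality_assoc, reassoc_of% h1, eqToHom_trans]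
    rfl

end Presentations

/-! ### Concatenation and permutations of blocks. -/

theorem perm_append_swap {K : Type} {L M N : List K} : (L ++ (M ++ N)).Perm (M ++ (L ++ N)) := by
  rw [← List.append_assoc, ← List.append_assoc]
  exact List.perm_append_comm.append_right N

section Symmetries

variable {C : Type u} [Category.{v} C] [MonoidalCategory C] [SymmetricCategory C]
variable {K : Type} [DecidableEq K] (W : K → C)

theorem tensLAppend_perm_right {M M' : List K} (h : M.Perm M') : ∀ L : List K,
    tensL W L ◁ (tensLPerm W M M' h).hom ≫ (tensLAppend W L M').hom =
      (tensLAppend W L M).hom ≫ (tensLPerm W (L ++ M) (L ++ M') (h.append_left L)).hom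
  | [] => by
    rw [tensLAppend_nil, tensLAppend_nil]
    exact leftUnitor_naturality _
  | k :: L => by
    have ih := tensLAppend_perm_right h L
    have h1 := tensLPerm_cons W k (h.append_left L)
    simp only [tensLAppend_cons, Category.assoc]
    rw [whisker_exchange_assoc, associator_naturality_right_assoc,
      ← MonoidalCategory.whiskerLeft_comp_assoc, ih]
    erw [h1]
    simp

/-- Induction over the generation of the permutation relation. Distinct entries are needed for
transpositions: `tensLPerm` pulls first occurrences, so for two equal entries it would be the
identity and not the symmetry. -/
theorem tensLAppend_perm_left {L L' : List K} (h : L.Perm L') (M : List K) (hL : L.Nodup) :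
    (tensLPerm W L L' h).hom ▷ tensL W M ≫ (tensLAppend W L' M).hom =
      (tensLAppend W L M).hom ≫ (tensLPerm W (L ++ M) (L' ++ M) (h.append_right M)).hom := by
  induction h with
  | nil => rw [tensLPerm_refl, tensLPerm_refl]; simp
  | @cons k L L' h ih =>
    have h1 := tensLPerm_cons W k (h.append_right M)
    have ih := ih (List.nodup_cons.1 hL).2
    rw [tensLPerm_cons W k h]
    simp only [tensLAppend_cons, Category.assoc, comp_whiskerRight, hom_inv_whiskerRight_assoc,
      associator_naturality_middle_assoc]
    erw [h1]
    rw [← MonoidalCategory.whiskerLeft_comp_assoc (W k) (_ ▷ _), ih]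
    simp
  | swap j k L =>
    have e : k ≠ j := by rintro rfl; simp at hL
    have h1 := tensLPerm_swap W e (L ++ M) (List.Perm.swap _ _ _)
    rw [tensLPerm_swap W e]
    have h2 : swapFront (W k) (W j) (tensL W L) ▷ tensL W M ≫ (α_ _ _ _).hom ≫
        W j ◁ (α_ _ _ _).hom = (α_ _ _ _).hom ≫ W k ◁ (α_ _ _ _).hom ≫
          swapFront (W k) (W j) (tensL W L ⊗ tensL W M) := by
      simp only [swapFront]; monoidal
    simp only [tensLAppend_cons, Category.assoc, comp_whiskerRight, hom_inv_whiskerRight_assoc,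
      associator_naturality_middle_assoc, MonoidalCategory.whiskerLeft_comp]
    erw [h1]
    simp only [← MonoidalCategory.whiskerLeft_comp_assoc, hom_inv_whiskerRight_assoc,
      Category.assoc]
    simp only [MonoidalCategory.whiskerLeft_comp, Category.assoc]
    rw [reassoc_of% h2]
    simp only [← MonoidalCategory.whiskerLeft_comp_assoc, Iso.hom_inv_id_assoc]
    simp only [MonoidalCategory.whiskerLeft_comp, Category.assoc]
    rw [← swapFront_natural_right_assoc]
    simp
  | @trans L L' L'' h h' ih ih' =>
    rw [← tensLPerm_trans W h h', comp_whiskerRight, Category.assoc, ih' (h.nodup_iff.1 hL),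
      reassoc_of% ih hL, tensLPerm_trans]

theorem tensLAppend_perm {L L' M M' : List K} (h : L.Perm L') (h' : M.Perm M') (hL : L.Nodup) :
    ((tensLPerm W L L' h).hom ⊗ₘ (tensLPerm W M M' h').hom) ≫ (tensLAppend W L' M').hom =
      (tensLAppend W L M).hom ≫ (tensLPerm W (L ++ M) (L' ++ M') (h.append h')).hom := by
  rw [MonoidalCategory.tensorHom_def, Category.assoc, tensLAppend_perm_right, reassoc_of% tensLAppend_perm_left W h M hL,
    tensLPerm_trans]

/-- The hexagon identity, in the form that moves a block past a factor one letter at a time. -/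
theorem swapFront_tensor_left (X Y Z T : C) :
    swapFront (X ⊗ Y) Z T = (α_ _ _ _).hom ≫ X ◁ swapFront Y Z T ≫ swapFront X Z (Y ⊗ T) ≫
      Z ◁ (α_ _ _ _).inv := by
  simp only [swapFront, BraidedCategory.braiding_tensor_left_hom]
  monoidal

theorem swapFront_tensor_right (X Y Z T : C) :
    swapFront X (Y ⊗ Z) T = X ◁ (α_ _ _ _).hom ≫ swapFront X Y (Z ⊗ T) ≫ Y ◁ swapFront X Z T ≫
      (α_ _ _ _).inv := by
  simp only [swapFront, BraidedCategory.braiding_tensor_right_hom]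
  monoidal

theorem swapFront_unit_left (Y T : C) :
    swapFront (𝟙_ C) Y T ≫ Y ◁ (λ_ T).hom = (λ_ (Y ⊗ T)).hom := by
  simp [swapFront, braiding_tensorUnit_left]

theorem swapFront_unit_right (X T : C) :
    swapFront X (𝟙_ C) T ≫ (λ_ (X ⊗ T)).hom = X ◁ (λ_ T).hom := by
  simp [swapFront, braiding_tensorUnit_right]

theorem tensLAppend_swapFront_cons (i : K) (N : List K) : ∀ M : List K, i ∉ M →
    swapFront (W i) (tensL W M) (tensL W N) ≫ tensL W M ◁ (tensLCons W i N).hom ≫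
        (tensLAppend W M (i :: N)).hom =
      W i ◁ (tensLAppend W M N).hom ≫ (tensLCons W i (M ++ N)).hom ≫
        (tensLPerm W (i :: (M ++ N)) (M ++ i :: N) List.perm_middle.symm).hom
  | [], _ => by
    rw [tensLAppend_nil, tensLAppend_nil]
    erw [tensLPerm_refl, Category.comp_id]
    have key : ∀ {X T S : C} (c : X ⊗ T ⟶ S), swapFront X (𝟙_ C) T ≫ 𝟙_ C ◁ c ≫ (λ_ S).hom =
        X ◁ (λ_ T).hom ≫ c := by
      intro X T S c
      rw [leftUnitor_naturality, reassoc_of% swapFront_unit_right]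
    exact key _
  | k :: M, h => by
    have e : i ≠ k := fun e => h (e ▸ List.mem_cons_self)
    have hM : i ∉ M := fun e => h (List.mem_cons_of_mem _ e)
    have ih := tensLAppend_swapFront_cons i N M hM
    have p1 : (i :: k :: (M ++ N)).Perm (k :: i :: (M ++ N)) := List.Perm.swap ..
    have p2 : (k :: i :: (M ++ N)).Perm (k :: (M ++ i :: N)) := (List.perm_middle.symm).cons k
    have h1 := tensLPerm_trans W p1 p2
    have h2 := tensLPerm_cons W k (List.perm_middle (a := i) (l₁ := M) (l₂ := N)).symm
    have h3 := swapFront_natural (𝟙 (W i)) (tensLCons W k M).inv (𝟙 (tensL W N))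
    have h4 := congrArg (fun f => W k ◁ f) ih
    simp only [id_tensorHom, id_whiskerRight, tensorHom_id] at h3
    simp only [MonoidalCategory.whiskerLeft_comp] at h4
    rw [h2, tensLPerm_swap W e] at h1
    simp only [tensLAppend_cons, Category.assoc, List.cons_append]
    erw [← h1]
    simp only [MonoidalCategory.whiskerLeft_comp, Category.assoc, Iso.hom_inv_id_assoc]
    rw [whisker_exchange_assoc, ← reassoc_of% h3, swapFront_tensor_right]
    simp only [Category.assoc, associator_naturality_right_assoc, Iso.inv_hom_id_assoc]
    rw [reassoc_of% h4]
    simp only [← MonoidalCategory.whiskerLeft_comp_assoc, Iso.hom_inv_id_assoc, Category.assoc,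
      Iso.hom_inv_id, Category.comp_id]
    simp only [MonoidalCategory.whiskerLeft_comp, Category.assoc]
    rw [← swapFront_natural_right_assoc]

/-- The braiding of two blocks is a permutation of letters: by the hexagon, the letters of `L` pass
the block `M` one at a time, each single move being `tensLAppend_swapFront_cons`. The blocks must be
disjoint because `tensLPerm` does not exchange equal letters, whereas the braiding does. -/
theorem tensLAppend_swapFront (M N : List K) : ∀ L : List K, List.Disjoint L M →
    swapFront (tensL W L) (tensL W M) (tensL W N) ≫ tensL W M ◁ (tensLAppend W L N).hom ≫
        (tensLAppend W M (L ++ N)).hom =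
      tensL W L ◁ (tensLAppend W M N).hom ≫ (tensLAppend W L (M ++ N)).hom ≫
        (tensLPerm W (L ++ (M ++ N)) (M ++ (L ++ N)) perm_append_swap).hom
  | [], _ => by
    rw [tensLAppend_nil, tensLAppend_nil]
    erw [tensLPerm_refl, Category.comp_id]
    have key : ∀ {X T S : C} (c : X ⊗ T ⟶ S), swapFront (𝟙_ C) X T ≫ X ◁ (λ_ T).hom ≫ c =
        𝟙_ C ◁ c ≫ (λ_ S).hom := by
      intro X T S c
      rw [leftUnitor_naturality, reassoc_of% swapFront_unit_left]
    exact key _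
  | i :: L, h => by
    have hi : i ∉ M := fun e => h List.mem_cons_self e
    have hL : List.Disjoint L M := fun x hx => h (List.mem_cons_of_mem _ hx)
    have ih := tensLAppend_swapFront M N L hL
    have p1 : (i :: (L ++ (M ++ N))).Perm (i :: (M ++ (L ++ N))) := perm_append_swap.cons i
    have p2 : (i :: (M ++ (L ++ N))).Perm (M ++ i :: (L ++ N)) := List.perm_middle.symm
    have h1 := tensLPerm_trans W p1 p2
    have h2 := tensLPerm_cons W i (perm_append_swap (L := L) (M := M) (N := N))
    have h3 := swapFront_natural (tensLCons W i L).inv (𝟙 (tensL W M)) (𝟙 (tensL W N))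
    have h4 := congrArg (fun f => W i ◁ f) ih
    have h5 := tensLAppend_swapFront_cons W i (L ++ N) M hi
    simp only [id_tensorHom, tensorHom_id, id_whiskerRight] at h3
    simp only [MonoidalCategory.whiskerLeft_comp] at h4
    rw [h2] at h1
    simp only [tensLAppend_cons, Category.assoc, List.cons_append]
    erw [← h1]
    simp only [MonoidalCategory.whiskerLeft_comp, Category.assoc, Iso.hom_inv_id_assoc]
    rw [whisker_exchange_assoc, ← reassoc_of% h3, swapFront_tensor_left]
    simp only [Category.assoc, associator_naturality_right_assoc]
    rw [← MonoidalCategory.whiskerLeft_comp_assoc (tensL W M) (α_ _ _ _).inv, Iso.inv_hom_id,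
      MonoidalCategory.whiskerLeft_id, Category.id_comp, ← swapFront_natural_right_assoc]
    erw [h5]
    rw [reassoc_of% h4]

end Symmetries

/-! ### Shuffles of presented tensor products. -/

section SymmetricPresentations

variable {C : Type u} [Category.{v} C] [MonoidalCategory C] [SymmetricCategory C]
variable {K : Type} [DecidableEq K] (W : K → C)

theorem tensLAppend_perm_right' {M M' : List K} (h : M.Perm M') (L : List K) {X Y : C}
    (f : X ⟶ tensL W L) (g : Y ⟶ tensL W M) :
    (f ⊗ₘ g ≫ (tensLPerm W M M' h).hom) ≫ (tensLAppend W L M').hom = (f ⊗ₘ g) ≫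
      (tensLAppend W L M).hom ≫ (tensLPerm W (L ++ M) (L ++ M') (h.append_left L)).hom := by
  rw [← tensLAppend_perm_right, ← id_tensorHom, tensorHom_comp_tensorHom_assoc, Category.comp_id]

variable {J : Type} {A : J → C} {B : J → List K} (ν : ∀ j, A j ⟶ tensL W (B j))

/-- It suffices to treat the generators of the permutation relation, and for a transposition of two
blocks this is `tensLAppend_swapFront`. The blocks are disjoint since the flattened list has no
repetitions. -/
theorem tensLPerm_presL [DecidableEq J] {L M : List J} (h : L.Perm M) (hL : L.Nodup)
    (hB : (L.flatMap B).Nodup) :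
    (tensLPerm A L M h).hom ≫ presL W ν M =
      presL W ν L ≫ (tensLPerm W (L.flatMap B) (M.flatMap B) (h.flatMap_right B)).hom := by
  induction h with
  | nil => rw [tensLPerm_refl, tensLPerm_refl]; simp
  | @cons j L M h ih =>
    have h1 := tensLAppend_perm_right' W (h.flatMap_right B) (B j) (ν j) (presL W ν L)
    rw [← ih (List.nodup_cons.1 hL).2 (by simp at hB; exact (List.nodup_append.1 hB).2.1)] at h1
    rw [tensLPerm_cons A j h, presL_cons, presL_cons]
    simp only [Category.assoc, Iso.hom_inv_id_assoc]
    rw [← id_tensorHom, tensorHom_comp_tensorHom_assoc, Category.id_comp, h1]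
    rfl
  | swap k j L =>
    have e : j ≠ k := by rintro rfl; simp at hL
    have hd : List.Disjoint (B j) (B k) := by
      have h2 : (B j ++ (B k ++ L.flatMap B)).Nodup := by simpa using hB
      intro x hx hx'
      exact (List.nodup_append.1 h2).2.2 x hx x (List.mem_append_left _ hx') rfl
    have h1 := tensLAppend_swapFront W (B k) (L.flatMap B) (B j) hd
    rw [tensLPerm_swap A e, presL_cons, presL_cons, presL_cons, presL_cons]
    simp only [Category.assoc, Iso.hom_inv_id_assoc]
    have h2 : A k ◁ (tensLCons A j L).hom ≫ (ν k ⊗ₘ (tensLCons A j L).inv ≫ (ν j ⊗ₘ presL W ν L) ≫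
        (tensLAppend W (B j) (L.flatMap B)).hom) = (ν k ⊗ₘ ν j ⊗ₘ presL W ν L) ≫ _ ◁
        (tensLAppend W (B j) (L.flatMap B)).hom := by
      simp [← id_tensorHom, tensorHom_comp_tensorHom]
    have h3 : (ν j ⊗ₘ (tensLCons A k L).inv ≫ (ν k ⊗ₘ presL W ν L) ≫
        (tensLAppend W (B k) (L.flatMap B)).hom) = A j ◁ (tensLCons A k L).inv ≫
        (ν j ⊗ₘ ν k ⊗ₘ presL W ν L) ≫ _ ◁ (tensLAppend W (B k) (L.flatMap B)).hom := by
      simp [← id_tensorHom, tensorHom_comp_tensorHom]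
    rw [reassoc_of% h2, h3, ← reassoc_of% swapFront_natural]
    simp only [Category.assoc]
    erw [h1]
    rfl
  | @trans L L' L'' h h' ih ih' =>
    rw [← tensLPerm_trans A h h', Category.assoc,
      ih' (h.nodup_iff.1 hL) ((h.flatMap_right B).nodup_iff.1 hB), reassoc_of% ih hL hB,
      tensLPerm_trans]

theorem flatMap_perm {J K : Type} {B B' : J → List K} (h : ∀ j, (B j).Perm (B' j)) :
    ∀ L : List J, (L.flatMap B).Perm (L.flatMap B')
  | [] => .refl _
  | j :: L => (h j).append (flatMap_perm h L)

theorem presL_perm {A' : J → C} {B' : J → List K} (ν' : ∀ j, A' j ⟶ tensL W (B' j))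
    (φ : ∀ j, A j ⟶ A' j) (h : ∀ j, (B j).Perm (B' j)) (hB : ∀ j, (B j).Nodup)
    (hφ : ∀ j, φ j ≫ ν' j = ν j ≫ (tensLPerm W _ _ (h j)).hom) : ∀ L : List J,
    tensLHom φ L ≫ presL W ν' L =
      presL W ν L ≫ (tensLPerm W _ _ (flatMap_perm h L)).hom
  | [] => by
    rw [tensLHom_presL]
    erw [tensLPerm_refl, Category.comp_id]
    rfl
  | j :: L => by
    have ih := presL_perm ν' φ h hB hφ L
    have h1 := tensLAppend_perm W (h j) (flatMap_perm h L) (hB j)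
    rw [tensLHom, presL_cons, presL_cons]
    simp only [Category.assoc, Iso.hom_inv_id_assoc]
    rw [tensorHom_comp_tensorHom_assoc, hφ, ih, ← tensorHom_comp_tensorHom_assoc]
    erw [h1]
    rfl

theorem tensLFlat_presL {I : Type} (D : I → List J) : ∀ L : List I,
    (tensLFlat A D L).hom ≫ presL W ν (L.flatMap D) =
      presL W (fun i => presL W ν (D i)) L ≫ castL W List.flatMap_assoc.symm
  | [] => by
    erw [presL_nil]
    change (𝟙 (𝟙_ C) ≫ 𝟙 (𝟙_ C)) ≫ 𝟙 (𝟙_ C) = 𝟙 (𝟙_ C) ≫ 𝟙 (𝟙_ C)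
    simp
  | i :: L => by
    have ih := tensLFlat_presL D L
    have h1 := presL_append W ν (D i) (L.flatMap D)
    have h2 := tensLAppend_castL W ((D i).flatMap B)
      (List.flatMap_assoc (l := L) (f := D) (g := B)).symm
    rw [presL_cons]
    simp only [tensLFlat, Iso.trans_hom, Iso.symm_hom, whiskerLeftIso_hom, Category.assoc]
    erw [h1]
    rw [← id_tensorHom, tensorHom_comp_tensorHom_assoc, Category.id_comp, ih]
    have h3 : (presL W ν (D i) ⊗ₘ presL W (fun i => presL W ν (D i)) L ≫
        castL W List.flatMap_assoc.symm) = (presL W ν (D i) ⊗ₘ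
        presL W (fun i => presL W ν (D i)) L) ≫ _ ◁ castL W List.flatMap_assoc.symm := by
      simp [← id_tensorHom, tensorHom_comp_tensorHom]
    rw [h3, Category.assoc]
    erw [reassoc_of% h2]
    simp

theorem tensLMap_presL {I : Type} (s : I → J) : ∀ L : List I,
    (tensLMap A s L).hom ≫ presL W (fun i => ν (s i)) L =
      presL W ν (L.map s) ≫ castL W (List.flatMap_map s B L)
  | [] => by
    erw [presL_nil]
    change (𝟙 (𝟙_ C) ≫ 𝟙 (𝟙_ C)) ≫ 𝟙 (𝟙_ C) = 𝟙 (𝟙_ C) ≫ 𝟙 (𝟙_ C)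
    simp
  | i :: L => by
    have ih := tensLMap_presL s L
    have h2 := tensLAppend_castL W (B (s i)) (List.flatMap_map s B L)
    rw [presL_cons]
    change _ = presL W ν (s i :: L.map s) ≫ _
    rw [presL_cons]
    simp only [tensLMap, Iso.trans_hom, Iso.symm_hom, whiskerLeftIso_hom, Category.assoc,
      Iso.hom_inv_id_assoc]
    rw [← id_tensorHom, tensorHom_comp_tensorHom_assoc, Category.id_comp, ih]
    have h3 : (ν (s i) ⊗ₘ presL W ν (L.map s) ≫ castL W (List.flatMap_map s B L)) =
        (ν (s i) ⊗ₘ presL W ν (L.map s)) ≫ _ ◁ castL W (List.flatMap_map s B L) := by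
      simp [← id_tensorHom, tensorHom_comp_tensorHom]
    rw [h3, Category.assoc, h2]

/-- The tautological presentation of the objects `W k`. -/
abbrev presSelf (k : K) : W k ⟶ tensL W [k] := 𝟙 (W k)

/-- A shuffle is a permutation followed by rebracketing and renaming. Flattening turns the last two
into equalities of lists, so only one permutation isomorphism of lists of letters remains. -/
theorem tensShuffle_presL {I : FinIdx} {F : I.α → FinIdx} {J : FinIdx}
    (σ : (Σ i, (F i).α) ≃ J.α) {A : J.α → C} {B : J.α → List K} (ν : ∀ j, A j ⟶ tensL W (B j))
    (hB : (J.list.flatMap B).Nodup)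
    (hp : (J.list.flatMap B).Perm
      (I.list.flatMap fun i => (F i).list.flatMap fun t => B (σ ⟨i, t⟩))) :
    (tensShuffle σ A).hom ≫
        presL W (fun i => presL W (fun t => ν (σ ⟨i, t⟩)) (F i).list) I.list =
      presL W ν J.list ≫ (tensLPerm W _ _ hp).hom := by
  have h1 := tensLPerm_presL W ν (FinIdx.blocks_perm σ) J.nodup_list hB
  have h2 := tensLFlat_presL W ν (fun i => (F i).list.map fun t => σ ⟨i, t⟩) I.list
  have h3 := fun i => tensLMap_presL W ν (fun t => σ ⟨i, t⟩) (F i).list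
  have hn := hp.nodup_iff.1 hB
  have h4 := presL_perm W (fun i => presL W ν ((F i).list.map fun t => σ ⟨i, t⟩))
    (fun i => presL W (fun t => ν (σ ⟨i, t⟩)) (F i).list)
    (fun i => (tensLMap A (fun t => σ ⟨i, t⟩) (F i).list).hom)
    (fun i => List.Perm.of_eq (List.flatMap_map ..))
    (fun i => by
      rw [List.flatMap_map]
      exact (List.nodup_flatMap.1 hn).1 i (I.mem_list i))
    (fun i => by rw [tensLPerm_eq]; exact h3 i) I.list
  have he : (FinIdx.blocks σ).flatMap B =
      I.list.flatMap fun i => ((F i).list.map fun t => σ ⟨i, t⟩).flatMap B := List.flatMap_assoc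
  have h5 : (tensLFlat A (fun i => (F i).list.map fun t => σ ⟨i, t⟩) I.list).inv ≫
      presL W (fun i => presL W ν ((F i).list.map fun t => σ ⟨i, t⟩)) I.list =
      presL W ν (FinIdx.blocks σ) ≫ (tensLPerm W _ _ (.of_eq he)).hom := by
    rw [Iso.inv_comp_eq, reassoc_of% h2, tensLPerm_eq W he]
    simp
  simp only [tensShuffle, Iso.trans_hom, Iso.symm_hom, Category.assoc, tensLIso]
  rw [h4, reassoc_of% h5, reassoc_of% h1, tensLPerm_trans, tensLPerm_trans]

end SymmetricPresentations

theorem FinIdx.flatMap_perm {K : Type} {I : FinIdx} {F : I.α → FinIdx} {J : FinIdx}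
    (σ : (Σ i, (F i).α) ≃ J.α) (B : J.α → List K) :
    (J.list.flatMap B).Perm
      (I.list.flatMap fun i => (F i).list.flatMap fun t => B (σ ⟨i, t⟩)) := by
  have h := (FinIdx.blocks_perm σ).flatMap_right B
  simpa only [List.flatMap_assoc, List.flatMap_map] using h

theorem FinIdx.nodup_flatMap_singleton (J : FinIdx) : (J.list.flatMap fun j => [j]).Nodup := by
  rw [List.flatMap_singleton']
  exact J.nodup_list

/-! ### Associativity and units of shuffles. -/

section Shuffle

variable {C : Type u} [Category.{v} C] [MonoidalCategory C] [SymmetricCategory C]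

theorem eqToHom_presSelf {K : Type} [DecidableEq K] (W : K → C) {k k' : K} (h : k = k') :
    eqToHom (congrArg W h) ≫ presSelf W k' =
      presSelf W k ≫ (tensLPerm W [k] [k'] (.of_eq (congrArg (fun x => [x]) h))).hom := by
  subst h
  rw [tensLPerm_refl]
  simp only [eqToHom_refl]
  rfl

/-- Both sides are compared after the presentation of the target by the letters `W k`, which is an
isomorphism. There every shuffle is a permutation isomorphism, and the two composites, having the
same ends, agree by `tensLPerm_trans`. The morphisms `eqToHom` are needed because `ρ ⟨σ ⟨i, t⟩, s⟩`
and `θ ⟨i, τ i ⟨t, s⟩⟩` are only propositionally equal. -/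
theorem tensShuffle_assoc {I : FinIdx} {F : I.α → FinIdx} {J : FinIdx} (σ : (Σ i, (F i).α) ≃ J.α)
    {G : J.α → FinIdx} {K : FinIdx} (ρ : (Σ j, (G j).α) ≃ K.α)
    {H : I.α → FinIdx} (τ : ∀ i, (Σ t, (G (σ ⟨i, t⟩)).α) ≃ (H i).α)
    (θ : (Σ i, (H i).α) ≃ K.α) (hθ : ∀ i t s, ρ ⟨σ ⟨i, t⟩, s⟩ = θ ⟨i, τ i ⟨t, s⟩⟩)
    (W : K.α → C) :
    (tensShuffle ρ W).hom ≫ (tensShuffle σ fun j => tens (G j) fun s => W (ρ ⟨j, s⟩)).hom =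
      (tensShuffle θ W).hom ≫ tensHom I fun i =>
        (tensShuffle (τ i) fun s => W (θ ⟨i, s⟩)).hom ≫ tensHom (F i) fun t =>
          tensHom (G (σ ⟨i, t⟩)) fun s => eqToHom (congrArg W (hθ i t s).symm) := by
  let νJ := fun j => presL W (fun s => presSelf W (ρ ⟨j, s⟩)) (G j).list
  let νI := fun i => presL W (fun s => presSelf W (θ ⟨i, s⟩)) (H i).list
  have hs : ∀ k, IsIso (presSelf W k) := fun k => inferInstanceAs (IsIso (𝟙 (W k)))
  have : ∀ j, IsIso (νJ j) := fun j =>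
    inferInstanceAs (IsIso (presL W (fun s => presSelf W (ρ ⟨j, s⟩)) (G j).list))
  have : ∀ i, IsIso (presL W (fun t => νJ (σ ⟨i, t⟩)) (F i).list) := fun i => inferInstance
  have hJ : (J.list.flatMap fun j => (G j).list.flatMap fun s => [ρ ⟨j, s⟩]).Nodup :=
    (FinIdx.flatMap_perm ρ fun k => [k]).nodup_iff.1 K.nodup_flatMap_singleton
  have hI : (I.list.flatMap fun i => (H i).list.flatMap fun s => [θ ⟨i, s⟩]).Nodup :=
    (FinIdx.flatMap_perm θ fun k => [k]).nodup_iff.1 K.nodup_flatMap_singleton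
  have e1 := tensShuffle_presL W σ νJ hJ (FinIdx.flatMap_perm σ _)
  have e2 := tensShuffle_presL W ρ (presSelf W) K.nodup_flatMap_singleton (FinIdx.flatMap_perm ρ _)
  have e3 := tensShuffle_presL W θ (presSelf W) K.nodup_flatMap_singleton (FinIdx.flatMap_perm θ _)
  have hG : ∀ i t, tensHom (G (σ ⟨i, t⟩)) (fun s => eqToHom (congrArg W (hθ i t s).symm)) ≫
      νJ (σ ⟨i, t⟩) = presL W (fun s => presSelf W (θ ⟨i, τ i ⟨t, s⟩⟩)) (G (σ ⟨i, t⟩)).list ≫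
        (tensLPerm W _ _ (flatMap_perm (fun s => .of_eq (by rw [hθ])) _)).hom := fun i t =>
    presL_perm W _ _ _ (fun s => .of_eq (by rw [hθ])) (fun s => List.nodup_singleton _)
      (fun s => eqToHom_presSelf W (hθ i t s).symm) _
  have hH : ∀ i, ((H i).list.flatMap fun s => [θ ⟨i, s⟩]).Nodup := fun i =>
    (List.nodup_flatMap.1 hI).1 i (I.mem_list i)
  have e4 := fun i => tensShuffle_presL W (τ i) (fun s => presSelf W (θ ⟨i, s⟩)) (hH i)
    (FinIdx.flatMap_perm (τ i) _)
  have hF : ∀ i, tensHom (F i) (fun t => tensHom (G (σ ⟨i, t⟩)) fun s =>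
      eqToHom (congrArg W (hθ i t s).symm)) ≫ presL W (fun t => νJ (σ ⟨i, t⟩)) (F i).list =
      presL W (fun t => presL W (fun s => presSelf W (θ ⟨i, τ i ⟨t, s⟩⟩)) (G (σ ⟨i, t⟩)).list)
        (F i).list ≫ (tensLPerm W _ _ (flatMap_perm (fun t => flatMap_perm
          (fun s => .of_eq (by rw [hθ])) _) _)).hom := fun i =>
    presL_perm W _ _ _ _ (fun t => (List.nodup_flatMap.1 ((FinIdx.flatMap_perm (τ i) _).nodup_iff.1
      (hH i))).1 t ((F i).mem_list t)) (hG i) _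
  have e5 := presL_perm W νI (fun i => presL W (fun t => νJ (σ ⟨i, t⟩)) (F i).list)
    (fun i => (tensShuffle (τ i) fun s => W (θ ⟨i, s⟩)).hom ≫ tensHom (F i) fun t =>
      tensHom (G (σ ⟨i, t⟩)) fun s => eqToHom (congrArg W (hθ i t s).symm))
    (fun i => (FinIdx.flatMap_perm (τ i) _).trans (flatMap_perm (fun t => flatMap_perm
          (fun s => .of_eq (by rw [hθ])) _) _)) hH
    (fun i => by rw [Category.assoc, hF, reassoc_of% e4, tensLPerm_trans]) I.list
  rw [← cancel_mono (presL W (fun i => presL W (fun t => νJ (σ ⟨i, t⟩)) (F i).list) I.list),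
    Category.assoc, e1, reassoc_of% e2, tensLPerm_trans, Category.assoc]
  erw [e5, reassoc_of% e3]
  rw [tensLPerm_trans]

theorem tensLAppend_nil_right {K : Type} (W : K → C) : ∀ L : List K,
    (tensLAppend W L []).hom = (ρ_ _).hom ≫ castL W (List.append_nil L).symm
  | [] => by
    rw [tensLAppend_nil]
    exact (unitors_equal (C := C)).trans (Category.comp_id _).symm
  | k :: L => by
    have key : ∀ {X T S T' S' : C} (c : X ⊗ T ≅ S) (f : T ⟶ T') (c' : X ⊗ T' ⟶ S') (f' : S ⟶ S'),
        X ◁ f ≫ c' = c.hom ≫ f' → c.inv ▷ 𝟙_ C ≫ (α_ X T (𝟙_ C)).hom ≫ X ◁ ((ρ_ T).hom ≫ f) ≫ c' =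
          (ρ_ S).hom ≫ f' := by
      intro X T S T' S' c f c' f' h
      rw [MonoidalCategory.whiskerLeft_comp, Category.assoc, h, ← rightUnitor_tensor_hom_assoc,
        rightUnitor_naturality_assoc, Iso.inv_hom_id_assoc]
    exact (congrArg (fun z => (tensLCons W k L).inv ▷ 𝟙_ C ≫ (α_ (W k) (tensL W L) (𝟙_ C)).hom ≫
      W k ◁ z ≫ (tensLCons W k (L ++ [])).hom) (tensLAppend_nil_right W L)).trans
        (key _ _ _ _ (tensLCons_castL W k (List.append_nil L).symm))

theorem presL_singleton {J K : Type} (W : K → C) {A : J → C} {B : J → List K}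
    (ν : ∀ j, A j ⟶ tensL W (B j)) (j : J) :
    presL W ν [j] = ν j ≫ castL W (List.append_nil (B j)).symm := by
  rw [presL_cons]
  have key : ∀ {X T S : C} (f : X ⟶ T) (c : T ⟶ S),
      (ρ_ X).inv ≫ (f ⊗ₘ 𝟙 (𝟙_ C)) ≫ (ρ_ T).hom ≫ c = f ≫ c := by
    intro X T S f c
    rw [tensorHom_id, rightUnitor_naturality_assoc, Iso.inv_hom_id_assoc]
  exact (congrArg₂ (fun (y : 𝟙_ C ⟶ 𝟙_ C) z => (ρ_ (A j)).inv ≫ (ν j ⊗ₘ y) ≫ z) (presL_nil W ν)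
    (tensLAppend_nil_right W (B j))).trans (key _ _)

/-- On presentations the shuffle with a single block is a permutation isomorphism between equal
lists, hence trivial. The case of one-element blocks below is analogous. -/
theorem tensShuffle_sigmaOne (J : FinIdx) (A : J.α → C) :
    (tensShuffle (F := fun _ => J) (FinIdx.sigmaOne J) A).hom = 𝟙 (tens J A) := by
  have hs : ∀ k, IsIso (presSelf A k) := fun k => inferInstanceAs (IsIso (𝟙 (A k)))
  have e := tensShuffle_presL A (F := fun _ : FinIdx.one.α => J) (FinIdx.sigmaOne J) (presSelf A)
    J.nodup_flatMap_singleton (FinIdx.flatMap_perm _ _)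
  have h1 := presL_singleton A (fun _ : FinIdx.one.α => presL A (presSelf A) J.list) (0 : Fin 1)
  have h2 := tensLPerm_eq A (List.append_nil (J.list.flatMap fun j => [j])).symm
  have h3 := e.trans (congrArg (presL A (presSelf A) J.list ≫ ·) h2)
  exact (cancel_mono (presL A (fun _ : FinIdx.one.α => presL A (presSelf A) J.list)
    FinIdx.one.list)).1 (h3.trans (h1.symm.trans (Category.id_comp _).symm))

theorem tensShuffle_sigmaUnit (I : FinIdx) (A : I.α → C) :
    (tensShuffle (F := fun _ => FinIdx.one) (FinIdx.sigmaUnit I) A).hom = 𝟙 (tens I A) := by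
  have hs : ∀ k, IsIso (presSelf A k) := fun k => inferInstanceAs (IsIso (𝟙 (A k)))
  have e := tensShuffle_presL A (F := fun _ => FinIdx.one) (FinIdx.sigmaUnit I) (presSelf A)
    I.nodup_flatMap_singleton (FinIdx.flatMap_perm _ _)
  have h1 : (fun i => presL A (fun t : FinIdx.one.α => presSelf A (FinIdx.sigmaUnit I ⟨i, t⟩))
      FinIdx.one.list) = presSelf A := by
    funext i
    exact (presL_singleton A (fun t : FinIdx.one.α => presSelf A (FinIdx.sigmaUnit I ⟨i, t⟩))
      (0 : Fin 1)).trans (Category.comp_id _)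
  have h2 : (tensShuffle (F := fun _ => FinIdx.one) (FinIdx.sigmaUnit I) A).hom ≫
      presL A (presSelf A) I.list = presL A (presSelf A) I.list ≫ 𝟙 _ := by
    rw [← tensLPerm_refl A _ (List.Perm.refl _)]
    exact (congrArg (fun z => (tensShuffle (F := fun _ => FinIdx.one) (FinIdx.sigmaUnit I) A).hom ≫
      presL A z I.list) h1).symm.trans e
  exact (cancel_mono (presL A (presSelf A) I.list)).1
    (h2.trans ((Category.comp_id _).trans (Category.id_comp _).symm))

end Shuffle

/-! ### Lax braided functors and shuffles. -/

section LaxFunctor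

open Functor.LaxMonoidal

variable {C : Type*} [Category C] [MonoidalCategory C] {D : Type*} [Category D]
  [MonoidalCategory D]

section Lax

variable (F : D ⥤ C) [F.LaxMonoidal]

/-- The morphism `⨂ F(A_j) ⟶ F(⨂ A_j)` of a lax monoidal functor `F`. -/
def tensLLax {J : Type} (A : J → D) : ∀ L : List J,
    tensL (fun j => F.obj (A j)) L ⟶ F.obj (tensL A L)
  | [] => (tensLNil _).hom ≫ ε F ≫ F.map (tensLNil A).inv
  | j :: L => (tensLCons (fun j => F.obj (A j)) j L).inv ≫ F.obj (A j) ◁ tensLLax A L ≫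
      μ F _ _ ≫ F.map (tensLCons A j L).hom

variable {J : Type} (A : J → D)

theorem tensLCons_lax (j : J) (L : List J) :
    (tensLCons (fun j => F.obj (A j)) j L).hom ≫ tensLLax F A (j :: L) =
      F.obj (A j) ◁ tensLLax F A L ≫ μ F _ _ ≫ F.map (tensLCons A j L).hom := by
  simp [tensLLax]

theorem tensLLax_cons_inv (j : J) (L : List J) :
    tensLLax F A (j :: L) ≫ F.map (tensLCons A j L).inv =
      (tensLCons (fun j => F.obj (A j)) j L).inv ≫ F.obj (A j) ◁ tensLLax F A L ≫ μ F _ _ := by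
  simp [tensLLax, ← F.map_comp]

theorem tensLLax_nil : tensLLax F A [] = ε F := by
  change 𝟙 (𝟙_ C) ≫ ε F ≫ F.map (𝟙 (𝟙_ D)) = ε F
  simp

theorem tensLLax_natural {B : J → D} (φ : ∀ j, A j ⟶ B j) : ∀ L : List J,
    tensLHom (fun j => F.map (φ j)) L ≫ tensLLax F B L = tensLLax F A L ≫ F.map (tensLHom φ L)
  | [] => by
    rw [tensLLax_nil, tensLLax_nil]
    change (𝟙 (𝟙_ C) ≫ 𝟙 (𝟙_ C)) ≫ ε F = ε F ≫ F.map (𝟙 (𝟙_ D) ≫ 𝟙 (𝟙_ D))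
    simp
  | j :: L => by
    have h := whisker_square (F.map (φ j)) (tensLLax_natural φ L)
    simp only [tensLHom, tensLLax, Category.assoc, Iso.hom_inv_id_assoc, Functor.map_comp,
      Iso.map_hom_inv_id_assoc]
    rw [reassoc_of% h, μ_natural_assoc]

theorem tensLLax_append : ∀ L M : List J,
    (tensLAppend (fun j => F.obj (A j)) L M).hom ≫ tensLLax F A (L ++ M) =
      (tensLLax F A L ⊗ₘ tensLLax F A M) ≫ μ F _ _ ≫ F.map (tensLAppend A L M).hom
  | [], M => by
    rw [tensLAppend_nil, tensLAppend_nil]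
    refine (?_ : (λ_ _).hom ≫ tensLLax F A M = (ε F ⊗ₘ tensLLax F A M) ≫
      μ F (𝟙_ D) _ ≫ F.map (λ_ _).hom).trans
      (congrArg (fun z => (z ⊗ₘ tensLLax F A M) ≫ μ F (𝟙_ D) _ ≫ F.map (λ_ _).hom)
        (tensLLax_nil F A).symm)
    rw [tensorHom_def'_assoc, ← left_unitality, leftUnitor_naturality]
  | j :: L, M => by
    have ih := tensLLax_append L M
    have h1 : (tensLLax F A (j :: L) ⊗ₘ tensLLax F A M) ≫ μ F _ _ ≫
        F.map ((tensLCons A j L).inv ▷ tensL A M) =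
        (tensLCons (fun j => F.obj (A j)) j L).inv ▷ _ ≫
          ((F.obj (A j) ◁ tensLLax F A L) ⊗ₘ tensLLax F A M) ≫ μ F _ _ ▷ _ ≫ μ F _ _ := by
      rw [← μ_natural_left, ← tensorHom_id, ← tensorHom_id, ← tensorHom_id,
        tensorHom_comp_tensorHom_assoc, tensLLax_cons_inv, tensorHom_comp_tensorHom_assoc,
        tensorHom_comp_tensorHom_assoc, Category.id_comp, Category.comp_id, Category.assoc]
    simp only [tensLAppend_cons, Category.assoc, Functor.map_comp]
    erw [tensLCons_lax]
    rw [← MonoidalCategory.whiskerLeft_comp_assoc, ih, reassoc_of% h1, associativity_assoc,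
      ← μ_natural_right_assoc]
    have h2 : ((F.obj (A j) ◁ tensLLax F A L) ⊗ₘ tensLLax F A M) ≫ (α_ _ _ _).hom =
        (α_ _ _ _).hom ≫ F.obj (A j) ◁ (tensLLax F A L ⊗ₘ tensLLax F A M) := by
      rw [← id_tensorHom, associator_naturality, id_tensorHom]
    rw [reassoc_of% h2]
    simp only [MonoidalCategory.whiskerLeft_comp, Category.assoc]

theorem tensLLax_flat {I : Type} (B : I → List J) : ∀ L : List I,
    (tensLFlat (fun j => F.obj (A j)) B L).hom ≫ tensLLax F A (L.flatMap B) =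
      tensLHom (fun i => tensLLax F A (B i)) L ≫ tensLLax F (fun i => tensL A (B i)) L ≫
        F.map (tensLFlat A B L).hom
  | [] => by
    refine Eq.trans ?_ (congrArg (fun z => tensLHom (fun i => tensLLax F A (B i)) [] ≫ z ≫
      F.map (tensLFlat A B []).hom) (tensLLax_nil F fun i => tensL A (B i)).symm)
    refine (congrArg (fun z => (tensLFlat (fun j => F.obj (A j)) B []).hom ≫ z)
      (tensLLax_nil F A)).trans ?_
    change (𝟙 (𝟙_ C) ≫ 𝟙 (𝟙_ C)) ≫ ε F = (𝟙 (𝟙_ C) ≫ 𝟙 (𝟙_ C)) ≫ ε F ≫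
      F.map (𝟙 (𝟙_ D) ≫ 𝟙 (𝟙_ D))
    simp
  | i :: L => by
    have ih := tensLLax_flat B L
    have h1 := tensLLax_append F A (B i) (L.flatMap B)
    simp only [tensLFlat, Iso.trans_hom, Iso.symm_hom, whiskerLeftIso_hom, Category.assoc,
      Functor.map_comp, tensLHom]
    erw [h1]
    rw [reassoc_of% tensLLax_cons_inv, Iso.hom_inv_id_assoc, ← μ_natural_right_assoc,
      ← id_tensorHom, ← id_tensorHom, ← id_tensorHom, tensorHom_comp_tensorHom_assoc,
      tensorHom_comp_tensorHom_assoc, tensorHom_comp_tensorHom_assoc, ih]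
    simp

theorem tensLLax_map {I : Type} (s : I → J) : ∀ L : List I,
    (tensLMap (fun j => F.obj (A j)) s L).hom ≫ tensLLax F (fun i => A (s i)) L =
      tensLLax F A (L.map s) ≫ F.map (tensLMap A s L).hom
  | [] => by
    refine Eq.trans ?_ (congrArg (fun z => z ≫ F.map (tensLMap A s []).hom)
      (tensLLax_nil F A).symm)
    refine (congrArg (fun z => (tensLMap (fun j => F.obj (A j)) s []).hom ≫ z)
      (tensLLax_nil F fun i => A (s i))).trans ?_
    change (𝟙 (𝟙_ C) ≫ 𝟙 (𝟙_ C)) ≫ ε F = ε F ≫ F.map (𝟙 (𝟙_ D) ≫ 𝟙 (𝟙_ D))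
    simp
  | i :: L => by
    have ih := tensLLax_map s L
    simp only [tensLMap, Iso.trans_hom, Iso.symm_hom, whiskerLeftIso_hom, Category.assoc,
      Functor.map_comp]
    erw [tensLCons_lax F (fun i => A (s i)) i L]
    rw [← MonoidalCategory.whiskerLeft_comp_assoc]
    erw [ih]
    have h1 := reassoc_of% tensLLax_cons_inv F A (s i) (L.map s)
    refine Eq.trans ?_ (h1 _).symm
    rw [← μ_natural_right_assoc, MonoidalCategory.whiskerLeft_comp, Category.assoc]

end Lax

variable [SymmetricCategory C] [SymmetricCategory D] (F : D ⥤ C) [F.LaxBraided]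

theorem swapFront_lax (X Y T : D) :
    swapFront (F.obj X) (F.obj Y) (F.obj T) ≫ F.obj Y ◁ μ F X T ≫ μ F Y (X ⊗ T) =
      F.obj X ◁ μ F Y T ≫ μ F X (Y ⊗ T) ≫ F.map (swapFront X Y T) := by
  simp only [swapFront, Category.assoc, Functor.map_comp]
  rw [← associativity, ← comp_whiskerRight_assoc, ← Functor.LaxBraided.braided,
    comp_whiskerRight_assoc, μ_natural_left_assoc, ← associativity_inv_assoc]

/-- Checked on the generators of the permutation relation; for a transposition of neighbours it is
the braiding axiom of the lax functor (`swapFront_lax`). -/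
theorem tensLLax_perm {J : Type} [DecidableEq J] (A : J → D) {L M : List J} (h : L.Perm M)
    (hL : L.Nodup) :
    (tensLPerm (fun j => F.obj (A j)) L M h).hom ≫ tensLLax F A M =
      tensLLax F A L ≫ F.map (tensLPerm A L M h).hom := by
  induction h with
  | nil => rw [tensLPerm_refl, tensLPerm_refl]; simp
  | @cons j L M h ih =>
    rw [tensLPerm_cons _ _ h, tensLPerm_cons _ _ h, Category.assoc, Category.assoc, tensLCons_lax,
      ← MonoidalCategory.whiskerLeft_comp_assoc, ih (List.nodup_cons.1 hL).2]
    simp only [Functor.map_comp]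
    rw [reassoc_of% tensLLax_cons_inv, ← μ_natural_right_assoc,
      MonoidalCategory.whiskerLeft_comp, Category.assoc]
  | swap k j L =>
    have e : j ≠ k := by rintro rfl; simp at hL
    rw [tensLPerm_swap _ e, tensLPerm_swap _ e]
    simp only [Category.assoc, Functor.map_comp]
    rw [tensLCons_lax, ← MonoidalCategory.whiskerLeft_comp_assoc, tensLCons_lax,
      reassoc_of% tensLLax_cons_inv, ← μ_natural_right_assoc,
      ← MonoidalCategory.whiskerLeft_comp_assoc, tensLLax_cons_inv]
    simp only [MonoidalCategory.whiskerLeft_comp, Category.assoc]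
    rw [← reassoc_of% swapFront_lax, μ_natural_right_assoc, swapFront_natural_right_assoc]
  | @trans L L' L'' h h' ih ih' =>
    rw [← tensLPerm_trans _ h h', ← tensLPerm_trans _ h h', Category.assoc,
      ih' (h.nodup_iff.1 hL), reassoc_of% ih hL, Functor.map_comp]

/-- The morphism of a lax braided functor is compatible with shuffles. -/
theorem tensShuffle_lax {I : FinIdx} {E : I.α → FinIdx} {J : FinIdx}
    (σ : (Σ i, (E i).α) ≃ J.α) (A : J.α → D) :
    (tensShuffle σ fun j => F.obj (A j)).hom ≫
        tensHom I (fun i => tensLLax F (fun t => A (σ ⟨i, t⟩)) (E i).list) ≫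
        tensLLax F (fun i => tens (E i) fun t => A (σ ⟨i, t⟩)) I.list =
      tensLLax F A J.list ≫ F.map (tensShuffle σ A).hom := by
  have h1 := tensLLax_perm F A (FinIdx.blocks_perm σ) J.nodup_list
  have h2 := tensLLax_flat F A (fun i => (E i).list.map fun t => σ ⟨i, t⟩) I.list
  have h3 := fun i => tensLLax_map F A (fun t => σ ⟨i, t⟩) (E i).list
  have h4 := tensLLax_natural F (A := fun i => tensL A ((E i).list.map fun t => σ ⟨i, t⟩))
    (B := fun i => tens (E i) fun t => A (σ ⟨i, t⟩))
    (fun i => (tensLMap A (fun t => σ ⟨i, t⟩) (E i).list).hom) I.list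
  have h5 := tensLHom_comp (fun i => (tensLMap (fun j => F.obj (A j)) (fun t => σ ⟨i, t⟩)
    (E i).list).hom) (fun i => tensLLax F (fun t => A (σ ⟨i, t⟩)) (E i).list) I.list
  simp only [h3] at h5
  rw [← tensLHom_comp] at h5
  simp only [tensShuffle, Iso.trans_hom, Iso.symm_hom, Functor.map_comp, Category.assoc]
  rw [← reassoc_of% h1, tensLIso, reassoc_of% h5, h4]
  congr 1
  rw [Iso.inv_comp_eq, reassoc_of% h2, Iso.map_hom_inv_id_assoc]
  rfl

end LaxFunctor

/-! ### Separating the two components of a family of pairs. -/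

section Mul

open Functor.LaxMonoidal

variable {C : Type u} [Category.{v} C] [MonoidalCategory C] [SymmetricCategory C]

/-- Here the symmetry of the braiding is essential: after expanding by the hexagons, the two sides
differ by the double braiding of `X₁` with `Y₂`. -/
theorem tensorμ_braiding (X₁ X₂ Y₁ Y₂ : C) :
    tensorμ X₁ X₂ Y₁ Y₂ ≫ ((β_ X₁ Y₁).hom ⊗ₘ (β_ X₂ Y₂).hom) =
      (β_ (X₁ ⊗ X₂) (Y₁ ⊗ Y₂)).hom ≫ tensorμ Y₁ Y₂ X₁ X₂ := by
  simp only [BraidedCategory.braiding_tensor_left_hom, BraidedCategory.braiding_tensor_right_hom,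
    tensorμ]
  symm
  calc
    _ = 𝟙 _ ⊗≫ X₁ ◁ (β_ X₂ Y₁).hom ▷ Y₂ ⊗≫ (β_ X₁ Y₁).hom ▷ (X₂ ⊗ Y₂) ⊗≫
        (Y₁ ⊗ X₁) ◁ (β_ X₂ Y₂).hom ⊗≫
        Y₁ ◁ ((β_ X₁ Y₂).hom ≫ (β_ Y₂ X₁).hom) ▷ X₂ ⊗≫ 𝟙 _ := by monoidal
    _ = 𝟙 _ ⊗≫ X₁ ◁ (β_ X₂ Y₁).hom ▷ Y₂ ⊗≫ ((β_ X₁ Y₁).hom ▷ (X₂ ⊗ Y₂) ≫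
        (Y₁ ⊗ X₁) ◁ (β_ X₂ Y₂).hom) ⊗≫ 𝟙 _ := by
      rw [SymmetricCategory.symmetry]; monoidal
    _ = _ := by
      rw [← MonoidalCategory.tensorHom_def]; monoidal

instance : SymmetricCategory (C × C) where
  braiding X Y := Iso.prod (β_ X.1 Y.1) (β_ X.2 Y.2)

instance : (tensor C).LaxBraided where
  braided X Y := tensorμ_braiding X.1 X.2 Y.1 Y.2

/-- The two projections and `⊗ : C × C ⥤ C` allow one statement on lax braided functors to treat a
family of pairs, its two components and its tensor products simultaneously. -/
instance : (CategoryTheory.Prod.fst C C).LaxBraided where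
  ε := 𝟙 _
  μ X Y := 𝟙 _

instance : (CategoryTheory.Prod.snd C C).LaxBraided where
  ε := 𝟙 _
  μ X Y := 𝟙 _

/-- The unit object is a commutative algebra, so the constant functor is lax braided. This yields
the coherence of trivial factors, to be applied to `□^0 ≅ 𝟙`. -/
instance : ((Functor.const C).obj (𝟙_ C)).LaxBraided where
  ε := 𝟙 _
  μ X Y := (λ_ _).hom
  associativity X Y Z := by dsimp; monoidal
  right_unitality X := by dsimp; monoidal
  braided X Y := by
    change (λ_ (𝟙_ C)).hom ≫ 𝟙 _ = (β_ (𝟙_ C) (𝟙_ C)).hom ≫ (λ_ (𝟙_ C)).hom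
    rw [braiding_leftUnitor, Category.comp_id, unitors_equal]

variable {J : Type}

/-- The tensor product of units. -/
def tensLTriv (L : List J) : tensL (fun _ => 𝟙_ C) L ⟶ 𝟙_ C :=
  tensLLax ((Functor.const C).obj (𝟙_ C)) (fun _ => 𝟙_ C) L

theorem tensLTriv_nil : tensLTriv (C := C) (J := J) [] = 𝟙 (𝟙_ C) :=
  tensLLax_nil _ _

theorem tensLTriv_cons (j : J) (L : List J) : tensLTriv (C := C) (j :: L) =
    (tensLCons (fun _ => 𝟙_ C) j L).inv ≫ 𝟙_ C ◁ tensLTriv L ≫ (λ_ (𝟙_ C)).hom := by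
  change (tensLCons (fun _ => 𝟙_ C) j L).inv ≫ 𝟙_ C ◁ tensLTriv L ≫ (λ_ (𝟙_ C)).hom ≫ 𝟙 _ = _
  rw [Category.comp_id]

theorem tensLLax_const (A : J → C) : ∀ L : List J,
    tensLLax ((Functor.const C).obj (𝟙_ C)) A L = tensLTriv L
  | [] => rfl
  | j :: L => by
    rw [tensLTriv_cons, ← tensLLax_const A L]
    change (tensLCons (fun _ => 𝟙_ C) j L).inv ≫ 𝟙_ C ◁ _ ≫ (λ_ (𝟙_ C)).hom ≫ 𝟙 _ = _
    rw [Category.comp_id]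

theorem tensShuffle_triv {I : FinIdx} {F : I.α → FinIdx} {J : FinIdx}
    (σ : (Σ i, (F i).α) ≃ J.α) :
    (tensShuffle σ fun _ => 𝟙_ C).hom ≫ tensHom I (fun i => tensLTriv (F i).list) ≫
      tensLTriv I.list = tensLTriv J.list := by
  have h := tensShuffle_lax ((Functor.const C).obj (𝟙_ C)) σ fun _ => 𝟙_ C
  simp only [tensLLax_const] at h
  exact h.trans (Category.comp_id _)

theorem tensLMul_triv (A : J → C) : ∀ L : List J,
    (tensLMul A (fun _ => 𝟙_ C) L).hom ≫ _ ◁ tensLTriv L ≫ (ρ_ _).hom =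
      tensLHom (fun j => (ρ_ (A j)).hom) L
  | [] => by
    refine (congrArg (fun z => (tensLMul A (fun _ => 𝟙_ C) []).hom ≫ 𝟙_ C ◁ z ≫ (ρ_ (𝟙_ C)).hom)
      tensLTriv_nil).trans ?_
    change (𝟙 (𝟙_ C) ≫ (λ_ (𝟙_ C)).inv ≫ 𝟙 (𝟙_ C) ▷ 𝟙_ C ≫ 𝟙_ C ◁ 𝟙 (𝟙_ C)) ≫
      𝟙_ C ◁ 𝟙 (𝟙_ C) ≫ (ρ_ (𝟙_ C)).hom = 𝟙 (𝟙_ C) ≫ 𝟙 (𝟙_ C)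
    rw [← unitors_equal]
    simp
  | j :: L => by
    have ih := tensLMul_triv A L
    rw [tensLTriv_cons]
    simp only [tensLMul, Iso.trans_hom, Iso.symm_hom, whiskerLeftIso_hom, whiskerRightIso_hom,
      Category.assoc, tensLHom]
    have h1 : _ ◁ (tensLCons (fun _ : J => 𝟙_ C) j L).hom ≫ tensL A (j :: L) ◁
        ((tensLCons (fun _ => 𝟙_ C) j L).inv ≫ 𝟙_ C ◁ tensLTriv L ≫ (λ_ (𝟙_ C)).hom) =
        _ ◁ (𝟙_ C ◁ tensLTriv L ≫ (λ_ (𝟙_ C)).hom) := by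
      rw [← MonoidalCategory.whiskerLeft_comp, Iso.hom_inv_id_assoc]
    have h2 := tensorμ_natural_right (A j) (𝟙_ C) (𝟙 (tensL A L)) (tensLTriv (C := C) L)
    rw [id_tensorHom, MonoidalCategory.whiskerLeft_id, id_tensorHom] at h2
    rw [reassoc_of% h1, ← whisker_exchange_assoc, rightUnitor_naturality,
      MonoidalCategory.whiskerLeft_comp_assoc, ← reassoc_of% h2, ← rightUnitor_monoidal_assoc,
      ← MonoidalCategory.whiskerLeft_comp_assoc, ← ih, tensorHom_def'_assoc,
      ← MonoidalCategory.whiskerLeft_comp_assoc, ← tensorHom_def'_assoc]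
    simp only [Category.assoc]

section

variable {C : Type*} [Category C] [MonoidalCategory C] {D : Type*} [Category D]
  [MonoidalCategory D] (F : D ⥤ C) [F.LaxMonoidal] [IsIso (ε F)] [∀ X Y, IsIso (μ F X Y)]

theorem isIso_tensLLax (A : J → D) : ∀ L : List J, IsIso (tensLLax F A L)
  | [] => by rw [tensLLax]; infer_instance
  | j :: L => by
    have := isIso_tensLLax A L
    rw [tensLLax]
    infer_instance

end

/-- Identifies `tensLMul` with the constraint of `⊗ : C × C ⥤ C`. The constraints of the projections
enter because the components of an iterated product in `C × C` have to be compared with the iterated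
products of the components. -/
theorem tensLMul_lax (A : J → C × C) : ∀ L : List J,
    (tensLMul (fun j => (A j).1) (fun j => (A j).2) L).hom ≫ (tensLLax (CategoryTheory.Prod.fst C C) A L ⊗ₘ
      tensLLax (CategoryTheory.Prod.snd C C) A L) =
      tensLLax (tensor C) A L
  | [] => by
    refine Eq.trans ?_ (tensLLax_nil (tensor C) A).symm
    refine (congrArg₂ (fun (y : 𝟙_ C ⟶ 𝟙_ C) (z : 𝟙_ C ⟶ 𝟙_ C) => (tensLMul (fun j => (A j).1) (fun j => (A j).2) []).hom ≫ (y ⊗ₘ z))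
      (tensLLax_nil (CategoryTheory.Prod.fst C C) A)
      (tensLLax_nil (CategoryTheory.Prod.snd C C) A)).trans ?_
    change (𝟙 (𝟙_ C) ≫ (λ_ (𝟙_ C)).inv ≫ 𝟙 (𝟙_ C) ▷ 𝟙_ C ≫ 𝟙_ C ◁ 𝟙 (𝟙_ C)) ≫
      (𝟙 (𝟙_ C) ⊗ₘ 𝟙 (𝟙_ C)) = (λ_ (𝟙_ C)).inv
    simp
  | j :: L => by
    have ih := tensLMul_lax A L
    have h1 := tensLCons_lax (CategoryTheory.Prod.fst C C) A j L
    have h2 := tensLCons_lax (CategoryTheory.Prod.snd C C) A j L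
    have h3 := tensorμ_natural_right (A j).1 (A j).2
      (tensLLax (CategoryTheory.Prod.fst C C) A L)
      (tensLLax (CategoryTheory.Prod.snd C C) A L)
    have h4 : (tensLCons (fun j => (A j).1) j L).hom ▷ _ ≫ _ ◁ (tensLCons (fun j => (A j).2) j L).hom ≫
        (tensLLax (CategoryTheory.Prod.fst C C) A (j :: L) ⊗ₘ
          tensLLax (CategoryTheory.Prod.snd C C) A (j :: L)) =
        ((A j).1 ◁ tensLLax (CategoryTheory.Prod.fst C C) A L ⊗ₘ
          (A j).2 ◁ tensLLax (CategoryTheory.Prod.snd C C) A L) ≫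
        (tensor C).map (tensLCons A j L).hom := by
      rw [← tensorHom_def_assoc, tensorHom_comp_tensorHom]
      refine (congrArg₂ (· ⊗ₘ ·) h1 h2).trans ?_
      refine Eq.trans ?_ (tensorHom_comp_tensorHom _ _ _ _).symm
      exact congrArg₂ (· ⊗ₘ ·) (congrArg _ (Category.id_comp _)) (congrArg _ (Category.id_comp _))
    simp only [tensLMul, Iso.trans_hom, Iso.symm_hom, whiskerLeftIso_hom, whiskerRightIso_hom,
      Category.assoc]
    erw [h4, ← reassoc_of% h3, ← MonoidalCategory.whiskerLeft_comp_assoc, ih]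
    rfl

/-- Three instances of `tensShuffle_lax`, for the two projections and for `⊗`, glued along
`tensLMul_lax`. The constraints of the projections are isomorphisms and cancel. -/
theorem tensShuffle_tensLMul {I : FinIdx} {F : I.α → FinIdx} {J : FinIdx}
    (σ : (Σ i, (F i).α) ≃ J.α) (A B : J.α → C) :
    (tensLMul A B J.list).hom ≫ ((tensShuffle σ A).hom ⊗ₘ (tensShuffle σ B).hom) =
      (tensShuffle σ fun j => A j ⊗ B j).hom ≫
        tensHom I (fun i => (tensLMul (fun t => A (σ ⟨i, t⟩)) (fun t => B (σ ⟨i, t⟩))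
          (F i).list).hom) ≫ (tensLMul _ _ I.list).hom := by
  let AB : J.α → C × C := fun j => (A j, B j)
  have hμ : ∀ X Y : C × C, IsIso (μ (CategoryTheory.Prod.fst C C) X Y) := fun X Y =>
    inferInstanceAs (IsIso (𝟙 _))
  have hε : IsIso (ε (CategoryTheory.Prod.fst C C)) := inferInstanceAs (IsIso (𝟙 _))
  have hμ' : ∀ X Y : C × C, IsIso (μ (CategoryTheory.Prod.snd C C) X Y) := fun X Y =>
    inferInstanceAs (IsIso (𝟙 _))
  have hε' : IsIso (ε (CategoryTheory.Prod.snd C C)) := inferInstanceAs (IsIso (𝟙 _))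
  have i1 : ∀ {J : Type} (A : J → C × C) (L : List J),
      IsIso (tensLLax (CategoryTheory.Prod.fst C C) A L) := fun A L => isIso_tensLLax _ A L
  have i2 : ∀ {J : Type} (A : J → C × C) (L : List J),
      IsIso (tensLLax (CategoryTheory.Prod.snd C C) A L) := fun A L => isIso_tensLLax _ A L
  have h1 := tensShuffle_lax (CategoryTheory.Prod.fst C C) σ AB
  have h2 := tensShuffle_lax (CategoryTheory.Prod.snd C C) σ AB
  have h3 := tensShuffle_lax (tensor C) σ AB
  let T : I.α → C × C := fun i => tens (F i) fun t => AB (σ ⟨i, t⟩)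
  have h4 := tensLMul_lax T I.list
  have h5 := fun i => tensLMul_lax (fun t => AB (σ ⟨i, t⟩)) (F i).list
  have h6 := tensLMul_lax AB J.list
  have h7 := tensLMul_natural
    (fun i => tensLLax (CategoryTheory.Prod.fst C C) (fun t => AB (σ ⟨i, t⟩)) (F i).list)
    (fun i => tensLLax (CategoryTheory.Prod.snd C C) (fun t => AB (σ ⟨i, t⟩)) (F i).list) I.list
  have h8 : ∀ {X X' Y YA YB YA' YB' ZA ZB : C} {t : X ⟶ X'} {u : X' ⟶ Y} {v : X ⟶ Y}
      {m : X' ⟶ YA ⊗ YB} {m' : Y ⟶ YA' ⊗ YB'} {a : YA ⟶ YA'} {b : YB ⟶ YB'} {a' : YA' ⟶ ZA}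
      {b' : YB' ⟶ ZB} {w : Y ⟶ ZA ⊗ ZB} (_ : t ≫ u = v) (_ : u ≫ m' = m ≫ (a ⊗ₘ b))
      (_ : m' ≫ (a' ⊗ₘ b') = w), t ≫ m ≫ (a ≫ a' ⊗ₘ b ≫ b') = v ≫ w := by
    rintro X X' Y YA YB YA' YB' ZA ZB t u v m m' a b a' b' w rfl h rfl
    rw [Category.assoc, reassoc_of% h, tensorHom_comp_tensorHom]
  have h9 := h8 ((tensLHom_comp _ _ I.list).trans
    (congrArg (fun z => tensLHom z I.list) (funext h5))) h7 h4
  -- The final diagram chase for arbitrary objects: equality is tested after the isomorphism `pA ⊗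
  -- pB`.
  have h10 : ∀ {X XA XB YA YB Y Y' ZA ZB WA WB : C} {m : X ⟶ XA ⊗ XB} {sA : XA ⟶ YA} {sB : XB ⟶ YB}
      {s : X ⟶ Y} {t : Y ⟶ Y'} {m' : Y' ⟶ YA ⊗ YB} {pA : YA ⟶ ZA} {pB : YB ⟶ ZB} {kA : XA ⟶ WA}
      {kB : XB ⟶ WB} {SA : WA ⟶ ZA} {SB : WB ⟶ ZB} {k : X ⟶ WA ⊗ WB} {r : Y ⟶ ZA ⊗ ZB}
      (_ : sA ≫ pA = kA ≫ SA) (_ : sB ≫ pB = kB ≫ SB) (_ : m ≫ (kA ⊗ₘ kB) = k)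
      (_ : s ≫ r = k ≫ (SA ⊗ₘ SB)) (_ : t ≫ m' ≫ (pA ⊗ₘ pB) = r) (_ : IsIso pA) (_ : IsIso pB),
      m ≫ (sA ⊗ₘ sB) = s ≫ t ≫ m' := by
    rintro X XA XB YA YB Y Y' ZA ZB WA WB m sA sB s t m' pA pB kA kB SA SB k r e1 e2 rfl e3 rfl _ _
    rw [← cancel_mono (pA ⊗ₘ pB)]
    simp only [Category.assoc] at e3 ⊢
    rw [tensorHom_comp_tensorHom, e1, e2, e3, tensorHom_comp_tensorHom]
  have j1 : IsIso (tensLLax (CategoryTheory.Prod.fst C C) T I.list) := i1 _ _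
  have j2 : IsIso (tensLLax (CategoryTheory.Prod.snd C C) T I.list) := i2 _ _
  exact h10 h1 h2 h6 h3 h9
    (inferInstanceAs (IsIso ((tensLIso (fun i => asIso (tensLLax (CategoryTheory.Prod.fst C C)
      (fun t => AB (σ ⟨i, t⟩)) (F i).list)) I.list).hom ≫ tensLLax _ T I.list)))
    (inferInstanceAs (IsIso ((tensLIso (fun i => asIso (tensLLax (CategoryTheory.Prod.snd C C)
      (fun t => AB (σ ⟨i, t⟩)) (F i).list)) I.list).hom ≫ tensLLax _ T I.list)))

end Mul

/-! ### Koszul signs modulo 2. -/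

section Signs

open scoped Classical in
/-- The truth value of a proposition, modulo `2`. -/
noncomputable def truthVal (p : Prop) : ZMod 2 := if p then 1 else 0

theorem truthVal_true {p : Prop} (h : p) : truthVal p = 1 := if_pos h

theorem truthVal_false {p : Prop} (h : ¬ p) : truthVal p = 0 := if_neg h

theorem truthVal_and (p q : Prop) : truthVal (p ∧ q) = truthVal p * truthVal q := by
  by_cases hp : p <;> by_cases hq : q <;> simp [truthVal, hp, hq]

theorem ite_eq_truthVal (p : Prop) [Decidable p] (x : ZMod 2) :
    (if p then x else 0) = truthVal p * x := by
  by_cases hp : p <;> simp [truthVal, hp]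

theorem negOnePow_eq_of_zmod {m n : ℤ} (h : (m : ZMod 2) = n) : m.negOnePow = n.negOnePow := by
  rw [Int.negOnePow_eq_iff, even_iff_two_dvd]
  have := (ZMod.intCast_eq_intCast_iff_dvd_sub n m 2).1 h.symm
  exact_mod_cast this

/-- The two properties of strict total orders which matter for signs. -/
structure IsStrictTotal {T : Type*} (r : T → T → Prop) : Prop where
  irrefl (a : T) : ¬ r a a
  not_iff (a b : T) (h : a ≠ b) : r a b ↔ ¬ r b a

theorem IsStrictTotal.truthVal_add {T : Type*} {r : T → T → Prop} (hr : IsStrictTotal r) {a b : T}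
    (h : a ≠ b) : truthVal (r a b) = 1 + truthVal (r b a) := by
  by_cases hb : r b a
  · rw [truthVal_true hb, truthVal_false fun ha => (hr.not_iff a b h).1 ha hb]; rfl
  · rw [truthVal_false hb, truthVal_true ((hr.not_iff a b h).2 hb)]; rfl

theorem FinIdx.isStrictTotal_lt (I : FinIdx) : IsStrictTotal (T := I.α) (· < ·) where
  irrefl a := lt_irrefl (I.e.symm a)
  not_iff a b h := by
    have h' : I.e.symm a ≠ I.e.symm b := fun e => h (I.e.symm.injective e)
    change I.e.symm a < I.e.symm b ↔ ¬ I.e.symm b < I.e.symm a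
    omega

theorem IsStrictTotal.lex {ι : Type*} {T : ι → Type*} {r : ι → ι → Prop}
    {s : ∀ i, T i → T i → Prop} (hr : IsStrictTotal r) (hs : ∀ i, IsStrictTotal (s i)) :
    IsStrictTotal (Sigma.Lex r s) where
  irrefl a h := by
    rcases Sigma.lex_iff.1 h with h | ⟨e, h⟩
    · exact hr.irrefl _ h
    · exact (hs _).irrefl _ h
  not_iff := by
    rintro ⟨i, a⟩ ⟨j, b⟩ h
    rw [Sigma.lex_iff, Sigma.lex_iff]
    by_cases e : i = j
    · subst e
      have hab : a ≠ b := fun e => h (by rw [e])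
      simp [hr.irrefl, (hs i).not_iff a b hab]
    · simp [e, Ne.symm e, hr.not_iff i j e]

theorem IsStrictTotal.comap {T T' : Type*} {r : T → T → Prop} (hr : IsStrictTotal r) (f : T' ≃ T) :
    IsStrictTotal fun a b => r (f a) (f b) where
  irrefl _ := hr.irrefl _
  not_iff _ _ h := hr.not_iff _ _ fun e => h (f.injective e)

theorem sum_pairs_eq_zero {T : Type*} [Fintype T] (f : T → T → ZMod 2)
    (h : ∀ a b, a ≠ b → f a b + f b a = 0) (h0 : ∀ a, f a a = 0) : ∑ a, ∑ b, f a b = 0 := by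
  rw [← Fintype.sum_prod_type']
  refine Finset.sum_involution (fun x _ => (x.2, x.1)) ?_ ?_ (fun _ _ => Finset.mem_univ _)
    (fun _ _ => rfl)
  · rintro ⟨a, b⟩ _
    by_cases e : a = b
    · subst e; simp [h0]
    · exact h a b e
  · rintro ⟨a, b⟩ _ hx e
    obtain rfl : b = a := congrArg Prod.fst e
    exact hx (h0 b)

/-- Off the diagonal only the sum of the values at `(a, b)` and `(b, a)` matters: the difference of
the two double sums is paired off by the exchange of the indices. -/
theorem sum_pairs_eq {T : Type*} [Fintype T] (f g : T → T → ZMod 2)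
    (h : ∀ a b, a ≠ b → f a b + f b a = g a b + g b a) (h0 : ∀ a, f a a = g a a) :
    ∑ a, ∑ b, f a b = ∑ a, ∑ b, g a b := by
  rw [← sub_eq_zero, ← Finset.sum_sub_distrib]
  simp only [← Finset.sum_sub_distrib]
  refine sum_pairs_eq_zero _ (fun a b e => ?_) fun a => sub_eq_zero.2 (h0 a)
  linear_combination h a b e

theorem sum_sum_equiv {T T' : Type*} [Fintype T] [Fintype T'] (e : T ≃ T')
    (f : T' → T' → ZMod 2) : ∑ a, ∑ b, f a b = ∑ a, ∑ b, f (e a) (e b) := by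
  rw [← e.sum_comp]
  exact Finset.sum_congr rfl fun a _ => (e.sum_comp _).symm

/-- The parity of the number of inversions between orders, with weights, is a cocycle. -/
theorem inversions_add {T : Type*} [Fintype T] {r r' r'' : T → T → Prop} (hr : IsStrictTotal r)
    (hr' : IsStrictTotal r') (hr'' : IsStrictTotal r'') (x : T → ZMod 2) :
    (∑ a, ∑ b, truthVal (r a b) * truthVal (r' b a) * (x a * x b)) +
      ∑ a, ∑ b, truthVal (r' a b) * truthVal (r'' b a) * (x a * x b) =
      ∑ a, ∑ b, truthVal (r a b) * truthVal (r'' b a) * (x a * x b) := by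
  rw [← Finset.sum_add_distrib]
  simp only [← Finset.sum_add_distrib]
  refine sum_pairs_eq _ _ (fun a b e => ?_) fun a => ?_
  -- Off the diagonal each truth value is `1` plus that of the reversed pair. The claim becomes a
  -- polynomial identity in three truth values, valid up to a multiple of `2`.
  · rw [hr.truthVal_add e, hr'.truthVal_add e, hr''.truthVal_add e]
    have h2 : (2 : ZMod 2) = 0 := rfl
    linear_combination (x a * x b * (truthVal (r' b a) + truthVal (r' b a) * truthVal (r'' b a) +
      truthVal (r b a) * truthVal (r' b a) - truthVal (r b a) * truthVal (r'' b a))) * h2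
  · rw [truthVal_false (hr.irrefl a), truthVal_false (hr'.irrefl a)]; ring

namespace FinIdx

theorem koszul_cast {I : FinIdx} {F : I.α → FinIdx} {J : FinIdx} (σ : (Σ i, (F i).α) ≃ J.α)
    (n : I.α → ℤ) (p : J.α → ℤ) : (koszul σ n p : ZMod 2) =
      (∑ i, ∑ l, truthVal (l < i) * ((∑ t, (p (σ ⟨l, t⟩) : ZMod 2)) * n i)) +
      ∑ a, ∑ b, truthVal (Sigma.Lex (· < ·) (fun _ => (· < ·)) a b) * truthVal (σ b < σ a) *
        ((p (σ a) : ZMod 2) * p (σ b)) := by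
  rw [koszul]
  push_cast
  simp only [ite_eq_truthVal, truthVal_and]

theorem koszul_sigmaOne (J : FinIdx) (n : one.α → ℤ) (p : J.α → ℤ) :
    koszul (F := fun _ => J) (sigmaOne J) n p = 0 := by
  rw [koszul, Finset.sum_eq_zero, Finset.sum_eq_zero, add_zero]
  · rintro ⟨i, t⟩ _
    refine Finset.sum_eq_zero ?_
    rintro ⟨i', t'⟩ _
    rw [if_neg]
    rintro ⟨h, h'⟩
    rcases Sigma.lex_iff.1 h with h | ⟨_, h⟩
    · rw [PseudoTensorData.one_unique i, PseudoTensorData.one_unique i'] at h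
      exact lt_irrefl (0 : Fin 1) h
    · obtain rfl : i' = i := by
        rw [PseudoTensorData.one_unique i, PseudoTensorData.one_unique i']
      exact lt_asymm (α := Fin _) h h'
  · intro i _
    refine Finset.sum_eq_zero fun l _ => ?_
    obtain rfl := PseudoTensorData.one_unique i
    obtain rfl := PseudoTensorData.one_unique l
    exact if_neg (lt_irrefl (0 : Fin 1))

theorem koszul_sigmaUnit (I : FinIdx) (p : I.α → ℤ) :
    koszul (F := fun _ => one) (sigmaUnit I) (fun _ => 0) p = 0 := by
  rw [koszul, Finset.sum_eq_zero, Finset.sum_eq_zero, add_zero]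
  · rintro ⟨i, t⟩ _
    refine Finset.sum_eq_zero ?_
    rintro ⟨i', t'⟩ _
    rw [if_neg]
    rintro ⟨h, h'⟩
    rcases h with ⟨_, _, h⟩ | ⟨_, _, h⟩
    · exact lt_asymm (α := Fin _) h h'
    · rw [PseudoTensorData.one_unique t, PseudoTensorData.one_unique t'] at h
      exact lt_irrefl (0 : Fin 1) h
  · intro i _
    refine Finset.sum_eq_zero fun l _ => ?_
    simp


section Assoc

variable {I : FinIdx} {F : I.α → FinIdx} {J : FinIdx} (σ : (Σ i, (F i).α) ≃ J.α)
  {G : J.α → FinIdx} {K : FinIdx} (ρ : (Σ j, (G j).α) ≃ K.α)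
  {H : I.α → FinIdx} (τ : ∀ i, (Σ t, (G (σ ⟨i, t⟩)).α) ≃ (H i).α)
  (θ : (Σ i, (H i).α) ≃ K.α)

/-- The weighted number of inversions of the bijection `σ`, modulo `2`. -/
noncomputable def inversions (x : J.α → ZMod 2) : ZMod 2 :=
  ∑ a, ∑ b, truthVal (Sigma.Lex (· < ·) (fun _ => (· < ·)) a b) * truthVal (σ b < σ a) *
    (x (σ a) * x (σ b))

theorem isStrictTotal_lex (F : I.α → FinIdx) :
    IsStrictTotal (T := Σ i, (F i).α) (Sigma.Lex (· < ·) (fun _ => (· < ·))) :=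
  I.isStrictTotal_lt.lex fun i => (F i).isStrictTotal_lt

/-- The set of triples `(i, t, s)` carries four total orders: `r0` from `K`, `r1` from the blocks `H
i`, `r2` from the blocks `G j`, and the triple lexicographic order `r3`. The inversions of `θ`, of
the `τ i`, of `ρ` and of `σ` compare `r1` with `r0`, `r3` with `r1`, `r2` with `r0` and `r3` with
`r2`. By the cocycle property both sides compare `r3` with `r0`. -/
theorem inversions_assoc (hθ : ∀ i t s, ρ ⟨σ ⟨i, t⟩, s⟩ = θ ⟨i, τ i ⟨t, s⟩⟩) (x : K.α → ZMod 2) :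
    inversions θ x + ∑ i, inversions (τ i) (fun r => x (θ ⟨i, r⟩)) =
      inversions ρ x + inversions σ (fun j => ∑ s, x (ρ ⟨j, s⟩)) := by
  let eH : (Σ i, Σ t, (G (σ ⟨i, t⟩)).α) ≃ Σ i, (H i).α := Equiv.sigmaCongrRight τ
  let eG : (Σ i, Σ t, (G (σ ⟨i, t⟩)).α) ≃ Σ j, (G j).α :=
    (Equiv.sigmaAssoc fun i t => (G (σ ⟨i, t⟩)).α).symm.trans
      (Equiv.sigmaCongrLeft (β := fun j => (G j).α) σ)
  have hK : ∀ y, ρ (eG y) = θ (eH y) := fun ⟨i, t, s⟩ => hθ i t s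
  let y : (Σ i, Σ t, (G (σ ⟨i, t⟩)).α) → ZMod 2 := fun a => x (θ (eH a))
  let r0 : (Σ i, Σ t, (G (σ ⟨i, t⟩)).α) → (Σ i, Σ t, (G (σ ⟨i, t⟩)).α) → Prop := fun a b =>
    θ (eH a) < θ (eH b)
  let r1 : (Σ i, Σ t, (G (σ ⟨i, t⟩)).α) → (Σ i, Σ t, (G (σ ⟨i, t⟩)).α) → Prop := fun a b =>
    Sigma.Lex (· < ·) (fun _ => (· < ·)) (eH a) (eH b)
  let r2 : (Σ i, Σ t, (G (σ ⟨i, t⟩)).α) → (Σ i, Σ t, (G (σ ⟨i, t⟩)).α) → Prop := fun a b =>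
    Sigma.Lex (· < ·) (fun _ => (· < ·)) (eG a) (eG b)
  let r3 : (Σ i, Σ t, (G (σ ⟨i, t⟩)).α) → (Σ i, Σ t, (G (σ ⟨i, t⟩)).α) → Prop :=
    Sigma.Lex (· < ·) (fun _ => Sigma.Lex (· < ·) (fun _ => (· < ·)))
  have h0 : IsStrictTotal r0 := K.isStrictTotal_lt.comap (eH.trans θ)
  have h1 : IsStrictTotal r1 := (isStrictTotal_lex H).comap eH
  have h2 : IsStrictTotal r2 := (isStrictTotal_lex G).comap eG
  have h3 : IsStrictTotal r3 := I.isStrictTotal_lt.lex fun i => isStrictTotal_lex _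
  have e1 : inversions θ x = ∑ a, ∑ b, truthVal (r1 a b) * truthVal (r0 b a) * (y a * y b) := by
    exact sum_sum_equiv eH _
  have e2 : inversions ρ x = ∑ a, ∑ b, truthVal (r2 a b) * truthVal (r0 b a) * (y a * y b) := by
    refine (sum_sum_equiv eG _).trans ?_
    simp only [hK]
    rfl
  have e3 : ∑ i, inversions (τ i) (fun r => x (θ ⟨i, r⟩)) =
      ∑ a, ∑ b, truthVal (r3 a b) * truthVal (r1 b a) * (y a * y b) := by
    rw [Fintype.sum_sigma]
    refine Finset.sum_congr rfl fun i _ => ?_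
    rw [inversions]
    refine Finset.sum_congr rfl fun u _ => ?_
    refine Eq.trans ?_ (Fintype.sum_sigma _).symm
    refine Eq.trans ?_ (Fintype.sum_eq_single i ?_).symm
    · refine Finset.sum_congr rfl fun u' _ => ?_
      have k3 : r3 ⟨i, u⟩ ⟨i, u'⟩ ↔ Sigma.Lex (· < ·) (fun _ => (· < ·)) u u' :=
        Sigma.lex_iff.trans ⟨fun h => h.elim (fun h => absurd h (I.isStrictTotal_lt.irrefl i))
          fun ⟨_, h⟩ => h, fun h => .inr ⟨rfl, h⟩⟩
      have k1 : r1 ⟨i, u'⟩ ⟨i, u⟩ ↔ τ i u' < τ i u :=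
        Sigma.lex_iff.trans ⟨fun h => h.elim (fun h => absurd h (I.isStrictTotal_lt.irrefl i))
          fun ⟨_, h⟩ => h, fun h => .inr ⟨rfl, h⟩⟩
      rw [k3, k1]
      rfl
    · intro i' hi
      refine Finset.sum_eq_zero fun u' _ => ?_
      rw [← truthVal_and, truthVal_false, zero_mul]
      rintro ⟨ha, hb⟩
      rcases Sigma.lex_iff.1 ha with ha | ⟨e, _⟩
      · rcases Sigma.lex_iff.1 hb with hb | ⟨e, _⟩
        · exact (I.isStrictTotal_lt.not_iff _ _ hi).1 hb ha
        · exact hi e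
      · exact hi e.symm
  have e4 : inversions σ (fun j => ∑ s, x (ρ ⟨j, s⟩)) =
      ∑ a, ∑ b, truthVal (r3 a b) * truthVal (r2 b a) * (y a * y b) := by
    have k : ∀ (f : (Σ i, Σ t, (G (σ ⟨i, t⟩)).α) → ZMod 2), ∑ a, f a =
        ∑ a : Σ i, (F i).α, ∑ s : (G (σ a)).α, f ⟨a.1, a.2, s⟩ := fun f => by
      simp only [Fintype.sum_sigma]
    rw [k, inversions]
    refine Finset.sum_congr rfl fun a _ => ?_
    refine Eq.trans ?_ (Finset.sum_congr rfl fun s _ => (k _).symm)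
    rw [Finset.sum_comm]
    refine Finset.sum_congr rfl fun b _ => ?_
    rw [Finset.sum_mul_sum, Finset.mul_sum]
    refine Finset.sum_congr rfl fun s _ => ?_
    rw [Finset.mul_sum]
    refine Finset.sum_congr rfl fun s' _ => ?_
    obtain ⟨i, t⟩ := a
    obtain ⟨i', t'⟩ := b
    change _ * (x (ρ ⟨σ ⟨i, t⟩, s⟩) * x (ρ ⟨σ ⟨i', t'⟩, s'⟩)) =
      _ * (x (θ ⟨i, τ i ⟨t, s⟩⟩) * x (θ ⟨i', τ i' ⟨t', s'⟩⟩))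
    rw [hθ, hθ, ← truthVal_and, ← truthVal_and]
    refine congrArg (fun z => truthVal z * _) (propext ?_)
    change _ ↔ Sigma.Lex _ _ _ _ ∧ Sigma.Lex _ _ (⟨σ ⟨i', t'⟩, s'⟩ : Σ j, (G j).α) ⟨σ ⟨i, t⟩, s⟩
    constructor
    · rintro ⟨ha, hb⟩
      refine ⟨?_, .left _ _ hb⟩
      rcases ha with ⟨_, _, ha⟩ | ⟨_, _, ha⟩
      · exact .left _ _ ha
      · exact .right _ _ (.left _ _ ha)
    -- Over one element of `J` the two orders agree and there is no inversion; over two different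
    -- elements both comparisons are decided by these elements.
    · rintro ⟨ha, hb⟩
      by_cases e : (⟨i, t⟩ : Σ i, (F i).α) = ⟨i', t'⟩
      · obtain rfl := congrArg Sigma.fst e
        obtain rfl := eq_of_heq (Sigma.mk.inj e).2
        have ha' : s < s' := by
          rcases ha with ⟨_, _, ha⟩ | ⟨_, _, ⟨_, _, ha⟩ | ⟨_, _, ha⟩⟩
          · exact absurd ha (I.isStrictTotal_lt.irrefl i)
          · exact absurd ha ((F i).isStrictTotal_lt.irrefl t)
          · exact ha
        have hb' : s' < s := by
          rcases hb with ⟨_, _, hb⟩ | ⟨_, _, hb⟩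
          · exact absurd hb (J.isStrictTotal_lt.irrefl _)
          · exact hb
        exact absurd hb' (lt_asymm (α := Fin _) ha')
      · constructor
        · rcases ha with ⟨_, _, ha⟩ | ⟨_, _, ⟨_, _, ha⟩ | ⟨_, _, ha⟩⟩
          · exact .left _ _ ha
          · exact .right _ _ ha
          · exact absurd rfl e
        · rcases Sigma.lex_iff.1 hb with hb | ⟨h, _⟩
          · exact hb
          · exact absurd (σ.injective h).symm e
  rw [e1, e2, e3, e4, add_comm, inversions_add h3 h1 h0, add_comm, inversions_add h3 h2 h0]

/-- The sign of the associativity of the compositions. -/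
theorem koszul_assoc (hθ : ∀ i t s, ρ ⟨σ ⟨i, t⟩, s⟩ = θ ⟨i, τ i ⟨t, s⟩⟩) (n : I.α → ℤ)
    (p : J.α → ℤ) (b : K.α → ℤ) :
    (koszul θ (fun i => n i + ∑ t, p (σ ⟨i, t⟩)) b +
        ∑ i, koszul (τ i) (fun t => p (σ ⟨i, t⟩)) (fun r => b (θ ⟨i, r⟩))).negOnePow =
      (koszul σ n p + (koszul ρ p b +
        koszul σ n (fun j => p j + ∑ s, b (ρ ⟨j, s⟩)))).negOnePow := by
  apply negOnePow_eq_of_zmod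
  have key := inversions_assoc σ ρ τ θ hθ (fun k => (b k : ZMod 2))
  have hB : ∀ i, ∑ r, (b (θ ⟨i, r⟩) : ZMod 2) = ∑ t, ∑ s, (b (ρ ⟨σ ⟨i, t⟩, s⟩) : ZMod 2) := by
    intro i
    rw [← (τ i).sum_comp, Fintype.sum_sigma]
    simp only [hθ]
  -- Degrees modulo 2: `N` of the `g_i`, `P` of the `h_j`, and `B` the total dimension of the cubes
  -- over `j`.
  let N : I.α → ZMod 2 := fun i => n i
  let P : J.α → ZMod 2 := fun j => p j
  let B : J.α → ZMod 2 := fun j => ∑ s, (b (ρ ⟨j, s⟩) : ZMod 2)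
  -- Pairs of a cube block and a later `h`, counted lexicographically and in the order of `J`: the
  -- two counts differ by the mixed terms at the inversions of `σ`.
  have mixed : (∑ a, ∑ a', truthVal (Sigma.Lex (· < ·) (fun _ => (· < ·)) a a') *
        (B (σ a) * P (σ a'))) =
      (∑ j, ∑ l, truthVal (l < j) * (B l * P j)) +
      ∑ a, ∑ a', truthVal (Sigma.Lex (· < ·) (fun _ => (· < ·)) a a') * truthVal (σ a' < σ a) *
        (P (σ a) * B (σ a') + B (σ a) * P (σ a')) := by
    rw [sum_sum_equiv σ, ← Finset.sum_add_distrib]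
    simp only [← Finset.sum_add_distrib]
    refine sum_pairs_eq _ _ (fun a a' e => ?_) fun a => ?_
    · rw [(isStrictTotal_lex F).truthVal_add e, (J.isStrictTotal_lt.comap σ).truthVal_add e]
      have h2 : (2 : ZMod 2) = 0 := rfl
      linear_combination (-(truthVal (σ a' < σ a) +
        truthVal (Sigma.Lex (· < ·) (fun _ => (· < ·)) a' a) * truthVal (σ a' < σ a)) *
        (B (σ a) * P (σ a') + B (σ a') * P (σ a))) * h2
    · rw [truthVal_false ((isStrictTotal_lex F).irrefl a),
        truthVal_false (J.isStrictTotal_lt.irrefl (σ a))]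
      ring
  -- A lexicographically ordered pair lies either in two different blocks, or in the right order
  -- within one block.
  have first : (∑ i, ∑ l, truthVal (l < i) * ((∑ t, B (σ ⟨l, t⟩)) * ∑ t, P (σ ⟨i, t⟩))) +
      ∑ i, ∑ t, ∑ t', truthVal (t' < t) * (B (σ ⟨i, t'⟩) * P (σ ⟨i, t⟩)) =
      ∑ a, ∑ a', truthVal (Sigma.Lex (· < ·) (fun _ => (· < ·)) a a') *
        (B (σ a) * P (σ a')) := by
    have split : ∀ (l : I.α) (t : (F l).α) (g : ∀ i, (F i).α → ZMod 2),
        ∑ i, ∑ t', truthVal (Sigma.Lex (· < ·) (fun _ => (· < ·)) (⟨l, t⟩ : Σ i, (F i).α) ⟨i, t'⟩) *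
          g i t' = (∑ i, ∑ t', truthVal (l < i) * g i t') + ∑ t', truthVal (t < t') * g l t' := by
      intro l t g
      rw [← sub_eq_iff_eq_add', ← Finset.sum_sub_distrib, Fintype.sum_eq_single l]
      · rw [← Finset.sum_sub_distrib]
        refine Finset.sum_congr rfl fun t' _ => ?_
        have e : Sigma.Lex (· < ·) (fun _ => (· < ·)) (⟨l, t⟩ : Σ i, (F i).α) ⟨l, t'⟩ ↔ t < t' :=
          Sigma.lex_iff.trans ⟨fun h => h.elim (fun h => absurd h (I.isStrictTotal_lt.irrefl l))
            fun ⟨_, h⟩ => h, fun h => .inr ⟨rfl, h⟩⟩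
        rw [e, truthVal_false (I.isStrictTotal_lt.irrefl l)]
        ring
      · intro i hi
        rw [sub_eq_zero]
        refine Finset.sum_congr rfl fun t' _ => ?_
        have e : Sigma.Lex (· < ·) (fun _ => (· < ·)) (⟨l, t⟩ : Σ i, (F i).α) ⟨i, t'⟩ ↔ l < i :=
          Sigma.lex_iff.trans ⟨fun h => h.elim id fun ⟨h, _⟩ => absurd h.symm hi, .inl⟩
        rw [e]
    rw [Fintype.sum_sigma]
    have e : ∀ l t, ∑ a', truthVal (Sigma.Lex (· < ·) (fun _ => (· < ·)) (⟨l, t⟩ : Σ i, (F i).α) a') *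
        (B (σ ⟨l, t⟩) * P (σ a')) = (∑ i, ∑ t', truthVal (l < i) * (B (σ ⟨l, t⟩) * P (σ ⟨i, t'⟩))) +
          ∑ t', truthVal (t < t') * (B (σ ⟨l, t⟩) * P (σ ⟨l, t'⟩)) := fun l t =>
      (Fintype.sum_sigma _).trans (split l t fun i t' => B (σ ⟨l, t⟩) * P (σ ⟨i, t'⟩))
    simp only [e, Finset.sum_add_distrib]
    refine congrArg₂ (· + ·) ?_ (Finset.sum_congr rfl fun i _ => Finset.sum_comm)
    rw [Finset.sum_comm]
    refine Finset.sum_congr rfl fun l _ => ?_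
    rw [Finset.sum_comm]
    refine Finset.sum_congr rfl fun i _ => ?_
    rw [Finset.sum_mul_sum, Finset.mul_sum]
    exact Finset.sum_congr rfl fun t _ => Finset.mul_sum ..
  -- The right side contains the inversions of `σ` with weights `P + B`. Their mixed terms are the
  -- ones produced by `mixed`.
  have cross : inversions σ (fun j => P j + B j) = inversions σ P + inversions σ B +
      ∑ a, ∑ a', truthVal (Sigma.Lex (· < ·) (fun _ => (· < ·)) a a') * truthVal (σ a' < σ a) *
        (P (σ a) * B (σ a') + B (σ a) * P (σ a')) := by
    simp only [inversions, ← Finset.sum_add_distrib]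
    exact Finset.sum_congr rfl fun a _ => Finset.sum_congr rfl fun a' _ => by ring
  have cast1 : (koszul θ (fun i => n i + ∑ t, p (σ ⟨i, t⟩)) b : ZMod 2) =
      (∑ i, ∑ l, truthVal (l < i) * ((∑ t, B (σ ⟨l, t⟩)) * N i)) +
      (∑ i, ∑ l, truthVal (l < i) * ((∑ t, B (σ ⟨l, t⟩)) * ∑ t, P (σ ⟨i, t⟩))) +
        inversions θ (fun k => (b k : ZMod 2)) := by
    rw [koszul_cast, ← Finset.sum_add_distrib]
    simp only [← Finset.sum_add_distrib]
    refine congrArg (· + _) (Finset.sum_congr rfl fun i _ => Finset.sum_congr rfl fun l _ => ?_)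
    rw [hB]
    push_cast
    ring
  have cast2 : ∀ i, (koszul (τ i) (fun t => p (σ ⟨i, t⟩)) (fun r => b (θ ⟨i, r⟩)) : ZMod 2) =
      (∑ t, ∑ t', truthVal (t' < t) * (B (σ ⟨i, t'⟩) * P (σ ⟨i, t⟩))) +
        inversions (τ i) (fun r => (b (θ ⟨i, r⟩) : ZMod 2)) := by
    intro i
    rw [koszul_cast]
    refine congrArg (· + _) (Finset.sum_congr rfl fun t _ => Finset.sum_congr rfl fun t' _ => ?_)
    simp only [← hθ]
    rfl
  have cast3 : (koszul σ n (fun j => p j + ∑ s, b (ρ ⟨j, s⟩)) : ZMod 2) =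
      (∑ i, ∑ l, truthVal (l < i) * ((∑ t, P (σ ⟨l, t⟩)) * N i)) +
      (∑ i, ∑ l, truthVal (l < i) * ((∑ t, B (σ ⟨l, t⟩)) * N i)) +
        inversions σ (fun j => P j + B j) := by
    rw [koszul_cast, ← Finset.sum_add_distrib]
    simp only [← Finset.sum_add_distrib]
    push_cast
    refine congrArg₂ (· + ·) (Finset.sum_congr rfl fun i _ => Finset.sum_congr rfl fun l _ => ?_) rfl
    rw [Finset.sum_add_distrib]
    ring
  have cast4 : (koszul σ n p : ZMod 2) = (∑ i, ∑ l, truthVal (l < i) *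
      ((∑ t, P (σ ⟨l, t⟩)) * N i)) + inversions σ P := koszul_cast σ n p
  have cast5 : (koszul ρ p b : ZMod 2) = (∑ j, ∑ l, truthVal (l < j) * (B l * P j)) +
      inversions ρ (fun k => (b k : ZMod 2)) := koszul_cast ρ p b
  push_cast
  rw [cast1, cast3, cast4, cast5]
  simp only [cast2, Finset.sum_add_distrib]
  have h2 : (2 : ZMod 2) = 0 := rfl
  -- The terms that are left over are the sign of `σ` with weights `P`; they occur twice.
  linear_combination key + first + mixed - cross -
    ((∑ i, ∑ l, truthVal (l < i) * ((∑ t, P (σ ⟨l, t⟩)) * N i)) + inversions σ P) * h2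

end Assoc

end FinIdx

end Signs

/-! ### Additivity of tensor products of morphisms in one factor. -/

section Slot

variable {C : Type u} [Category.{v} C] [MonoidalCategory C]

theorem tensLHom_congr {J : Type} {A B : J → C} {φ ψ : ∀ j, A j ⟶ B j} :
    ∀ {L : List J}, (∀ j ∈ L, φ j = ψ j) → tensLHom φ L = tensLHom ψ L
  | [], _ => rfl
  | j :: L, h => by
    rw [tensLHom, tensLHom, h j List.mem_cons_self,
      tensLHom_congr fun k hk => h k (List.mem_cons_of_mem j hk)]

variable [Preadditive C] [MonoidalPreadditive C]

/-- The tensor product of a family of morphisms, as a function of the factor `k`. -/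
def tensLHomAt {J : Type} [DecidableEq J] {A B : J → C} (φ : ∀ j, A j ⟶ B j) (k : J) (L : List J)
    (hL : L.Nodup) (hk : k ∈ L) : (A k ⟶ B k) →+ (tensL A L ⟶ tensL B L) :=
  AddMonoidHom.mk' (fun x => tensLHom (Function.update φ k x) L) (fun x y => by
    induction L with
    | nil => exact absurd hk List.not_mem_nil
    | cons j L ih =>
      rw [List.nodup_cons] at hL
      by_cases h : j = k
      · subst h
        have e (z : A j ⟶ B j) : tensLHom (Function.update φ j z) L = tensLHom φ L :=
          tensLHom_congr fun l hl => Function.update_of_ne (ne_of_mem_of_not_mem hl hL.1) _ _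
        simp only [tensLHom, e, Function.update_self, MonoidalPreadditive.add_tensor,
          Preadditive.add_comp, Preadditive.comp_add]
      · simp only [tensLHom, Function.update_of_ne h,
          ih hL.2 ((List.mem_cons.1 hk).resolve_left (Ne.symm h)), MonoidalPreadditive.tensor_add,
          Preadditive.add_comp, Preadditive.comp_add])

/-- The tensor product of a family of morphisms, as a function of the factor `k`. -/
def tensHomAt (I : FinIdx) {A B : I.α → C} (φ : ∀ j, A j ⟶ B j) (k : I.α) :
    (A k ⟶ B k) →+ (tens I A ⟶ tens I B) :=
  tensLHomAt φ k I.list I.nodup_list (I.mem_list k)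

theorem tensLHom_smul {J : Type} {A B : J → C} (s : J → ℤˣ) (φ : ∀ j, A j ⟶ B j) :
    ∀ L : List J, tensLHom (fun j => s j • φ j) L = (L.map s).prod • tensLHom φ L
  | [] => by simp [tensLHom]
  | j :: L => by
    have h1 {X X' Y Y' : C} (a b : ℤ) (f : X ⟶ X') (g : Y ⟶ Y') :
        (a • f) ⊗ₘ (b • g) = (a * b) • (f ⊗ₘ g) := by
      have h2 : (a • f) ▷ Y = a • f ▷ Y := (tensorRight Y).map_zsmul
      have h3 : X' ◁ (b • g) = b • X' ◁ g := (tensorLeft X').map_zsmul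
      rw [MonoidalCategory.tensorHom_def, MonoidalCategory.tensorHom_def, h2, h3,
        Preadditive.zsmul_comp, Preadditive.comp_zsmul, smul_smul]
    rw [tensLHom, tensLHom, tensLHom_smul s φ L, List.map_cons, List.prod_cons]
    simp only [Units.smul_def, h1, Preadditive.zsmul_comp, Preadditive.comp_zsmul, Units.val_mul]

theorem tensHom_smul (I : FinIdx) {A B : I.α → C} (s : I.α → ℤˣ) (φ : ∀ j, A j ⟶ B j) :
    tensHom I (fun j => s j • φ j) = (∏ i, s i) • tensHom I φ := by
  have h : (I.list.map s).prod = ∏ i, s i := by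
    rw [← Equiv.prod_comp I.e, FinIdx.list, List.map_ofFn, List.prod_ofFn]
    rfl
  rw [tensHom, tensLHom_smul, h]

end Slot

/-! ### Change of the signs when a degree is raised by one. -/

namespace FinIdx

/-- The additional degree of `g_k` costs the signs for passing the elements of all blocks before
`k`. -/
theorem koszul_add_single {I : FinIdx} {F : I.α → FinIdx} {J : FinIdx} (σ : (Σ i, (F i).α) ≃ J.α)
    (n : I.α → ℤ) (p : J.α → ℤ) (k : I.α) :
    koszul σ (fun i => n i + if i = k then 1 else 0) p =
      koszul σ n p + ∑ l with l < k, ∑ t, p (σ ⟨l, t⟩) := by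
  have h (i l : I.α) : (if l < i then (∑ t, p (σ ⟨l, t⟩)) * (n i + if i = k then 1 else 0) else 0) =
      (if l < i then (∑ t, p (σ ⟨l, t⟩)) * n i else 0) +
        if i = k then if l < i then ∑ t, p (σ ⟨l, t⟩) else 0 else 0 := by
    split_ifs <;> ring
  have h2 : ∑ i, ∑ l, (if i = k then if l < i then ∑ t, p (σ ⟨l, t⟩) else 0 else 0) =
      ∑ l with l < k, ∑ t, p (σ ⟨l, t⟩) := by
    rw [Fintype.sum_eq_single k fun i hi => Finset.sum_eq_zero fun l _ => if_neg hi,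
      Finset.sum_filter]
    exact Finset.sum_congr rfl fun l _ => if_pos rfl
  simp only [koszul, h, Finset.sum_add_distrib, h2]
  ring

/-- The sign of a composition in which the degree of one variable is increased by one. -/
theorem koszul_bump {I : FinIdx} {F : I.α → FinIdx} {J : FinIdx} (σ : (Σ i, (F i).α) ≃ J.α)
    (n : I.α → ℤ) (b : J.α → ℕ) (k : I.α) (t : (F k).α) (m : ℤ) :
    (m + ∑ i, n i + (∑ j with j < σ ⟨k, t⟩, (b j : ℤ) +
        koszul σ n fun j => (bump b (σ ⟨k, t⟩) j : ℤ))).negOnePow =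
      (m + ∑ i with i < k, n i + (koszul σ (fun i => n i + if i = k then 1 else 0)
        (fun j => (b j : ℤ)) + (n k + ∑ s with s < t, (b (σ ⟨k, s⟩) : ℤ)))).negOnePow := by
  apply negOnePow_eq_of_zmod
  rw [koszul_add_single]
  push_cast
  rw [koszul_cast, koszul_cast]
  let L : (Σ i, (F i).α) → (Σ i, (F i).α) → Prop := Sigma.Lex (· < ·) (fun _ => (· < ·))
  have hL : IsStrictTotal L := I.isStrictTotal_lt.lex fun i => (F i).isStrictTotal_lt
  let S : (Σ i, (F i).α) → (Σ i, (F i).α) → Prop := fun x y => σ x < σ y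
  have hS : IsStrictTotal S := J.isStrictTotal_lt.comap σ
  let z : Σ i, (F i).α := ⟨k, t⟩
  let y : (Σ i, (F i).α) → ZMod 2 := fun x => (b (σ x) : ZMod 2)
  -- Raising one cube adds a point mass at `z` to the degrees `y`; the terms of the sign are
  -- expanded in it.
  let δ : (Σ i, (F i).α) → ZMod 2 := fun x => if x = z then 1 else 0
  have hb (x : Σ i, (F i).α) : ((bump b (σ z) (σ x) : ℤ) : ZMod 2) = y x + δ x := by
    simp only [bump, EmbeddingLike.apply_eq_iff_eq, y, δ]
    split_ifs <;> simp
  have hq : ∑ a, ∑ c, truthVal (L a c) * truthVal (S c a) * ((y a + δ a) * (y c + δ c)) =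
      (∑ a, ∑ c, truthVal (L a c) * truthVal (S c a) * (y a * y c)) +
        ((∑ a, truthVal (L a z) * y a) + ∑ a, truthVal (S a z) * y a) := by
    have h1 (a c : Σ i, (F i).α) :
        truthVal (L a c) * truthVal (S c a) * ((y a + δ a) * (y c + δ c)) =
        truthVal (L a c) * truthVal (S c a) * (y a * y c) +
        ((if c = z then truthVal (L a c) * truthVal (S c a) * y a else 0) +
        ((if a = z then truthVal (L a c) * truthVal (S c a) * y c else 0) +
        if a = z then if c = z then truthVal (L a c) * truthVal (S c a) else 0 else 0)) := by
      simp only [δ]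
      split_ifs <;> ring
    simp only [h1, Finset.sum_add_distrib, Finset.sum_ite_eq', Finset.mem_univ, if_true]
    have h2 : ∑ a, ∑ c, (if a = z then truthVal (L a c) * truthVal (S c a) * y c else 0) =
        ∑ c, truthVal (L z c) * truthVal (S c z) * y c :=
      Fintype.sum_eq_single z (fun a ha => Finset.sum_eq_zero fun c _ => if_neg ha) |>.trans
        (Finset.sum_congr rfl fun c _ => if_pos rfl)
    have h3 : ∑ a, ∑ c, (if a = z then if c = z then truthVal (L a c) * truthVal (S c a) else 0
        else 0) = 0 :=
      Fintype.sum_eq_single z (fun a ha => Finset.sum_eq_zero fun c _ => if_neg ha) |>.trans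
        (by
          simp only [if_true, Finset.sum_ite_eq', Finset.mem_univ]
          rw [truthVal_false (hL.irrefl z), zero_mul])
    rw [h2, h3, add_zero]
    congr 1
    -- The inversions involving `z` are the `a` which precede `z` in exactly one of the two orders,
    -- so modulo 2 they are counted by the sum of the two truth values.
    rw [← Finset.sum_add_distrib, ← Finset.sum_add_distrib]
    refine Finset.sum_congr rfl fun a _ => ?_
    by_cases ha : a = z
    · subst ha
      rw [truthVal_false (hL.irrefl _), truthVal_false (hS.irrefl _)]
      ring
    · rw [hL.truthVal_add (Ne.symm ha), hS.truthVal_add (Ne.symm ha)]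
      have e : (2 : ZMod 2) = 0 := rfl
      linear_combination truthVal (L a z) * truthVal (S a z) * y a * e
  have h4 : ∑ a, truthVal (L a z) * y a = (∑ l with l < k, ∑ t, (b (σ ⟨l, t⟩) : ZMod 2)) +
      ∑ s with s < t, (b (σ ⟨k, s⟩) : ZMod 2) := by
    rw [Fintype.sum_sigma, Finset.sum_filter, Finset.sum_filter]
    have h5 (i : I.α) : ∑ s, truthVal (L ⟨i, s⟩ z) * y ⟨i, s⟩ =
        (if i < k then ∑ s, (b (σ ⟨i, s⟩) : ZMod 2) else 0) +
        if i = k then ∑ s, (if s < t then (b (σ ⟨k, s⟩) : ZMod 2) else 0) else 0 := by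
      by_cases hi : i = k
      · subst hi
        rw [if_neg (I.isStrictTotal_lt.irrefl i), if_pos rfl, zero_add]
        refine Finset.sum_congr rfl fun s _ => ?_
        rw [ite_eq_truthVal]
        congr 2
        refine propext (Sigma.lex_iff.trans ⟨?_, fun h => Or.inr ⟨rfl, h⟩⟩)
        rintro (h | ⟨_, h⟩)
        · exact absurd h (I.isStrictTotal_lt.irrefl i)
        · exact h
      · rw [if_neg hi, add_zero, ite_eq_truthVal, Finset.mul_sum]
        refine Finset.sum_congr rfl fun s _ => ?_
        congr 2
        refine propext (Sigma.lex_iff.trans ⟨?_, fun h => Or.inl h⟩)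
        rintro (h | ⟨h, _⟩)
        · exact h
        · exact absurd h hi
    simp only [h5, Finset.sum_add_distrib, Finset.sum_ite_eq', Finset.mem_univ, if_true]
  have h6 : ∑ a, truthVal (S a z) * y a = ∑ j with j < σ z, (b j : ZMod 2) := by
    rw [Finset.sum_filter, ← σ.sum_comp]
    exact Finset.sum_congr rfl fun a _ => (ite_eq_truthVal _ _).symm
  -- In the part linear in `n` the new degree in block `k` is felt exactly by the `g_i` with `i >
  -- k`.
  have h7 : ∑ i, ∑ l, truthVal (l < i) * ((∑ s, ((bump b (σ z) (σ ⟨l, s⟩) : ℤ) : ZMod 2)) * n i) =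
      (∑ i, ∑ l, truthVal (l < i) * ((∑ s, ((b (σ ⟨l, s⟩) : ℤ) : ZMod 2)) * n i)) +
        ∑ i with k < i, (n i : ZMod 2) := by
    have h8 (l : I.α) : ∑ s, ((bump b (σ z) (σ ⟨l, s⟩) : ℤ) : ZMod 2) =
        (∑ s, ((b (σ ⟨l, s⟩) : ℤ) : ZMod 2)) + if l = k then 1 else 0 := by
      simp only [hb, Finset.sum_add_distrib, y, Int.cast_natCast]
      congr 1
      by_cases h : l = k
      · subst h
        simp [δ, z]
      · rw [if_neg h]
        exact Finset.sum_eq_zero fun s _ => if_neg fun e => h (congrArg Sigma.fst e)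
    simp only [h8, add_mul, mul_add, Finset.sum_add_distrib]
    congr 1
    rw [Finset.sum_filter]
    refine Finset.sum_congr rfl fun i _ => ?_
    rw [Fintype.sum_eq_single k fun l hl => by rw [if_neg hl, zero_mul, mul_zero], if_pos rfl,
      one_mul, ← ite_eq_truthVal]
  have h9 : ∑ i, (n i : ZMod 2) = (∑ i with i < k, (n i : ZMod 2)) + n k +
      ∑ i with k < i, (n i : ZMod 2) := by
    have h10 (i : I.α) : (n i : ZMod 2) = (if i < k then (n i : ZMod 2) else 0) +
        (if i = k then (n i : ZMod 2) else 0) + if k < i then (n i : ZMod 2) else 0 := by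
      have hI := I.isStrictTotal_lt
      by_cases h : i = k
      · subst h
        simp [hI.irrefl i]
      · have := hI.not_iff i k h
        by_cases h' : i < k
        · simp [h, h', this.1 h']
        · have h'' : k < i := by
            by_contra h3
            exact h' (this.2 h3)
          simp [h, h', h'']
    rw [Finset.sum_congr rfl fun i _ => h10 i, Finset.sum_add_distrib, Finset.sum_add_distrib]
    simp only [Finset.sum_filter, Finset.sum_ite_eq', Finset.mem_univ, if_true]
  have hq' : ∑ a, ∑ c, truthVal (Sigma.Lex (· < ·) (fun _ => (· < ·)) a c) * truthVal (σ c < σ a) *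
      (((bump b (σ z) (σ a) : ℤ) : ZMod 2) * ((bump b (σ z) (σ c) : ℤ) : ZMod 2)) =
      (∑ a, ∑ c, truthVal (L a c) * truthVal (S c a) * (y a * y c)) +
        ((∑ a, truthVal (L a z) * y a) + ∑ a, truthVal (S a z) * y a) := by
    rw [← hq]
    simp only [hb]
    rfl
  rw [hq', h7, h9, h4, h6]
  simp only [Int.cast_natCast, y, L, S, z]
  have e : (2 : ZMod 2) = 0 := rfl
  linear_combination ((∑ i with k < i, (n i : ZMod 2)) +
    ∑ j with j < σ ⟨k, t⟩, (b j : ZMod 2)) * e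

end FinIdx

/-! ### Dealing objects and cubes out to the blocks. -/

section Deal

variable {C : Type u} [Category.{v} C] [MonoidalCategory C] [SymmetricCategory C]

/-- The symmetry isomorphism `(⨂_j A_j) ⊗ (⨂_j B_j) ⟶ ⨂_i ((⨂_{j ∈ F i} A_j) ⊗ (⨂_{j ∈ F i} B_j))`. -/
def tensDeal {I : FinIdx} {F : I.α → FinIdx} {J : FinIdx} (σ : (Σ i, (F i).α) ≃ J.α)
    (A B : J.α → C) : tens J A ⊗ tens J B ⟶
      tens I fun i => (tens (F i) fun t => A (σ ⟨i, t⟩)) ⊗ tens (F i) fun t => B (σ ⟨i, t⟩) :=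
  ((tensShuffle σ A).hom ⊗ₘ (tensShuffle σ B).hom) ≫ (tensLMul _ _ I.list).inv

theorem tensDeal_natural {I : FinIdx} {F : I.α → FinIdx} {J : FinIdx} (σ : (Σ i, (F i).α) ≃ J.α)
    {A A' B B' : J.α → C} (φ : ∀ j, A j ⟶ A' j) (ψ : ∀ j, B j ⟶ B' j) :
    (tensHom J φ ⊗ₘ tensHom J ψ) ≫ tensDeal σ A' B' = tensDeal σ A B ≫ tensHom I fun i =>
      (tensHom (F i) fun t => φ (σ ⟨i, t⟩)) ⊗ₘ (tensHom (F i) fun t => ψ (σ ⟨i, t⟩)) := by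
  rw [tensDeal, tensDeal, tensorHom_comp_tensorHom_assoc, tensShuffle_natural, tensShuffle_natural,
    Category.assoc, ← tensorHom_comp_tensorHom_assoc]
  congr 1
  rw [Iso.comp_inv_eq, Category.assoc, tensLMul_natural, Iso.inv_hom_id_assoc]

theorem tensDeal_natural_right {I : FinIdx} {F : I.α → FinIdx} {J : FinIdx}
    (σ : (Σ i, (F i).α) ≃ J.α) {A B B' : J.α → C} (ψ : ∀ j, B j ⟶ B' j) :
    tens J A ◁ tensHom J ψ ≫ tensDeal σ A B' = tensDeal σ A B ≫ tensHom I fun i =>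
      _ ◁ (tensHom (F i) fun t => ψ (σ ⟨i, t⟩)) := by
  have h := tensDeal_natural σ (fun j => 𝟙 (A j)) ψ
  simpa only [tensHom, tensLHom_id, id_tensorHom] using h

theorem tensLMul_natural_right {J : Type} {A B B' : J → C} (ψ : ∀ j, B j ⟶ B' j) (L : List J) :
    tensLHom (fun j => A j ◁ ψ j) L ≫ (tensLMul A B' L).hom =
      (tensLMul A B L).hom ≫ tensL A L ◁ tensLHom ψ L := by
  have h := tensLMul_natural (fun j => 𝟙 (A j)) ψ L
  simpa only [tensLHom_id, id_tensorHom] using h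

end Deal

/-! ### The Leibniz rule for the composition. -/

section MultiComp

variable {C : Type u} [Category.{v} C] [Preadditive C] [MonoidalCategory C]
  [MonoidalPreadditive C] [SymmetricCategory C] (Q : ECube ⥤ C)

/-- The degrees of the cubes in the target of the inner elements of a composition. -/
def compDeg {I : FinIdx} {F : I.α → FinIdx} {J : FinIdx} (σ : (Σ i, (F i).α) ≃ J.α) (n : I.α → ℤ)
    (b : J.α → ℕ) (i : I.α) : ℕ := (n i + ∑ t, (b (σ ⟨i, t⟩) : ℤ)).toNat

theorem multiCompFun_eq {I : FinIdx} {F : I.α → FinIdx} {J : FinIdx} (σ : (Σ i, (F i).α) ≃ J.α)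
    {X : J.α → C} {Y : I.α → C} {Z : C} (n : I.α → ℤ)
    (f : ∀ (a : I.α → ℕ) (k : ℕ), tens I Y ⊗ cubes Q I a ⟶ Z ⊗ Q.obj ⟨k⟩)
    (g : ∀ (i : I.α) (b : (F i).α → ℕ) (k : ℕ),
      tens (F i) (fun t => X (σ ⟨i, t⟩)) ⊗ cubes Q (F i) b ⟶ Y i ⊗ Q.obj ⟨k⟩)
    (b : J.α → ℕ) (k : ℕ) :
    multiCompFun Q σ n f g b k = (FinIdx.koszul σ n fun j => (b j : ℤ)).negOnePow •
      (tensDeal σ X (fun j => Q.obj ⟨b j⟩) ≫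
        tensHom I (fun i => g i (fun t => b (σ ⟨i, t⟩)) (compDeg σ n b i)) ≫
        (tensLMul Y (fun i => Q.obj ⟨compDeg σ n b i⟩) I.list).hom ≫ f (compDeg σ n b) k) := by
  rw [tensDeal, Category.assoc]
  rfl

/-- Raising a cube in block `k` and raising the degree of `g_k` lead to the same intermediate
dimensions. This makes the terms coming from the different differentials comparable. -/
theorem compDeg_bump {I : FinIdx} {F : I.α → FinIdx} {J : FinIdx} (σ : (Σ i, (F i).α) ≃ J.α)
    (n : I.α → ℤ) (b : J.α → ℕ) (k : I.α) (t : (F k).α) :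
    compDeg σ n (bump b (σ ⟨k, t⟩)) = compDeg σ (fun i => n i + if i = k then 1 else 0) b := by
  funext i
  have h : ∑ s, (bump b (σ ⟨k, t⟩) (σ ⟨i, s⟩) : ℤ) =
      (if i = k then 1 else 0) + ∑ s, (b (σ ⟨i, s⟩) : ℤ) := by
    have h1 (s : (F i).α) : (bump b (σ ⟨k, t⟩) (σ ⟨i, s⟩) : ℤ) =
        (if (⟨i, s⟩ : Σ i, (F i).α) = ⟨k, t⟩ then 1 else 0) + b (σ ⟨i, s⟩) := by
      simp only [bump, EmbeddingLike.apply_eq_iff_eq]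
      split_ifs <;> push_cast <;> ring
    simp only [h1, Finset.sum_add_distrib]
    congr 1
    by_cases h : i = k
    · subst h
      simp
    · rw [if_neg h]
      exact Finset.sum_eq_zero fun s _ => if_neg fun e => h (congrArg Sigma.fst e)
  simp only [compDeg, h]
  congr 1
  ring

theorem bump_comp_self {I : FinIdx} {F : I.α → FinIdx} {J : FinIdx} (σ : (Σ i, (F i).α) ≃ J.α)
    (b : J.α → ℕ) (k : I.α) (t : (F k).α) :
    (fun s => bump b (σ ⟨k, t⟩) (σ ⟨k, s⟩)) = bump (fun s => b (σ ⟨k, s⟩)) t := by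
  funext s
  simp [bump]

theorem bump_comp_ne {I : FinIdx} {F : I.α → FinIdx} {J : FinIdx} (σ : (Σ i, (F i).α) ≃ J.α)
    (b : J.α → ℕ) (k : I.α) (t : (F k).α) {i : I.α} (h : i ≠ k) :
    (fun s => bump b (σ ⟨k, t⟩) (σ ⟨i, s⟩)) = fun s => b (σ ⟨i, s⟩) := by
  funext s
  exact bump_ne b fun e => h (congrArg Sigma.fst (σ.injective e))

/-- The composition of an inner differential, up to sign. -/
theorem cubesD_comp {I : FinIdx} {F : I.α → FinIdx} {J : FinIdx} (σ : (Σ i, (F i).α) ≃ J.α)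
    {X : J.α → C} {Y : I.α → C} {Z : C}
    (f : ∀ (a : I.α → ℕ) (k : ℕ), tens I Y ⊗ cubes Q I a ⟶ Z ⊗ Q.obj ⟨k⟩)
    (g : ∀ (i : I.α) (b : (F i).α → ℕ) (k : ℕ),
      tens (F i) (fun t => X (σ ⟨i, t⟩)) ⊗ cubes Q (F i) b ⟶ Y i ⊗ Q.obj ⟨k⟩)
    (b : J.α → ℕ) (l : ℕ) (k : I.α) (t : (F k).α) (a : I.α → ℕ) :
    tens J X ◁ cubesD Q J b (bump b (σ ⟨k, t⟩)) (σ ⟨k, t⟩) ≫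
      tensDeal σ X (fun j => Q.obj ⟨bump b (σ ⟨k, t⟩) j⟩) ≫
        tensHom I (fun i => g i (fun s => bump b (σ ⟨k, t⟩) (σ ⟨i, s⟩)) (a i)) ≫
        (tensLMul Y (fun i => Q.obj ⟨a i⟩) I.list).hom ≫ f a l =
      tensDeal σ X (fun j => Q.obj ⟨b j⟩) ≫
        tensHom I (Function.update (fun i => g i (fun s => b (σ ⟨i, s⟩)) (a i)) k
          (tens (F k) (fun s => X (σ ⟨k, s⟩)) ◁ cubesD Q (F k) (fun s => b (σ ⟨k, s⟩))
            (bump (fun s => b (σ ⟨k, s⟩)) t) t ≫ g k (bump (fun s => b (σ ⟨k, s⟩)) t) (a k))) ≫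
        (tensLMul Y (fun i => Q.obj ⟨a i⟩) I.list).hom ≫ f a l := by
  have h := tensDeal_natural_right σ (A := X) (B := fun j => Q.obj ⟨b j⟩)
    (B' := fun j => Q.obj ⟨bump b (σ ⟨k, t⟩) j⟩) (fun j => if j = σ ⟨k, t⟩ then
      cubeStep Q (b j) (bump b (σ ⟨k, t⟩) j) else cubeSame Q (b j) (bump b (σ ⟨k, t⟩) j))
  rw [cubesD, reassoc_of% h]
  congr 1
  simp only [tensHom]
  rw [← Category.assoc, tensLHom_comp]
  congr 2
  funext i
  by_cases hi : i = k
  · subst hi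
    rw [Function.update_self]
    -- The restriction of the raised family and the raised restriction agree only propositionally,
    -- so the identity is proved for an arbitrary equal family.
    have key (b' b'' : (F i).α → ℕ) (h : b'' = bump b' t) (φ : ∀ s, Q.obj ⟨b' s⟩ ⟶ Q.obj ⟨b'' s⟩)
        (hφ : φ = fun s => if s = t then cubeStep Q (b' s) (b'' s) else cubeSame Q (b' s) (b'' s)) :
        tens (F i) (fun s => X (σ ⟨i, s⟩)) ◁ tensHom (F i) φ ≫ g i b'' (a i) =
        tens (F i) (fun s => X (σ ⟨i, s⟩)) ◁ cubesD Q (F i) b' (bump b' t) t ≫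
          g i (bump b' t) (a i) := by
      subst h hφ
      rfl
    refine key (fun s => b (σ ⟨i, s⟩)) _ (bump_comp_self σ b i t) _ ?_
    funext s
    simp only [EmbeddingLike.apply_eq_iff_eq, Sigma.mk.injEq, heq_eq_eq, true_and]
  · rw [Function.update_of_ne hi]
    have key (b' b'' : (F i).α → ℕ) (h : b'' = b') (φ : ∀ s, Q.obj ⟨b' s⟩ ⟶ Q.obj ⟨b'' s⟩)
        (hφ : φ = fun s => cubeSame Q (b' s) (b'' s)) :
        tens (F i) (fun s => X (σ ⟨i, s⟩)) ◁ tensHom (F i) φ ≫ g i b'' (a i) = g i b' (a i) := by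
      subst h hφ
      simp only [cubeSame_self, tensHom, tensLHom_id, whiskerLeft_id, Category.id_comp]
    refine key (fun s => b (σ ⟨i, s⟩)) _ (bump_comp_ne σ b k t hi) _ ?_
    funext s
    exact if_neg fun e => hi (congrArg Sigma.fst (σ.injective e))

/-- The composition with an outer differential, up to sign. -/
theorem comp_cubesD {I : FinIdx} {A Y : I.α → C} {Z : C} (n : I.α → ℤ) (B : I.α → ℤ)
    (f : ∀ (a : I.α → ℕ) (k : ℕ), tens I Y ⊗ cubes Q I a ⟶ Z ⊗ Q.obj ⟨k⟩)
    (g : ∀ (i : I.α) (k : ℕ), A i ⟶ Y i ⊗ Q.obj ⟨k⟩)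
    (l : ℕ) (k : I.α) (hk : ∀ i, 0 ≤ n i + B i) :
    tensHom I (fun i => g i (n i + B i).toNat) ≫
      (tensLMul Y (fun i => Q.obj ⟨(n i + B i).toNat⟩) I.list).hom ≫
      tens I Y ◁ cubesD Q I (fun i => (n i + B i).toNat) (bump (fun i => (n i + B i).toNat) k) k ≫
      f (bump (fun i => (n i + B i).toNat) k) l =
    tensHom I (Function.update (fun i => g i ((n i + if i = k then 1 else 0) + B i).toNat) k
      (dTarget Q (g k) ((n k + if k = k then 1 else 0) + B k).toNat)) ≫
      (tensLMul Y (fun i => Q.obj ⟨((n i + if i = k then 1 else 0) + B i).toNat⟩) I.list).hom ≫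
      f (fun i => ((n i + if i = k then 1 else 0) + B i).toNat) l := by
  -- This uses `0 ≤ n i + B i`; for negative values the truncation by `toNat` would break the
  -- equality.
  have e : (fun i => ((n i + if i = k then 1 else 0) + B i).toNat) =
      bump (fun i => (n i + B i).toNat) k := by
    funext i
    have := hk i
    simp only [bump]
    split_ifs <;> omega
  have key (a' a'' : I.α → ℕ) (h : a' = a'') (φ : ∀ i, A i ⟶ Y i ⊗ Q.obj ⟨a' i⟩)
      (ψ : ∀ i, A i ⟶ Y i ⊗ Q.obj ⟨a'' i⟩) (hφ : ∀ i, HEq (φ i) (ψ i)) :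
      tensHom I φ ≫ (tensLMul Y (fun i => Q.obj ⟨a' i⟩) I.list).hom ≫ f a' l =
      tensHom I ψ ≫ (tensLMul Y (fun i => Q.obj ⟨a'' i⟩) I.list).hom ≫ f a'' l := by
    subst h
    obtain rfl : φ = ψ := funext fun i => eq_of_heq (hφ i)
    rfl
  rw [cubesD]
  have h := tensLMul_natural_right (A := Y) (B := fun i => Q.obj ⟨(n i + B i).toNat⟩)
    (B' := fun i => Q.obj ⟨bump (fun i => (n i + B i).toNat) k i⟩)
    (fun i => if i = k then cubeStep Q (n i + B i).toNat (bump (fun i => (n i + B i).toNat) k i)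
      else cubeSame Q (n i + B i).toNat (bump (fun i => (n i + B i).toNat) k i)) I.list
  simp only [tensHom]
  rw [← reassoc_of% h, ← Category.assoc, tensLHom_comp]
  refine key _ _ e.symm _ _ fun i => ?_
  have hi : ((n i + if i = k then 1 else 0) + B i).toNat =
    bump (fun i => (n i + B i).toNat) k i := congrFun e i
  by_cases h : i = k
  · subst h
    rw [Function.update_self, if_pos rfl, hi, bump_self, cubeStep_succ]
    rfl
  · rw [Function.update_of_ne h, if_neg h, hi, bump_ne _ h, cubeSame_self,
      MonoidalCategory.whiskerLeft_id, Category.comp_id]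

/-- Three kinds of terms occur: `d` applied in the target of `f`; terms `W k` with `d` between `g_k`
and `f`; terms `V k t` with `d` in the cube `t` in the source of `g_k`. The differential of the
composition has the first and the third kind, the composition with the differential of `f` has the
first and the second, and the one with the differential of `g_k` the second and the third. The `W k`
cancel; the signs of the `V k t` match by `koszul_bump`, those of the `W k` by `koszul_add_single`.
-/
theorem multiComp_d {I : FinIdx} {F : I.α → FinIdx} {J : FinIdx} (σ : (Σ i, (F i).α) ≃ J.α)
    {X : J.α → C} {Y : I.α → C} {Z : C} {m : ℤ} {n : I.α → ℤ} {N : ℤ} (h : m + ∑ i, n i = N)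
    (f : ∀ (a : I.α → ℕ) (k : ℕ), tens I Y ⊗ cubes Q I a ⟶ Z ⊗ Q.obj ⟨k⟩)
    {g : ∀ (i : I.α) (b : (F i).α → ℕ) (k : ℕ),
      tens (F i) (fun t => X (σ ⟨i, t⟩)) ⊗ cubes Q (F i) b ⟶ Y i ⊗ Q.obj ⟨k⟩}
    (hg : ∀ i, g i ∈ multiHom Q (F i) (fun t => X (σ ⟨i, t⟩)) (Y i) (n i)) :
    multiD Q J X Z N (multiCompFun Q σ n f g) = multiCompFun Q σ n (multiD Q I Y Z m f) g +
      ∑ k, (m + ∑ i with i < k, n i).negOnePow •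
        multiCompFun Q σ (fun i => n i + if i = k then 1 else 0) f
          (Function.update g k (multiD Q (F k) _ (Y k) (n k) (g k))) := by
  subst h
  funext b l
  let S := tensDeal σ X (fun j => Q.obj ⟨b j⟩)
  let R (a : I.α → ℕ) := (tensLMul Y (fun i => Q.obj ⟨a i⟩) I.list).hom
  let n' (k i : I.α) : ℤ := n i + if i = k then 1 else 0
  let a' (k : I.α) : I.α → ℕ := compDeg σ (n' k) b
  let T (k : I.α) := tensHomAt I (A := fun i => tens (F i) (fun t => X (σ ⟨i, t⟩)) ⊗
      cubes Q (F i) fun t => b (σ ⟨i, t⟩)) (B := fun i => Y i ⊗ Q.obj ⟨a' k i⟩)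
      (fun i => g i (fun t => b (σ ⟨i, t⟩)) (a' k i)) k
  let K : ℤ := FinIdx.koszul σ n fun j => (b j : ℤ)
  let K' (k : I.α) : ℤ := FinIdx.koszul σ (n' k) fun j => (b j : ℤ)
  let W (k : I.α) : tens J X ⊗ cubes Q J b ⟶ Z ⊗ Q.obj ⟨l⟩ :=
    S ≫ T k (dTarget Q (g k fun t => b (σ ⟨k, t⟩)) (a' k k)) ≫ R (a' k) ≫ f (a' k) l
  let V (k : I.α) (t : (F k).α) : tens J X ⊗ cubes Q J b ⟶ Z ⊗ Q.obj ⟨l⟩ :=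
    S ≫ T k (tens (F k) (fun s => X (σ ⟨k, s⟩)) ◁ cubesD Q (F k) (fun s => b (σ ⟨k, s⟩))
            (bump (fun s => b (σ ⟨k, s⟩)) t) t ≫ g k (bump (fun s => b (σ ⟨k, s⟩)) t) (a' k k)) ≫
      R (a' k) ≫ f (a' k) l
  let T₀ := tensHom I (fun i => g i (fun t => b (σ ⟨i, t⟩)) (compDeg σ n b i))
  have hV (k : I.α) (t : (F k).α) :
      tens J X ◁ cubesD Q J b (bump b (σ ⟨k, t⟩)) (σ ⟨k, t⟩) ≫
        multiCompFun Q σ n f g (bump b (σ ⟨k, t⟩)) l =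
      (FinIdx.koszul σ n fun j => (bump b (σ ⟨k, t⟩) j : ℤ)).negOnePow • V k t := by
    rw [multiCompFun_eq, compDeg_bump, Units.smul_def, Preadditive.comp_zsmul,
      cubesD_comp Q σ f g b l k t]
    rfl
  have hleft : multiD Q J X Z (m + ∑ i, n i) (multiCompFun Q σ n f g) b l =
      K.negOnePow • (S ≫ T₀ ≫ R (compDeg σ n b) ≫ dTarget Q (f (compDeg σ n b)) l) -
      ∑ k, ∑ t, (m + ∑ i with i < k, n i + (K' k + (n k + ∑ s with s < t,
        (b (σ ⟨k, s⟩) : ℤ)))).negOnePow • V k t := by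
    rw [multiD]
    congr 1
    · have : multiCompFun Q σ n f g b = fun l => K.negOnePow •
          (S ≫ T₀ ≫ R (compDeg σ n b) ≫ f (compDeg σ n b) l) :=
        funext fun l => multiCompFun_eq Q σ n f g b l
      rw [this, dTarget_smul, dTarget_comp, dTarget_comp, dTarget_comp]
    · rw [← σ.sum_comp, Fintype.sum_sigma, Finset.smul_sum]
      refine Finset.sum_congr rfl fun k _ => ?_
      rw [Finset.smul_sum]
      refine Finset.sum_congr rfl fun t _ => ?_
      rw [hV, smul_smul, smul_smul, ← Int.negOnePow_add, ← Int.negOnePow_add,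
        add_assoc (m + ∑ i, n i), FinIdx.koszul_bump σ n b k t m]
  have hmid : multiCompFun Q σ n (multiD Q I Y Z m f) g b l =
      K.negOnePow • (S ≫ T₀ ≫ R (compDeg σ n b) ≫ dTarget Q (f (compDeg σ n b)) l) -
      ∑ k, (K + (m + ∑ i with i < k, (compDeg σ n b i : ℤ))).negOnePow •
        (S ≫ T₀ ≫ R (compDeg σ n b) ≫ tens I Y ◁ cubesD Q I (compDeg σ n b)
          (bump (compDeg σ n b) k) k ≫ f (bump (compDeg σ n b) k) l) := by
    rw [multiCompFun_eq]
    simp only [multiD, Preadditive.comp_sub, Units.smul_def, Preadditive.comp_zsmul,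
      Preadditive.comp_sum, smul_sub, Finset.smul_sum, smul_smul, Int.negOnePow_add, Units.val_mul]
    rfl
  have hW (k : I.α) : (K + (m + ∑ i with i < k, (compDeg σ n b i : ℤ))).negOnePow •
        (S ≫ T₀ ≫ R (compDeg σ n b) ≫ tens I Y ◁ cubesD Q I (compDeg σ n b)
          (bump (compDeg σ n b) k) k ≫ f (bump (compDeg σ n b) k) l) =
      (m + ∑ i with i < k, n i + K' k).negOnePow • W k := by
    -- With non-negative degrees `toNat` loses nothing. If some degree is negative, both sides are
    -- zero since a factor vanishes.
    by_cases hn : ∀ i, 0 ≤ n i + ∑ t, (b (σ ⟨i, t⟩) : ℤ)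
    · have hs : K + (m + ∑ i with i < k, (compDeg σ n b i : ℤ)) =
          m + ∑ i with i < k, n i + K' k := by
        have h1 : ∑ i with i < k, (compDeg σ n b i : ℤ) =
            ∑ i with i < k, (n i + ∑ t, (b (σ ⟨i, t⟩) : ℤ)) :=
          Finset.sum_congr rfl fun i _ => Int.toNat_of_nonneg (hn i)
        rw [h1, Finset.sum_add_distrib]
        simp only [K', n', FinIdx.koszul_add_single, K]
        ring
      rw [hs]
      exact congrArg (fun z => (m + ∑ i with i < k, n i + K' k).negOnePow • (S ≫ z))
        (comp_cubesD Q n (fun i => ∑ t, (b (σ ⟨i, t⟩) : ℤ)) f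
          (fun i => g i fun t => b (σ ⟨i, t⟩)) l k hn)
    · push Not at hn
      obtain ⟨i, hi⟩ := hn
      have h0 : T₀ = 0 := tensLHom_zero _ i ((hg i).1 _ _ (by omega)) _ (I.mem_list i)
      have h1 : T k (dTarget Q (g k fun t => b (σ ⟨k, t⟩)) (a' k k)) = 0 := by
        refine tensLHom_zero _ i ?_ _ (I.mem_list i)
        by_cases hik : i = k
        · subst hik
          rw [Function.update_self]
          -- The raised degree is still at most `0`, so its truncation is `0`, and in dimension `0`
          -- no differential arrives.
          have : a' i i = 0 := by
            simp only [a', compDeg, n', if_true]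
            omega
          rw [this]
          rfl
        · rw [Function.update_of_ne hik]
          exact (hg i).1 _ _ (by omega)
      simp only [W, h0, h1, Limits.zero_comp, Limits.comp_zero, smul_zero]
  have hright (k : I.α) : multiCompFun Q σ (n' k) f
        (Function.update g k (multiD Q (F k) _ (Y k) (n k) (g k))) b l =
      (K' k).negOnePow • (W k - ∑ t, (n k + ∑ s with s < t, (b (σ ⟨k, s⟩) : ℤ)).negOnePow • V k t) := by
    rw [multiCompFun_eq]
    have e : tensHom I (fun i => Function.update g k (multiD Q (F k) _ (Y k) (n k) (g k)) i
        (fun t => b (σ ⟨i, t⟩)) (compDeg σ (n' k) b i)) =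
        T k (multiD Q (F k) _ (Y k) (n k) (g k) (fun t => b (σ ⟨k, t⟩)) (a' k k)) := by
      refine tensLHom_congr fun i _ => ?_
      by_cases hi : i = k
      · subst hi
        rw [Function.update_self, Function.update_self]
      · rw [Function.update_of_ne hi, Function.update_of_ne hi]
    rw [e, multiD, map_sub]
    simp only [Units.smul_def, map_zsmul, map_sum, Preadditive.comp_sub, Preadditive.sub_comp,
      Preadditive.comp_zsmul, Preadditive.zsmul_comp, Preadditive.comp_sum, Preadditive.sum_comp,
      Finset.smul_sum, smul_smul, Int.negOnePow_add, Units.val_mul, W, V]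
    rfl
  rw [hleft]
  have hR : (multiCompFun Q σ n (multiD Q I Y Z m f) g +
      ∑ k, (m + ∑ i with i < k, n i).negOnePow • multiCompFun Q σ (n' k) f
          (Function.update g k (multiD Q (F k) _ (Y k) (n k) (g k)))) b l =
      multiCompFun Q σ n (multiD Q I Y Z m f) g b l +
      ∑ k, (m + ∑ i with i < k, n i).negOnePow • multiCompFun Q σ (n' k) f
          (Function.update g k (multiD Q (F k) _ (Y k) (n k) (g k))) b l := by
    simp only [Pi.add_apply, Finset.sum_apply, Pi.smul_apply]
  rw [hR, hmid]
  simp only [hW, hright, smul_sub, Finset.smul_sum, smul_smul, ← Int.negOnePow_add,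
    Finset.sum_sub_distrib, add_assoc]
  abel

end MultiComp

/-! ### Associativity of the composition. -/

section Deal

variable {C : Type u} [Category.{v} C] [MonoidalCategory C] [SymmetricCategory C]

theorem tensLMul_inv_natural {J : Type} {A B A' B' : J → C} (φ : ∀ j, A j ⟶ A' j)
    (ψ : ∀ j, B j ⟶ B' j) (L : List J) :
    (tensLHom φ L ⊗ₘ tensLHom ψ L) ≫ (tensLMul A' B' L).inv =
      (tensLMul A B L).inv ≫ tensLHom (fun j => φ j ⊗ₘ ψ j) L := by
  rw [Iso.comp_inv_eq, Category.assoc, tensLMul_natural, Iso.inv_hom_id_assoc]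

theorem tensLMul_tensDeal {I : FinIdx} {F : I.α → FinIdx} {J : FinIdx}
    (σ : (Σ i, (F i).α) ≃ J.α) (A B : J.α → C) :
    (tensLMul A B J.list).hom ≫ tensDeal σ A B = (tensShuffle σ fun j => A j ⊗ B j).hom ≫
      tensHom I fun i => (tensLMul (fun t => A (σ ⟨i, t⟩)) (fun t => B (σ ⟨i, t⟩)) (F i).list).hom := by
  have h := tensShuffle_tensLMul σ A B
  rw [tensDeal, reassoc_of% h, Iso.hom_inv_id, Category.comp_id]

/-- The associativity of shuffles is applied separately to the `A k` and to the `B k`; the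
compatibility of `tensLMul` with shuffles recombines the two. -/
theorem tensDeal_tensShuffle {I : FinIdx} {F : I.α → FinIdx} {J : FinIdx}
    (σ : (Σ i, (F i).α) ≃ J.α) {G : J.α → FinIdx} {K : FinIdx} (ρ : (Σ j, (G j).α) ≃ K.α)
    {H : I.α → FinIdx} (τ : ∀ i, (Σ t, (G (σ ⟨i, t⟩)).α) ≃ (H i).α) (θ : (Σ i, (H i).α) ≃ K.α)
    (hθ : ∀ i t s, ρ ⟨σ ⟨i, t⟩, s⟩ = θ ⟨i, τ i ⟨t, s⟩⟩) (A B : K.α → C) :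
    tensDeal ρ A B ≫ (tensShuffle σ fun j =>
        (tens (G j) fun s => A (ρ ⟨j, s⟩)) ⊗ tens (G j) fun s => B (ρ ⟨j, s⟩)).hom =
      tensDeal θ A B ≫ tensHom I fun i =>
        tensDeal (τ i) (fun r => A (θ ⟨i, r⟩)) (fun r => B (θ ⟨i, r⟩)) ≫ tensHom (F i) fun t =>
          (tensHom (G (σ ⟨i, t⟩)) fun s => eqToHom (congrArg A (hθ i t s).symm)) ⊗ₘ
          (tensHom (G (σ ⟨i, t⟩)) fun s => eqToHom (congrArg B (hθ i t s).symm)) := by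
  have hA := tensShuffle_assoc σ ρ τ θ hθ A
  have hB := tensShuffle_assoc σ ρ τ θ hθ B
  have h1 := tensShuffle_tensLMul σ (fun j => tens (G j) fun s => A (ρ ⟨j, s⟩))
    (fun j => tens (G j) fun s => B (ρ ⟨j, s⟩))
  have h2 (i : I.α) : tensDeal (τ i) (fun r => A (θ ⟨i, r⟩)) (fun r => B (θ ⟨i, r⟩)) ≫
      (tensHom (F i) fun t =>
          (tensHom (G (σ ⟨i, t⟩)) fun s => eqToHom (congrArg A (hθ i t s).symm)) ⊗ₘ
          (tensHom (G (σ ⟨i, t⟩)) fun s => eqToHom (congrArg B (hθ i t s).symm))) =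
      (((tensShuffle (τ i) fun r => A (θ ⟨i, r⟩)).hom ≫ tensHom (F i) fun t =>
          (tensHom (G (σ ⟨i, t⟩)) fun s => eqToHom (congrArg A (hθ i t s).symm))) ⊗ₘ
        ((tensShuffle (τ i) fun r => B (θ ⟨i, r⟩)).hom ≫ tensHom (F i) fun t =>
          (tensHom (G (σ ⟨i, t⟩)) fun s => eqToHom (congrArg B (hθ i t s).symm)))) ≫
        (tensLMul _ _ (F i).list).inv := by
    rw [tensDeal, Category.assoc, ← tensLMul_inv_natural, tensorHom_comp_tensorHom_assoc]
  have h3 : (tensLMul (fun j => tens (G j) fun s => A (ρ ⟨j, s⟩))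
      (fun j => tens (G j) fun s => B (ρ ⟨j, s⟩)) J.list).inv ≫ (tensShuffle σ fun j =>
        (tens (G j) fun s => A (ρ ⟨j, s⟩)) ⊗ tens (G j) fun s => B (ρ ⟨j, s⟩)).hom =
      tensDeal σ _ _ ≫ tensHom I fun i => (tensLMul (fun t => tens (G (σ ⟨i, t⟩))
        fun s => A (ρ ⟨σ ⟨i, t⟩, s⟩)) (fun t => tens (G (σ ⟨i, t⟩))
        fun s => B (ρ ⟨σ ⟨i, t⟩, s⟩)) (F i).list).inv := by
    rw [Iso.inv_comp_eq, ← Category.assoc, tensLMul_tensDeal, Category.assoc]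
    simp only [tensHom]
    rw [tensLHom_comp]
    simp only [Iso.hom_inv_id, tensLHom_id, Category.comp_id]
  simp only [h2]
  rw [tensDeal, Category.assoc, h3, tensDeal, Category.assoc, tensorHom_comp_tensorHom_assoc, hA, hB,
    ← tensorHom_comp_tensorHom_assoc, tensDeal, Category.assoc]
  congr 1
  simp only [tensHom]
  rw [← Category.assoc, tensLMul_inv_natural, Category.assoc, tensLHom_comp]

/-- Associativity of the compositions, without signs. -/
theorem deal_assoc {I : FinIdx} {F : I.α → FinIdx} {J : FinIdx}
    (σ : (Σ i, (F i).α) ≃ J.α) {G : J.α → FinIdx} {K : FinIdx} (ρ : (Σ j, (G j).α) ≃ K.α)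
    {H : I.α → FinIdx} (τ : ∀ i, (Σ t, (G (σ ⟨i, t⟩)).α) ≃ (H i).α) (θ : (Σ i, (H i).α) ≃ K.α)
    (hθ : ∀ i t s, ρ ⟨σ ⟨i, t⟩, s⟩ = θ ⟨i, τ i ⟨t, s⟩⟩) (A B : K.α → C) (X D : J.α → C)
    (Y : I.α → C)
    (h : ∀ j, (tens (G j) fun s => A (ρ ⟨j, s⟩)) ⊗ (tens (G j) fun s => B (ρ ⟨j, s⟩)) ⟶ X j ⊗ D j)
    (g : ∀ i, (tens (F i) fun t => X (σ ⟨i, t⟩)) ⊗ (tens (F i) fun t => D (σ ⟨i, t⟩)) ⟶ Y i) :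
    tensDeal ρ A B ≫ tensHom J h ≫ (tensLMul X D J.list).hom ≫ tensDeal σ X D ≫ tensHom I g =
      tensDeal θ A B ≫ tensHom I fun i =>
        tensDeal (τ i) (fun r => A (θ ⟨i, r⟩)) (fun r => B (θ ⟨i, r⟩)) ≫ (tensHom (F i) fun t =>
          ((tensHom (G (σ ⟨i, t⟩)) fun s => eqToHom (congrArg A (hθ i t s).symm)) ⊗ₘ
          (tensHom (G (σ ⟨i, t⟩)) fun s => eqToHom (congrArg B (hθ i t s).symm))) ≫ h (σ ⟨i, t⟩)) ≫
        (tensLMul (fun t => X (σ ⟨i, t⟩)) (fun t => D (σ ⟨i, t⟩)) (F i).list).hom ≫ g i := by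
  have h1 := tensLMul_tensDeal σ X D
  have h2 := tensShuffle_natural σ h
  have h3 := tensDeal_tensShuffle σ ρ τ θ hθ A B
  rw [reassoc_of% h1, reassoc_of% h2, reassoc_of% h3]
  simp only [tensHom, tensLHom_comp, Category.assoc]
  congr 2
  funext i
  rw [← tensLHom_comp, Category.assoc]

end Deal

section PseudoTensor

variable {C : Type u} [Category.{v} C] [Preadditive C] [MonoidalCategory C]
  [MonoidalPreadditive C] [SymmetricCategory C] (Q : ECube ⥤ C)

/-- The components of an element of `P_I({X_i}, Y)`. -/
abbrev multiVal {I : FinIdx} {X : I.α → C} {Y : C} {m : ℤ} (f : ((dgeData Q).P I X Y).X m) :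
    ∀ (b : I.α → ℕ) (n : ℕ), tens I X ⊗ cubes Q I b ⟶ Y ⊗ Q.obj ⟨n⟩ :=
  (f : multiHom Q I X Y m).1

theorem multiVal_ext {I : FinIdx} {X : I.α → C} {Y : C} {m : ℤ} {f g : ((dgeData Q).P I X Y).X m}
    (h : multiVal Q f = multiVal Q g) : f = g := Subtype.ext h

theorem multiVal_mem {I : FinIdx} {X : I.α → C} {Y : C} {m : ℤ} (f : ((dgeData Q).P I X Y).X m) :
    multiVal Q f ∈ multiHom Q I X Y m := (f : multiHom Q I X Y m).2

theorem multiVal_d {I : FinIdx} {X : I.α → C} {Y : C} {m : ℤ} (f : ((dgeData Q).P I X Y).X m) :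
    multiVal Q (((dgeData Q).P I X Y).d m (m + 1) f) = multiD Q I X Y m (multiVal Q f) := by
  have h : ((dgeData Q).P I X Y).d m (m + 1) = AddCommGrpCat.ofHom (multiDHom Q I X Y m) :=
    multiComplex_d Q I X Y m
  exact congrArg Subtype.val (ConcreteCategory.congr_hom h f)

theorem multiVal_dAt {I : FinIdx} {F : I.α → FinIdx} {X : ∀ i, (F i).α → C} {Y : I.α → C}
    {n : I.α → ℤ} (g : ∀ i, ((dgeData Q).P (F i) (X i) (Y i)).X (n i)) (k : I.α) :
    (fun i => multiVal Q (AbComplex.dAt g k i)) =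
      Function.update (fun i => multiVal Q (g i)) k
        (multiD Q (F k) (X k) (Y k) (n k) (multiVal Q (g k))) := by
  funext i
  have key (p q : ℤ) (h : p = q) (x : ((dgeData Q).P (F i) (X i) (Y i)).X p)
      (y : ((dgeData Q).P (F i) (X i) (Y i)).X q) (hxy : HEq x y) :
      multiVal Q x = multiVal Q y := by
    subst h
    rw [eq_of_heq hxy]
  by_cases h : i = k
  · subst h
    rw [Function.update_self, ← multiVal_d]
    exact key _ _ (by rw [if_pos rfl]) _ _ (PseudoTensorData.dAt_self g i)
  · rw [Function.update_of_ne h]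
    refine key _ _ (by rw [if_neg h, add_zero]) _ _ ?_
    rw [AbComplex.dAt, dif_neg h]
    exact cast_heq _ _

theorem multiVal_castX {I : FinIdx} {X X' : I.α → C} {Y : C} {m : ℤ} (h : ∀ i, X i = X' i)
    (f : ((dgeData Q).P I X Y).X m) (b b' : I.α → ℕ) (hb : ∀ i, b i = b' i) (n : ℕ) :
    multiVal Q ((dgeData Q).castX h f) b n =
      ((tensHom I fun i => eqToHom (h i).symm) ⊗ₘ
        (tensHom I fun i => eqToHom (congrArg (fun k : ℕ => Q.obj ⟨k⟩) (hb i)))) ≫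
        multiVal Q f b' n := by
  obtain rfl : X = X' := funext h
  obtain rfl : b = b' := funext hb
  simp only [eqToHom_refl, tensHom, tensLHom_id, id_tensorHom, MonoidalCategory.whiskerLeft_id,
    Category.id_comp]
  rfl

theorem sum_sigma_fiber {I : FinIdx} {F : I.α → FinIdx} {J : FinIdx} (σ : (Σ i, (F i).α) ≃ J.α)
    (p : J.α → ℤ) : ∑ j, p j = ∑ i, ∑ t, p (σ ⟨i, t⟩) := by
  rw [← σ.sum_comp, Fintype.sum_sigma]

/-- On components the underlying morphisms agree by `deal_assoc` and the signs by `koszul_assoc`;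
the signs of the inner compositions are taken out of the tensor product as a product over `I`. -/
theorem multiComp_assoc {I : FinIdx} {F : I.α → FinIdx} {J : FinIdx} (σ : (Σ i, (F i).α) ≃ J.α)
    {G : J.α → FinIdx} {K : FinIdx} (ρ : (Σ j, (G j).α) ≃ K.α)
    {H : I.α → FinIdx} (τ : ∀ i, (Σ t, (G (σ ⟨i, t⟩)).α) ≃ (H i).α)
    (θ : (Σ i, (H i).α) ≃ K.α) (hθ : ∀ i t s, ρ ⟨σ ⟨i, t⟩, s⟩ = θ ⟨i, τ i ⟨t, s⟩⟩)
    {W : K.α → C} {X : J.α → C} {Y : I.α → C} {Z : C} (n : I.α → ℤ) (p : J.α → ℤ)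
    (f : ∀ (a : I.α → ℕ) (k : ℕ), tens I Y ⊗ cubes Q I a ⟶ Z ⊗ Q.obj ⟨k⟩)
    (g : ∀ (i : I.α) (b : (F i).α → ℕ) (k : ℕ),
      tens (F i) (fun t => X (σ ⟨i, t⟩)) ⊗ cubes Q (F i) b ⟶ Y i ⊗ Q.obj ⟨k⟩)
    (h : ∀ j, ((dgeData Q).P (G j) (fun s => W (ρ ⟨j, s⟩)) (X j)).X (p j)) :
    multiCompFun Q θ (fun i => n i + ∑ t, p (σ ⟨i, t⟩)) f (fun i =>
        multiCompFun Q (τ i) (X := fun r => W (θ ⟨i, r⟩)) (fun t => p (σ ⟨i, t⟩)) (g i) fun t =>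
          multiVal Q ((dgeData Q).castX (fun s => congrArg W (hθ i t s)) (h (σ ⟨i, t⟩)))) =
      (FinIdx.koszul σ n p).negOnePow • multiCompFun Q ρ p (multiCompFun Q σ n f g)
        fun j => multiVal Q (h j) := by
  funext b l
  let c : J.α → ℕ := compDeg ρ p b
  let a : I.α → ℕ := compDeg σ n c
  let B : K.α → C := fun k => Q.obj ⟨b k⟩
  have hR : ((FinIdx.koszul σ n p).negOnePow • multiCompFun Q ρ p (multiCompFun Q σ n f g)
        fun j => multiVal Q (h j)) b l =
      (FinIdx.koszul σ n p + (FinIdx.koszul ρ p (fun k => (b k : ℤ)) +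
          FinIdx.koszul σ n fun j => (c j : ℤ))).negOnePow •
        (tensDeal ρ W B ≫ tensHom J (fun j => multiVal Q (h j) (fun s => b (ρ ⟨j, s⟩)) (c j)) ≫
        (tensLMul X (fun j => Q.obj ⟨c j⟩) J.list).hom ≫ tensDeal σ X (fun j => Q.obj ⟨c j⟩) ≫
        tensHom I (fun i => g i (fun t => c (σ ⟨i, t⟩)) (a i)) ≫
        (tensLMul Y (fun i => Q.obj ⟨a i⟩) I.list).hom ≫ f a l) := by
    rw [Pi.smul_apply, Pi.smul_apply, multiCompFun_eq, multiCompFun_eq]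
    simp only [Units.smul_def, Preadditive.comp_zsmul, smul_smul, ← Units.val_mul,
      ← Int.negOnePow_add]
    rfl
  rw [hR, multiCompFun_eq]
  -- Only for non-negative target dimensions of the `h_j` do the intermediate dimensions of both
  -- sides coincide. Otherwise the component of one `h_j` vanishes, and with it both sides.
  by_cases hc : ∀ j, 0 ≤ p j + ∑ s, (b (ρ ⟨j, s⟩) : ℤ)
  · have hcj (j : J.α) : (c j : ℤ) = p j + ∑ s, (b (ρ ⟨j, s⟩) : ℤ) := Int.toNat_of_nonneg (hc j)
    have hdeg : compDeg θ (fun i => n i + ∑ t, p (σ ⟨i, t⟩)) b = a := by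
      funext i
      simp only [a, compDeg, hcj, Finset.sum_add_distrib, hθ]
      rw [sum_sigma_fiber (τ i) fun r => (b (θ ⟨i, r⟩) : ℤ)]
      congr 1
      ring
    have hdeg2 (i : I.α) : compDeg (τ i) (fun t => p (σ ⟨i, t⟩)) (fun r => b (θ ⟨i, r⟩)) =
        fun t => c (σ ⟨i, t⟩) := by
      funext t
      simp only [c, compDeg, hθ]
    have hin (i : I.α) : multiCompFun Q (τ i) (X := fun r => W (θ ⟨i, r⟩)) (fun t => p (σ ⟨i, t⟩))
        (g i) (fun t => multiVal Q ((dgeData Q).castX (fun s => congrArg W (hθ i t s))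
          (h (σ ⟨i, t⟩)))) (fun r => b (θ ⟨i, r⟩)) (a i) =
        (FinIdx.koszul (τ i) (fun t => p (σ ⟨i, t⟩)) fun r => (b (θ ⟨i, r⟩) : ℤ)).negOnePow •
        (tensDeal (τ i) (fun r => W (θ ⟨i, r⟩)) (fun r => B (θ ⟨i, r⟩)) ≫ (tensHom (F i) fun t =>
          ((tensHom (G (σ ⟨i, t⟩)) fun s => eqToHom (congrArg W (hθ i t s).symm)) ⊗ₘ
          (tensHom (G (σ ⟨i, t⟩)) fun s => eqToHom (congrArg B (hθ i t s).symm))) ≫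
            multiVal Q (h (σ ⟨i, t⟩)) (fun s => b (ρ ⟨σ ⟨i, t⟩, s⟩)) (c (σ ⟨i, t⟩))) ≫
        (tensLMul (fun t => X (σ ⟨i, t⟩)) (fun t => Q.obj ⟨c (σ ⟨i, t⟩)⟩) (F i).list).hom ≫
          g i (fun t => c (σ ⟨i, t⟩)) (a i)) := by
      rw [multiCompFun_eq, hdeg2]
      have e (t : (F i).α) := multiVal_castX Q (fun s => congrArg W (hθ i t s)) (h (σ ⟨i, t⟩))
        (fun s => b (θ ⟨i, τ i ⟨t, s⟩⟩)) (fun s => b (ρ ⟨σ ⟨i, t⟩, s⟩))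
        (fun s => congrArg b (hθ i t s).symm) (c (σ ⟨i, t⟩))
      simp only [e]
      rfl
    rw [hdeg]
    simp only [hin]
    rw [tensHom_smul]
    simp only [Units.smul_def, Preadditive.zsmul_comp, Preadditive.comp_zsmul, smul_smul,
      ← Units.val_mul]
    have hs : (FinIdx.koszul θ (fun i => n i + ∑ t, p (σ ⟨i, t⟩)) fun j => (b j : ℤ)).negOnePow *
        ∏ i, (FinIdx.koszul (τ i) (fun t => p (σ ⟨i, t⟩))
          fun r => (b (θ ⟨i, r⟩) : ℤ)).negOnePow =
        (FinIdx.koszul σ n p + (FinIdx.koszul ρ p (fun k => (b k : ℤ)) +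
          FinIdx.koszul σ n fun j => (c j : ℤ))).negOnePow := by
      have hp (x : I.α → ℤ) : ∏ i, (x i).negOnePow = (∑ i, x i).negOnePow := by
        classical
        induction (Finset.univ : Finset I.α) using Finset.induction_on with
        | empty => simp
        | insert i s hi ih => rw [Finset.prod_insert hi, Finset.sum_insert hi, ih, Int.negOnePow_add]
      rw [hp, ← Int.negOnePow_add]
      simp only [hcj]
      exact FinIdx.koszul_assoc σ ρ τ θ hθ n p fun k => (b k : ℤ)
    have hd := deal_assoc σ ρ τ θ hθ W B X (fun j => Q.obj ⟨c j⟩) (fun i => Y i ⊗ Q.obj ⟨a i⟩)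
      (fun j => multiVal Q (h j) (fun s => b (ρ ⟨j, s⟩)) (c j))
      (fun i => g i (fun t => c (σ ⟨i, t⟩)) (a i))
    rw [hs]
    congr 1
    rw [← reassoc_of% hd]
  · push Not at hc
    obtain ⟨j, hj⟩ := hc
    obtain ⟨⟨i, t⟩, rfl⟩ := σ.surjective j
    have h1 : tensHom J (fun j => multiVal Q (h j) (fun s => b (ρ ⟨j, s⟩)) (c j)) = 0 := by
      refine tensLHom_zero _ (σ ⟨i, t⟩) ?_ _ (J.mem_list _)
      exact (multiVal_mem Q (h (σ ⟨i, t⟩))).1 _ _ (by omega)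
    have h2 (d : ℕ) : multiCompFun Q (τ i) (X := fun r => W (θ ⟨i, r⟩)) (fun t => p (σ ⟨i, t⟩))
        (g i) (fun t => multiVal Q ((dgeData Q).castX (fun s => congrArg W (hθ i t s))
          (h (σ ⟨i, t⟩)))) (fun r => b (θ ⟨i, r⟩)) d = 0 := by
      rw [multiCompFun_eq]
      have : tensHom (F i) (fun t' => multiVal Q ((dgeData Q).castX
          (fun s => congrArg W (hθ i t' s)) (h (σ ⟨i, t'⟩))) (fun s => b (θ ⟨i, τ i ⟨t', s⟩⟩))
          (compDeg (τ i) (fun t => p (σ ⟨i, t⟩)) (fun r => b (θ ⟨i, r⟩)) t')) = 0 := by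
        refine tensLHom_zero _ t ?_ _ ((F i).mem_list _)
        refine (multiVal_mem Q _).1 _ _ ?_
        simp only [hθ] at hj
        omega
      rw [this, Limits.zero_comp, Limits.comp_zero, smul_zero]
    rw [h1, Limits.zero_comp, Limits.comp_zero, smul_zero, tensHom,
      tensLHom_zero _ i (h2 _) _ (I.mem_list i), Limits.zero_comp, Limits.comp_zero, smul_zero]

end PseudoTensor

/-! ### Units, and the pseudo-tensor axioms. -/

theorem iso_inv_eq_id {C : Type u} [Category.{v} C] {X : C} (i : X ≅ X) (h : i.hom = 𝟙 X) :
    i.inv = 𝟙 X := by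
  rw [← cancel_epi i.hom, i.hom_inv_id, h, Category.comp_id]

section Units

variable {C : Type u} [Category.{v} C] [MonoidalCategory C] [SymmetricCategory C]

theorem tensLMul_singleton {J : Type} (A B : J → C) (j : J) :
    (tensLMul A B [j]).hom = 𝟙 (A j ⊗ B j) := by
  have h := rightUnitor_monoidal (A j) (B j)
  have h2 : tensorμ (A j) (B j) (𝟙_ C) (𝟙_ C) ≫ tensorμ (A j) (𝟙_ C) (B j) (𝟙_ C) = 𝟙 _ := by
    rw [← tensorμ_tensorδ (A j) (B j) (𝟙_ C) (𝟙_ C)]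
    congr 1
    simp [tensorμ, tensorδ]
  change (ρ_ (A j ⊗ B j)).inv ≫ (A j ⊗ B j) ◁ (𝟙 (𝟙_ C) ≫ (λ_ (𝟙_ C)).inv ≫ 𝟙 (𝟙_ C) ▷ 𝟙_ C ≫
    𝟙_ C ◁ 𝟙 (𝟙_ C)) ≫ tensorμ (A j) (B j) (𝟙_ C) (𝟙_ C) ≫
    (ρ_ (A j)).hom ▷ (B j ⊗ 𝟙_ C) ≫ A j ◁ (ρ_ (B j)).hom = 𝟙 _
  rw [← MonoidalCategory.tensorHom_def (ρ_ (A j)).hom, h, reassoc_of% h2]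
  simp

theorem tensDeal_sigmaOne (J : FinIdx) (A B : J.α → C) :
    tensDeal (F := fun _ => J) (FinIdx.sigmaOne J) A B = 𝟙 (tens J A ⊗ tens J B) := by
  have h := tensLMul_singleton (fun _ : FinIdx.one.α => tens J A) (fun _ => tens J B) (0 : Fin 1)
  have h2 : (tensLMul (fun _ : FinIdx.one.α => tens J A) (fun _ => tens J B)
      [(0 : Fin 1)]).inv = 𝟙 (tens J A ⊗ tens J B) :=
    iso_inv_eq_id (X := tens J A ⊗ tens J B) _ h
  refine (congrArg₂ (fun x y => (x ⊗ₘ y) ≫ (tensLMul (fun _ : FinIdx.one.α => tens J A)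
    (fun _ => tens J B) [(0 : Fin 1)]).inv) (tensShuffle_sigmaOne J A)
    (tensShuffle_sigmaOne J B)).trans ?_
  exact (congrArg (fun x => x ≫ _) (id_tensorHom_id (tens J A) (tens J B))).trans
    ((Category.id_comp _).trans h2)

theorem tensDeal_sigmaUnit (I : FinIdx) (A B : I.α → C) :
    tensDeal (F := fun _ => FinIdx.one) (FinIdx.sigmaUnit I) A B = (tensLMul A B I.list).inv := by
  refine (congrArg₂ (fun x y => (x ⊗ₘ y) ≫ (tensLMul A B I.list).inv) (tensShuffle_sigmaUnit I A)
    (tensShuffle_sigmaUnit I B)).trans ?_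
  exact (congrArg (fun x => x ≫ _) (id_tensorHom_id (tens I A) (tens I B))).trans
    (Category.id_comp _)

end Units

section PseudoTensor

variable {C : Type u} [Category.{v} C] [Preadditive C] [MonoidalCategory C]
  [MonoidalPreadditive C] [SymmetricCategory C] (Q : ECube ⥤ C)

theorem multiVal_smul {I : FinIdx} {X : I.α → C} {Y : C} {m : ℤ} (s : ℤˣ)
    (x : ((dgeData Q).P I X Y).X m) : multiVal Q (s • x) = s • multiVal Q x := by
  rw [Units.smul_def, Units.smul_def]
  let φ : multiHom Q I X Y m →+ _ := (multiHom Q I X Y m).subtype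
  exact map_zsmul φ s.1 x

/-- With a one-element outer index set there is nothing to shuffle and no sign. This gives the left
unit axiom, the composition of unary elements and the action of `dg_e C` on `P_I`. -/
theorem multiComp_sigmaOne {J : FinIdx} {X : J.α → C} {Y Z : C} (n : ℤ)
    (g : ∀ (a : FinIdx.one.α → ℕ) (k : ℕ),
      tens FinIdx.one (fun _ => Y) ⊗ cubes Q FinIdx.one a ⟶ Z ⊗ Q.obj ⟨k⟩)
    (f : ∀ (b : J.α → ℕ) (k : ℕ), tens J X ⊗ cubes Q J b ⟶ Y ⊗ Q.obj ⟨k⟩)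
    (b : J.α → ℕ) (l : ℕ) :
    multiCompFun Q (F := fun _ => J) (FinIdx.sigmaOne J) (fun _ => n) g (fun _ => f) b l =
      f b (n + ∑ j, (b j : ℤ)).toNat ≫ g (fun _ => (n + ∑ j, (b j : ℤ)).toNat) l := by
  let c := (n + ∑ j, (b j : ℤ)).toNat
  refine (multiCompFun_eq Q (F := fun _ => J) (FinIdx.sigmaOne J) (X := X) (fun _ => n) g
    (fun _ => f) b l).trans ?_
  refine (congrArg (fun s : ℤ => s.negOnePow • _) (FinIdx.koszul_sigmaOne J _ _)).trans ?_
  refine (one_smul ℤˣ _).trans ?_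
  have h1 := tensDeal_sigmaOne J X (fun j => Q.obj ⟨b j⟩)
  have h2 := tensLMul_singleton (fun _ : FinIdx.one.α => Y) (fun _ => Q.obj ⟨c⟩) (0 : Fin 1)
  have h3 := tensHom_one (A := fun _ => tens J X ⊗ cubes Q J b) (B := fun _ => Y ⊗ Q.obj ⟨c⟩)
    (fun _ => f b c)
  refine (congrArg (fun x => x ≫ _) h1).trans ?_
  refine (Category.id_comp _).trans ?_
  refine (congrArg (fun x => x ≫ _) h3).trans ?_
  refine congrArg (fun x => f b c ≫ x) ?_
  refine (congrArg (fun x => x ≫ g (fun _ => c) l) h2).trans ?_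
  exact Category.id_comp _

theorem dgeData_isPseudoTensor : (dgeData Q).IsPseudoTensor where
  comp_add_left {I F J} σ {X Y Z} m n N h f f' g := by
    refine multiVal_ext Q ?_
    funext b k
    change multiCompFun Q σ n (multiVal Q f + multiVal Q f') (fun i => multiVal Q (g i)) b k =
      multiCompFun Q σ n (multiVal Q f) (fun i => multiVal Q (g i)) b k +
      multiCompFun Q σ n (multiVal Q f') (fun i => multiVal Q (g i)) b k
    simp only [multiCompFun_eq, Pi.add_apply, Preadditive.comp_add, smul_add]
  comp_add_right {I F J} σ {X Y Z} m n N h f g k x y := by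
    refine multiVal_ext Q ?_
    funext b l
    have e (z : ((dgeData Q).P (F k) (fun t => X (σ ⟨k, t⟩)) (Y k)).X (n k)) :
        multiCompFun Q σ n (multiVal Q f) (fun i => multiVal Q (Function.update g k z i)) b l =
        (FinIdx.koszul σ n fun j => (b j : ℤ)).negOnePow •
        (tensDeal σ X (fun j => Q.obj ⟨b j⟩) ≫
        tensHomAt I (fun i => multiVal Q (g i) (fun t => b (σ ⟨i, t⟩)) (compDeg σ n b i)) k
          (multiVal Q z (fun t => b (σ ⟨k, t⟩)) (compDeg σ n b k)) ≫
        (tensLMul Y (fun i => Q.obj ⟨compDeg σ n b i⟩) I.list).hom ≫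
          multiVal Q f (compDeg σ n b) l) := by
      rw [multiCompFun_eq]
      congr 3
      refine tensLHom_congr fun i _ => ?_
      by_cases hi : i = k
      · subst hi
        rw [Function.update_self, Function.update_self]
      · rw [Function.update_of_ne hi, Function.update_of_ne hi]
    refine (e (x + y)).trans (Eq.trans ?_ (congrArg₂ (· + ·) (e x) (e y)).symm)
    have hxy : multiVal Q (x + y) (fun t => b (σ ⟨k, t⟩)) (compDeg σ n b k) =
      multiVal Q x (fun t => b (σ ⟨k, t⟩)) (compDeg σ n b k) +
        multiVal Q y (fun t => b (σ ⟨k, t⟩)) (compDeg σ n b k) := rfl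
    rw [hxy, map_add]
    simp only [Preadditive.comp_add, Preadditive.add_comp, smul_add]
  d_comp {I F J} σ {X Y Z} m n N h f g := by
    refine multiVal_ext Q ?_
    have h1 := multiComp_d Q σ h (multiVal Q f) (fun i => multiVal_mem Q (g i))
    refine (multiVal_d Q _).trans (h1.trans ?_)
    have h2 : ∀ k, multiVal Q ((dgeData Q).comp σ m _ (N + 1) (AbComplex.sum_dAt h k) f
        (AbComplex.dAt g k)) = multiCompFun Q σ (fun i => n i + if i = k then 1 else 0)
          (multiVal Q f) (Function.update (fun i => multiVal Q (g i)) k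
            (multiD Q (F k) _ (Y k) (n k) (multiVal Q (g k)))) := fun k =>
      congrArg (multiCompFun Q σ (fun i => n i + if i = k then 1 else 0) (multiVal Q f))
        (multiVal_dAt Q (X := fun i t => X (σ ⟨i, t⟩)) g k)
    have h3 : multiVal Q ((dgeData Q).comp σ (m + 1) n (N + 1) (by omega)
        (((dgeData Q).P I Y Z).d m (m + 1) f) g) =
        multiCompFun Q σ n (multiD Q I Y Z m (multiVal Q f)) (fun i => multiVal Q (g i)) :=
      congrArg (fun z => multiCompFun Q σ n z (fun i => multiVal Q (g i))) (multiVal_d Q f)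
    simp only [← h2, ← h3]
    have h4 (s : I.α → ℤˣ) (x : I.α → ((dgeData Q).P J X Z).X (N + 1))
        (y : ((dgeData Q).P J X Z).X (N + 1)) :
        multiVal Q y + ∑ k, s k • multiVal Q (x k) = multiVal Q (y + ∑ k, s k • x k) := by
      let φ : multiHom Q J X Z (N + 1) →+ _ := (multiHom Q J X Z (N + 1)).subtype
      have hs (k : I.α) : s k • multiVal Q (x k) = φ (s k • x k) := (multiVal_smul Q _ _).symm
      simp only [hs]
      exact ((map_add φ y (∑ k, s k • x k)).trans
        (congrArg (φ y + ·) (map_sum φ (fun k => s k • x k) Finset.univ))).symm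
    exact h4 _ _ _
  assoc {I F J} σ {G K} ρ {H} τ θ hθ {W X Y Z} m n p q M N hq hN' hM hN f g h := by
    refine multiVal_ext Q ?_
    obtain rfl : (fun i => n i + ∑ t, p (σ ⟨i, t⟩)) = q := funext hq
    refine (multiComp_assoc Q σ ρ τ θ hθ n p (multiVal Q f) (fun i => multiVal Q (g i)) h).trans ?_
    exact (multiVal_smul Q _
      ((dgeData Q).comp ρ M p N hN ((dgeData Q).comp σ m n M hM f g) h)).symm
  id_comp {J X Y} n h f := by
    refine multiVal_ext Q ?_
    funext b l
    refine (multiComp_sigmaOne Q n (unFun Q (dgeIdFun Q Y)) (multiVal Q f) b l).trans ?_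
    -- The identity family has only diagonal components. Off the diagonal `f` itself vanishes for
    -- degree reasons.
    by_cases hl : (n + ∑ j, (b j : ℤ)).toNat = l
    · subst hl
      refine (congrArg (fun z => multiVal Q f b _ ≫ z) (dgeIdFun_self Q Y _)).trans ?_
      exact (multiVal_mem Q f).2.2 _ _
    · refine (congrArg (fun z => multiVal Q f b _ ≫ z) (dgeIdFun_ne Q Y hl)).trans ?_
      rw [Limits.comp_zero, (multiVal_mem Q f).1 b l (by omega)]
  comp_id {I X Y} m h f := by
    refine multiVal_ext Q ?_
    funext b l
    refine (multiCompFun_eq Q (F := fun _ => FinIdx.one) (FinIdx.sigmaUnit I) (fun _ => 0)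
      (multiVal Q f) (fun i => unFun Q (dgeIdFun Q (X i))) b l).trans ?_
    have h0 : compDeg (F := fun _ => FinIdx.one) (FinIdx.sigmaUnit I) (fun _ => 0) b = b := by
      funext i
      have : ∑ t : FinIdx.one.α, (b (FinIdx.sigmaUnit I ⟨i, t⟩) : ℤ) = b i := sum_one_eq _
      rw [compDeg, this]
      omega
    rw [h0, FinIdx.koszul_sigmaUnit, Int.negOnePow_zero, one_smul]
    refine (congrArg (fun x => x ≫ _) (tensDeal_sigmaUnit I X fun i => Q.obj ⟨b i⟩)).trans ?_
    have h1 : (tensHom I fun i => dgeIdFun Q (X i) (b i) (b i)) =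
        tensHom I fun i => X i ◁ cubeE Q (b i) :=
      tensLHom_congr fun i _ => dgeIdFun_self Q (X i) (b i)
    have h2 := tensLMul_natural_right (A := X) (fun i => cubeE Q (b i)) I.list
    have h3 : (tensHom I fun i => X i ◁ cubeE Q (b i)) ≫
        (tensLMul X (fun i => Q.obj ⟨b i⟩) I.list).hom ≫ multiVal Q f b l =
        (tensLMul X (fun i => Q.obj ⟨b i⟩) I.list).hom ≫ multiVal Q f b l := by
      rw [reassoc_of% h2]
      exact congrArg ((tensLMul X (fun i => Q.obj ⟨b i⟩) I.list).hom ≫ ·)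
        ((multiVal_mem Q f).2.1 b l)
    refine (congrArg (fun x => (tensLMul X (fun i => Q.obj ⟨b i⟩) I.list).inv ≫ x ≫
      (tensLMul X (fun i => Q.obj ⟨b i⟩) I.list).hom ≫ multiVal Q f b l) h1).trans ?_
    exact ((Iso.inv_comp_eq (tensLMul X (fun i => Q.obj ⟨b i⟩) I.list)).2 h3)
  un_comp {X Y Z} p q n h h' g f := by
    refine multiVal_ext Q ?_
    funext b l
    refine Eq.trans ?_ (multiComp_sigmaOne Q (J := FinIdx.one) (X := fun _ => X) q
      (unFun Q (g : dgeHom Q Y Z p).1) (unFun Q (f : dgeHom Q X Y q).1) b l).symm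
    rw [sum_one_eq]
    rfl

end PseudoTensor

/-! ### Homology of complexes of abelian groups in terms of elements. -/

section Homology

open HomologicalComplex

variable {ι : Type*} {c : ComplexShape ι} {K L : HomologicalComplex AddCommGrpCat.{v} c}

theorem exists_cycle (K : HomologicalComplex AddCommGrpCat.{v} c) {j k : ι} (hk : c.next j = k)
    (x : K.X j) (hx : K.d j k x = 0) : ∃ z : K.cycles j, K.iCycles j z = x := by
  let γ : AddCommGrpCat.of (K.d j k).hom.ker ⟶ K.X j :=
    AddCommGrpCat.ofHom (K.d j k).hom.ker.subtype
  have hγ : γ ≫ K.d j k = 0 := by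
    ext y
    exact y.2
  refine ⟨K.liftCycles γ k hk hγ ⟨x, hx⟩, ?_⟩
  rw [← ConcreteCategory.comp_apply, liftCycles_i]
  rfl

/-- A zero homology class bounds after a refinement; for abelian groups a refinement is a
surjection, and a preimage of the given cycle can be chosen. -/
theorem exists_boundary (K : HomologicalComplex AddCommGrpCat.{v} c) {i j : ι} (hi : c.prev j = i)
    (z : K.cycles j) (hz : K.homologyπ j z = 0) : ∃ w : K.X i, K.iCycles j z = K.d i j w := by
  let γ : AddCommGrpCat.of (K.homologyπ j).hom.ker ⟶ K.cycles j :=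
    AddCommGrpCat.ofHom (K.homologyπ j).hom.ker.subtype
  have hγ : γ ≫ K.homologyπ j = 0 := by
    ext y
    exact y.2
  obtain ⟨A, π, hπ, w, hw⟩ := (K.comp_homologyπ_eq_zero_iff_up_to_refinements i j hi γ).1 hγ
  obtain ⟨a, ha⟩ := (AddCommGrpCat.epi_iff_surjective π).1 hπ ⟨z, hz⟩
  refine ⟨w a, ?_⟩
  have h := congrArg (fun f => K.iCycles j (f a)) hw
  simp only [ConcreteCategory.comp_apply, ha] at h
  refine h.trans ?_
  rw [← ConcreteCategory.comp_apply, toCycles_i]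

theorem exists_of_epi_homologyMap (φ : K ⟶ L) {i j k : ι} (hi : c.prev j = i) (hk : c.next j = k)
    [Epi (homologyMap φ j)] (y : L.X j) (hy : L.d j k y = 0) :
    ∃ (x : K.X j) (w : L.X i), K.d j k x = 0 ∧ y = φ.f j x + L.d i j w := by
  obtain ⟨z, rfl⟩ := exists_cycle L hk y hy
  obtain ⟨h, hh⟩ := (AddCommGrpCat.epi_iff_surjective (homologyMap φ j)).1 inferInstance
    (L.homologyπ j z)
  obtain ⟨x, rfl⟩ := (AddCommGrpCat.epi_iff_surjective (K.homologyπ j)).1 inferInstance h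
  rw [← ConcreteCategory.comp_apply, homologyπ_naturality, ConcreteCategory.comp_apply] at hh
  obtain ⟨w, hw⟩ := exists_boundary L hi (z - cyclesMap φ j x) (by rw [map_sub, hh, sub_self])
  refine ⟨K.iCycles j x, w, by rw [← ConcreteCategory.comp_apply, iCycles_d]; rfl, ?_⟩
  rw [← hw, map_sub, ← ConcreteCategory.comp_apply, ← ConcreteCategory.comp_apply, cyclesMap_i]
  exact (add_sub_cancel _ _).symm

theorem isIso_homologyMap_of_elements (φ : K ⟶ L) {i j k : ι} (hi : c.prev j = i)
    (hk : c.next j = k)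
    (hsurj : ∀ y : L.X j, L.d j k y = 0 →
      ∃ (x : K.X j) (w : L.X i), K.d j k x = 0 ∧ y = φ.f j x + L.d i j w)
    (hinj : ∀ (x : K.X j) (w : L.X i), K.d j k x = 0 → φ.f j x = L.d i j w →
      ∃ v : K.X i, x = K.d i j v) : IsIso (homologyMap φ j) := by
  have hinj' (M : HomologicalComplex AddCommGrpCat.{v} c) :
      Function.Injective (M.iCycles j) :=
    (AddCommGrpCat.mono_iff_injective (M.iCycles j)).1 inferInstance
  have hd (M : HomologicalComplex AddCommGrpCat.{v} c) (z : M.cycles j) :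
      M.d j k (M.iCycles j z) = 0 := by
    rw [← ConcreteCategory.comp_apply, iCycles_d]
    rfl
  have hb (M : HomologicalComplex AddCommGrpCat.{v} c) (w : M.X i) (z : M.cycles j)
      (h : M.iCycles j z = M.d i j w) : M.homologyπ j z = 0 := by
    have : z = M.toCycles i j w := hinj' M (by
      rw [h, ← ConcreteCategory.comp_apply, toCycles_i])
    rw [this, ← ConcreteCategory.comp_apply, toCycles_comp_homologyπ]
    rfl
  have h1 : Epi (homologyMap φ j) := by
    refine (AddCommGrpCat.epi_iff_surjective _).2 fun h => ?_
    obtain ⟨z, rfl⟩ := (AddCommGrpCat.epi_iff_surjective (L.homologyπ j)).1 inferInstance h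
    obtain ⟨x, w, hx, hw⟩ := hsurj _ (hd L z)
    obtain ⟨x, rfl⟩ := exists_cycle K hk x hx
    refine ⟨K.homologyπ j x, ?_⟩
    rw [← ConcreteCategory.comp_apply, homologyπ_naturality, ConcreteCategory.comp_apply, eq_comm,
      ← sub_eq_zero, ← map_sub]
    refine hb L w _ ?_
    rw [map_sub, hw, sub_eq_iff_eq_add, ← ConcreteCategory.comp_apply,
      ← ConcreteCategory.comp_apply, cyclesMap_i, add_comm]
  have h2 : Mono (homologyMap φ j) := by
    refine (AddCommGrpCat.mono_iff_injective _).2 ((injective_iff_map_eq_zero _).2 fun h h0 => ?_)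
    obtain ⟨x, rfl⟩ := (AddCommGrpCat.epi_iff_surjective (K.homologyπ j)).1 inferInstance h
    rw [← ConcreteCategory.comp_apply, homologyπ_naturality, ConcreteCategory.comp_apply] at h0
    obtain ⟨w, hw⟩ := exists_boundary L hi _ h0
    rw [← ConcreteCategory.comp_apply, cyclesMap_i, ConcreteCategory.comp_apply] at hw
    obtain ⟨u, hu⟩ := hinj _ w (hd K x) hw
    exact hb K u x hu
  exact isIso_of_mono_of_epi _

end Homology

/-! ### The maximum map on cubes. -/

namespace ECube

/-- Up to permutations of the coordinates the map is the product of the maximum `{0,1}² → {0,1}`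
with an identity. As `n = m + 1`, the injection `r` misses exactly the coordinate `A`. -/
theorem isECubeMap_of_injective {n m : ℕ} (r : Fin m → Fin n) (hr : Function.Injective r)
    (A : Fin n) (hA : ∀ j, r j ≠ A) (hn : n = m + 1) (i : Fin m) :
    IsECubeMap (fun (y : Fin n → Bool) (j : Fin m) => if j = i then y (r j) || y A else y (r j)) := by
  subst hn
  obtain ⟨k, rfl⟩ : ∃ k, m = k + 1 := ⟨m - 1, by have := i.isLt; omega⟩
  -- De Morgan: the maximum is obtained from the multiplication by conjugating with the involutions.
  -- Here the extended structure of the cube category enters.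
  have hor : IsECubeMap (fun (y : Fin 2 → Bool) (_ : Fin 1) => y 0 || y 1) := by
    have h := (((IsECubeMap.invol 2 0).comp (.invol 2 1)).comp .mul).comp (.invol 1 0)
    convert h using 3 with y j
    obtain rfl : j = 0 := Subsingleton.elim _ _
    simp
  have hprod := hor.prod (.id k)
  -- The two coordinates `r i` and `A` which are to be merged come first; the others follow in the
  -- order obtained by exchanging `0` and `i`.
  let s : Fin (2 + k) ≃ Fin (k + 1 + 1) := Equiv.ofBijective
    (Fin.addCases (fun l : Fin 2 => if l = 0 then r i else A)
      fun l : Fin k => r (Equiv.swap 0 i l.succ)) (by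
    rw [Fintype.bijective_iff_injective_and_card]
    refine ⟨?_, by simp; omega⟩
    have hne (l : Fin k) : Equiv.swap 0 i l.succ ≠ i := by
      intro h
      rw [Equiv.swap_apply_eq_iff, Equiv.swap_apply_right] at h
      exact Fin.succ_ne_zero _ h
    intro x y
    refine Fin.addCases (fun x => ?_) (fun x => ?_) x <;>
    refine Fin.addCases (fun y => ?_) (fun y => ?_) y
    · simp only [Fin.addCases_left]
      intro h
      split_ifs at h with h1 h2 h2
      · rw [h1, h2]
      · exact absurd h (hA i)
      · exact absurd h.symm (hA i)
      · congr 1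
        omega
    · simp only [Fin.addCases_left, Fin.addCases_right]
      intro h
      split_ifs at h with h1
      · exact absurd (hr h).symm (hne y)
      · exact absurd h.symm (hA _)
    · simp only [Fin.addCases_left, Fin.addCases_right]
      intro h
      split_ifs at h with h1
      · exact absurd (hr h) (hne x)
      · exact absurd h (hA _)
    · simp only [Fin.addCases_right]
      intro h
      rw [Fin.succ_injective _ ((Equiv.swap 0 i).injective (hr h))])
  let t : Fin (k + 1) ≃ Fin (1 + k) := (Equiv.swap 0 i).trans (finCongr (Nat.add_comm k 1))
  have h := ((isECubeMap_equiv s).comp hprod).comp (isECubeMap_equiv t)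
  convert h using 3 with y j
  obtain ⟨l, rfl⟩ := (Equiv.swap 0 i).surjective j
  refine Fin.cases ?_ (fun l => ?_) l
  · have e : t (Equiv.swap 0 i 0) = Fin.castAdd k 0 := by
      simp only [t, Equiv.trans_apply, Equiv.swap_apply_self]
      rfl
    rw [e, Fin.append_left, Equiv.swap_apply_left, if_pos rfl]
    simp [s]
  · have e : t (Equiv.swap 0 i l.succ) = Fin.natAdd 1 l := by
      simp only [t, Equiv.trans_apply, Equiv.swap_apply_self]
      ext
      simp [add_comm]
    have hne : Equiv.swap 0 i l.succ ≠ i := by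
      intro h
      rw [Equiv.swap_apply_eq_iff, Equiv.swap_apply_right] at h
      exact Fin.succ_ne_zero _ h
    rw [e, Fin.append_right, if_neg hne]
    simp [s]

/-- The map `{0,1}^{a+1} × {0,1}^m → {0,1}^a × {0,1}^m` which removes the last coordinate of the
first factor and replaces the coordinate `i` of the second factor by its maximum with it. -/
def absorb (a m : ℕ) (i : Fin m) : (⟨a + 1 + m⟩ : ECube) ⟶ ⟨a + m⟩ :=
  ⟨_, isECubeMap_of_injective (n := a + 1 + m) (m := a + m)
    (Fin.addCases (fun j => Fin.castAdd m j.castSucc) (Fin.natAdd (a + 1))) (by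
      intro x y
      refine Fin.addCases (fun x => ?_) (fun x => ?_) x <;>
      refine Fin.addCases (fun y => ?_) (fun y => ?_) y <;>
      simp only [Fin.addCases_left, Fin.addCases_right, Fin.ext_iff, Fin.val_castAdd,
        Fin.val_natAdd, Fin.val_castSucc] <;> omega)
    (Fin.castAdd m (Fin.last a)) (by
      intro x
      refine Fin.addCases (fun x => ?_) (fun x => ?_) x <;>
      simp only [Fin.addCases_left, Fin.addCases_right, Fin.ext_iff, Fin.val_castAdd,
        Fin.val_natAdd, Fin.val_castSucc, Fin.val_last, ne_eq] <;> omega) (by omega) (Fin.natAdd a i)⟩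

theorem absorb_left (a m : ℕ) (i : Fin m) (y : Fin (a + 1 + m) → Bool) (j : Fin a) :
    Hom.fn (absorb a m i) y (Fin.castAdd m j) = y (Fin.castAdd m j.castSucc) := by
  have h : Fin.castAdd m j ≠ Fin.natAdd a i := by
    rw [Ne, Fin.ext_iff, Fin.val_castAdd, Fin.val_natAdd]
    omega
  refine (if_neg h).trans ?_
  rw [Fin.addCases_left]

theorem absorb_right (a m : ℕ) (i : Fin m) (y : Fin (a + 1 + m) → Bool) (j : Fin m) :
    Hom.fn (absorb a m i) y (Fin.natAdd a j) = if j = i then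
      y (Fin.natAdd (a + 1) j) || y (Fin.castAdd m (Fin.last a)) else y (Fin.natAdd (a + 1) j) := by
  change (if Fin.natAdd a j = Fin.natAdd a i then _ else _) = _
  simp only [Fin.addCases_right, Fin.natAdd_inj]

end ECube

/-! ### The contraction of the first cube by the maximum map. -/

section Absorb

variable {C : Type u} [Category.{v} C] [Preadditive C] [MonoidalCategory C]
  [MonoidalPreadditive C] [SymmetricCategory C] {Q : ECube ⥤ C} {e : Q.obj ⟨0⟩ ≅ 𝟙_ C}

/-- The maximum with `0` changes nothing, and the maximum with `1` is the constant `1`. -/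
theorem ECube.prod_face_absorb_last (a m : ℕ) (i : Fin m) (ε : Bool) :
    ECube.prod (ECube.face a (Fin.last a) ε) (𝟙 (⟨m⟩ : ECube)) ≫ ECube.absorb a m i =
      if ε then ECube.prod (𝟙 (⟨a⟩ : ECube)) (ECube.setOne m i) else 𝟙 _ := by
  ext1 y
  change ECube.Hom.fn (ECube.absorb a m i) (ECube.Hom.fn (ECube.prod _ _) y) = _
  funext j
  have hf (x : Fin a → Bool) : ECube.Hom.fn (ECube.face a (Fin.last a) ε) x =
    Fin.insertNth (α := fun _ => Bool) (Fin.last a) ε x := rfl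
  refine Fin.addCases (fun j => ?_) (fun j => ?_) j
  · rw [ECube.absorb_left]
    change Fin.append _ _ _ = _
    rw [Fin.append_left, hf, ← Fin.succAbove_last_apply, Fin.insertNth_apply_succAbove]
    split_ifs
    · change _ = Fin.append _ _ _
      rw [Fin.append_left]
      rfl
    · rfl
  · rw [ECube.absorb_right]
    change (if j = i then Fin.append _ _ _ || Fin.append _ _ _ else Fin.append _ _ _) = _
    rw [Fin.append_right, Fin.append_left, hf, Fin.insertNth_apply_same]
    split_ifs with h1 h2 h2
    · subst h1 h2
      change _ = Fin.append _ _ _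
      rw [Fin.append_right, ECube.setOne_fn, Function.update_self, Bool.or_true]
    · simp only [Bool.not_eq_true] at h2
      rw [h2, Bool.or_false]
      rfl
    · change _ = Fin.append _ _ _
      rw [Fin.append_right, ECube.setOne_fn, Function.update_of_ne h1]
      rfl
    · rfl

/-- Only the last coordinate is merged, so inserting another one before it commutes with the
merging. -/
theorem ECube.prod_face_absorb (a m : ℕ) (i : Fin m) (k : Fin (a + 1)) (ε : Bool) :
    ECube.prod (ECube.face (a + 1) k.castSucc ε) (𝟙 (⟨m⟩ : ECube)) ≫ ECube.absorb (a + 1) m i =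
      ECube.absorb a m i ≫ ECube.prod (ECube.face a k ε) (𝟙 (⟨m⟩ : ECube)) := by
  ext1 y
  change ECube.Hom.fn (ECube.absorb (a + 1) m i) (ECube.Hom.fn (ECube.prod _ _) y) =
    ECube.Hom.fn (ECube.prod _ _) (ECube.Hom.fn (ECube.absorb a m i) y)
  funext j
  have hf (n : ℕ) (k : Fin (n + 1)) (x : Fin n → Bool) : ECube.Hom.fn (ECube.face n k ε) x =
    Fin.insertNth (α := fun _ => Bool) k ε x := rfl
  refine Fin.addCases (fun j => ?_) (fun j => ?_) j
  · rw [ECube.absorb_left]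
    change Fin.append _ _ _ = Fin.append _ _ _
    rw [Fin.append_left, Fin.append_left, hf, hf]
    refine Fin.succAboveCases k ?_ (fun j => ?_) j
    · rw [Fin.insertNth_apply_same, Fin.insertNth_apply_same]
    · rw [Fin.insertNth_apply_succAbove, ← Fin.castSucc_succAbove_castSucc,
        Fin.insertNth_apply_succAbove, ECube.absorb_left]
  · rw [ECube.absorb_right]
    change (if j = i then Fin.append _ _ _ || Fin.append _ _ _ else Fin.append _ _ _) =
      Fin.append _ _ _
    have h1 : Fin.last (a + 1) = k.castSucc.succAbove (Fin.last a) := by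
      rw [Fin.succAbove_of_le_castSucc, Fin.succ_last]
      simpa [Fin.le_def] using Fin.le_last k
    rw [Fin.append_right, Fin.append_right, Fin.append_left, hf, h1,
      Fin.insertNth_apply_succAbove]
    exact (ECube.absorb_right a m i y j).symm

/-- The morphism `□^{a+1} ⊗ □^m ⟶ □^a ⊗ □^m` given by `absorb`. -/
def CubeBimul.absorb (B : CubeBimul Q e) (a m : ℕ) (i : Fin m) :
    Q.obj ⟨a + 1⟩ ⊗ Q.obj ⟨m⟩ ⟶ Q.obj ⟨a⟩ ⊗ Q.obj ⟨m⟩ :=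
  B.mul.hom (a + 1) m ≫ Q.map (ECube.absorb a m i) ≫ B.comul.split a m

theorem CubeBimul.face_mul (B : CubeBimul Q e) (a m : ℕ) (k : Fin (a + 1)) (ε : Bool) :
    Q.map (ECube.face a k ε) ▷ Q.obj ⟨m⟩ ≫ B.mul.hom (a + 1) m =
      B.mul.hom a m ≫ Q.map (ECube.prod (ECube.face a k ε) (𝟙 (⟨m⟩ : ECube))) := by
  rw [← B.mul.natural, Q.map_id, tensorHom_id]

/-- Transported from the naturality of `μ` through the inverse isomorphisms. -/
theorem CubeBimul.split_natural (B : CubeBimul Q e) {n m n' m' : ℕ} (f : (⟨n⟩ : ECube) ⟶ ⟨m⟩)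
    (g : (⟨n'⟩ : ECube) ⟶ ⟨m'⟩) : Q.map (ECube.prod f g) ≫ B.comul.split m m' =
      B.comul.split n n' ≫ (Q.map f ⊗ₘ Q.map g) := by
  have h : B.mul.hom n n' ≫ Q.map (ECube.prod f g) ≫ B.comul.split m m' = Q.map f ⊗ₘ Q.map g := by
    rw [← Category.assoc, ← B.mul.natural, Category.assoc, B.mul_split, Category.comp_id]
  rw [← h, ← Category.assoc (B.comul.split n n'), B.split_mul, Category.id_comp]

theorem CubeBimul.face_last_absorb (B : CubeBimul Q e) (a m : ℕ) (i : Fin m) :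
    Q.map (ECube.face a (Fin.last a) true) ▷ Q.obj ⟨m⟩ ≫ B.absorb a m i =
      Q.obj ⟨a⟩ ◁ Q.map (ECube.setOne m i) := by
  have h := B.face_mul a m (Fin.last a) true
  rw [CubeBimul.absorb, reassoc_of% h, ← Q.map_comp_assoc, ECube.prod_face_absorb_last, if_pos rfl,
    B.split_natural, ← Category.assoc, B.mul_split, Category.id_comp, Q.map_id, id_tensorHom]

theorem CubeBimul.face_last_absorb' (B : CubeBimul Q e) (a m : ℕ) (i : Fin m) :
    Q.map (ECube.face a (Fin.last a) false) ▷ Q.obj ⟨m⟩ ≫ B.absorb a m i = 𝟙 _ := by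
  have h := B.face_mul a m (Fin.last a) false
  rw [CubeBimul.absorb, reassoc_of% h, ← Q.map_comp_assoc, ECube.prod_face_absorb_last,
    if_neg Bool.false_ne_true, Q.map_id, Category.id_comp, B.mul_split]

theorem CubeBimul.face_absorb (B : CubeBimul Q e) (a m : ℕ) (i : Fin m) (k : Fin (a + 1))
    (ε : Bool) : Q.map (ECube.face (a + 1) k.castSucc ε) ▷ Q.obj ⟨m⟩ ≫ B.absorb (a + 1) m i =
      B.absorb a m i ≫ Q.map (ECube.face a k ε) ▷ Q.obj ⟨m⟩ := by
  have h := B.face_mul (a + 1) m k.castSucc ε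
  rw [CubeBimul.absorb, reassoc_of% h, ← Q.map_comp_assoc, ECube.prod_face_absorb, Q.map_comp,
    Category.assoc, B.split_natural, Q.map_id, tensorHom_id, CubeBimul.absorb, Category.assoc,
    Category.assoc]

theorem whiskerRight_zsmul' {X Y : C} (s : ℤ) (f : X ⟶ Y) (Z : C) : (s • f) ▷ Z = s • f ▷ Z :=
  (tensorRight Z).map_zsmul

theorem whiskerRight_sub' {X Y : C} (f g : X ⟶ Y) (Z : C) : (f - g) ▷ Z = f ▷ Z - g ▷ Z :=
  (tensorRight Z).map_sub

theorem cubeD_whiskerRight (n : ℕ) (Z : C) : cubeD Q n ▷ Z = ∑ i : Fin (n + 1),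
    (-1 : ℤ) ^ ((i : ℕ) + 1) • (Q.map (ECube.face n i true) ▷ Z -
      Q.map (ECube.face n i false) ▷ Z) := by
  rw [cubeD, sum_whiskerRight]
  simp only [whiskerRight_zsmul', whiskerRight_sub']

theorem CubeBimul.cubeD_absorb_zero (B : CubeBimul Q e) (m : ℕ) (i : Fin m) :
    cubeD Q 0 ▷ Q.obj ⟨m⟩ ≫ B.absorb 0 m i = 𝟙 _ - Q.obj ⟨0⟩ ◁ Q.map (ECube.setOne m i) := by
  have h1 := B.face_last_absorb 0 m i
  have h2 := B.face_last_absorb' 0 m i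
  rw [cubeD_whiskerRight, Fin.sum_univ_one, Preadditive.zsmul_comp, Preadditive.sub_comp]
  simp only [Fin.last_zero] at h1 h2
  rw [h1, h2]
  simp

/-- The two faces in the last direction give `setOne` and the identity, the others commute with
`absorb` and reassemble to `d`. On morphisms which vanish after `setOne`, precomposition with
`absorb` is therefore, up to sign, a contracting homotopy. -/
theorem CubeBimul.cubeD_absorb_succ (B : CubeBimul Q e) (a m : ℕ) (i : Fin m) :
    cubeD Q (a + 1) ▷ Q.obj ⟨m⟩ ≫ B.absorb (a + 1) m i =
      (-1 : ℤ) ^ a • (Q.obj ⟨a + 1⟩ ◁ Q.map (ECube.setOne m i) - 𝟙 _) +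
        B.absorb a m i ≫ cubeD Q a ▷ Q.obj ⟨m⟩ := by
  rw [cubeD_whiskerRight, cubeD_whiskerRight, Fin.sum_univ_castSucc]
  simp only [Preadditive.add_comp, Preadditive.sum_comp, Preadditive.comp_sum,
    Preadditive.zsmul_comp, Preadditive.comp_zsmul, Preadditive.sub_comp, Preadditive.comp_sub,
    B.face_last_absorb, B.face_last_absorb', B.face_absorb, Fin.val_castSucc, Fin.val_last]
  have hs : (-1 : ℤ) ^ (a + 1 + 1) = (-1) ^ a := by rw [pow_succ, pow_succ]; simp
  rw [hs]
  exact add_comm _ _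

end Absorb

/-! ### Exactness in the direction of one cube. -/

section Contraction

variable {C : Type u} [Category.{v} C] [Preadditive C] [MonoidalCategory C]
  [MonoidalPreadditive C] [SymmetricCategory C] {Q : ECube ⥤ C} {e : Q.obj ⟨0⟩ ≅ 𝟙_ C}

/-- A morphism of the two middle factors of `V ⊗ (S ⊗ (T ⊗ R))`. -/
def spread (V R : C) {S T S' T' : C} (f : S ⊗ T ⟶ S' ⊗ T') :
    V ⊗ (S ⊗ (T ⊗ R)) ⟶ V ⊗ (S' ⊗ (T' ⊗ R)) :=
  V ◁ ((α_ S T R).inv ≫ f ▷ R ≫ (α_ S' T' R).hom)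

theorem spread_comp (V R : C) {S T S' T' S'' T'' : C} (f : S ⊗ T ⟶ S' ⊗ T')
    (g : S' ⊗ T' ⟶ S'' ⊗ T'') : spread V R (f ≫ g) = spread V R f ≫ spread V R g := by
  simp [spread]

theorem spread_id (V R S T : C) : spread V R (𝟙 (S ⊗ T)) = 𝟙 _ := by
  simp [spread]

theorem spread_add (V R : C) {S T S' T' : C} (f g : S ⊗ T ⟶ S' ⊗ T') :
    spread V R (f + g) = spread V R f + spread V R g := by
  simp [spread]

theorem spread_sub (V R : C) {S T S' T' : C} (f g : S ⊗ T ⟶ S' ⊗ T') :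
    spread V R (f - g) = spread V R f - spread V R g := by
  rw [eq_sub_iff_add_eq, ← spread_add, sub_add_cancel]

theorem spread_zsmul (V R : C) {S T S' T' : C} (s : ℤ) (f : S ⊗ T ⟶ S' ⊗ T') :
    spread V R (s • f) = s • spread V R f :=
  map_zsmul (AddMonoidHom.mk' (spread V R (S := S) (T := T)) (spread_add V R)) s f

theorem spread_whiskerRight (V R : C) {S S' : C} (f : S ⟶ S') (T : C) :
    spread V R (f ▷ T) = V ◁ (f ▷ (T ⊗ R)) := by
  rw [spread, associator_naturality_left, Iso.inv_hom_id_assoc]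

theorem spread_whiskerLeft (V R : C) (S : C) {T T' : C} (f : T ⟶ T') :
    spread V R (S ◁ f) = V ◁ (S ◁ (f ▷ R)) := by
  simp [spread]

/-- Exactness at the spot `a`: the preimage is `φ` precomposed with `absorb`. The hypothesis `h1`
kills the term with `setOne`, and `h2` kills the term in which `d` meets `φ`. The index `i : Fin m`
ensures that `m ≥ 1`. -/
theorem CubeBimul.exists_cubeStep_comp (B : CubeBimul Q e) {V R W : C} {a a' m : ℕ} (i : Fin m)
    (φ : V ⊗ (Q.obj ⟨a⟩ ⊗ (Q.obj ⟨m⟩ ⊗ R)) ⟶ W)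
    (h1 : V ◁ (Q.obj ⟨a⟩ ◁ (Q.map (ECube.setOne m i) ▷ R)) ≫ φ = 0)
    (h2 : ∀ c, V ◁ (cubeStep Q c a ▷ (Q.obj ⟨m⟩ ⊗ R)) ≫ φ = 0) (ha : a + 1 = a') :
    ∃ ψ : V ⊗ (Q.obj ⟨a'⟩ ⊗ (Q.obj ⟨m⟩ ⊗ R)) ⟶ W,
      V ◁ (cubeStep Q a a' ▷ (Q.obj ⟨m⟩ ⊗ R)) ≫ ψ = φ := by
  subst ha
  rw [cubeStep_succ, ← spread_whiskerRight]
  rw [← spread_whiskerLeft] at h1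
  obtain _ | a := a
  · refine ⟨spread V R (B.absorb 0 m i) ≫ φ, ?_⟩
    rw [← Category.assoc, ← spread_comp, B.cubeD_absorb_zero, spread_sub, spread_id,
      Preadditive.sub_comp, h1, Category.id_comp, sub_zero]
  -- The scalar compensates the coefficient `(-1)^a` and the sign of the identity in
  -- `cubeD_absorb_succ`.
  · refine ⟨(-(-1 : ℤ) ^ a) • spread V R (B.absorb (a + 1) m i) ≫ φ, ?_⟩
    have h3 := h2 a
    rw [cubeStep_succ, ← spread_whiskerRight] at h3
    rw [Preadditive.comp_zsmul, ← Category.assoc, ← spread_comp, B.cubeD_absorb_succ, spread_add,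
      spread_zsmul, spread_sub, spread_id, spread_comp, Preadditive.add_comp,
      Preadditive.zsmul_comp, Preadditive.sub_comp, Category.assoc, h1, h3, Category.id_comp,
      Limits.comp_zero, add_zero, zero_sub, smul_neg, neg_smul, smul_neg, neg_neg, smul_smul,
      ← mul_pow]
    simp

theorem cubeSame_cubeSame {n m k : ℕ} (h : n = m) :
    cubeSame Q n m ≫ cubeSame Q m k = cubeSame Q n k := by
  subst h
  rw [cubeSame_self, Category.id_comp]

theorem cubeSame_cubeSame_self {n m : ℕ} (h : n = m) :
    cubeSame Q n m ≫ cubeSame Q m n = 𝟙 _ := by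
  rw [cubeSame_cubeSame h, cubeSame_self]

theorem setOne_cubeSame_cubeE {n m : ℕ} (h : n = m) (i : Fin n) :
    Q.map (ECube.setOne n i) ≫ cubeSame Q n m ≫ cubeE Q m = 0 := by
  subst h
  rw [cubeSame_self, Category.id_comp, setOne_comp_cubeE]

/-- The rearrangement of a tensor product of cubes with the factors `i` and `j` in front, the
factors other than `i` being indexed by the family `b`. -/
def cubesFront (Q : ECube ⥤ C) {I : FinIdx} {i j : I.α} (hij : j ≠ i) (b c : I.α → ℕ) :
    cubes Q I c ⟶ Q.obj ⟨c i⟩ ⊗ (Q.obj ⟨b j⟩ ⊗ tensL (fun k => Q.obj ⟨b k⟩)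
      ((I.list.erase i).erase j)) :=
  (tensLPull (fun k => Q.obj ⟨c k⟩) i I.list (I.mem_list i)).hom ≫ Q.obj ⟨c i⟩ ◁
    ((tensLPull (fun k => Q.obj ⟨c k⟩) j (I.list.erase i)
      ((List.mem_erase_of_ne hij).2 (I.mem_list j))).hom ≫
      (cubeSame Q (c j) (b j) ⊗ₘ tensLHom (fun k => cubeSame Q (c k) (b k)) _))

/-- The inverse of `cubesFront`. -/
def cubesFrontInv (Q : ECube ⥤ C) {I : FinIdx} {i j : I.α} (hij : j ≠ i) (b c : I.α → ℕ) :
    Q.obj ⟨c i⟩ ⊗ (Q.obj ⟨b j⟩ ⊗ tensL (fun k => Q.obj ⟨b k⟩)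
      ((I.list.erase i).erase j)) ⟶ cubes Q I c :=
  Q.obj ⟨c i⟩ ◁ ((cubeSame Q (b j) (c j) ⊗ₘ tensLHom (fun k => cubeSame Q (b k) (c k)) _) ≫
    (tensLPull (fun k => Q.obj ⟨c k⟩) j (I.list.erase i)
      ((List.mem_erase_of_ne hij).2 (I.mem_list j))).inv) ≫
    (tensLPull (fun k => Q.obj ⟨c k⟩) i I.list (I.mem_list i)).inv

theorem FinIdx.ne_of_mem_erase_erase {I : FinIdx} {i j k : I.α}
    (h : k ∈ (I.list.erase i).erase j) : k ≠ i := fun hk =>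
  (I.nodup_list.not_mem_erase) (hk ▸ List.mem_of_mem_erase h)

theorem cubesFront_inv {I : FinIdx} {i j : I.α} (hij : j ≠ i) {b c : I.α → ℕ}
    (h : ∀ k, k ≠ i → c k = b k) : cubesFront Q hij b c ≫ cubesFrontInv Q hij b c = 𝟙 _ := by
  have h2 : (cubeSame Q (c j) (b j) ⊗ₘ tensLHom (fun k => cubeSame Q (c k) (b k))
      ((I.list.erase i).erase j)) ≫
      (cubeSame Q (b j) (c j) ⊗ₘ tensLHom (fun k => cubeSame Q (b k) (c k)) _) = 𝟙 _ := by
    rw [tensorHom_comp_tensorHom, tensLHom_comp, cubeSame_cubeSame_self (h j hij),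
      tensLHom_congr fun k hk => cubeSame_cubeSame_self (h k (FinIdx.ne_of_mem_erase_erase hk)),
      tensLHom_id, id_tensorHom_id]
  rw [cubesFront, cubesFrontInv, Category.assoc, ← whiskerLeft_comp_assoc, Category.assoc,
    reassoc_of% h2, Iso.hom_inv_id, whiskerLeft_id, Category.id_comp, Iso.hom_inv_id]

theorem cubesFrontInv_inv {I : FinIdx} {i j : I.α} (hij : j ≠ i) {b c : I.α → ℕ}
    (h : ∀ k, k ≠ i → c k = b k) : cubesFrontInv Q hij b c ≫ cubesFront Q hij b c = 𝟙 _ := by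
  have h2 : (cubeSame Q (b j) (c j) ⊗ₘ tensLHom (fun k => cubeSame Q (b k) (c k))
      ((I.list.erase i).erase j)) ≫
      (cubeSame Q (c j) (b j) ⊗ₘ tensLHom (fun k => cubeSame Q (c k) (b k)) _) = 𝟙 _ := by
    rw [tensorHom_comp_tensorHom, tensLHom_comp, cubeSame_cubeSame_self (h j hij).symm,
      tensLHom_congr fun k hk =>
        cubeSame_cubeSame_self (h k (FinIdx.ne_of_mem_erase_erase hk)).symm,
      tensLHom_id, id_tensorHom_id]
  rw [cubesFront, cubesFrontInv, Category.assoc, Iso.inv_hom_id_assoc, ← whiskerLeft_comp,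
    Category.assoc, Iso.inv_hom_id_assoc, h2, whiskerLeft_id]

theorem cubesD_cubesFront {I : FinIdx} {i j : I.α} (hij : j ≠ i) {b c c' : I.α → ℕ}
    (h : ∀ k, k ≠ i → c k = b k) (h' : ∀ k, k ≠ i → c' k = b k) :
    cubesD Q I c c' i ≫ cubesFront Q hij b c' =
      cubesFront Q hij b c ≫ cubeStep Q (c i) (c' i) ▷ _ := by
  have h2 : ∀ k, k ≠ i → (if k = i then cubeStep Q (c k) (c' k) else cubeSame Q (c k) (c' k)) ≫
      cubeSame Q (c' k) (b k) = cubeSame Q (c k) (b k) := fun k hk => by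
    rw [if_neg hk, cubeSame_cubeSame ((h k hk).trans (h' k hk).symm)]
  rw [cubesD, cubesFront, ← Category.assoc, tensLPull_natural, if_pos rfl, Category.assoc,
    cubesFront, Category.assoc]
  congr 1
  rw [MonoidalCategory.tensorHom_def', Category.assoc, ← whisker_exchange, ← Category.assoc,
    ← whiskerLeft_comp]
  congr 2
  rw [← Category.assoc, tensLPull_natural, Category.assoc, tensorHom_comp_tensorHom,
    tensLHom_comp, h2 j hij, tensLHom_congr fun k hk => h2 k (FinIdx.ne_of_mem_erase_erase hk)]

/-- The projector `cubesE` contains the factor `cubeE` at the place `j`, which kills `setOne`. -/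
theorem setOne_cubesFrontInv_cubesE {I : FinIdx} {i j : I.α} (hij : j ≠ i) (b : I.α → ℕ)
    (s : Fin (b j)) : Q.obj ⟨b i⟩ ◁ (Q.map (ECube.setOne (b j) s) ▷ _) ≫
      cubesFrontInv Q hij b b ≫ cubesE Q I b = 0 := by
  have h1 := tensLPull_natural (fun k => cubeE Q (b k)) i I.list (I.mem_list i)
  have h2 := tensLPull_natural (fun k => cubeE Q (b k)) j (I.list.erase i)
    ((List.mem_erase_of_ne hij).2 (I.mem_list j))
  rw [← Iso.inv_comp_eq, ← Category.assoc, ← Iso.eq_comp_inv] at h1 h2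
  have h3 : Q.map (ECube.setOne (b j) s) ▷ tensL (fun k => Q.obj ⟨b k⟩)
      ((I.list.erase i).erase j) ≫
      (cubeSame Q (b j) (b j) ⊗ₘ tensLHom (fun k => cubeSame Q (b k) (b k)) _) ≫
      (cubeE Q (b j) ⊗ₘ tensLHom (fun k => cubeE Q (b k)) _) = 0 := by
    rw [tensorHom_comp_tensorHom, ← tensorHom_id, tensorHom_comp_tensorHom,
      setOne_cubeSame_cubeE rfl, MonoidalPreadditive.zero_tensor]
  have h4 := MonoidalCategory.tensorHom_def' (cubeE Q (b i))
    (tensLHom (fun k => cubeE Q (b k)) (I.list.erase i))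
  rw [cubesFrontInv, Category.assoc, h1, h4, Category.assoc, ← whiskerLeft_comp_assoc,
    ← whiskerLeft_comp_assoc, Category.assoc, Category.assoc, h2, reassoc_of% h3, Limits.zero_comp,
    MonoidalPreadditive.whiskerLeft_zero, Limits.zero_comp]

/-- The contraction of two neighbouring cubes, transported to the places `i` and `j` by
`cubesFront`. The condition `b j ≠ 0` supplies the coordinate of the cube `j` into which the cube
`i` is absorbed. -/
theorem CubeBimul.exists_cubesD_comp (B : CubeBimul Q e) {I : FinIdx} {i j : I.α} (hij : j ≠ i)
    {b b' : I.α → ℕ} (hj : b j ≠ 0) {V W : C} (φ : V ⊗ cubes Q I b ⟶ W)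
    (hE : V ◁ cubesE Q I b ≫ φ = φ)
    (hD : ∀ c, bump c i = b → V ◁ cubesD Q I c b i ≫ φ = 0) (hb : bump b i = b') :
    ∃ ψ : V ⊗ cubes Q I b' ⟶ W, V ◁ cubesD Q I b b' i ≫ ψ = φ := by
  subst hb
  have hb' : ∀ k, k ≠ i → bump b i k = b k := fun k hk => bump_ne b hk
  obtain ⟨ψ, hψ⟩ := B.exists_cubeStep_comp (m := b j) ⟨0, Nat.pos_of_ne_zero hj⟩
    (V ◁ cubesFrontInv Q hij b b ≫ φ) (by
      have h := setOne_cubesFrontInv_cubesE hij b ⟨0, Nat.pos_of_ne_zero hj⟩ (Q := Q)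
      rw [← hE, ← whiskerLeft_comp_assoc, ← whiskerLeft_comp_assoc, Category.assoc, h,
        MonoidalPreadditive.whiskerLeft_zero, Limits.zero_comp]) (fun c => by
      -- For a one-step differential into `□^{b i}`, the dimension `c` is completed to a family `d`
      -- with `bump d i = b`, and `hD` applies. Otherwise `cubeStep` is zero.
      by_cases hc : c + 1 = b i
      · obtain ⟨d, rfl, hd⟩ : ∃ d : I.α → ℕ, d i = c ∧ ∀ k, k ≠ i → d k = b k :=
          ⟨Function.update b i c, Function.update_self _ _ _,
            fun k hk => Function.update_of_ne hk _ _⟩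
        have hbump : bump d i = b := by
          funext k
          by_cases hk : k = i
          · subst hk
            rw [bump_self, hc]
          · rw [bump_ne d hk, hd k hk]
        have h := cubesD_cubesFront (Q := Q) hij hd (fun _ _ => rfl : ∀ k, k ≠ i → b k = b k)
        have h5 : cubeStep Q (d i) (b i) ▷ _ ≫ cubesFrontInv Q hij b b =
            cubesFrontInv Q hij b d ≫ cubesD Q I d b i := by
          rw [← Category.comp_id (cubesD Q I d b i), ← cubesFront_inv hij fun _ _ => rfl,
            reassoc_of% h, ← Category.assoc (cubesFrontInv Q hij b d), cubesFrontInv_inv hij hd,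
            Category.id_comp]
        rw [← whiskerLeft_comp_assoc, h5, whiskerLeft_comp, Category.assoc, hD d hbump,
          Limits.comp_zero]
      · rw [cubeStep, dif_neg hc]
        simp) (a' := bump b i i) (bump_self b i).symm
  refine ⟨V ◁ cubesFront Q hij b (bump b i) ≫ ψ, ?_⟩
  rw [← whiskerLeft_comp_assoc, cubesD_cubesFront hij (fun _ _ => rfl) hb', whiskerLeft_comp_assoc,
    hψ, ← whiskerLeft_comp_assoc, cubesFront_inv hij (fun _ _ => rfl), whiskerLeft_id,
    Category.id_comp]

end Contraction

/-! ### Clearing the components outside the first direction. -/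

namespace FinIdx

/-- The first element. -/
abbrev fst (I : FinIdx) : I.α := I.e 0

/-- The family has a non-zero value at an element other than the first. -/
def Off (I : FinIdx) (b : I.α → ℕ) : Prop := ∃ j, j ≠ I.fst ∧ b j ≠ 0

/-- Hence `d` in the first cube enters the total differential without sign. -/
theorem filter_lt_fst (I : FinIdx) : (Finset.univ.filter fun i => i < I.fst) = ∅ := by
  rw [Finset.filter_eq_empty_iff]
  intro i _ h
  have h' : I.e.symm i < I.e.symm (I.e 0) := h
  rw [Equiv.symm_apply_apply] at h'
  exact absurd h' (Fin.not_lt_zero _)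

theorem Off.bump {I : FinIdx} {b : I.α → ℕ} (h : I.Off b) (j : I.α) : I.Off (bump b j) := by
  obtain ⟨k, hk, hb⟩ := h
  refine ⟨k, hk, ?_⟩
  rw [_root_.bump]
  split_ifs
  · exact Nat.succ_ne_zero _
  · exact hb

theorem Off.of_bump_fst {I : FinIdx} {b : I.α → ℕ} (h : I.Off (_root_.bump b I.fst)) : I.Off b := by
  obtain ⟨k, hk, hb⟩ := h
  exact ⟨k, hk, bump_ne b hk ▸ hb⟩

theorem off_bump {I : FinIdx} (b : I.α → ℕ) {j : I.α} (h : j ≠ I.fst) :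
    I.Off (_root_.bump b j) := ⟨j, h, by rw [bump_self]; exact Nat.succ_ne_zero _⟩

end FinIdx

theorem bump_injective {I : FinIdx} (j : I.α) :
    Function.Injective fun b : I.α → ℕ => bump b j := by
  intro b c h
  funext k
  have := congrFun h k
  simp only [bump] at this
  split_ifs at this <;> omega

section Clearing

variable {C : Type u} [Category.{v} C] [Preadditive C] [MonoidalCategory C]
  [MonoidalPreadditive C] {Q : ECube ⥤ C} {I : FinIdx} {X : I.α → C} {Y : C}

theorem dTarget_eq_zero {A Y : C} {f : ∀ n : ℕ, A ⟶ Y ⊗ Q.obj ⟨n⟩} (h : ∀ n, f n = 0) (n : ℕ) :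
    dTarget Q f n = 0 := by
  cases n with
  | zero => rfl
  | succ n => rw [dTarget, h, Limits.zero_comp]

theorem multiD_congr {m : ℤ}
    {f g : ∀ (b : I.α → ℕ) (n : ℕ), tens I X ⊗ cubes Q I b ⟶ Y ⊗ Q.obj ⟨n⟩} {b : I.α → ℕ}
    (h : f b = g b) (h' : ∀ j, f (bump b j) = g (bump b j)) (n : ℕ) :
    multiD Q I X Y m f b n = multiD Q I X Y m g b n := by
  simp only [multiD, h, h']

/-- If the only relevant components are those in the direction of the first index. -/
theorem multiD_eq_fst {m : ℤ}
    {f : ∀ (b : I.α → ℕ) (n : ℕ), tens I X ⊗ cubes Q I b ⟶ Y ⊗ Q.obj ⟨n⟩} {b : I.α → ℕ}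
    (h' : ∀ j, j ≠ I.fst → ∀ n, f (bump b j) n = 0) (n : ℕ) :
    multiD Q I X Y m f b n = dTarget Q (f b) n - m.negOnePow •
      (tens I X ◁ cubesD Q I b (bump b I.fst) I.fst ≫ f (bump b I.fst) n) := by
  rw [multiD, Finset.sum_eq_single I.fst, I.filter_lt_fst, Finset.sum_empty,
    Int.negOnePow_zero, one_smul]
  · intro j _ hj
    rw [h' j hj, Limits.comp_zero, smul_zero]
  · exact fun h => absurd (Finset.mem_univ _) h

theorem cubesE_idem (b : I.α → ℕ) : cubesE Q I b ≫ cubesE Q I b = cubesE Q I b := by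
  simp only [cubesE, tensHom, tensLHom_comp, cubeE_idem]

variable [SymmetricCategory C] {e : Q.obj ⟨0⟩ ≅ 𝟙_ C}

/-- The off-components of `f` vanish when the first cube has dimension less than `k`. So at level
`k` the equation `hD` says that they are cocycles for `d` in the first cube alone, and exactness in
that direction gives a preimage one dimension higher. At most one `b` is relevant for a given `b'`
because `bump` is injective. -/
theorem CubeBimul.exists_clearing_component (B : CubeBimul Q e) {m : ℤ} {k : ℕ}
    {f : ∀ (b : I.α → ℕ) (n : ℕ), tens I X ⊗ cubes Q I b ⟶ Y ⊗ Q.obj ⟨n⟩}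
    (hf : f ∈ multiHom Q I X Y (m + 1))
    (hD : ∀ b, I.Off b → ∀ n, multiD Q I X Y (m + 1) f b n = 0)
    (h0 : ∀ b, I.Off b → b I.fst < k → ∀ n, f b n = 0) (b' : I.α → ℕ) (n : ℕ) :
    ∃ ζ : tens I X ⊗ cubes Q I b' ⟶ Y ⊗ Q.obj ⟨n⟩,
      (((n : ℤ) ≠ m + ∑ i, (b' i : ℤ) → ζ = 0) ∧ tens I X ◁ cubesE Q I b' ≫ ζ = ζ ∧
        ζ ≫ Y ◁ cubeE Q n = ζ) ∧ (¬ (I.Off b' ∧ b' I.fst = k + 1) → ζ = 0) ∧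
      ∀ b, I.Off b → b I.fst = k → bump b I.fst = b' →
        -(m.negOnePow • (tens I X ◁ cubesD Q I b b' I.fst ≫ ζ)) = f b n := by
  by_cases hb : (n : ℤ) = m + ∑ i, (b' i : ℤ) ∧
    ∃ b, I.Off b ∧ b I.fst = k ∧ bump b I.fst = b'
  · obtain ⟨hn, b, hoff, hk, rfl⟩ := hb
    obtain ⟨j, hj, hbj⟩ := hoff
    have hoff : I.Off b := ⟨j, hj, hbj⟩
    -- The equation `hD` at `c`, one level lower: the terms raising another index and the one with
    -- the differential in the target lie below level `k`, so only `d` in the first cube followed by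
    -- `f b` survives.
    obtain ⟨ψ, hψ⟩ := B.exists_cubesD_comp (Q := Q) hj hbj (f b n) (hf.2.1 b n) (fun c hc => by
      subst hc
      have hc := hoff.of_bump_fst
      rw [bump_self] at hk
      have h := hD c hc n
      rw [multiD_eq_fst (fun j hj n => h0 _ (hc.bump j) (by rw [bump_ne c hj.symm]; omega) n),
        dTarget_eq_zero (h0 c hc (by omega)), zero_sub, neg_eq_zero, smul_eq_zero_iff_eq] at h
      exact h) rfl
    obtain ⟨ψ', h1, h2, h3⟩ : ∃ ψ' : tens I X ⊗ cubes Q I (bump b I.fst) ⟶ Y ⊗ Q.obj ⟨n⟩,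
        tens I X ◁ cubesE Q I _ ≫ ψ' = ψ' ∧ ψ' ≫ Y ◁ cubeE Q n = ψ' ∧
        tens I X ◁ cubesD Q I b (bump b I.fst) I.fst ≫ ψ' = f b n := by
      -- Both projectors commute with the equation, so the preimage may be made non-degenerate on
      -- both sides.
      refine ⟨tens I X ◁ cubesE Q I _ ≫ ψ ≫ Y ◁ cubeE Q n, ?_, ?_, ?_⟩
      · rw [← whiskerLeft_comp_assoc, cubesE_idem]
      · simp only [Category.assoc, ← whiskerLeft_comp, cubeE_idem]
      · rw [← whiskerLeft_comp_assoc, ← cubesD_cubesE, whiskerLeft_comp_assoc, reassoc_of% hψ,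
          ← Category.assoc, hf.2.1, hf.2.2]
    refine ⟨-(m.negOnePow • ψ'), ⟨fun h => absurd hn h, ?_, ?_⟩, fun h =>
      absurd ⟨hoff.bump _, ?_⟩ h, fun c hc hck hcb => ?_⟩
    · rw [Preadditive.comp_neg, Linear.comp_units_smul, h1]
    · rw [Preadditive.neg_comp, Linear.units_smul_comp, h2]
    · obtain rfl := bump_injective _ hcb
      rw [Preadditive.comp_neg, Linear.comp_units_smul, h3, smul_neg, neg_neg, smul_smul,
        Int.units_mul_self, one_smul]
    · rw [bump_self, hk]
  · refine ⟨0, ⟨fun _ => rfl, Limits.comp_zero, Limits.zero_comp⟩, fun _ => rfl, fun c hc hck hcb => ?_⟩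
    have hn : (n : ℤ) ≠ m + ∑ i, (b' i : ℤ) := fun h => hb ⟨h, c, hc, hck, hcb⟩
    rw [Limits.comp_zero, smul_zero, neg_zero, hf.1]
    rw [← hcb] at hn
    have := sum_bump c I.fst
    intro h
    apply hn
    rw [this, h]
    ring

/-- The correction lives only where the first cube has dimension `k + 1`. At levels up to `k` its
differential therefore reduces to the term with `d` in the first cube, which was prescribed. -/
theorem CubeBimul.exists_clearing_step (B : CubeBimul Q e) {m : ℤ} {k : ℕ}
    (f : multiHom Q I X Y (m + 1))
    (hD : ∀ b, I.Off b → ∀ n, (multiDHom Q I X Y (m + 1) f).1 b n = 0)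
    (h0 : ∀ b, I.Off b → b I.fst < k → ∀ n, f.1 b n = 0) :
    ∃ z : multiHom Q I X Y m, (∀ b, b I.fst ≠ k + 1 → z.1 b = 0) ∧
      ∀ b, I.Off b → b I.fst < k + 1 → ∀ n, (multiDHom Q I X Y m z).1 b n = f.1 b n := by
  choose z hz hz0 hzf using B.exists_clearing_component f.2 hD h0
  refine ⟨⟨z, fun b n => (hz b n).1, fun b n => (hz b n).2.1, fun b n => (hz b n).2.2⟩,
    fun b hb => funext fun n => hz0 b n fun h => hb h.2, fun b hb hk n => ?_⟩
  refine (multiD_eq_fst (fun j hj n => hz0 _ n fun h => ?_) n).trans ?_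
  · rw [bump_ne b hj.symm] at h
    omega
  · rw [dTarget_eq_zero fun n => hz0 b n fun h => by omega, zero_sub]
    obtain rfl | hk := (Nat.lt_succ_iff_lt_or_eq.1 hk).symm
    · exact hzf _ n b hb rfl rfl
    · rw [hz0 _ n, h0 b hb hk, Limits.comp_zero, smul_zero, neg_zero]
      rw [bump_self]
      omega

/-- The elements of `P_I` are products over all dimensions, so infinitely many corrections may be
summed: the `k`-th one only touches components whose first cube has dimension `k + 1`, hence each
component becomes stationary. -/
theorem CubeBimul.exists_clearing (B : CubeBimul Q e) {m : ℤ} (f : multiHom Q I X Y (m + 1))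
    (hD : ∀ b, I.Off b → ∀ n, (multiDHom Q I X Y (m + 1) f).1 b n = 0) :
    ∃ y : multiHom Q I X Y m, ∀ b, I.Off b → ∀ n, (f - multiDHom Q I X Y m y).1 b n = 0 := by
  let P (k : ℕ) (y : multiHom Q I X Y m) : Prop :=
    ∀ b, I.Off b → b I.fst < k → ∀ n, (f - multiDHom Q I X Y m y).1 b n = 0
  have step (k : ℕ) (y : {y // P k y}) : ∃ y' : {y // P (k + 1) y},
      ∀ b, b I.fst ≠ k + 1 → y'.1.1 b = y.1.1 b := by
    obtain ⟨z, hz, hz'⟩ := B.exists_clearing_step (f - multiDHom Q I X Y m y.1)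
      (fun b hb n => by
        have h : multiDHom Q I X Y (m + 1) (multiDHom Q I X Y m y.1) = 0 :=
          Subtype.ext (multiD_multiD Q m _)
        rw [map_sub, h, sub_zero]
        exact hD b hb n) y.2
    refine ⟨⟨y.1 + z, fun b hb hk n => ?_⟩, fun b hb => ?_⟩
    · rw [map_add, ← sub_sub]
      exact sub_eq_zero.2 (hz' b hb hk n).symm
    · exact (congrArg (y.1.1 b + ·) (hz b hb)).trans (add_zero _)
  choose next hnext using step
  let seq (k : ℕ) : {y // P k y} := Nat.rec ⟨0, fun _ _ h => absurd h (Nat.not_lt_zero _)⟩ next k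
  -- The component at `b` no longer changes after stage `b I.fst`, and this stationary value is the
  -- limit.
  have hseq (b : I.α → ℕ) (k : ℕ) (hk : b I.fst ≤ k) : (seq k).1.1 b = (seq (b I.fst)).1.1 b := by
    induction k, hk using Nat.le_induction with
    | base => rfl
    | succ k hk ih => exact (hnext k (seq k) b (by omega)).trans ih
  refine ⟨⟨fun b => (seq (b I.fst)).1.1 b, fun b => (seq (b I.fst)).1.2.1 b,
    fun b => (seq (b I.fst)).1.2.2.1 b, fun b => (seq (b I.fst)).1.2.2.2 b⟩, fun b hb n => ?_⟩
  rw [← (seq (b I.fst + 1)).2 b hb (Nat.lt_succ_self _) n]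
  -- The differential at `b` only involves components whose first dimension is at most `b I.fst +
  -- 1`, so the limit may be replaced by one stage.
  have h : multiD Q I X Y m (fun b => (seq (b I.fst)).1.1 b) b n =
      multiD Q I X Y m (seq (b I.fst + 1)).1.1 b n := by
    refine multiD_congr (f := fun b => (seq (b I.fst)).1.1 b) (hseq b _ (Nat.le_succ _)).symm
      (fun j => ?_) n
    have hj : bump b j I.fst ≤ (b I.fst).succ := by
      rw [bump]
      split_ifs <;> omega
    exact (hseq (bump b j) _ hj).symm
  exact congrArg (f.1 b n - ·) h

end Clearing

/-! ### Projection to one cube, and extension by zero from the first one. -/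

theorem ECube.toPt_zeroPt (n : ℕ) (h : n = 0) : ECube.toPt n ≫ ECube.zeroPt n = 𝟙 _ := by
  subst h
  ext1 y
  exact Subsingleton.elim (α := Fin 0 → Bool) _ _

theorem ECube.comp_toPt {n m : ℕ} (f : (⟨n⟩ : ECube) ⟶ ⟨m⟩) :
    f ≫ ECube.toPt m = ECube.toPt n := by
  ext1 y
  exact Subsingleton.elim (α := Fin 0 → Bool) _ _

theorem ECube.zeroPt_toPt (n : ℕ) : ECube.zeroPt n ≫ ECube.toPt n = 𝟙 _ := by
  ext1 y
  exact Subsingleton.elim (α := Fin 0 → Bool) _ _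

section First

variable {C : Type u} [Category.{v} C] [MonoidalCategory C] [SymmetricCategory C]

instance isIso_tensLTriv {J : Type} : ∀ L : List J, IsIso (tensLTriv (C := C) L)
  | [] => by rw [tensLTriv_nil]; exact IsIso.id (𝟙_ C)
  | j :: L => by
    have := isIso_tensLTriv L
    rw [tensLTriv_cons]
    infer_instance

variable (Q : ECube ⥤ C) (e : Q.obj ⟨0⟩ ≅ 𝟙_ C) (I : FinIdx) (i : I.α)

/-- The projection of a tensor product of cubes to the `i`-th one. -/
def cubesAt (b : I.α → ℕ) : cubes Q I b ⟶ Q.obj ⟨b i⟩ :=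
  (tensLPull (fun k => Q.obj ⟨b k⟩) i I.list (I.mem_list _)).hom ≫
    Q.obj ⟨b i⟩ ◁ (tensLHom (fun k => Q.map (ECube.toPt (b k)) ≫ e.hom) _ ≫ tensLTriv _) ≫
      (ρ_ _).hom

/-- The `i`-th cube as a face of a tensor product of cubes. -/
noncomputable def cubesAtInv (b : I.α → ℕ) : Q.obj ⟨b i⟩ ⟶ cubes Q I b :=
  (ρ_ _).inv ≫ Q.obj ⟨b i⟩ ◁ (inv (tensLTriv (I.list.erase i)) ≫
    tensLHom (fun k => e.inv ≫ Q.map (ECube.zeroPt (b k))) _) ≫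
    (tensLPull (fun k => Q.obj ⟨b k⟩) i I.list (I.mem_list _)).inv

theorem FinIdx.ne_of_mem_erase {I : FinIdx} {i k : I.α} (h : k ∈ I.list.erase i) :
    k ≠ i := fun hk => I.nodup_list.not_mem_erase (hk ▸ h)

theorem cubesAtInv_cubesAt (b : I.α → ℕ) : cubesAtInv Q e I i b ≫ cubesAt Q e I i b = 𝟙 _ := by
  rw [cubesAtInv, cubesAt]
  simp only [Category.assoc, Iso.inv_hom_id_assoc]
  rw [← whiskerLeft_comp_assoc, Category.assoc, ← Category.assoc (tensLHom _ _), tensLHom_comp,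
    tensLHom_congr (ψ := fun _ => 𝟙 _) fun k _ => ?_, tensLHom_id, Category.id_comp,
    IsIso.inv_hom_id, whiskerLeft_id, Category.id_comp, Iso.inv_hom_id]
  rw [Category.assoc, ← Q.map_comp_assoc, ECube.zeroPt_toPt, Q.map_id, Category.id_comp,
    Iso.inv_hom_id]

/-- When all other cubes have dimension `0`, their projections to the point are isomorphisms inverse
to the inclusions of the point. -/
theorem cubesAt_cubesAtInv {b : I.α → ℕ} (hb : ∀ k, k ≠ i → b k = 0) :
    cubesAt Q e I i b ≫ cubesAtInv Q e I i b = 𝟙 _ := by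
  rw [cubesAtInv, cubesAt]
  simp only [Category.assoc, Iso.hom_inv_id_assoc]
  rw [← whiskerLeft_comp_assoc, Category.assoc, IsIso.hom_inv_id_assoc, tensLHom_comp,
    tensLHom_congr (ψ := fun _ => 𝟙 _) fun k hk => ?_, tensLHom_id, whiskerLeft_id,
    Category.id_comp, Iso.hom_inv_id]
  rw [Category.assoc, Iso.hom_inv_id_assoc, ← Q.map_comp, ECube.toPt_zeroPt, Q.map_id]
  exact hb k (FinIdx.ne_of_mem_erase hk)

/-- Compatibility of `cubesAt` with morphisms of the cubes which are compatible with the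
projections to the point for all but the `i`-th factor. -/
theorem cubesAt_natural {b c : I.α → ℕ} (φ : ∀ k, Q.obj ⟨b k⟩ ⟶ Q.obj ⟨c k⟩)
    (h : ∀ k, k ≠ i → φ k ≫ Q.map (ECube.toPt (c k)) = Q.map (ECube.toPt (b k))) :
    tensHom I φ ≫ cubesAt Q e I i c = cubesAt Q e I i b ≫ φ i := by
  rw [cubesAt, cubesAt, ← Category.assoc, tensLPull_natural, Category.assoc, Category.assoc,
    Category.assoc]
  congr 1
  rw [MonoidalCategory.tensorHom_def', Category.assoc, ← whisker_exchange_assoc,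
    rightUnitor_naturality, ← whiskerLeft_comp_assoc, ← Category.assoc (tensLHom φ _),
    tensLHom_comp, tensLHom_congr fun k hk => ?_]
  rw [← Category.assoc, h k (FinIdx.ne_of_mem_erase hk)]

theorem tensLPull_singleton {J : Type} [DecidableEq J] {A : J → C} (ψ : ∀ k, A k ⟶ 𝟙_ C) (j : J)
    (h : j ∈ [j]) : (tensLPull A j [j] h).hom ≫ A j ◁ (tensLHom ψ _ ≫ tensLTriv _) ≫
      (ρ_ (A j)).hom = 𝟙 (A j) := by
  have key (M : List J) (hM : [] = M) :
      castL A hM ≫ tensLHom ψ M ≫ tensLTriv M = 𝟙 (𝟙_ C) := by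
    subst hM
    rw [tensLTriv_nil]
    refine (Category.id_comp _).trans ((Category.comp_id _).trans ?_)
    exact Category.comp_id (𝟙 (𝟙_ C))
  rw [tensLPull_self, Category.assoc, ← whiskerLeft_comp_assoc, key]
  exact (congrArg (fun z => (ρ_ (A j)).inv ≫ z ≫ (ρ_ (A j)).hom)
    (MonoidalCategory.whiskerLeft_id _ _)).trans (by rw [Category.id_comp, Iso.inv_hom_id])

theorem cubesAt_one (b : FinIdx.one.α → ℕ) : cubesAt Q e FinIdx.one FinIdx.one.fst b = 𝟙 _ :=
  tensLPull_singleton (A := fun k => Q.obj ⟨b k⟩) (fun k => Q.map (ECube.toPt (b k)) ≫ e.hom)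
    FinIdx.one.fst _

end First

section First

variable {C : Type u} [Category.{v} C] [Preadditive C] [MonoidalCategory C]
  [SymmetricCategory C] (Q : ECube ⥤ C) (e : Q.obj ⟨0⟩ ≅ 𝟙_ C) (I : FinIdx) (i : I.α)

theorem cubesD_cubesAt (b : I.α → ℕ) :
    cubesD Q I b (bump b i) i ≫ cubesAt Q e I i (bump b i) =
      cubesAt Q e I i b ≫ cubeStep Q (b i) (bump b i i) := by
  rw [cubesD, cubesAt_natural Q e I i _ fun k hk => ?_, if_pos rfl]
  rw [if_neg hk, cubeSame, dif_pos (bump_ne b hk).symm, ← Q.map_comp, ECube.comp_toPt]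

theorem cubesE_cubesAt {b : I.α → ℕ} (hb : ∀ k, k ≠ i → b k = 0) :
    cubesE Q I b ≫ cubesAt Q e I i b = cubesAt Q e I i b ≫ cubeE Q (b i) := by
  rw [cubesE, cubesAt_natural Q e I i _ fun k hk => ?_]
  rw [hb k hk]
  exact Category.id_comp _

theorem cubesE_cubesAtInv {b : I.α → ℕ} (hb : ∀ k, k ≠ i → b k = 0) :
    cubesAtInv Q e I i b ≫ cubesE Q I b = cubeE Q (b i) ≫ cubesAtInv Q e I i b := by
  rw [← Category.comp_id (cubesE Q I b), ← cubesAt_cubesAtInv Q e I i hb,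
    reassoc_of% cubesE_cubesAt Q e I i hb, ← Category.assoc, cubesAtInv_cubesAt, Category.id_comp]

end First

theorem FinIdx.exists_not_off (I : FinIdx) (a : ℕ) : ∃ c : I.α → ℕ, ¬ I.Off c ∧ c I.fst = a :=
  ⟨fun k => if k = I.fst then a else 0, fun ⟨_, hk, h⟩ => h (if_neg hk), if_pos rfl⟩

theorem FinIdx.eq_zero_of_not_off {I : FinIdx} {b : I.α → ℕ} (hb : ¬ I.Off b) (k : I.α)
    (hk : k ≠ I.fst) : b k = 0 := by
  by_contra h
  exact hb ⟨k, hk, h⟩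

theorem FinIdx.eq_of_not_off {I : FinIdx} {b c : I.α → ℕ} (hb : ¬ I.Off b) (hc : ¬ I.Off c)
    (h : b I.fst = c I.fst) : b = c := by
  funext k
  by_cases hk : k = I.fst
  · rw [hk, h]
  · rw [eq_zero_of_not_off hb k hk, eq_zero_of_not_off hc k hk]

theorem FinIdx.sum_of_not_off {I : FinIdx} {b : I.α → ℕ} (hb : ¬ I.Off b) :
    ∑ i, (b i : ℤ) = b I.fst := by
  refine Finset.sum_eq_single _ (fun k _ hk => ?_) fun h => absurd (Finset.mem_univ _) h
  rw [eq_zero_of_not_off hb k hk, Nat.cast_zero]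

section Extend

variable {C : Type u} [Category.{v} C] [Preadditive C] [MonoidalCategory C]
  [MonoidalPreadditive C] [SymmetricCategory C] (Q : ECube ⥤ C) (e : Q.obj ⟨0⟩ ≅ 𝟙_ C)
  {I : FinIdx} {X : I.α → C} {Y : C}

open Classical in
/-- The extension by zero of a family indexed by the dimension of the first cube. -/
noncomputable def extendFst (φ : ∀ a n : ℕ, tens I X ⊗ Q.obj ⟨a⟩ ⟶ Y ⊗ Q.obj ⟨n⟩) (b : I.α → ℕ)
    (n : ℕ) : tens I X ⊗ cubes Q I b ⟶ Y ⊗ Q.obj ⟨n⟩ :=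
  if I.Off b then 0 else tens I X ◁ cubesAt Q e I I.fst b ≫ φ (b I.fst) n

variable {Q}

theorem extendFst_off {φ : ∀ a n : ℕ, tens I X ⊗ Q.obj ⟨a⟩ ⟶ Y ⊗ Q.obj ⟨n⟩} {b : I.α → ℕ}
    (hb : I.Off b) (n : ℕ) : extendFst Q e φ b n = 0 := if_pos hb

theorem extendFst_not_off {φ : ∀ a n : ℕ, tens I X ⊗ Q.obj ⟨a⟩ ⟶ Y ⊗ Q.obj ⟨n⟩} {b : I.α → ℕ}
    (hb : ¬ I.Off b) (n : ℕ) :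
    extendFst Q e φ b n = tens I X ◁ cubesAt Q e I I.fst b ≫ φ (b I.fst) n := if_neg hb

theorem cubesAtInv_comp_extendFst {φ : ∀ a n : ℕ, tens I X ⊗ Q.obj ⟨a⟩ ⟶ Y ⊗ Q.obj ⟨n⟩}
    {b : I.α → ℕ} (hb : ¬ I.Off b) (n : ℕ) :
    tens I X ◁ cubesAtInv Q e I I.fst b ≫ extendFst Q e φ b n = φ (b I.fst) n := by
  rw [extendFst_not_off e hb, ← whiskerLeft_comp_assoc, cubesAtInv_cubesAt, whiskerLeft_id,
    Category.id_comp]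

theorem extendFst_injective :
    Function.Injective (extendFst (I := I) (X := X) (Y := Y) Q e) := by
  intro φ ψ h
  funext a n
  obtain ⟨c, hc, rfl⟩ := I.exists_not_off a
  exact (cubesAtInv_comp_extendFst e hc n).symm.trans
    ((congrArg (fun z => _ ≫ z c n) h).trans (cubesAtInv_comp_extendFst e hc n))

theorem extendFst_mem {m : ℤ} {φ : ∀ a n : ℕ, tens I X ⊗ Q.obj ⟨a⟩ ⟶ Y ⊗ Q.obj ⟨n⟩}
    (hφ : φ ∈ dgeHom Q (tens I X) Y m) : extendFst Q e φ ∈ multiHom Q I X Y m := by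
  refine ⟨fun b n h => ?_, fun b n => ?_, fun b n => ?_⟩ <;> by_cases hb : I.Off b
  · exact extendFst_off e hb n
  · rw [extendFst_not_off e hb, hφ.1, Limits.comp_zero]
    rwa [FinIdx.sum_of_not_off hb] at h
  · rw [extendFst_off e hb, Limits.comp_zero]
  · rw [extendFst_not_off e hb, ← whiskerLeft_comp_assoc, cubesE_cubesAt Q e I I.fst (FinIdx.eq_zero_of_not_off hb),
      whiskerLeft_comp_assoc, hφ.2.1]
  · rw [extendFst_off e hb, Limits.zero_comp]
  · rw [extendFst_not_off e hb, Category.assoc, hφ.2.2]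

/-- The differential raises indices. Raising one keeps a family off, and raising another index than
the first leads off, where the extension is zero; so only the differential of the first cube and
that of the target contribute. -/
theorem extendFst_multiD (m : ℤ) (φ : ∀ a n : ℕ, tens I X ⊗ Q.obj ⟨a⟩ ⟶ Y ⊗ Q.obj ⟨n⟩) :
    multiD Q I X Y m (extendFst Q e φ) = extendFst Q e (dgeD Q (tens I X) Y m φ) := by
  funext b n
  rw [multiD_eq_fst (fun j hj n => extendFst_off e (FinIdx.off_bump b hj) n)]
  by_cases hb : I.Off b
  · rw [extendFst_off e hb, extendFst_off e (hb.bump _), Limits.comp_zero, smul_zero, sub_zero,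
      dTarget_eq_zero fun n => extendFst_off e hb n]
  · have hb' : ¬ I.Off (bump b I.fst) := fun h => hb h.of_bump_fst
    have h1 : extendFst Q e φ b = fun n => tens I X ◁ cubesAt Q e I I.fst b ≫ φ (b I.fst) n :=
      funext fun n => extendFst_not_off e hb n
    have h2 (a : ℕ) (ha : a = b I.fst + 1) :
        tens I X ◁ cubeStep Q (b I.fst) a ≫ φ a n = tens I X ◁ cubeD Q (b I.fst) ≫
          φ (b I.fst + 1) n := by
      subst ha
      rw [cubeStep_succ]
    rw [h1, dTarget_comp, extendFst_not_off e hb', extendFst_not_off e hb, ← whiskerLeft_comp_assoc,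
      cubesD_cubesAt, whiskerLeft_comp_assoc, h2 _ (bump_self _ _), dgeD, Preadditive.comp_sub,
      Linear.comp_units_smul]

/-- A family which is not off is determined by its first entry, and for it `cubesAt` is invertible.
So the extensions are exactly the elements whose off-components vanish. -/
theorem exists_extendFst {m : ℤ} (f : multiHom Q I X Y m) (hf : ∀ b, I.Off b → ∀ n, f.1 b n = 0) :
    ∃ φ : dgeHom Q (tens I X) Y m, extendFst Q e φ.1 = f.1 := by
  choose c hc hca using I.exists_not_off
  have key (b : I.α → ℕ) (hb : ¬ I.Off b) (n : ℕ) (a : I.α → ℕ) (ha : a = b) :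
      tens I X ◁ cubesAt Q e I I.fst b ≫ tens I X ◁ (cubeSame Q (b I.fst) (a I.fst) ≫
        cubesAtInv Q e I I.fst a) ≫ f.1 a n = f.1 b n := by
    subst ha
    rw [cubeSame_self, Category.id_comp, ← whiskerLeft_comp_assoc, cubesAt_cubesAtInv Q e I I.fst (FinIdx.eq_zero_of_not_off hb),
      whiskerLeft_id, Category.id_comp]
  refine ⟨⟨fun a n => tens I X ◁ (cubeSame Q a (c a I.fst) ≫ cubesAtInv Q e I I.fst (c a)) ≫
    f.1 (c a) n, fun a n h => ?_, fun a n => ?_, fun a n => ?_⟩, ?_⟩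
  · change _ ≫ f.1 (c a) n = 0
    rw [f.2.1 _ _ (by rwa [FinIdx.sum_of_not_off (hc a), hca]), Limits.comp_zero]
  · change _ ≫ _ ≫ f.1 (c a) n = _ ≫ f.1 (c a) n
    rw [← whiskerLeft_comp_assoc, ← Category.assoc, cubeE_same, Category.assoc,
      ← cubesE_cubesAtInv Q e I I.fst (FinIdx.eq_zero_of_not_off (hc a)), ← Category.assoc, whiskerLeft_comp_assoc, f.2.2.1]
  · change (_ ≫ f.1 (c a) n) ≫ _ = _ ≫ f.1 (c a) n
    rw [Category.assoc, f.2.2.2]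
  · funext b n
    by_cases hb : I.Off b
    · rw [extendFst_off e hb, hf b hb]
    · rw [extendFst_not_off e hb]
      exact key b hb n _ (FinIdx.eq_of_not_off (hc _) hb (hca _))

theorem extendFst_sub (φ ψ : ∀ a n : ℕ, tens I X ⊗ Q.obj ⟨a⟩ ⟶ Y ⊗ Q.obj ⟨n⟩) :
    extendFst Q e (φ - ψ) = extendFst Q e φ - extendFst Q e ψ := by
  funext b n
  change _ = extendFst Q e φ b n - extendFst Q e ψ b n
  by_cases hb : I.Off b
  · rw [extendFst_off e hb, extendFst_off e hb, extendFst_off e hb, sub_zero]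
  · rw [extendFst_not_off e hb, extendFst_not_off e hb, extendFst_not_off e hb,
      ← Preadditive.comp_sub]
    rfl

theorem extendFst_zero : extendFst (I := I) (X := X) (Y := Y) Q e 0 = 0 := by
  have h := extendFst_sub (I := I) (X := X) (Y := Y) (Q := Q) e 0 0
  rwa [sub_self, sub_self] at h

theorem extendFst_id_comp {p : ℤ} {φ : ∀ a n : ℕ, tens I X ⊗ Q.obj ⟨a⟩ ⟶ Y ⊗ Q.obj ⟨n⟩}
    (hφ : φ ∈ dgeHom Q (tens I X) Y p) (b : I.α → ℕ) (l : ℕ) :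
    extendFst Q e (dgeIdFun Q (tens I X)) b (0 + ∑ j, (b j : ℤ)).toNat ≫
      φ (0 + ∑ j, (b j : ℤ)).toNat l = extendFst Q e φ b l := by
  by_cases hb : I.Off b
  · rw [extendFst_off e hb, extendFst_off e hb, Limits.zero_comp]
  · rw [FinIdx.sum_of_not_off hb, zero_add, Int.toNat_natCast, extendFst_not_off e hb,
      extendFst_not_off e hb, dgeIdFun_self, Category.assoc, hφ.2.1]

end Extend

/-! ### The universal element induces a quasi-isomorphism. -/

section Universal

variable {C : Type u} [Category.{v} C] [Preadditive C] [MonoidalCategory C]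
  [MonoidalPreadditive C] [SymmetricCategory C] (Q : ECube ⥤ C) (e : Q.obj ⟨0⟩ ≅ 𝟙_ C)
  (I : FinIdx) (X : I.α → C)

/-- The universal element of `P_I({X_i}, ⊗_i X_i)`. -/
noncomputable def univFst : ((dgeData Q).P I X (tens I X)).Z0 :=
  ⟨(⟨extendFst Q e (dgeIdFun Q (tens I X)), extendFst_mem e (dgeIdFun_mem Q _)⟩ :
    multiHom Q I X (tens I X) 0), by
    refine multiVal_ext Q ((multiVal_d Q _).trans ?_)
    refine (extendFst_multiD e 0 _).trans ?_
    rw [dgeIdFun_d]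
    funext b n
    by_cases hb : I.Off b
    · exact extendFst_off e hb n
    · exact (extendFst_not_off e hb n).trans Limits.comp_zero⟩

variable {I X}

/-- The map given by the universal element is the extension by zero. This makes the clearing
argument applicable to it. -/
theorem act_univFst {Y : C} {p n : ℤ} (h : p + 0 = n) (φ : ((dge Q).Hom (tens I X) Y).X p) :
    multiVal Q ((dgeData Q).act h φ (univFst Q e I X).1) =
      extendFst Q e (φ : dgeHom Q (tens I X) Y p).1 := by
  funext b l
  exact (multiComp_sigmaOne Q 0 _ (extendFst Q e (dgeIdFun Q (tens I X))) b l).trans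
    (extendFst_id_comp e (φ : dgeHom Q (tens I X) Y p).2 b l)

/-- The map is the inclusion of the subcomplex of elements without off-components, and clearing says
that the quotient complex is acyclic. -/
theorem quasiIso_ofCocycle_univFst (B : CubeBimul Q e) (hD : (dgeData Q).IsPseudoTensor) :
    DGMod.quasiIso (dge Q)
      ((PseudoTensorData.toMod hD I X).ofCocycle (tens I X) (univFst Q e I X)) := by
  intro Y
  refine ⟨fun j => ?_⟩
  rw [quasiIsoAt_iff_isIso_homologyMap]
  -- Clearing corrects an element of degree `m + 1` by one of degree `m`. It is used in degree `j`
  -- for surjectivity and in degree `j - 1` for injectivity.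
  obtain ⟨t, rfl⟩ : ∃ t, j = t + 1 + 1 := ⟨j - 2, by ring⟩
  have hφ (m : ℤ) (x : ((dge Q).Hom (tens I X) Y).X m) :
      multiVal Q ((((PseudoTensorData.toMod hD I X).ofCocycle (tens I X)
        (univFst Q e I X)).app Y).f m x) = extendFst Q e (x : dgeHom Q (tens I X) Y m).1 :=
    act_univFst Q e (add_zero m) x
  have hdK (m : ℤ) (x : ((dge Q).Hom (tens I X) Y).X m) :
      ((dge Q).Hom (tens I X) Y).d m (m + 1) x =
        dgeDHom Q (tens I X) Y m (x : dgeHom Q (tens I X) Y m) :=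
    ConcreteCategory.congr_hom (dgeComplex_d Q (tens I X) Y m) x
  refine isIso_homologyMap_of_elements _ (i := t + 1) (j := t + 1 + 1) (k := t + 1 + 1 + 1)
    (ComplexShape.prev_eq' _ rfl) (ComplexShape.next_eq' _ rfl) (fun y hy => ?_)
    (fun x w hx hw => ?_)
  · have hy' := (multiVal_d Q y).symm.trans (congrArg (multiVal Q) hy)
    let y' : multiHom Q I X Y (t + 1 + 1) := y
    obtain ⟨w, hw⟩ := B.exists_clearing y'
      (fun b _ n => congrFun (congrFun hy' b) n)
    obtain ⟨x, hx⟩ := exists_extendFst e _ hw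
    refine ⟨x, w, ?_, multiVal_ext Q ?_⟩
    · refine (hdK _ x).trans (Subtype.ext (extendFst_injective e ?_))
      refine (extendFst_multiD e _ _).symm.trans ?_
      rw [hx]
      refine Eq.trans ?_ (extendFst_zero e).symm
      have h : multiDHom Q I X Y (t + 1 + 1) (y' - multiDHom Q I X Y (t + 1) w) = 0 := by
        rw [map_sub]
        refine sub_eq_zero.2 ((Subtype.ext hy').trans (Subtype.ext ?_))
        exact (multiD_multiD Q (t + 1) _).symm
      exact congrArg Subtype.val h
    · refine Eq.trans ?_ (congrArg₂ (· + ·) (hφ _ x) (multiVal_d Q w)).symm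
      refine Eq.trans ?_ (congrArg (· + multiD Q I X Y (t + 1) (multiVal Q w)) hx).symm
      exact (sub_add_cancel _ _).symm
  · have hw' : extendFst Q e (x : dgeHom Q (tens I X) Y _).1 =
        multiD Q I X Y (t + 1) (multiVal Q w) :=
      (hφ _ x).symm.trans ((congrArg (multiVal Q) hw).trans (multiVal_d Q w))
    let w' : multiHom Q I X Y (t + 1) := w
    -- The differential of `w` is the extension of `x`, hence zero at off-components. So `w` can be
    -- moved into the subcomplex by a coboundary, without changing its differential.
    obtain ⟨y, hy⟩ := B.exists_clearing w' (fun b hb n =>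
      (congrFun (congrFun hw' b) n).symm.trans (extendFst_off e hb n))
    obtain ⟨v, hv⟩ := exists_extendFst e _ hy
    refine ⟨v, Eq.trans (Subtype.ext (extendFst_injective e ?_)) (hdK _ v).symm⟩
    refine hw'.trans (Eq.trans ?_ (extendFst_multiD e _ _))
    rw [hv]
    have h : multiDHom Q I X Y (t + 1) (w' - multiDHom Q I X Y t y) =
        multiDHom Q I X Y (t + 1) w' := by
      rw [map_sub]
      refine sub_eq_self.2 (Subtype.ext ?_)
      exact multiD_multiD Q t _
    exact (congrArg Subtype.val h).symm

end Universal

/-! ### Homotopy invariance and coboundaries of degree 0. -/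

section Exact

variable {C : Type u} [Category.{v} C] [Preadditive C] [MonoidalCategory C]
  [MonoidalPreadditive C] {Q : ECube ⥤ C} {e : Q.obj ⟨0⟩ ≅ 𝟙_ C} {X Y : C}

theorem cubeE_toPt (n : ℕ) : cubeE Q (n + 1) ≫ Q.map (ECube.toPt (n + 1)) = 0 := by
  rw [← ECube.comp_toPt (ECube.proj n 0), Q.map_comp,
    reassoc_of% ((comp_cubeE_eq_iff Q n (cubeE Q (n + 1))).1 (cubeE_idem Q _) 0),
    Limits.zero_comp]

theorem cubeE_zero : cubeE Q 0 = 𝟙 _ := rfl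

/-- For `n ≥ 1` the complex of morphisms to `Y ⊗ □^n` killed by the projections is exact. -/
theorem HomotopyInvariant.exists_cubeD_comp (hinv : HomotopyInvariant Q e) {a n : ℕ}
    (f : X ⊗ Q.obj ⟨a⟩ ⟶ Y ⊗ Q.obj ⟨n + 1⟩) (hl : X ◁ cubeE Q a ≫ f = f)
    (hr : f ≫ Y ◁ cubeE Q (n + 1) = f) (hd : ∀ c, X ◁ cubeStep Q c a ≫ f = 0) :
    ∃ g : X ⊗ Q.obj ⟨a + 1⟩ ⟶ Y ⊗ Q.obj ⟨n + 1⟩, X ◁ cubeE Q (a + 1) ≫ g = g ∧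
      g ≫ Y ◁ cubeE Q (n + 1) = g ∧ X ◁ cubeD Q a ≫ g = f := by
  have := hinv (n + 1) X Y
  set i := (ρ_ Y).inv ≫ Y ◁ e.inv ≫ Y ◁ Q.map (ECube.zeroPt (n + 1))
  have hep : Epi (HomologicalComplex.homologyMap (dgHomMap Q X i) a) := inferInstance
  -- Up to the boundary of some `w`, the cycle `f` factors through the vertex `i` of `□^{n+1}`.
  obtain ⟨x, w, -, h⟩ := exists_of_epi_homologyMap (dgHomMap Q X i) (i := a + 1) (j := a)
    (k := (ComplexShape.down ℕ).next a) (ComplexShape.prev_eq' _ rfl) rfl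
    (⟨f, hl⟩ : dgHomGroup Q X (Y ⊗ Q.obj ⟨n + 1⟩) a) (by
      -- In degree `0` every element is a cycle; otherwise the cycle condition is `hd` for the
      -- dimension one below.
      obtain _ | c := a
      · rw [HomologicalComplex.shape]
        · rfl
        · intro h
          exact absurd h (Nat.succ_ne_zero _)
      · rw [ComplexShape.next_eq' _ (show (ComplexShape.down ℕ).Rel (c + 1) c from rfl), dgHom_d]
        refine Subtype.ext ?_
        have h := hd c
        rw [cubeStep_succ] at h
        exact h)
  rw [dgHom_d] at h
  let x' : dgHomGroup Q X Y a := x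
  let w' : dgHomGroup Q X (Y ⊗ Q.obj ⟨n + 1⟩) (a + 1) := w
  have h' : f = x'.1 ≫ i + X ◁ cubeD Q a ≫ w'.1 := congrArg Subtype.val h
  have hw : X ◁ cubeE Q (a + 1) ≫ w'.1 = w'.1 := w'.2
  have hi : i ≫ Y ◁ Q.map (ECube.toPt (n + 1)) ≫ Y ◁ Q.map (ECube.zeroPt (n + 1)) = i := by
    have : Q.map (ECube.zeroPt (n + 1)) ≫ Q.map (ECube.toPt (n + 1)) = 𝟙 _ := by
      rw [← Q.map_comp, ECube.zeroPt_toPt, Q.map_id]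
    simp only [i, Category.assoc, ← MonoidalCategory.whiskerLeft_comp]
    rw [reassoc_of% this]
  have h0 : f ≫ Y ◁ Q.map (ECube.toPt (n + 1)) = 0 := by
    rw [← hr, Category.assoc, ← whiskerLeft_comp, cubeE_toPt, MonoidalPreadditive.whiskerLeft_zero,
      Limits.comp_zero]
  -- Retracting `□^{n+1}` to the vertex kills `f`, because `f` is killed by the projections, and
  -- fixes `i`. So the part through the vertex is itself a boundary, expressed by `w`.
  have h1 : x'.1 ≫ i = -(X ◁ cubeD Q a ≫ w'.1 ≫ Y ◁ Q.map (ECube.toPt (n + 1)) ≫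
      Y ◁ Q.map (ECube.zeroPt (n + 1))) := by
    rw [eq_neg_iff_add_eq_zero]
    have h2 := congrArg (fun z => z ≫ Y ◁ Q.map (ECube.toPt (n + 1)) ≫
      Y ◁ Q.map (ECube.zeroPt (n + 1))) h'
    simp only [Preadditive.add_comp, Category.assoc, hi] at h2
    rw [← h2, reassoc_of% h0, Limits.zero_comp]
  -- The correction of `w` by its retraction to the vertex; the projector in the target is applied
  -- afterwards, which `f` allows by `hr`.
  let g := w'.1 - w'.1 ≫ Y ◁ Q.map (ECube.toPt (n + 1)) ≫ Y ◁ Q.map (ECube.zeroPt (n + 1))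
  have hg : X ◁ cubeD Q a ≫ g = f := by
    rw [Preadditive.comp_sub, h', h1]
    abel
  refine ⟨g ≫ Y ◁ cubeE Q (n + 1), ?_, ?_, ?_⟩
  · simp only [g, Preadditive.sub_comp, Preadditive.comp_sub, Category.assoc, reassoc_of% hw]
  · rw [Category.assoc, ← whiskerLeft_comp, cubeE_idem]
  · rw [← Category.assoc, hg, hr]

/-- A null homotopy is built by induction on the dimension. The obstruction `f (a + 1) - h a ≫ d` is
a cocycle with values in `Y ⊗ □^{a+1}`, where the complex is exact. Only the start, with target
`□^0`, has to be given, by `k`. -/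
theorem HomotopyInvariant.exists_homotopy (hinv : HomotopyInvariant Q e)
    (f : ∀ a, X ⊗ Q.obj ⟨a⟩ ⟶ Y ⊗ Q.obj ⟨a⟩) (hl : ∀ a, X ◁ cubeE Q a ≫ f a = f a)
    (hr : ∀ a, f a ≫ Y ◁ cubeE Q a = f a)
    (hd : ∀ a, f a ≫ Y ◁ cubeD Q a = X ◁ cubeD Q a ≫ f (a + 1))
    (k : X ⊗ Q.obj ⟨0 + 1⟩ ⟶ Y ⊗ Q.obj ⟨0⟩) (hk : X ◁ cubeD Q 0 ≫ k = f 0) :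
    ∃ h : ∀ a, X ⊗ Q.obj ⟨a + 1⟩ ⟶ Y ⊗ Q.obj ⟨a⟩, (∀ a, X ◁ cubeE Q (a + 1) ≫ h a = h a) ∧
      (∀ a, h a ≫ Y ◁ cubeE Q a = h a) ∧ X ◁ cubeD Q 0 ≫ h 0 = f 0 ∧
      ∀ a, X ◁ cubeD Q (a + 1) ≫ h (a + 1) = f (a + 1) - h a ≫ Y ◁ cubeD Q a := by
  let P (a : ℕ) (h : X ⊗ Q.obj ⟨a + 1⟩ ⟶ Y ⊗ Q.obj ⟨a⟩) : Prop :=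
    X ◁ cubeE Q (a + 1) ≫ h = h ∧ h ≫ Y ◁ cubeE Q a = h ∧
      X ◁ cubeD Q a ≫ h ≫ Y ◁ cubeD Q a = f a ≫ Y ◁ cubeD Q a
  have step (a : ℕ) (h : {h // P a h}) : ∃ h' : {h' // P (a + 1) h'},
      X ◁ cubeD Q (a + 1) ≫ h'.1 = f (a + 1) - h.1 ≫ Y ◁ cubeD Q a := by
    obtain ⟨h, h1, h2, h3⟩ := h
    obtain ⟨g, g1, g2, g3⟩ := hinv.exists_cubeD_comp (f (a + 1) - h ≫ Y ◁ cubeD Q a)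
      (by rw [Preadditive.comp_sub, hl, reassoc_of% h1])
      (by rw [Preadditive.sub_comp, hr, Category.assoc, ← whiskerLeft_comp, ← cubeE_comp_cubeD,
        whiskerLeft_comp, reassoc_of% h2])
      (fun c => by
        by_cases hc : c = a
        · subst hc
          rw [cubeStep_succ, Preadditive.comp_sub, h3, hd, sub_self]
        · rw [cubeStep, dif_neg (by omega), MonoidalPreadditive.whiskerLeft_zero,
            Limits.zero_comp])
    refine ⟨⟨g, g1, g2, ?_⟩, g3⟩
    rw [reassoc_of% g3, Preadditive.sub_comp, Category.assoc, ← whiskerLeft_comp, cubeD_comp_cubeD,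
      MonoidalPreadditive.whiskerLeft_zero, Limits.comp_zero, sub_zero]
  choose next hnext using step
  -- The non-degenerate part of `k`. It satisfies the same equation because `cubeE` commutes with
  -- `d` and is the identity in dimension `0`.
  let h0 : {h // P 0 h} := ⟨X ◁ cubeE Q (0 + 1) ≫ k, by
      rw [← whiskerLeft_comp_assoc, cubeE_idem], by
      rw [cubeE_zero, whiskerLeft_id, Category.comp_id], by
      rw [Category.assoc, ← whiskerLeft_comp_assoc, ← cubeE_comp_cubeD, cubeE_zero,
        Category.id_comp, reassoc_of% hk]⟩
  let seq (a : ℕ) : {h // P a h} := Nat.rec h0 next a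
  refine ⟨fun a => (seq a).1, fun a => (seq a).2.1, fun a => (seq a).2.2.1, ?_, fun a =>
    hnext a (seq a)⟩
  change X ◁ cubeD Q 0 ≫ X ◁ cubeE Q (0 + 1) ≫ k = f 0
  rw [← whiskerLeft_comp_assoc, ← cubeE_comp_cubeD, cubeE_zero, Category.id_comp, hk]

theorem dgeHom_d_apply {p : ℤ} (f : ((dge Q).Hom X Y).X p) :
    ((dge Q).Hom X Y).d p (p + 1) f = dgeDHom Q X Y p (f : dgeHom Q X Y p) :=
  ConcreteCategory.congr_hom (dgeComplex_d Q X Y p) f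

/-- The component `X ⊗ □^0 ⟶ Y ⊗ □^0`. -/
abbrev zeroComponent (f : ((dge Q).Hom X Y).X 0) : X ⊗ Q.obj ⟨0⟩ ⟶ Y ⊗ Q.obj ⟨0⟩ :=
  (f : dgeHom Q X Y 0).1 0 0

/-- No differential of the target arrives in `□^0`, so the lowest component of a coboundary consists
of the source term alone. -/
theorem exists_of_mem_B0 (f : ((dge Q).Hom X Y).X 0) (hf : f ∈ ((dge Q).Hom X Y).B0) :
    ∃ k : X ⊗ Q.obj ⟨0 + 1⟩ ⟶ Y ⊗ Q.obj ⟨0⟩, X ◁ cubeD Q 0 ≫ k = zeroComponent f := by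
  obtain ⟨h, rfl⟩ := hf
  refine ⟨(h : dgeHom Q X Y (-1)).1 1 0, ?_⟩
  have h1 := congrArg (fun z : dgeHom Q X Y 0 => z.1 0 0) (dgeHom_d_apply h)
  refine Eq.trans ?_ h1.symm
  change _ = 0 - (-1 : ℤ).negOnePow • (X ◁ cubeD Q 0 ≫ (h : dgeHom Q X Y (-1)).1 (0 + 1) 0)
  rw [Int.negOnePow_neg, Int.negOnePow_one, Units.neg_smul, one_smul, zero_sub, neg_neg]

/-- The converse of the preceding criterion: the diagonal components of a `0`-cocycle are null
homotopic as soon as the lowest one factors through `d : □^0 ⟶ □^1`. -/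
theorem HomotopyInvariant.mem_B0 (hinv : HomotopyInvariant Q e) (f : ((dge Q).Hom X Y).Z0)
    (k : X ⊗ Q.obj ⟨0 + 1⟩ ⟶ Y ⊗ Q.obj ⟨0⟩) (hk : X ◁ cubeD Q 0 ≫ k = zeroComponent f.1) :
    f.1 ∈ ((dge Q).Hom X Y).B0 := by
  let φ : dgeHom Q X Y 0 := f.1
  have hφ : dgeD Q X Y 0 φ.1 = 0 := congrArg Subtype.val ((dgeHom_d_apply f.1).symm.trans f.2)
  obtain ⟨h, h1, h2, h3, h4⟩ := hinv.exists_homotopy (fun a => φ.1 a a) (fun a => φ.2.2.1 a a)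
    (fun a => φ.2.2.2 a a) (fun a => by
      have := congrFun (congrFun hφ a) (a + 1)
      rw [dgeD, Int.negOnePow_zero, one_smul] at this
      exact sub_eq_zero.1 this) k hk
  have hn {a n : ℕ} (ha : a ≠ n + 1) : X ◁ cubeSame Q a (n + 1) ≫ h n = 0 := by
    rw [cubeSame, dif_neg ha, MonoidalPreadditive.whiskerLeft_zero, Limits.zero_comp]
  have hs (n : ℕ) : X ◁ cubeSame Q (n + 1) (n + 1) ≫ h n = h n := by
    rw [cubeSame_self, whiskerLeft_id, Category.id_comp]
  -- The homotopy as an element of degree `-1`; `cubeSame` places `h n` at `a = n + 1` and gives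
  -- zero elsewhere.
  let η : dgeHom Q X Y (-1) := ⟨fun a n => X ◁ cubeSame Q a (n + 1) ≫ h n,
    fun a n ha => hn (by omega), fun a n => by
      change _ ≫ _ ≫ h n = _ ≫ h n
      rw [← whiskerLeft_comp_assoc, cubeE_same, whiskerLeft_comp_assoc, h1], fun a n => by
      change (_ ≫ h n) ≫ _ = _ ≫ h n
      rw [Category.assoc, h2]⟩
  refine ⟨η, (dgeHom_d_apply (p := -1) η).trans (Subtype.ext ?_)⟩
  funext a n
  change dTarget Q (fun n => X ◁ cubeSame Q a (n + 1) ≫ h n) n - (-1 : ℤ).negOnePow •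
    (X ◁ cubeD Q a ≫ X ◁ cubeSame Q (a + 1) (n + 1) ≫ h n) = φ.1 a n
  rw [Int.negOnePow_neg, Int.negOnePow_one, Units.neg_smul, one_smul, sub_neg_eq_add]
  by_cases han : a = n
  · subst han
    rw [hs]
    obtain _ | a := a
    · exact (zero_add _).trans h3
    · rw [dTarget, hs, h4, add_sub_cancel]
  · rw [hn (a := a + 1) (by omega), Limits.comp_zero, add_zero, φ.2.1 a n (by omega)]
    obtain _ | n := n
    · rfl
    · rw [dTarget, hn (by omega), Limits.zero_comp]

end Exact

/-! ### The homotopy category as a quotient of `C`. -/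

section ToH0

variable {C : Type u} [Category.{v} C] [Preadditive C] [MonoidalCategory C]
  [MonoidalPreadditive C] (Q : ECube ⥤ C)

/-- The family `φ ⊗ id` given by a morphism `φ` of `C`. -/
def dgeOf {X Y : C} (φ : X ⟶ Y) (a n : ℕ) : X ⊗ Q.obj ⟨a⟩ ⟶ Y ⊗ Q.obj ⟨n⟩ :=
  φ ▷ Q.obj ⟨a⟩ ≫ dgeIdFun Q Y a n

theorem dgeOf_mem {X Y : C} (φ : X ⟶ Y) : dgeOf Q φ ∈ dgeHom Q X Y 0 := by
  have h := dgeIdFun_mem Q Y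
  refine ⟨fun a n ha => ?_, fun a n => ?_, fun a n => ?_⟩
  · rw [dgeOf, h.1 a n ha, Limits.comp_zero]
  · rw [dgeOf, whisker_exchange_assoc, h.2.1]
  · rw [dgeOf, Category.assoc, h.2.2]

theorem dgeOf_d {X Y : C} (φ : X ⟶ Y) : dgeD Q X Y 0 (dgeOf Q φ) = 0 := by
  funext a n
  have h := congrFun (congrFun (dgeIdFun_d Q Y) a) n
  have h1 : dgeOf Q φ a = fun n => φ ▷ Q.obj ⟨a⟩ ≫ dgeIdFun Q Y a n := rfl
  rw [dgeD, h1, dTarget_comp, dgeOf, whisker_exchange_assoc]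
  rw [dgeD] at h
  rw [← Linear.comp_units_smul, ← Preadditive.comp_sub, h]
  exact Limits.comp_zero

/-- The `0`-cocycle of `dg_e C` given by a morphism of `C`. -/
def dgeOfCycle {X Y : C} (φ : X ⟶ Y) : ((dge Q).Hom X Y).Z0 :=
  ⟨(⟨dgeOf Q φ, dgeOf_mem Q φ⟩ : dgeHom Q X Y 0),
    (dgeHom_d_apply _).trans (Subtype.ext (dgeOf_d Q φ))⟩

theorem zeroComponent_dgeOfCycle {X Y : C} (φ : X ⟶ Y) :
    zeroComponent (dgeOfCycle Q φ).1 = φ ▷ Q.obj ⟨0⟩ := by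
  change φ ▷ Q.obj ⟨0⟩ ≫ dgeIdFun Q Y 0 0 = _
  rw [dgeIdFun_self, cubeE_zero, whiskerLeft_id, Category.comp_id]

/-- The functor from `C` to the homotopy category of `dg_e C`. -/
def toH0 : C ⥤ H0Cat (dge Q) where
  obj X := ⟨X⟩
  map φ := H0Cat.homMk (dgeOfCycle Q φ)
  map_id X := by
    refine congrArg H0Cat.homMk (Subtype.ext (Subtype.ext ?_))
    funext a n
    change 𝟙 X ▷ Q.obj ⟨a⟩ ≫ dgeIdFun Q X a n = dgeIdFun Q X a n
    rw [id_whiskerRight, Category.id_comp]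
  map_comp {X Y Z} φ ψ := by
    refine congrArg H0Cat.homMk (Subtype.ext (Subtype.ext ?_))
    funext a n
    change (φ ≫ ψ) ▷ Q.obj ⟨a⟩ ≫ dgeIdFun Q Z a n = (φ ▷ Q.obj ⟨a⟩ ≫ dgeIdFun Q Y a (0 + (a : ℤ)).toNat) ≫
      ψ ▷ Q.obj ⟨(0 + (a : ℤ)).toNat⟩ ≫ dgeIdFun Q Z (0 + (a : ℤ)).toNat n
    rw [zero_add, Int.toNat_natCast, dgeIdFun_self, comp_whiskerRight, Category.assoc,
      Category.assoc, whisker_exchange_assoc, (dgeIdFun_mem Q Z).2.1]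

variable {Q}

theorem homMk_eq_zero {X Y : C} (z : ((dge Q).Hom X Y).Z0) :
    H0Cat.homMk z = 0 ↔ z.1 ∈ ((dge Q).Hom X Y).B0 :=
  (QuotientAddGroup.eq_zero_iff z).trans AddSubgroup.mem_addSubgroupOf

theorem homMk_sub {X Y : C} (z w : ((dge Q).Hom X Y).Z0) :
    H0Cat.homMk (z - w) = H0Cat.homMk z - H0Cat.homMk w := rfl

instance : (toH0 Q).Additive where
  map_add {X Y φ ψ} := by
    refine congrArg H0Cat.homMk (Subtype.ext (Subtype.ext ?_))
    funext a n
    change (φ + ψ) ▷ Q.obj ⟨a⟩ ≫ dgeIdFun Q Y a n =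
      φ ▷ Q.obj ⟨a⟩ ≫ dgeIdFun Q Y a n + ψ ▷ Q.obj ⟨a⟩ ≫ dgeIdFun Q Y a n
    rw [MonoidalPreadditive.add_whiskerRight, Preadditive.add_comp]

section

variable (e : Q.obj ⟨0⟩ ≅ 𝟙_ C)

/-- The morphism `X ⟶ Y` given by a morphism `X ⊗ □^0 ⟶ Y ⊗ □^0`. -/
def unitStrip {X Y : C} (f : X ⊗ Q.obj ⟨0⟩ ⟶ Y ⊗ Q.obj ⟨0⟩) : X ⟶ Y :=
  (ρ_ X).inv ≫ X ◁ e.inv ≫ f ≫ Y ◁ e.hom ≫ (ρ_ Y).hom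

theorem unitStrip_whiskerRight {X Y : C} (φ : X ⟶ Y) : unitStrip e (φ ▷ Q.obj ⟨0⟩) = φ := by
  rw [unitStrip, whisker_exchange_assoc, ← whiskerLeft_comp_assoc, e.inv_hom_id, whiskerLeft_id,
    Category.id_comp, rightUnitor_naturality, Iso.inv_hom_id_assoc]

theorem whiskerRight_unitStrip {X Y : C} (f : X ⊗ Q.obj ⟨0⟩ ⟶ Y ⊗ Q.obj ⟨0⟩) :
    unitStrip e f ▷ Q.obj ⟨0⟩ = f := by
  have h : unitStrip e f ▷ 𝟙_ C = X ◁ e.inv ≫ f ≫ Y ◁ e.hom := by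
    rw [← cancel_mono (ρ_ Y).hom, rightUnitor_naturality, unitStrip, Iso.hom_inv_id_assoc]
    simp only [Category.assoc]
  rw [← cancel_mono (Y ◁ e.hom), ← whisker_exchange, h, ← whiskerLeft_comp_assoc, e.hom_inv_id,
    whiskerLeft_id, Category.id_comp]

end

variable {e : Q.obj ⟨0⟩ ≅ 𝟙_ C}

theorem HomotopyInvariant.toH0_map_eq_zero (hinv : HomotopyInvariant Q e) {X Y : C} (φ : X ⟶ Y)
    (k : X ⊗ Q.obj ⟨0 + 1⟩ ⟶ Y ⊗ Q.obj ⟨0⟩) (hk : X ◁ cubeD Q 0 ≫ k = φ ▷ Q.obj ⟨0⟩) :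
    (toH0 Q).map φ = 0 :=
  (homMk_eq_zero _).2 (hinv.mem_B0 _ k (hk.trans (zeroComponent_dgeOfCycle Q φ).symm))

theorem exists_of_toH0_map_eq_zero {X Y : C} (φ : X ⟶ Y) (h : (toH0 Q).map φ = 0) :
    ∃ k : X ⊗ Q.obj ⟨0 + 1⟩ ⟶ Y ⊗ Q.obj ⟨0⟩, X ◁ cubeD Q 0 ≫ k = φ ▷ Q.obj ⟨0⟩ := by
  obtain ⟨k, hk⟩ := exists_of_mem_B0 _ ((homMk_eq_zero _).1 h)
  exact ⟨k, hk.trans (zeroComponent_dgeOfCycle Q φ)⟩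

/-- Two cocycles with the same lowest component are cohomologous: their difference satisfies the
criterion with `k = 0`. So each class comes from a morphism of `C`, and `toH0` is full. -/
theorem HomotopyInvariant.homMk_eq (hinv : HomotopyInvariant Q e) {X Y : C}
    (z : ((dge Q).Hom X Y).Z0) :
    H0Cat.homMk z = (toH0 Q).map (unitStrip e (zeroComponent z.1)) := by
  refine sub_eq_zero.1 ((homMk_sub z (dgeOfCycle Q _)).symm.trans
    ((homMk_eq_zero _).2 (hinv.mem_B0 _ 0 ?_)))
  refine Limits.comp_zero.trans (Eq.symm ?_)
  change zeroComponent z.1 - zeroComponent (dgeOfCycle Q _).1 = 0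
  rw [zeroComponent_dgeOfCycle, whiskerRight_unitStrip, sub_self]

theorem HomotopyInvariant.full_toH0 (hinv : HomotopyInvariant Q e) : (toH0 Q).Full where
  map_surjective := by
    rintro X Y ⟨z⟩
    exact ⟨_, (hinv.homMk_eq z).symm⟩

/-- Morphisms factoring through `d : □^0 ⟶ □^1` are zero in the homotopy category. -/
theorem HomotopyInvariant.toH0_map_cubeD (hinv : HomotopyInvariant Q e) {X Y : C}
    (u : 𝟙_ C ⟶ Q.obj ⟨0⟩) (n : ℕ) (k : X ⊗ Q.obj ⟨n⟩ ⟶ Y) :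
    (toH0 Q).map ((ρ_ X).inv ≫ X ◁ (u ≫ cubeStep Q 0 n) ≫ k) = 0 := by
  by_cases hn : 0 + 1 = n
  · subst hn
    rw [cubeStep_succ]
    have h : (toH0 Q).map ((ρ_ X).inv ≫ X ◁ e.inv ≫ X ◁ cubeD Q 0 ≫ k) = 0 := by
      refine hinv.toH0_map_eq_zero _ (k ≫ (ρ_ Y).inv ≫ Y ◁ e.inv) ?_
      rw [← whiskerRight_unitStrip e (X ◁ cubeD Q 0 ≫ k ≫ (ρ_ Y).inv ≫ Y ◁ e.inv)]
      congr 1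
      rw [unitStrip]
      simp
    -- The morphism `u` differs from the fixed isomorphism `e.inv` by an endomorphism of the unit,
    -- which is split off as a factor.
    have hu : (ρ_ X).inv ≫ X ◁ (u ≫ cubeD Q 0) ≫ k =
        ((ρ_ X).inv ≫ X ◁ (u ≫ e.hom) ≫ (ρ_ X).hom) ≫ (ρ_ X).inv ≫ X ◁ e.inv ≫ X ◁ cubeD Q 0 ≫ k := by
      simp
    rw [hu, Functor.map_comp, h, Limits.comp_zero]
  · rw [cubeStep, dif_neg hn]
    simp

/-- Tensoring a factorization through `d : □^0 ⟶ □^1` with `Z` gives again such a factorization. So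
the ideal of null morphisms is stable under the tensor product. -/
theorem HomotopyInvariant.toH0_map_whiskerLeft (hinv : HomotopyInvariant Q e) {X Y : C}
    (φ ψ : X ⟶ Y) (Z : C) (h : (toH0 Q).map φ = (toH0 Q).map ψ) :
    (toH0 Q).map (Z ◁ φ) = (toH0 Q).map (Z ◁ ψ) := by
  rw [← sub_eq_zero, ← Functor.map_sub] at h ⊢
  obtain ⟨k, hk⟩ := exists_of_toH0_map_eq_zero _ h
  refine hinv.toH0_map_eq_zero _ ((α_ _ _ _).hom ≫ Z ◁ k ≫ (α_ _ _ _).inv) ?_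
  have h1 : Z ◁ φ - Z ◁ ψ = Z ◁ (φ - ψ) := ((tensorLeft Z).map_sub).symm
  rw [h1, whisker_assoc, ← hk, whiskerLeft_comp]
  simp

end ToH0

/-! ### The symmetric monoidal structure of the homotopy category. -/

section MonoidalH0

variable {C : Type u} [Category.{v} C] [Preadditive C] [MonoidalCategory C]
  [MonoidalPreadditive C]

/-- The functor to the homotopy category is full, and the tensor product of `C` is compatible with
the homotopy relation. -/
class TensorHomotopy (Q : ECube ⥤ C) : Prop where
  full : (toH0 Q).Full
  whiskerLeft {X Y : C} (φ ψ : X ⟶ Y) (Z : C) (h : (toH0 Q).map φ = (toH0 Q).map ψ) :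
    (toH0 Q).map (Z ◁ φ) = (toH0 Q).map (Z ◁ ψ)

theorem HomotopyInvariant.tensorHomotopy {Q : ECube ⥤ C} {e : Q.obj ⟨0⟩ ≅ 𝟙_ C}
    (hinv : HomotopyInvariant Q e) : TensorHomotopy Q where
  full := hinv.full_toH0
  whiskerLeft φ ψ Z h := hinv.toH0_map_whiskerLeft φ ψ Z h

namespace TensorHomotopy

variable [SymmetricCategory C] {Q : ECube ⥤ C} [TensorHomotopy Q]

theorem whiskerRight {X Y : C} (φ ψ : X ⟶ Y) (Z : C) (h : (toH0 Q).map φ = (toH0 Q).map ψ) :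
    (toH0 Q).map (φ ▷ Z) = (toH0 Q).map (ψ ▷ Z) := by
  have key (χ : X ⟶ Y) : χ ▷ Z = (β_ X Z).hom ≫ Z ◁ χ ≫ (β_ Y Z).inv := by
    rw [← BraidedCategory.braiding_naturality_left_assoc, Iso.hom_inv_id, Category.comp_id]
  rw [key, key, Functor.map_comp, Functor.map_comp, TensorHomotopy.whiskerLeft _ _ Z h,
    Functor.map_comp, Functor.map_comp]

/-- A morphism of `C` representing a morphism of the homotopy category. -/
noncomputable def lift {X Y : H0Cat (dge Q)} (f : X ⟶ Y) : X.obj ⟶ Y.obj :=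
  (TensorHomotopy.full (Q := Q)).map_surjective (X := X.obj) (Y := Y.obj) f |>.choose

theorem map_lift {X Y : H0Cat (dge Q)} (f : X ⟶ Y) : (toH0 Q).map (lift f) = f :=
  ((TensorHomotopy.full (Q := Q)).map_surjective (X := X.obj) (Y := Y.obj) f).choose_spec

theorem exists_map_eq {X Y : H0Cat (dge Q)} (f : X ⟶ Y) :
    ∃ φ : X.obj ⟶ Y.obj, (toH0 Q).map φ = f := ⟨_, map_lift f⟩

/-- Tensor products of morphisms are defined by chosen representatives in `C`; `toH0_whiskerLeft`,
`toH0_whiskerRight` and `toH0_tensorHom` show that the choice is irrelevant. -/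
noncomputable instance : MonoidalCategoryStruct (H0Cat (dge Q)) where
  tensorObj X Y := ⟨X.obj ⊗ Y.obj⟩
  whiskerLeft X _ _ f := (toH0 Q).map (X.obj ◁ lift f)
  whiskerRight f Y := (toH0 Q).map (lift f ▷ Y.obj)
  tensorHom f g := (toH0 Q).map (lift f ⊗ₘ lift g)
  tensorUnit := ⟨𝟙_ C⟩
  associator X Y Z := (toH0 Q).mapIso (α_ X.obj Y.obj Z.obj)
  leftUnitor X := (toH0 Q).mapIso (λ_ X.obj)
  rightUnitor X := (toH0 Q).mapIso (ρ_ X.obj)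

theorem toH0_whiskerLeft (Z : H0Cat (dge Q)) {X Y : C} (φ : X ⟶ Y) :
    Z ◁ (toH0 Q).map φ = (toH0 Q).map (Z.obj ◁ φ) :=
  TensorHomotopy.whiskerLeft _ _ _ (map_lift ((toH0 Q).map φ))

theorem toH0_whiskerRight {X Y : C} (φ : X ⟶ Y) (Z : H0Cat (dge Q)) :
    (toH0 Q).map φ ▷ Z = (toH0 Q).map (φ ▷ Z.obj) :=
  TensorHomotopy.whiskerRight _ _ _ (map_lift ((toH0 Q).map φ))

theorem toH0_tensorHom {X Y X' Y' : C} (φ : X ⟶ Y) (ψ : X' ⟶ Y') :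
    (toH0 Q).map φ ⊗ₘ (toH0 Q).map ψ = (toH0 Q).map (φ ⊗ₘ ψ) := by
  change (toH0 Q).map (lift ((toH0 Q).map φ) ⊗ₘ lift ((toH0 Q).map ψ)) = _
  rw [MonoidalCategory.tensorHom_def, MonoidalCategory.tensorHom_def, Functor.map_comp,
    Functor.map_comp, TensorHomotopy.whiskerLeft _ _ _ (map_lift ((toH0 Q).map ψ)),
    TensorHomotopy.whiskerRight _ _ _ (map_lift ((toH0 Q).map φ))]
  rfl

/-- By fullness every morphism is replaced by a representative, and each axiom is the image under
`toH0` of the same axiom in `C`. The braiding and additivity below are treated likewise. -/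
noncomputable instance : MonoidalCategory (H0Cat (dge Q)) where
  tensorHom_def f g := by
    obtain ⟨f, rfl⟩ := exists_map_eq f
    obtain ⟨g, rfl⟩ := exists_map_eq g
    refine (toH0_tensorHom f g).trans ?_
    rw [MonoidalCategory.tensorHom_def, Functor.map_comp]
    exact congrArg₂ (· ≫ ·) (toH0_whiskerRight f _).symm (toH0_whiskerLeft _ g).symm
  id_tensorHom_id X Y :=
    (congrArg₂ (· ⊗ₘ ·) ((toH0 Q).map_id X.obj).symm ((toH0 Q).map_id Y.obj).symm).trans
      ((toH0_tensorHom _ _).trans ((congrArg (toH0 Q).map (id_tensorHom_id _ _)).trans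
        ((toH0 Q).map_id _)))
  tensorHom_comp_tensorHom f f' g g' := by
    obtain ⟨f, rfl⟩ := exists_map_eq f
    obtain ⟨f', rfl⟩ := exists_map_eq f'
    obtain ⟨g, rfl⟩ := exists_map_eq g
    obtain ⟨g', rfl⟩ := exists_map_eq g'
    exact (congrArg₂ (· ≫ ·) (toH0_tensorHom f f') (toH0_tensorHom g g')).trans
      (((toH0 Q).map_comp _ _).symm.trans ((congrArg (toH0 Q).map
        (tensorHom_comp_tensorHom f f' g g')).trans ((toH0_tensorHom _ _).symm.trans
          (congrArg₂ (· ⊗ₘ ·) ((toH0 Q).map_comp f g) ((toH0 Q).map_comp f' g')))))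
  whiskerLeft_id X Y :=
    (congrArg (X ◁ ·) ((toH0 Q).map_id Y.obj).symm).trans ((toH0_whiskerLeft X _).trans
      ((congrArg (toH0 Q).map (whiskerLeft_id _ _)).trans ((toH0 Q).map_id _)))
  id_whiskerRight X Y :=
    (congrArg (· ▷ Y) ((toH0 Q).map_id X.obj).symm).trans ((toH0_whiskerRight _ Y).trans
      ((congrArg (toH0 Q).map (id_whiskerRight _ _)).trans ((toH0 Q).map_id _)))
  associator_naturality {X₁ X₂ X₃ Y₁ Y₂ Y₃} f g h := by
    obtain ⟨f, rfl⟩ := exists_map_eq f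
    obtain ⟨g, rfl⟩ := exists_map_eq g
    obtain ⟨h, rfl⟩ := exists_map_eq h
    have h1 : (toH0 Q).map ((f ⊗ₘ g) ⊗ₘ h) = (((toH0 Q).map f ⊗ₘ (toH0 Q).map g) ⊗ₘ
        (toH0 Q).map h) := (toH0_tensorHom _ _).symm.trans
      (congrArg (· ⊗ₘ (toH0 Q).map h) (toH0_tensorHom f g).symm)
    have h2 : (toH0 Q).map (f ⊗ₘ g ⊗ₘ h) = ((toH0 Q).map f ⊗ₘ (toH0 Q).map g ⊗ₘ
        (toH0 Q).map h) := (toH0_tensorHom _ _).symm.trans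
      (congrArg ((toH0 Q).map f ⊗ₘ ·) (toH0_tensorHom g h).symm)
    exact (congrArg (· ≫ (toH0 Q).map (α_ Y₁.obj Y₂.obj Y₃.obj).hom) h1.symm).trans
      (((toH0 Q).map_comp _ _).symm.trans ((congrArg (toH0 Q).map
        (associator_naturality f g h)).trans (((toH0 Q).map_comp _ _).trans
          (congrArg ((toH0 Q).map (α_ X₁.obj X₂.obj X₃.obj).hom ≫ ·) h2))))
  leftUnitor_naturality {X Y} f := by
    obtain ⟨f, rfl⟩ := exists_map_eq f
    exact (congrArg (· ≫ (toH0 Q).map (λ_ Y.obj).hom)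
      (toH0_whiskerLeft ⟨𝟙_ C⟩ f)).trans (((toH0 Q).map_comp _ _).symm.trans
        ((congrArg (toH0 Q).map (leftUnitor_naturality f)).trans ((toH0 Q).map_comp _ _)))
  rightUnitor_naturality {X Y} f := by
    obtain ⟨f, rfl⟩ := exists_map_eq f
    exact (congrArg (· ≫ (toH0 Q).map (ρ_ Y.obj).hom)
      (toH0_whiskerRight f ⟨𝟙_ C⟩)).trans (((toH0 Q).map_comp _ _).symm.trans
        ((congrArg (toH0 Q).map (rightUnitor_naturality f)).trans ((toH0 Q).map_comp _ _)))
  pentagon W X Y Z := by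
    have h := congrArg (toH0 Q).map (pentagon W.obj X.obj Y.obj Z.obj)
    rw [Functor.map_comp, Functor.map_comp, Functor.map_comp] at h
    refine Eq.trans ?_ h
    exact congrArg₂ (fun a b => a ≫ (toH0 Q).map _ ≫ b) (toH0_whiskerRight _ Z)
      (toH0_whiskerLeft W _)
  triangle X Y := by
    have h := congrArg (toH0 Q).map (triangle X.obj Y.obj)
    rw [Functor.map_comp] at h
    exact (congrArg ((toH0 Q).map _ ≫ ·) (toH0_whiskerLeft X _)).trans
      (h.trans (toH0_whiskerRight _ Y).symm)

noncomputable instance : BraidedCategory (H0Cat (dge Q)) where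
  braiding X Y := (toH0 Q).mapIso (β_ X.obj Y.obj)
  braiding_naturality_right X {Y Z} f := by
    obtain ⟨f, rfl⟩ := exists_map_eq f
    have h := congrArg (toH0 Q).map (BraidedCategory.braiding_naturality_right X.obj f)
    rw [Functor.map_comp, Functor.map_comp] at h
    exact (congrArg (· ≫ (toH0 Q).map (β_ X.obj Z.obj).hom) (toH0_whiskerLeft X f)).trans
      (h.trans (congrArg ((toH0 Q).map (β_ X.obj Y.obj).hom ≫ ·) (toH0_whiskerRight f X).symm))
  braiding_naturality_left {X Y} f Z := by
    obtain ⟨f, rfl⟩ := exists_map_eq f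
    have h := congrArg (toH0 Q).map (BraidedCategory.braiding_naturality_left f Z.obj)
    rw [Functor.map_comp, Functor.map_comp] at h
    exact (congrArg (· ≫ (toH0 Q).map (β_ Y.obj Z.obj).hom) (toH0_whiskerRight f Z)).trans
      (h.trans (congrArg ((toH0 Q).map (β_ X.obj Z.obj).hom ≫ ·) (toH0_whiskerLeft Z f).symm))
  hexagon_forward X Y Z := by
    have h := congrArg (toH0 Q).map (BraidedCategory.hexagon_forward X.obj Y.obj Z.obj)
    simp only [Functor.map_comp] at h
    refine h.trans ?_
    exact congrArg₂ (fun a b => a ≫ (toH0 Q).map _ ≫ b) (toH0_whiskerRight _ Z).symm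
      (toH0_whiskerLeft Y _).symm
  hexagon_reverse X Y Z := by
    have h := congrArg (toH0 Q).map (BraidedCategory.hexagon_reverse X.obj Y.obj Z.obj)
    simp only [Functor.map_comp] at h
    refine h.trans ?_
    exact congrArg₂ (fun a b => a ≫ (toH0 Q).map _ ≫ b) (toH0_whiskerLeft X _).symm
      (toH0_whiskerRight _ Y).symm

noncomputable instance : SymmetricCategory (H0Cat (dge Q)) where
  symmetry X Y := by
    have h := congrArg (toH0 Q).map (SymmetricCategory.symmetry X.obj Y.obj)
    rw [Functor.map_comp] at h
    exact h.trans ((toH0 Q).map_id _)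

instance : MonoidalPreadditive (H0Cat (dge Q)) where
  whiskerLeft_zero {X Y Z} := by
    have h := toH0_whiskerLeft X (0 : Y.obj ⟶ Z.obj)
    rw [MonoidalPreadditive.whiskerLeft_zero] at h
    exact (congrArg (X ◁ ·) ((toH0 Q).map_zero Y.obj Z.obj).symm).trans
      (h.trans ((toH0 Q).map_zero _ _))
  zero_whiskerRight {X Y Z} := by
    have h := toH0_whiskerRight (0 : Y.obj ⟶ Z.obj) X
    rw [MonoidalPreadditive.zero_whiskerRight] at h
    exact (congrArg (· ▷ X) ((toH0 Q).map_zero Y.obj Z.obj).symm).trans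
      (h.trans ((toH0 Q).map_zero _ _))
  whiskerLeft_add {X Y Z} f g := by
    obtain ⟨f, rfl⟩ := exists_map_eq f
    obtain ⟨g, rfl⟩ := exists_map_eq g
    have h := toH0_whiskerLeft X (f + g)
    rw [MonoidalPreadditive.whiskerLeft_add] at h
    exact (congrArg (X ◁ ·) (toH0 Q).map_add.symm).trans (h.trans ((toH0 Q).map_add.trans
      (congrArg₂ (· + ·) (toH0_whiskerLeft X f).symm (toH0_whiskerLeft X g).symm)))
  add_whiskerRight {X Y Z} f g := by
    obtain ⟨f, rfl⟩ := exists_map_eq f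
    obtain ⟨g, rfl⟩ := exists_map_eq g
    have h := toH0_whiskerRight (f + g) X
    rw [MonoidalPreadditive.add_whiskerRight] at h
    exact (congrArg (· ▷ X) (toH0 Q).map_add.symm).trans (h.trans ((toH0 Q).map_add.trans
      (congrArg₂ (· + ·) (toH0_whiskerRight f X).symm (toH0_whiskerRight g X).symm)))

/-- The functor is strict, with identity constraints. As a lax braided functor it carries the
shuffles of `C` to those of the homotopy category by `tensShuffle_lax`. -/
noncomputable instance : (toH0 Q).LaxMonoidal where
  ε := 𝟙 (⟨𝟙_ C⟩ : H0Cat (dge Q))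
  μ X Y := 𝟙 (⟨X ⊗ Y⟩ : H0Cat (dge Q))
  μ_natural_left f X' :=
    (Category.comp_id _).trans ((toH0_whiskerRight f _).trans (Category.id_comp _).symm)
  μ_natural_right X' f :=
    (Category.comp_id _).trans ((toH0_whiskerLeft _ f).trans (Category.id_comp _).symm)
  associativity X Y Z := by
    have h1 := congrArg (· ≫ 𝟙 (⟨(X ⊗ Y) ⊗ Z⟩ : H0Cat (dge Q)) ≫ (toH0 Q).map (α_ X Y Z).hom)
      (id_whiskerRight (⟨X ⊗ Y⟩ : H0Cat (dge Q)) ⟨Z⟩)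
    have h2 := congrArg (fun z => (toH0 Q).map (α_ X Y Z).hom ≫ z ≫
      𝟙 (⟨X ⊗ (Y ⊗ Z)⟩ : H0Cat (dge Q))) (whiskerLeft_id (⟨X⟩ : H0Cat (dge Q)) ⟨Y ⊗ Z⟩)
    exact h1.trans (((Category.id_comp _).trans (Category.id_comp _)).trans
      (h2.trans ((congrArg ((toH0 Q).map _ ≫ ·) (Category.id_comp _)).trans
        (Category.comp_id _))).symm)
  left_unitality X := by
    have h := congrArg (· ≫ 𝟙 (⟨𝟙_ C ⊗ X⟩ : H0Cat (dge Q)) ≫ (toH0 Q).map (λ_ X).hom)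
      (id_whiskerRight (⟨𝟙_ C⟩ : H0Cat (dge Q)) ⟨X⟩)
    exact (h.trans ((Category.id_comp _).trans (Category.id_comp _))).symm
  right_unitality X := by
    have h := congrArg (· ≫ 𝟙 (⟨X ⊗ 𝟙_ C⟩ : H0Cat (dge Q)) ≫ (toH0 Q).map (ρ_ X).hom)
      (whiskerLeft_id (⟨X⟩ : H0Cat (dge Q)) ⟨𝟙_ C⟩)
    exact (h.trans ((Category.id_comp _).trans (Category.id_comp _))).symm

noncomputable instance : (toH0 Q).LaxBraided where
  braided _ _ := (Category.id_comp _).trans (Category.comp_id _).symm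

end TensorHomotopy

end MonoidalH0

/-! ### Components with all cubes of dimension 0. -/

section Strip

variable {C : Type u} [Category.{v} C] [MonoidalCategory C] [SymmetricCategory C]
  {Q : ECube ⥤ C} (e : Q.obj ⟨0⟩ ≅ 𝟙_ C)

instance isIso_tensLHom {J : Type} {A B : J → C} (φ : ∀ j, A j ⟶ B j) [∀ j, IsIso (φ j)]
    (L : List J) : IsIso (tensLHom φ L) :=
  inferInstanceAs (IsIso (tensLIso (fun j => asIso (φ j)) L).hom)

/-- The isomorphism `⊗_i □^0 ≅ 𝟙`. -/
def cubesTriv (I : FinIdx) : (cubes Q I fun _ => 0) ⟶ 𝟙_ C :=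
  tensHom I (fun _ => e.hom) ≫ tensLTriv I.list

instance (I : FinIdx) : IsIso (cubesTriv e I) := by
  rw [cubesTriv]
  infer_instance

theorem FinIdx.list_eq (I : FinIdx) : ∃ M, I.list = I.fst :: M :=
  ⟨_, List.ofFn_succ⟩

theorem tensLPull_head {J : Type} [DecidableEq J] {A : J → C} (ψ : ∀ k, A k ⟶ 𝟙_ C) (j : J)
    {L : List J} (hL : ∃ M, L = j :: M) (h : j ∈ L) :
    (tensLPull A j L h).hom ≫ A j ◁ (tensLHom ψ _ ≫ tensLTriv _) ≫ (ρ_ (A j)).hom ≫ ψ j =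
      tensLHom ψ L ≫ tensLTriv L := by
  obtain ⟨M, rfl⟩ := hL
  have key (M' : List J) (hM : M = M') :
      castL A hM ≫ tensLHom ψ M' ≫ tensLTriv M' = tensLHom ψ M ≫ tensLTriv M := by
    subst hM
    exact Category.id_comp _
  rw [tensLPull_self, Category.assoc, ← whiskerLeft_comp_assoc, key, ← rightUnitor_naturality,
    ← unitors_equal, tensLTriv_cons, tensLHom, Category.assoc, Category.assoc,
    Iso.hom_inv_id_assoc, MonoidalCategory.tensorHom_def, Category.assoc, ← whisker_exchange_assoc,
    ← whisker_exchange_assoc, whiskerLeft_comp, Category.assoc]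

/-- In dimension `0` the preference for the first cube disappears: dropping the other trivial
factors and then trivializing the first one is the symmetric trivialization of all of them. This
makes the universal element compatible with `multiStrip`. -/
theorem cubesAt_fst_zero (I : FinIdx) :
    cubesAt Q e I I.fst (fun _ => 0) ≫ e.hom = cubesTriv e I := by
  have h0 : Q.map (ECube.toPt 0) = 𝟙 _ := by
    rw [show ECube.toPt 0 = 𝟙 _ from by ext1 y; exact Subsingleton.elim (α := Fin 0 → Bool) _ _,
      Q.map_id]
  rw [cubesAt]
  simp only [h0, Category.id_comp, Category.assoc]
  exact tensLPull_head (A := fun _ => Q.obj ⟨0⟩) (fun _ => e.hom) I.fst I.list_eq _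

theorem tensShuffle_cubesTriv {I : FinIdx} {F : I.α → FinIdx} {J : FinIdx}
    (σ : (Σ i, (F i).α) ≃ J.α) :
    (tensShuffle σ fun _ => Q.obj ⟨0⟩).hom ≫ tensHom I (fun i => cubesTriv e (F i)) ≫
      tensLTriv I.list = cubesTriv e J := by
  have h := tensShuffle_natural σ (fun _ => e.hom)
  have h2 : tensHom I (fun i => cubesTriv e (F i)) = tensHom I (fun i => tensHom (F i) fun _ => e.hom) ≫
      tensHom I (fun i => tensLTriv (F i).list) := (tensLHom_comp _ _ _).symm
  rw [h2, Category.assoc, ← reassoc_of% h, tensShuffle_triv]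
  rfl

end Strip

section Strip

variable {C : Type u} [Category.{v} C] [Preadditive C] [MonoidalCategory C]
  [MonoidalPreadditive C] [SymmetricCategory C] {Q : ECube ⥤ C} (e : Q.obj ⟨0⟩ ≅ 𝟙_ C)
  {I : FinIdx} {X : I.α → C} {Y : C}

/-- The morphism `⊗_i X_i ⟶ Y` given by a morphism `⊗_i X_i ⊗ ⊗_i □^0 ⟶ Y ⊗ □^0`. -/
noncomputable def multiStrip : (tens I X ⊗ (cubes Q I fun _ => 0) ⟶ Y ⊗ Q.obj ⟨0⟩) →+
    (tens I X ⟶ Y) :=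
  AddMonoidHom.mk' (fun f => (ρ_ _).inv ≫ tens I X ◁ inv (cubesTriv e I) ≫ f ≫ Y ◁ e.hom ≫
    (ρ_ Y).hom) fun f g => by simp

theorem multiStrip_apply (f : tens I X ⊗ (cubes Q I fun _ => 0) ⟶ Y ⊗ Q.obj ⟨0⟩) :
    multiStrip e f = (ρ_ _).inv ≫ tens I X ◁ inv (cubesTriv e I) ≫ f ≫ Y ◁ e.hom ≫
      (ρ_ Y).hom := rfl

theorem eq_multiStrip (f : tens I X ⊗ (cubes Q I fun _ => 0) ⟶ Y ⊗ Q.obj ⟨0⟩) :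
    f = tens I X ◁ cubesTriv e I ≫ (ρ_ _).hom ≫ multiStrip e f ≫ (ρ_ Y).inv ≫ Y ◁ e.inv := by
  rw [multiStrip_apply]
  simp only [Category.assoc, Iso.hom_inv_id_assoc, ← whiskerLeft_comp, e.hom_inv_id,
    whiskerLeft_id, Category.comp_id]
  rw [← whiskerLeft_comp_assoc, IsIso.hom_inv_id, whiskerLeft_id, Category.id_comp]

theorem multiStrip_extendFst (φ : ∀ a n : ℕ, tens I X ⊗ Q.obj ⟨a⟩ ⟶ Y ⊗ Q.obj ⟨n⟩) :
    multiStrip e (extendFst Q e φ (fun _ => 0) 0) = unitStrip e (φ 0 0) := by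
  have h0 : ¬ I.Off fun _ => 0 := fun ⟨_, _, h⟩ => h rfl
  have h1 : inv (cubesTriv e I) ≫ cubesAt Q e I I.fst (fun _ => 0) = e.inv := by
    rw [IsIso.inv_comp_eq, ← cubesAt_fst_zero, Category.assoc, e.hom_inv_id]
    exact (Category.comp_id _).symm
  rw [multiStrip_apply, extendFst_not_off e h0, unitStrip, Category.assoc,
    ← whiskerLeft_comp_assoc, h1]

variable {e}

/-- The target `□^0` receives no differential, and the source term at the place `j` factors through
`d : □^0 ⟶ □^1` in the `j`-th cube. Each summand thus vanishes in the homotopy category. -/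
theorem HomotopyInvariant.toH0_map_multiStrip_d (hinv : HomotopyInvariant Q e)
    (f : ∀ (b : I.α → ℕ) (n : ℕ), tens I X ⊗ cubes Q I b ⟶ Y ⊗ Q.obj ⟨n⟩) (m : ℤ) :
    (toH0 Q).map (multiStrip e (multiD Q I X Y m f (fun _ => 0) 0)) = 0 := by
  change (toH0 Q).mapAddHom (multiStrip e _) = 0
  rw [multiD, dTarget, zero_sub, Units.smul_def, map_neg, map_zsmul, map_neg, map_zsmul, map_sum,
    map_sum, Finset.sum_eq_zero, smul_zero, neg_zero]
  intro j _
  rw [Units.smul_def, map_zsmul, map_zsmul]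
  have h1 := cubesD_cubesAt Q e I j (fun _ => 0)
  have h2 : cubesD Q I (fun _ => 0) (bump (fun _ => 0) j) j = cubesAt Q e I j (fun _ => 0) ≫
      cubeStep Q 0 (bump (fun _ => 0) j j) ≫ cubesAtInv Q e I j (bump (fun _ => 0) j) := by
    rw [← reassoc_of% h1, cubesAt_cubesAtInv Q e I j fun k hk => bump_ne _ hk, Category.comp_id]
  have h3 := hinv.toH0_map_cubeD (X := tens I X) (Y := Y)
    (inv (cubesTriv e I) ≫ cubesAt Q e I j (fun _ => 0)) (bump (fun _ => 0) j j)
    (tens I X ◁ cubesAtInv Q e I j (bump (fun _ => 0) j) ≫ f (bump (fun _ => 0) j) 0 ≫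
      Y ◁ e.hom ≫ (ρ_ Y).hom)
  refine (congrArg _ ?_).trans (smul_zero _)
  refine Eq.trans (congrArg (toH0 Q).map ?_) h3
  rw [multiStrip_apply, h2]
  simp only [whiskerLeft_comp, Category.assoc]

/-- For elements of degree `0` in dimension `0` all intermediate dimensions and the Koszul exponent
are `0`. What remains is that trivial cubes may be removed before or after shuffling, which is the
coherence for the constant functor. -/
theorem multiStrip_comp {F : I.α → FinIdx} {J : FinIdx}
    (σ : (Σ i, (F i).α) ≃ J.α) {X : J.α → C} {Y : I.α → C} {Z : C}
    (f : ∀ (a : I.α → ℕ) (k : ℕ), tens I Y ⊗ cubes Q I a ⟶ Z ⊗ Q.obj ⟨k⟩)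
    (g : ∀ (i : I.α) (b : (F i).α → ℕ) (k : ℕ),
      tens (F i) (fun t => X (σ ⟨i, t⟩)) ⊗ cubes Q (F i) b ⟶ Y i ⊗ Q.obj ⟨k⟩) :
    multiStrip e (multiCompFun Q σ (fun _ => 0) f g (fun _ => 0) 0) =
      (tensShuffle σ X).hom ≫ tensHom I (fun i => multiStrip e (g i (fun _ => 0) 0)) ≫
        multiStrip e (f (fun _ => 0) 0) := by
  have hk : FinIdx.koszul σ (fun _ => 0) (fun _ => ((0 : ℕ) : ℤ)) = 0 := by
    simp [FinIdx.koszul]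
  have ha : compDeg σ (fun _ => 0) (fun _ => 0) = fun _ => 0 := by
    funext i
    simp [compDeg]
  -- Every inner component is the stripped morphism with the trivial cubes taken off before it and
  -- put back after it.
  have hg : tensHom I (fun i => g i (fun _ => 0) 0) =
      tensHom I (fun i => _ ◁ cubesTriv e (F i)) ≫ tensHom I (fun i => (ρ_ _).hom) ≫
        tensHom I (fun i => multiStrip e (g i (fun _ => 0) 0)) ≫
          tensHom I (fun i => (ρ_ (Y i)).inv) ≫ tensHom I (fun i => Y i ◁ e.inv) := by
    simp only [tensHom, tensLHom_comp, ← eq_multiStrip]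
  have h1 : tensDeal σ X (fun _ => Q.obj ⟨0⟩) ≫ tensHom I (fun i => _ ◁ cubesTriv e (F i)) ≫
      tensHom I (fun i => (ρ_ _).hom) = ((tensShuffle σ X).hom ⊗ₘ cubesTriv e J) ≫ (ρ_ _).hom := by
    have h := tensLMul_inv_natural (fun i => 𝟙 (tens (F i) fun t => X (σ ⟨i, t⟩)))
      (fun i => cubesTriv e (F i)) I.list
    simp only [id_tensorHom, tensLHom_id] at h
    have h' := tensLMul_triv (fun i => tens (F i) fun t => X (σ ⟨i, t⟩)) I.list
    rw [← Iso.eq_inv_comp] at h'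
    rw [tensDeal, Category.assoc, ← reassoc_of% h, tensHom, ← h', ← tensShuffle_cubesTriv e σ,
      ← tensorHom_comp_whiskerLeft, whiskerLeft_comp]
    simp only [Category.assoc]
  have h2 : tensHom I (fun i => (ρ_ (Y i)).inv) ≫ tensHom I (fun i => Y i ◁ e.inv) ≫
      (tensLMul Y (fun _ => Q.obj ⟨0⟩) I.list).hom =
        (ρ_ _).inv ≫ tens I Y ◁ inv (cubesTriv e I) := by
    have h := tensLMul_natural_right (A := Y) (fun _ => e.inv) I.list
    have h' : tensHom I (fun i => (ρ_ (Y i)).inv) ≫ tensHom I (fun i => (ρ_ (Y i)).hom) = 𝟙 _ := by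
      simp only [tensHom, tensLHom_comp, Iso.inv_hom_id, tensLHom_id]
    have h3 : cubesTriv e I ≫ inv (tensLTriv I.list) ≫ tensHom I (fun _ => e.inv) = 𝟙 _ := by
      rw [cubesTriv, Category.assoc, IsIso.hom_inv_id_assoc]
      simp only [tensHom, tensLHom_comp, Iso.hom_inv_id, tensLHom_id]
    rw [tensHom, tensHom, ← tensLMul_triv] at h'
    have h4 : tensHom I (fun i => (ρ_ (Y i)).inv) ≫ (tensLMul Y (fun _ => 𝟙_ C) I.list).hom =
        (ρ_ _).inv ≫ tens I Y ◁ inv (tensLTriv I.list) := by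
      rw [← cancel_mono (tens I Y ◁ tensLTriv I.list ≫ (ρ_ (tens I Y)).hom), Category.assoc, h',
        Category.assoc, ← whiskerLeft_comp_assoc, IsIso.inv_hom_id, whiskerLeft_id,
        Category.id_comp, Iso.inv_hom_id]
    rw [tensHom, tensHom, h, ← IsIso.eq_inv_of_hom_inv_id h3, whiskerLeft_comp, reassoc_of% h4]
  rw [multiCompFun_eq, hk, ha, Int.negOnePow_zero, one_smul, multiStrip_apply, hg]
  simp only [Category.assoc]
  rw [reassoc_of% h1, reassoc_of% h2, MonoidalCategory.tensorHom_def', Category.assoc,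
    ← whiskerLeft_comp_assoc, IsIso.inv_hom_id, whiskerLeft_id, Category.id_comp,
    rightUnitor_naturality_assoc, Iso.inv_hom_id_assoc, multiStrip_apply]

end Strip

/-! ### Coboundaries in degree 0 of `P_I`. -/

section Cocycles

variable {C : Type u} [Category.{v} C] [Preadditive C] [MonoidalCategory C]
  [MonoidalPreadditive C] [SymmetricCategory C] {Q : ECube ⥤ C} (e : Q.obj ⟨0⟩ ≅ 𝟙_ C)
  {I : FinIdx} {X : I.α → C} {Y : C}

/-- The morphism `⊗_i X_i ⟶ Y` given by an element of degree `0` of `P_I({X_i}, Y)`. -/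
noncomputable def zeroStrip : ((dgeData Q).P I X Y).X 0 →+ (tens I X ⟶ Y) :=
  AddMonoidHom.mk' (fun z => multiStrip e (multiVal Q z (fun _ => 0) 0)) fun _ _ =>
    map_add (multiStrip e) _ _

theorem zeroStrip_apply (z : ((dgeData Q).P I X Y).X 0) :
    zeroStrip e z = multiStrip e (multiVal Q z (fun _ => 0) 0) := rfl

theorem zeroStrip_act_univFst (φ : ((dge Q).Hom (tens I X) Y).X 0) :
    zeroStrip e ((dgeData Q).act (add_zero 0) φ (univFst Q e I X).1) =
      unitStrip e (zeroComponent φ) := by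
  rw [zeroStrip_apply, act_univFst, multiStrip_extendFst]

theorem zeroStrip_univFst : zeroStrip e (univFst Q e I X).1 = 𝟙 _ := by
  refine (multiStrip_extendFst e (dgeIdFun Q (tens I X))).trans ?_
  rw [dgeIdFun_self, cubeE_zero, whiskerLeft_id, ← id_whiskerRight, unitStrip_whiskerRight]

theorem zeroStrip_comp {F : I.α → FinIdx} {J : FinIdx} (σ : (Σ i, (F i).α) ≃ J.α) {X : J.α → C}
    {Y : I.α → C} {Z : C} (h : 0 + ∑ _ : I.α, (0 : ℤ) = 0) (f : ((dgeData Q).P I Y Z).X 0)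
    (g : ∀ i, ((dgeData Q).P (F i) (fun t => X (σ ⟨i, t⟩)) (Y i)).X 0) :
    zeroStrip e ((dgeData Q).comp σ 0 (fun _ => 0) 0 h f g) =
      (tensShuffle σ X).hom ≫ tensHom I (fun i => zeroStrip e (g i)) ≫ zeroStrip e f :=
  multiStrip_comp σ _ _

theorem zeroStrip_un {X Y : C} (f : ((dge Q).Hom X Y).X 0) :
    zeroStrip e ((dgeData Q).un f) = unitStrip e (zeroComponent f) := by
  have h0 : ¬ FinIdx.one.Off fun _ => 0 := fun ⟨_, _, h⟩ => h rfl
  have h1 (φ : ∀ a n : ℕ, X ⊗ Q.obj ⟨a⟩ ⟶ Y ⊗ Q.obj ⟨n⟩) :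
      unFun Q φ (fun _ => 0) 0 =
        extendFst (I := FinIdx.one) (X := fun _ => X) Q e φ (fun _ => 0) 0 := by
    refine Eq.trans ?_ (extendFst_not_off (I := FinIdx.one) (X := fun _ => X) e h0 0).symm
    refine (Category.id_comp _).symm.trans (congrArg (· ≫ φ 0 0) ?_)
    exact ((congrArg (X ◁ ·) (cubesAt_one Q e fun _ => 0)).trans (whiskerLeft_id X _)).symm
  exact (congrArg (multiStrip e) (h1 _)).trans (multiStrip_extendFst (I := FinIdx.one)
    (X := fun _ => X) e (f : dgeHom Q X Y 0).1)

variable {e}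

theorem HomotopyInvariant.toH0_map_zeroStrip (hinv : HomotopyInvariant Q e)
    (z : ((dgeData Q).P I X Y).X 0) (hz : z ∈ ((dgeData Q).P I X Y).B0) :
    (toH0 Q).map (zeroStrip e z) = 0 := by
  obtain ⟨w, rfl⟩ := hz
  refine Eq.trans (congrArg (fun t => (toH0 Q).map (multiStrip e (t (fun _ => 0) 0)))
    (multiVal_d Q w)) (hinv.toH0_map_multiStrip_d _ (-1))

/-- Surjectivity on `H⁰` of the quasi-isomorphism given by the universal element, for
representatives. -/
theorem CubeBimul.exists_act_univFst (B : CubeBimul Q e) (z : ((dgeData Q).P I X Y).Z0) :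
    ∃ φ : ((dge Q).Hom (tens I X) Y).Z0,
      z.1 - (dgeData Q).act (add_zero 0) φ.1 (univFst Q e I X).1 ∈
        ((dgeData Q).P I X Y).B0 := by
  have h := quasiIso_ofCocycle_univFst (I := I) (X := X) Q e B (dgeData_isPseudoTensor Q) Y
  have h0 := (quasiIsoAt_iff_isIso_homologyMap _ 0).1 (h.quasiIsoAt 0)
  obtain ⟨x, w, hx, hz⟩ := exists_of_epi_homologyMap
    (((PseudoTensorData.toMod (dgeData_isPseudoTensor Q) I X).ofCocycle (tens I X)
      (univFst Q e I X)).app Y) (i := -1) (j := 0) (k := 1)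
    (ComplexShape.prev_eq' _ (by simp)) (ComplexShape.next_eq' _ (by simp)) z.1 z.2
  exact ⟨⟨x, hx⟩, w, (sub_eq_iff_eq_add'.2 hz).symm⟩

theorem act_univFst_mem_B0 (φ : ((dge Q).Hom (tens I X) Y).X 0)
    (hφ : φ ∈ ((dge Q).Hom (tens I X) Y).B0) :
    (dgeData Q).act (add_zero 0) φ (univFst Q e I X).1 ∈ ((dgeData Q).P I X Y).B0 := by
  obtain ⟨w, rfl⟩ := hφ
  exact ⟨(dgeData Q).act (add_zero (-1)) w (univFst Q e I X).1, ConcreteCategory.congr_hom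
    ((((PseudoTensorData.toMod (dgeData_isPseudoTensor Q) I X).ofCocycle (tens I X)
      (univFst Q e I X)).app Y).comm (-1) 0) w⟩

/-- Modulo coboundaries the cocycle is the composition of some `φ` with the universal element. Its
strip and the class of `φ` are the same morphism of the homotopy category; if this is zero, `φ` is a
coboundary, and so is the cocycle. -/
theorem HomotopyInvariant.mem_B0_iff (hinv : HomotopyInvariant Q e) (B : CubeBimul Q e)
    (z : ((dgeData Q).P I X Y).Z0) :
    z.1 ∈ ((dgeData Q).P I X Y).B0 ↔ (toH0 Q).map (zeroStrip e z.1) = 0 := by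
  refine ⟨hinv.toH0_map_zeroStrip z.1, fun h => ?_⟩
  obtain ⟨φ, hφ⟩ := B.exists_act_univFst z
  have h1 := hinv.toH0_map_zeroStrip _ hφ
  rw [map_sub, Functor.map_sub, h, zero_sub, neg_eq_zero, zeroStrip_act_univFst,
    ← hinv.homMk_eq] at h1
  have h2 := AddSubgroup.add_mem _ hφ (act_univFst_mem_B0 (e := e) φ.1 ((homMk_eq_zero φ).1 h1))
  rwa [sub_add_cancel] at h2

end Cocycles

/-! ### Comparison with the tensor structure of the homotopy category. -/

section Lax

open Functor.LaxMonoidal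

variable {C : Type*} [Category C] [MonoidalCategory C] {D : Type*} [Category D]
  [MonoidalCategory D] (F : D ⥤ C) [F.LaxMonoidal] {J : Type} (A : J → D)

theorem tensLLax_singleton (j : J) : tensLLax F A [j] = 𝟙 (F.obj (A j)) := by
  refine (congrArg (fun z => (ρ_ (F.obj (A j))).inv ≫ F.obj (A j) ◁ z ≫ μ F (A j) (𝟙_ D) ≫
    F.map (ρ_ (A j)).hom) (tensLLax_nil F A)).trans ?_
  rw [← right_unitality, Iso.inv_hom_id]

end Lax

section Comparison

variable {C : Type u} [Category.{v} C] [Preadditive C] [MonoidalCategory C]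
  [MonoidalPreadditive C] [SymmetricCategory C] {Q : ECube ⥤ C} {e : Q.obj ⟨0⟩ ≅ 𝟙_ C}
  {I : FinIdx} {X : I.α → C} {Y : C}

variable (e) in
theorem act_univFst_mem_Z0 (φ : ((dge Q).Hom (tens I X) Y).Z0) :
    (dgeData Q).act (add_zero 0) φ.1 (univFst Q e I X).1 ∈ ((dgeData Q).P I X Y).Z0 := by
  let ψ := ((PseudoTensorData.toMod (dgeData_isPseudoTensor Q) I X).ofCocycle (tens I X)
    (univFst Q e I X)).app Y
  exact (ConcreteCategory.congr_hom (ψ.comm 0 1) φ.1).trans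
    ((congrArg (ψ.f 1) φ.2).trans (map_zero (ψ.f 1).hom))

/-- By the Leibniz rule every term of the differential contains the differential of one of the
cocycles. -/
theorem comp_mem_Z0 {F : I.α → FinIdx} {J : FinIdx} (σ : (Σ i, (F i).α) ≃ J.α) {X : J.α → C}
    {Y : I.α → C} {Z : C} (h : 0 + ∑ _ : I.α, (0 : ℤ) = 0) (f : ((dgeData Q).P I Y Z).Z0)
    (g : ∀ i, ((dgeData Q).P (F i) (fun t => X (σ ⟨i, t⟩)) (Y i)).Z0) :
    (dgeData Q).comp σ 0 (fun _ => 0) 0 h f.1 (fun i => (g i).1) ∈ ((dgeData Q).P J X Z).Z0 := by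
  have hd {K : FinIdx} {A : K.α → C} {B : C} (z : ((dgeData Q).P K A B).Z0) :
      multiD Q K A B 0 (multiVal Q z.1) = 0 :=
    (multiVal_d Q z.1).symm.trans (congrArg (multiVal Q (m := 0 + 1)) z.2)
  refine multiVal_ext Q ((multiVal_d Q _).trans ?_)
  refine (multiComp_d Q σ h (multiVal Q f.1) fun i => multiVal_mem Q (g i).1).trans ?_
  funext b n
  rw [hd f]
  rw [Pi.add_apply, Pi.add_apply, Finset.sum_apply, Finset.sum_apply, Finset.sum_eq_zero, add_zero,
    multiCompFun_eq]
  · exact (congrArg _ (by simp)).trans (smul_zero _)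
  · intro k _
    refine (congrArg _ ?_).trans (zsmul_zero _)
    rw [multiCompFun_eq, tensHom, tensLHom_zero _ k _ _ (FinIdx.mem_list _ k)]
    · simp
    · rw [Function.update_self, hd (g k)]
      rfl

/-- The isomorphism `H⁰ P_I({X_i}, Y) ≅ Hom(⊗_i X_i, Y)`. -/
noncomputable def HomotopyInvariant.zeroEquiv (hinv : HomotopyInvariant Q e) (B : CubeBimul Q e)
    (I : FinIdx) (X : I.α → C) (Y : C) :
    ((dgeData Q).P I X Y).H0 ≃+ ((toH0 Q).obj (tens I X) ⟶ (toH0 Q).obj Y) :=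
  AddEquiv.ofBijective (QuotientAddGroup.lift _
    ((toH0 Q).mapAddHom.comp ((zeroStrip e).comp (AddSubgroup.subtype _)))
    fun z hz => hinv.toH0_map_zeroStrip z.1 (AddSubgroup.mem_addSubgroupOf.1 hz)) <| by
  refine ⟨(injective_iff_map_eq_zero _).2 ?_, fun f => ?_⟩
  · rintro ⟨z⟩ hz
    exact (QuotientAddGroup.eq_zero_iff z).2
      (AddSubgroup.mem_addSubgroupOf.2 ((hinv.mem_B0_iff B z).2 hz))
  · have := hinv.full_toH0
    obtain ⟨φ, rfl⟩ := (toH0 Q).map_surjective f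
    -- A representative `φ` in `C`, composed with the universal element, strips back to `φ`.
    refine ⟨AbComplex.mk _ ⟨_, act_univFst_mem_Z0 e (dgeOfCycle Q φ)⟩, congrArg (toH0 Q).map ?_⟩
    refine (zeroStrip_act_univFst e _).trans ?_
    rw [zeroComponent_dgeOfCycle, unitStrip_whiskerRight]

/-- Precomposition with an isomorphism. -/
noncomputable def precompEquiv {D : Type*} [Category D] [Preadditive D] {A B : D} (f : A ⟶ B) [IsIso f] (Z : D) :
    (B ⟶ Z) ≃+ (A ⟶ Z) where
  toFun g := f ≫ g
  invFun g := inv f ≫ g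
  left_inv g := by simp
  right_inv g := by simp
  map_add' g h := by simp

variable [TensorHomotopy Q]

instance : IsIso (Functor.LaxMonoidal.ε (toH0 Q)) :=
  inferInstanceAs (IsIso (𝟙 (⟨𝟙_ C⟩ : H0Cat (dge Q))))

instance (X Y : C) : IsIso (Functor.LaxMonoidal.μ (toH0 Q) X Y) :=
  inferInstanceAs (IsIso (𝟙 (⟨X ⊗ Y⟩ : H0Cat (dge Q))))

/-- The isomorphism of the tensor products of `H⁰ dg_e C` and `C`. -/
noncomputable def tensToH0 (I : FinIdx) (X : I.α → C) :
    tens I (fun i => (toH0 Q).obj (X i)) ⟶ (toH0 Q).obj (tens I X) :=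
  tensLLax (toH0 Q) X I.list

instance (I : FinIdx) (X : I.α → C) : IsIso (tensToH0 (Q := Q) I X) :=
  isIso_tensLLax (toH0 Q) X I.list

theorem tensToH0_one (X : C) : tensToH0 (Q := Q) FinIdx.one (fun _ => X) = 𝟙 _ :=
  tensLLax_singleton (toH0 Q) (fun _ => X) FinIdx.one.fst

theorem tensToH0_natural {X Y : I.α → C} (φ : ∀ i, X i ⟶ Y i) :
    tensHom I (fun i => (toH0 Q).map (φ i)) ≫ tensToH0 I Y =
      tensToH0 I X ≫ (toH0 Q).map (tensHom I φ) :=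
  tensLLax_natural (toH0 Q) X φ I.list

theorem tensShuffle_tensToH0 {F : I.α → FinIdx} {J : FinIdx} (σ : (Σ i, (F i).α) ≃ J.α)
    (X : J.α → C) :
    (tensShuffle σ fun j => (toH0 Q).obj (X j)).hom ≫
        tensHom I (fun i => tensToH0 (F i) fun t => X (σ ⟨i, t⟩)) ≫
        tensToH0 I (fun i => tens (F i) fun t => X (σ ⟨i, t⟩)) =
      tensToH0 J X ≫ (toH0 Q).map (tensShuffle σ X).hom :=
  tensShuffle_lax (toH0 Q) σ X

/-- The tensor structure on `H⁰ dg_e C` induced by the pseudo-tensor structure. -/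
noncomputable def HomotopyInvariant.tensorComparison (hinv : HomotopyInvariant Q e)
    (B : CubeBimul Q e) : (dgeData Q).TensorComparison where
  iso I X Y := (hinv.zeroEquiv B I X Y).trans (precompEquiv (tensToH0 I X) ((toH0 Q).obj Y))
  iso_un {X Y} f c hc := by
    have h : tensToH0 (Q := Q) FinIdx.one (fun _ => X) ≫ (toH0 Q).map (zeroStrip e c.1) =
        H0Cat.homMk f := by
      rw [hc, zeroStrip_un, hinv.homMk_eq, tensToH0_one]
      exact Category.id_comp _
    exact h
  iso_comp {I F J} σ {X Y Z} h f g c hc := by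
    -- The multiplicativity of stripping in `C`, carried over by the compatibility of `toH0` with
    -- shuffles and by its naturality.
    have key : tensToH0 J X ≫ (toH0 Q).map (zeroStrip e c.1) =
        (tensShuffle σ fun j => (toH0 Q).obj (X j)).hom ≫
          tensHom I (fun i => tensToH0 (F i) (fun t => X (σ ⟨i, t⟩)) ≫
            (toH0 Q).map (zeroStrip e (g i).1)) ≫
          tensToH0 I Y ≫ (toH0 Q).map (zeroStrip e f.1) := by
      rw [hc, zeroStrip_comp, Functor.map_comp, Functor.map_comp, ← reassoc_of%
        tensShuffle_tensToH0, ← reassoc_of% tensToH0_natural]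
      have h2 := tensLHom_comp (fun i => tensToH0 (Q := Q) (F i) (fun t => X (σ ⟨i, t⟩)))
        (fun i => (toH0 Q).map (zeroStrip e (g i).1)) I.list
      rw [tensHom, tensHom, tensHom, ← h2, Category.assoc]
    exact key

end Comparison

/-! ### Representability and the main theorem. -/

section Representation

variable {C : Type u} [Category.{v} C] [Preadditive C] [MonoidalCategory C]
  [MonoidalPreadditive C] [SymmetricCategory C] {Q : ECube ⥤ C} {e : Q.obj ⟨0⟩ ≅ 𝟙_ C}

/-- The pseudo-tensor structure on `dg_e C` is representable by the tensor products of `C`. -/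
noncomputable def CubeBimul.representation (B : CubeBimul Q e) :
    PseudoTensorData.Representation (dgeData_isPseudoTensor Q) where
  obj I X := tens I X
  lam I X := (Localization.isoOfHom (DGMod.quasiIso (dge Q)).Q (DGMod.quasiIso (dge Q)) _
    (quasiIso_ofCocycle_univFst (I := I) (X := X) Q e B (dgeData_isPseudoTensor Q))).symm
  univ I X := univFst Q e I X
  lam_inv I X := rfl
  obj_one X := rfl
  univ_one X := by
    refine heq_of_eq (multiVal_ext Q ?_)
    funext b n
    -- For one object there is no cube besides the first, so nothing is extended by zero and the
    -- universal element is the identity.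
    have h0 : ¬ FinIdx.one.Off b := fun ⟨i, hi, _⟩ => hi (Subsingleton.elim (α := Fin 1) _ _)
    refine (extendFst_not_off (I := FinIdx.one) (X := fun _ => X) e h0 n).trans ?_
    refine Eq.trans (congrArg (· ≫ dgeIdFun Q X (b FinIdx.one.fst) n) ?_) (Category.id_comp _)
    exact (congrArg (X ◁ ·) (cubesAt_one Q e b)).trans (whiskerLeft_id X _)

/-- The morphism `ε_π` is the class of the shuffle isomorphism of `C`, hence invertible. Its
defining equation is tested by stripping: the strip of a universal element is an identity, so both
sides strip to the shuffle. -/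
theorem HomotopyInvariant.inducesTensorStructure (hinv : HomotopyInvariant Q e)
    (B : CubeBimul Q e) : (B.representation).InducesTensorStructure := by
  have := hinv.tensorHomotopy
  refine ⟨fun I F J σ X => ⟨dgeOfCycle Q (tensShuffle σ X).hom, ?_,
    inferInstanceAs (IsIso ((toH0 Q).map (tensShuffle σ X).hom))⟩, inferInstance, inferInstance,
    inferInstance, hinv.tensorComparison B, fun I X => ?_⟩
  · let z : ((dgeData Q).P J X (tens I fun i => tens (F i) fun t => X (σ ⟨i, t⟩))).Z0 :=
      ⟨_, act_univFst_mem_Z0 e (dgeOfCycle Q (tensShuffle σ X).hom)⟩ -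
        ⟨_, comp_mem_Z0 σ (by simp) (univFst Q e I _) fun i => univFst Q e (F i) _⟩
    refine (hinv.mem_B0_iff B z).2 ((congrArg (toH0 Q).map ?_).trans ((toH0 Q).map_zero _ _))
    refine (map_sub (zeroStrip e) _ _).trans (sub_eq_zero.2 ?_)
    refine (zeroStrip_act_univFst e _).trans (Eq.trans ?_ (zeroStrip_comp e σ (by simp) _ _).symm)
    rw [zeroComponent_dgeOfCycle, unitStrip_whiskerRight]
    simp only [zeroStrip_univFst, tensHom, tensLHom_id]
    exact ((congrArg _ (Category.id_comp _)).trans (Category.comp_id _)).symm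
  -- The universal element corresponds to the comparison of the two tensor products, followed by an
  -- identity.
  · have h : IsIso (tensToH0 I X ≫ (toH0 Q).map (zeroStrip e (univFst Q e I X).1)) := by
      rw [zeroStrip_univFst]
      infer_instance
    exact h

end Representation

theorem mainTheorem4 {C : Type u} [Category.{v} C] [Preadditive C] [MonoidalCategory C]
    [SymmetricCategory C] [MonoidalPreadditive C] (Q : ECube ⥤ C) (e : Q.obj ⟨0⟩ ≅ 𝟙_ C)
    (hbi : Nonempty (CubeBimul Q e)) (hinv : HomotopyInvariant Q e) :
    ∃ (hD : (dgeData Q).IsPseudoTensor) (R : PseudoTensorData.Representation hD),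
      (∀ (I : FinIdx) (X : I.α → C), R.obj I X = tens I X) ∧ R.InducesTensorStructure := by
  obtain ⟨B⟩ := hbi
  exact ⟨dgeData_isPseudoTensor Q, B.representation, fun _ _ => rfl, hinv.inducesTensorStructure B⟩
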